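/- Let $d\ge 1$, $U\in\mathcal C^2(\mathbb R^d)$ and $L,m>0$ be such that $|\nabla U(x)-\nabla U(y)|\le L|x-y|$ and $(x-y)\cdot(\nabla U(x)-\nabla U(y))\ge m|x-y|^2$ for all $x,y\in\mathbb R^d$. Let $\gamma\ge 2\sqrt L$, $0<\delta\le m/(33\gamma^3)$ and $\eta=e^{-\delta\gamma/2}$. Let $\pi$ be the probability measure on $\mathbb R^{2d}$ with density proportional to $\exp(-U(x)-|v|^2/2)$, and let $P$ be the transition operator of the OBABO Markov chain on $\mathbb R^{d}\times\mathbb R^d$, \[x_1=x_0+\delta\big(\eta v_0+\sqrt{1-\eta^2}\,G\big)-\tfrac{\delta^2}{2}\nabla U(x_0),\qquad v_1=\eta^2v_0-\tfrac{\delta\eta}{2}\big(\nabla U(x_0)+\nabla U(x_1)\big)+\sqrt{1-\eta^2}\,(\eta G+G'),\] with $G,G'$ independent standard Gaussian vectors of $\mathbb R^d$, independent of $(x_0,v_0)$. Let $\mathcal W_p$ be the Wasserstein distance of order $p$ for the Euclidean distance of $\mathbb R^{2d}$, and $\|\nu-\mu\|_{TV}=\inf 2\,\mathbb P(X\ne Y)$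 over couplings $(X,Y)$ of $\nu$ and $\mu$. For $\ell\ge2$, set \[\kappa=\frac{m}{3\gamma},\quad K_1=\sqrt3\max(L^{1/2},L^{-1/2}),\quad K_2=\sqrt{\frac{\delta}{2\pi(1-\eta^2)}}\,\max\Big(2+\frac{3\delta^2L}{2},3\delta\Big)\] (in $K_2$, $\pi$ is the number), \[K_5=\frac{L}{4\sqrt m}+\frac L6\Big[1+\delta\frac{L+1}{2}+\delta^3\frac{L}{40}\Big]e^{L\delta^2}\Big(1+\delta\frac{L}{2\sqrt m}\Big),\] \[K_6=2^{\ell-2}\Big(1+e^{L\delta^2}\frac{\delta^2}{12}\Big)\Big(1+\delta+e^{L\delta^2}\frac{\delta^3}{6}\Big)^{\ell-2}\Big(1+\frac{\delta L}{2}\Big)^{\ell}\Big(1+\frac1{m^{\ell/2}}\Big),\] \[K_7=L(1+\delta L)\Big(1+\frac{\delta^2L^2}{4m}\Big),\qquad K_8=2^{\ell+1}\Big(1+\delta+\frac{\delta^2L}{2}\Big)^{\ell-2}\Big(1+\frac{\delta L}{2}\Big)^3\Big(1+\frac1{m^{(\ell+1)/2}}\Big).\] As $\delta\to0$, $K_5\to\frac{L}{4\sqrt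 m}+\frac L6$, $K_6\to2^{\ell-2}(1+m^{-\ell/2})$, $K_7\to L$ and $K_8\to2^{\ell+1}(1+m^{-(\ell+1)/2})$. The chain has a unique invariant probability distribution $\pi_\delta$, and the following holds. 1. Let $\ell\ge2$ and $L_\ell>0$ be real, let $x_\star$ be the global minimum of $U$, and suppose that for all $x,y\in\mathbb R^d$ (in operator norm) \[|\nabla^2U(y)-\nabla^2U(x)|\le \tfrac14L_\ell|x-y|\big(2+|x-x_\star|^{\ell-2}+|y-x_\star|^{\ell-2}\big).\] Then, for all $p\in[1,\infty)$, \[\mathcal W_p(\pi_\delta,\pi)\le\delta^2(d+\ell p-2)^{\ell/2}\,\frac{2K_1(K_5+L_\ell K_6)}{\kappa},\] and \[\|\pi_\delta-\pi\|_{TV}\le\delta^2\big(2+|\ln(\delta^3(d+\ell-1))|\big)(d+\ell-1)^{(\ell+1)/2}\,\frac{2K_1^2K_2(K_5+L_\ell K_6)+K_7+L_\ell K_8}{\kappa}.\] 2. Let $\ell\ge2$ and $L_\ell>0$ be real, $\mathcal Q$ an orthogonal transformation of $\mathbb R^d$, $U_1,\dots,U_d\in\mathcal C^2(\mathbb R)$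 with $U(\mathcal Qx)=\sum_{i=1}^dU_i(x_i)$ for all $x$, and let $x_\star$ be the point at which $x\mapsto U(\mathcal Qx)$ is minimal. Suppose that for all $i$ and all $s,t\in\mathbb R$ \[|U_i''(t)-U_i''(s)|\le\tfrac14L_\ell|s-t|\big(2+|s-x_{\star,i}|^{\ell-2}+|t-x_{\star,i}|^{\ell-2}\big).\] Then, for all $p\in[2,\infty)$, \[\mathcal W_p(\pi_\delta,\pi)\le\delta^2\sqrt d\,(\ell p-1)^{\ell/2}\,\frac{2K_1(K_5+L_\ell K_6)}{\kappa},\] and \[\|\pi_\delta-\pi\|_{TV}\le\delta^2d\,\big(2+|\ln(\delta^3\ell)|\big)\,\ell^{(\ell+1)/2}\,\frac{2K_1^2K_2(K_5+L_\ell K_6)+K_7+L_\ell K_8}{\kappa}.\] -/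

import Mathlib

open MeasureTheory ProbabilityTheory Filter Topology

noncomputable section

namespace OBABO

/-- Position (or velocity) space: `ℝ^d` with its Euclidean norm. -/
abbrev Pos (d : ℕ) : Type := EuclideanSpace ℝ (Fin d)

/-- Phase space `ℝ^d × ℝ^d`. As a Lean type it carries the product σ-algebra and Lebesgue measure;
its Euclidean distance is `phaseDist` below (not the sup distance of the product type). -/
abbrev Phase (d : ℕ) : Type := Pos d × Pos d

/-- The Euclidean distance of `ℝ^{2d}`. -/
def phaseDist {d : ℕ} (z w : Phase d) : ℝ :=
  Real.sqrt (‖z.1 - w.1‖ ^ 2 + ‖z.2 - w.2‖ ^ 2)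

/-! Couplings, Wasserstein distances and the total variation norm. -/

/-- `c` is a transference plan (coupling) of `μ` and `ν`. -/
def IsCoupling {X : Type*} [MeasurableSpace X] (c : Measure (X × X)) (μ ν : Measure X) : Prop :=
  c.map Prod.fst = μ ∧ c.map Prod.snd = ν

/-- The Wasserstein distance of order `p ∈ [1, ∞)` for the Euclidean distance of `ℝ^{2d}`:
the infimum over couplings `c` of the `L^p(c)` norm of the distance. -/
def wasserstein {d : ℕ} (p : ℝ) (μ ν : Measure (Phase d)) : ENNReal :=
  ⨅ (c : Measure (Phase d × Phase d)) (_ : IsCoupling c μ ν),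
    (∫⁻ q, ENNReal.ofReal (phaseDist q.1 q.2) ^ p ∂c) ^ (1 / p)

/-- The total variation norm `‖μ - ν‖_TV = inf 2 ℙ(X ≠ Y)` over couplings `(X, Y)` of `μ`, `ν`
(so that it takes its values in `[0, 2]` for probability measures). -/
def tvNorm {X : Type*} [MeasurableSpace X] (μ ν : Measure X) : ENNReal :=
  ⨅ (c : Measure (X × X)) (_ : IsCoupling c μ ν), 2 * c {q | q.1 ≠ q.2}

/-! The target measure and the chain. -/

/-- The Gibbs measure on `ℝ^{2d}`: density proportional to `exp (-H)` with respect to Lebesgue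
measure, where `H (x, v) = U x + |v|² / 2`. -/
def gibbs {d : ℕ} (U : Pos d → ℝ) : Measure (Phase d) :=
  (volume : Measure (Phase d)).tilted (fun z => -(U z.1 + ‖z.2‖ ^ 2 / 2))

/-- `η = exp (-δ γ / 2)`. -/
def damping (γ δ : ℝ) : ℝ := Real.exp (-(δ * γ / 2))

/-- Position after one OBABO step from `z = (x₀, v₀)` with noise `g`. -/
def stepPos {d : ℕ} (U : Pos d → ℝ) (γ δ : ℝ) (z : Phase d) (g : Pos d) : Pos d :=
  z.1 + δ • (damping γ δ • z.2 + Real.sqrt (1 - damping γ δ ^ 2) • g)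
    - (δ ^ 2 / 2) • gradient U z.1

/-- Velocity after one OBABO step from `z = (x₀, v₀)` with noises `g`, `g'`. -/
def stepVel {d : ℕ} (U : Pos d → ℝ) (γ δ : ℝ) (z : Phase d) (g g' : Pos d) : Pos d :=
  damping γ δ ^ 2 • z.2
    - (δ * damping γ δ / 2) • (gradient U z.1 + gradient U (stepPos U γ δ z g))
    + Real.sqrt (1 - damping γ δ ^ 2) • (damping γ δ • g + g')

/-- The action `μ ↦ μ P` of the OBABO transition operator on measures: the law of the chain after
one step, when it starts from `Z ∼ μ` and uses two independent standard `d`-dimensional Gaussian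
vectors, independent of `Z`. -/
def transition {d : ℕ} (U : Pos d → ℝ) (γ δ : ℝ) (μ : Measure (Phase d)) : Measure (Phase d) :=
  (μ.prod ((stdGaussian (Pos d)).prod (stdGaussian (Pos d)))).map
    (fun q => (stepPos U γ δ q.1 q.2.1, stepVel U γ δ q.1 q.2.1 q.2.2))

/-- `μ` is an invariant probability distribution of the OBABO chain. -/
def IsInvariantProb {d : ℕ} (U : Pos d → ℝ) (γ δ : ℝ) (μ : Measure (Phase d)) : Prop :=
  IsProbabilityMeasure μ ∧ transition U γ δ μ = μ

/-! The conditions on the potential. -/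

/-- The gradient of `U` is `L`-Lipschitz. -/
def GradLip {d : ℕ} (U : Pos d → ℝ) (L : ℝ) : Prop :=
  ∀ x y, ‖gradient U x - gradient U y‖ ≤ L * ‖x - y‖

/-- `U` is `m`-strongly convex. -/
def StrongConv {d : ℕ} (U : Pos d → ℝ) (m : ℝ) : Prop :=
  ∀ x y, m * ‖x - y‖ ^ 2 ≤ inner ℝ (x - y) (gradient U x - gradient U y)

/-- The Hessian of `U` (the derivative of the gradient, with its operator norm) is locally
Lipschitz, with a local Lipschitz constant that grows polynomially with the distance to `xs`. -/
def HessPol {d : ℕ} (U : Pos d → ℝ) (l Ll : ℝ) (xs : Pos d) : Prop :=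
  ∀ x y, ‖fderiv ℝ (gradient U) y - fderiv ℝ (gradient U) x‖
    ≤ Ll * ‖x - y‖ * (2 + ‖x - xs‖ ^ (l - 2) + ‖y - xs‖ ^ (l - 2)) / 4

/-- `U` is separable in the orthonormal basis given by the orthogonal transformation `Q`, with
`C²` one-dimensional potentials whose second derivatives satisfy the polynomial local Lipschitz
condition around the coordinates of `xs`. -/
def SeparablePol {d : ℕ} (U : Pos d → ℝ) (Q : Pos d ≃ₗᵢ[ℝ] Pos d) (l Ll : ℝ) (xs : Pos d) :
    Prop :=
  ∃ V : Fin d → ℝ → ℝ,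
    (∀ i, ContDiff ℝ 2 (V i)) ∧
    (∀ x, U (Q x) = ∑ i, V i (x i)) ∧
    ∀ i (s t : ℝ), |iteratedDeriv 2 (V i) t - iteratedDeriv 2 (V i) s|
      ≤ Ll * |s - t| * (2 + |s - xs i| ^ (l - 2) + |t - xs i| ^ (l - 2)) / 4

/-! The explicit constants. -/

def κ (m γ : ℝ) : ℝ := m / (3 * γ)

def K₁ (L : ℝ) : ℝ := Real.sqrt 3 * max (L ^ (1 / 2 : ℝ)) (L ^ (-(1 / 2) : ℝ))

def K₂ (L γ δ : ℝ) : ℝ :=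
  Real.sqrt (δ / (2 * Real.pi * (1 - damping γ δ ^ 2))) * max (2 + 3 * δ ^ 2 * L / 2) (3 * δ)

def K₅ (m L δ : ℝ) : ℝ :=
  L / (4 * Real.sqrt m)
    + L / 6 * (1 + δ * ((L + 1) / 2) + δ ^ 3 * (L / 40)) * Real.exp (L * δ ^ 2)
      * (1 + δ * (L / (2 * Real.sqrt m)))

def K₆ (m L l δ : ℝ) : ℝ :=
  (2 : ℝ) ^ (l - 2) * (1 + Real.exp (L * δ ^ 2) * (δ ^ 2 / 12))
    * (1 + δ + Real.exp (L * δ ^ 2) * (δ ^ 3 / 6)) ^ (l - 2)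
    * (1 + δ * L / 2) ^ l * (1 + 1 / m ^ (l / 2))

def K₇ (m L δ : ℝ) : ℝ := L * (1 + δ * L) * (1 + δ ^ 2 * L ^ 2 / (4 * m))

def K₈ (m L l δ : ℝ) : ℝ :=
  (2 : ℝ) ^ (l + 1) * (1 + δ + δ ^ 2 * L / 2) ^ (l - 2) * (1 + δ * L / 2) ^ 3
    * (1 + 1 / m ^ ((l + 1) / 2))

/-- The constant in the Wasserstein bounds. -/
def constW (m L γ l Ll δ : ℝ) : ℝ :=
  2 * K₁ L * (K₅ m L δ + Ll * K₆ m L l δ) / κ m γ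

/-- The constant in the total variation bounds. -/
def constTV (m L γ l Ll δ : ℝ) : ℝ :=
  (2 * K₁ L ^ 2 * K₂ L γ δ * (K₅ m L δ + Ll * K₆ m L l δ) + K₇ m L δ + Ll * K₈ m L l δ) / κ m γ

end OBABO

end

noncomputable section

namespace OBABO

local notation "⟪" x ", " y "⟫" => inner ℝ x y

/-! ### Contraction of the parallel coupling -/

/-! One OBABO step is a partial refreshment of the velocity, a Verlet step of length δ, and a second
refreshment (`obaboStep_eq_sandwich`). Replacing the Verlet map by the exact Hamiltonian flow gives
an ideal kernel that leaves the Gibbs measure π invariant. The proof compares the two kernels.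

Wasserstein bounds. Two copies of the chain driven by the same noise approach each other by a factor
1 - δκ per step, in the norm whose square is |x|² + 2x·v/γ + |v|²/L
(`Setting.starNorm_step_sub_le`). This rests on cocoercivity of the gradient, which pays for all
quadratic gradient terms, and on strong convexity. Started from π, the two kernels with common noise
differ after one step by O(δ³) in L^p (`Blocks.eLpNorm_blockError_le`). Coupling the stationary
chain with the ideal stationary chain, the distance a obeys a ↦ (1 - δκ)a + O(δ³), so couplings at
distance arbitrarily close to O(δ²)/κ exist (`Setting.exists_coupling`).

The local error has order three because the Verlet position is a Taylor polynomial and the Verlet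
velocity a trapezoidal rule. It is controlled by powers up to l of the initial velocity, gradient
and distance to the minimizer. Their moments come from integration by parts against |G|^(q-2) G
(`IsConfining.moment_le`), which gives the scale k + q - 2 in a space of dimension k.

Both parts of the theorem are instances of one statement about `Blocks`: orthogonal blocks along
which the gradient decouples, each of dimension at most k. A single block with k = d gives the first
part, d lines with k = 1 the second. For p ≥ 2 the errors of N blocks add up with a factor √N.

Total variation. Since the position is itself noisy, one step turns a Wasserstein bound into a total
variation bound (`Setting.tvLe_transition_of_coupling`), at a cost of order 1/(δ√(1 - η²)). To make
up for it, about |ln δ|/(δκ) contracting steps are run first. During these steps π must hardly move,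
and π itself drifts too fast. The Gibbs measure π' of the modified potential U - δ²|∇U|²/8 is
preserved up to O(δ³) per step (`Blocks.tvLe_transition_modPot`), because the Verlet map changes the
modified energy exactly by the trapezoidal error for U (`modEnergy_verlet_sub`). It lies within
O(δ²) of π (`Blocks.tvLe_modPot`). Over the whole run the drift is O(δ²|ln δ|).

Two facts are proved along the way. The flow preserves π because it is the limit of
volume-preserving symplectic Euler schemes and conserves the energy (`Setting.exists_flow`). The
invariant law exists and is unique because backward iterations of the contraction converge almost
surely (`Setting.exists_invariant`). -/

lemma damping_bounds {q : ℝ} (hq : 0 ≤ q) :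
    let η := Real.exp (-(q / 2))
    0 < η ∧ η ≤ 1 ∧ 1 - q / 2 ≤ η ∧ η * (1 + q / 2) ≤ 1 ∧ η ^ 2 ≤ 1 - q + q ^ 2 / 2
      ∧ η ≤ 1 - q / 2 + q ^ 2 / 8 := by
  intro η
  have h0 : 0 < η := Real.exp_pos _
  have h1 : η ≤ 1 := Real.exp_le_one_iff.2 (by linarith)
  have h2 : 1 - q / 2 ≤ η := by
    have := Real.add_one_le_exp (-(q / 2)); simp only [η]; linarith
  have h3 : η * (1 + q / 2) ≤ 1 := by
    have h : 1 + q / 2 ≤ Real.exp (q / 2) := by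
      have := Real.add_one_le_exp (q / 2); linarith
    have h' : η * Real.exp (q / 2) = 1 := by
      simp only [η]; rw [← Real.exp_add]; simp
    calc η * (1 + q / 2) ≤ η * Real.exp (q / 2) := by gcongr
      _ = 1 := h'
  have h4 : ∀ t : ℝ, 0 ≤ t → Real.exp (-t) ≤ 1 - t + t ^ 2 / 2 := by
    intro t ht
    have h := Real.quadratic_le_exp_of_nonneg ht
    have h' : Real.exp (-t) * Real.exp t = 1 := by rw [← Real.exp_add]; simp
    have hp : 0 < Real.exp (-t) := Real.exp_pos _
    have : Real.exp (-t) * (1 + t + t ^ 2 / 2) ≤ 1 := by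
      calc Real.exp (-t) * (1 + t + t ^ 2 / 2) ≤ Real.exp (-t) * Real.exp t := by gcongr
        _ = 1 := h'
    have hq : 0 < 1 + t + t ^ 2 / 2 := by positivity
    have : Real.exp (-t) ≤ 1 / (1 + t + t ^ 2 / 2) := by rwa [le_div_iff₀ hq]
    refine this.trans ?_
    rw [div_le_iff₀ hq]
    nlinarith [sq_nonneg (t ^ 2)]
  have h5 : η ^ 2 ≤ 1 - q + q ^ 2 / 2 := by
    have : η ^ 2 = Real.exp (-q) := by
      simp only [η]; rw [← Real.exp_nat_mul]; congr 1; push_cast; ring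
    rw [this]; exact h4 q hq
  have h6 := h4 (q / 2) (by linarith)
  refine ⟨h0, h1, h2, h3, h5, ?_⟩
  simp only [η]; linarith

section Inner

variable {E : Type*} [NormedAddCommGroup E] [InnerProductSpace ℝ E]

/-- Young's inequality with weight b: expand ‖p + b g‖² ≥ 0. -/
lemma neg_inner_le_weighted (p g : E) {b : ℝ} (hb : 0 < b) :
    -⟪p, g⟫ ≤ (b * ‖g‖ ^ 2 + ‖p‖ ^ 2 / b) / 2 := by
  have h : 0 ≤ ‖p + b • g‖ ^ 2 := by positivity
  rw [norm_add_sq_real, inner_smul_right, norm_smul, Real.norm_eq_abs, mul_pow, sq_abs] at h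
  have : b * ((b * ‖g‖ ^ 2 + ‖p‖ ^ 2 / b) / 2 + ⟪p, g⟫) ≥ 0 := by
    have : b * ((b * ‖g‖ ^ 2 + ‖p‖ ^ 2 / b) / 2 + ⟪p, g⟫)
      = (‖p‖ ^ 2 + 2 * (b * ⟪p, g⟫) + b ^ 2 * ‖g‖ ^ 2) / 2 := by field_simp; ring
    rw [this]; linarith
  linarith [nonneg_of_mul_nonneg_right this hb]

/-- Effect of the last kick and of the last partial refreshment on the modified norm. -/
lemma kick_refresh_le (y p g : E) {b q ν η : ℝ} (hb : 0 < b) (hq : 0 ≤ q)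
    (h3 : η * (1 + q / 2) ≤ 1) (h0 : 0 < η) {μ : ℝ} (hν : ν = μ * b ^ 2)
    (hg : ‖g‖ ^ 2 ≤ ⟪y, g⟫) (hμ : μ * ‖y‖ ^ 2 ≤ ⟪y, g⟫) :
    ‖y‖ ^ 2 + 2 * b * ⟪y, η • p - (q * b * η / 2) • g⟫ + ‖η • p - (q * b * η / 2) • g‖ ^ 2
      ≤ (1 - q * ν * η / 2) * ‖y‖ ^ 2 + 2 * (b * η) * ⟪y, p⟫
        + η ^ 2 * (1 + q / 2) * ‖p‖ ^ 2 := by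
  have hw := neg_inner_le_weighted p g hb
  rw [norm_sub_sq_real]
  simp only [inner_sub_right, inner_smul_right, inner_smul_left, norm_smul, Real.norm_eq_abs,
    mul_pow, sq_abs, RCLike.conj_to_real]
  have e1 : (q * b * η ^ 2) * (-⟪p, g⟫) ≤ (q * b * η ^ 2) * ((b * ‖g‖ ^ 2 + ‖p‖ ^ 2 / b) / 2) :=
    mul_le_mul_of_nonneg_left hw (by positivity)
  have e1' : (q * b * η ^ 2) * ((b * ‖g‖ ^ 2 + ‖p‖ ^ 2 / b) / 2)
    = q * b ^ 2 * η ^ 2 / 2 * ‖g‖ ^ 2 + q * η ^ 2 / 2 * ‖p‖ ^ 2 := by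
    field_simp
  have e2 : (q * b ^ 2 * η) * ‖g‖ ^ 2 ≤ (q * b ^ 2 * η) * ⟪y, g⟫ :=
    mul_le_mul_of_nonneg_left hg (by positivity)
  have e3 : (q * b ^ 2 * η) * (μ * ‖y‖ ^ 2) ≤ (q * b ^ 2 * η) * ⟪y, g⟫ :=
    mul_le_mul_of_nonneg_left hμ (by positivity)
  have e4 : 0 ≤ (q * b ^ 2 * η / 2 * ‖g‖ ^ 2) * (1 - η * (1 + q / 2)) :=
    mul_nonneg (by positivity) (by linarith)
  rw [e1'] at e1
  subst hν
  nlinarith [e1, e2, e3, e4]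

/-- Pulls the quadratic form left by `kick_refresh_le` back through the first kick and the free
flight. After expansion, half of the good term -q b B ⟪x, g⟫ absorbs every ‖g‖² term by
cocoercivity, and the other half becomes a decrease of ‖x‖² by strong monotonicity. -/
lemma drift_kick_le (x w g : E) {b q ν η μ : ℝ} (hb : 0 < b) (hb2 : b ≤ 1 / 2) (hq : 0 ≤ q)
    (hq1 : q ≤ 1 / 132) (hν : ν = μ * b ^ 2) (hν0 : 0 < ν) (hν1 : ν ≤ 1 / 4)
    (h0 : 0 < η) (h1 : η ≤ 1) (h2 : 1 - q / 2 ≤ η) (h3 : η * (1 + q / 2) ≤ 1)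
    (hg : ‖g‖ ^ 2 ≤ ⟪x, g⟫) (hμ : μ * ‖x‖ ^ 2 ≤ ⟪x, g⟫) :
    let α := 1 - q * ν * η / 2
    let B := b * (α * q + η)
    let C := α * q ^ 2 * b ^ 2 + 2 * b ^ 2 * η * q + η ^ 2 * (1 + q / 2)
    let p := w - (q * b / 2) • g
    let y := x + (q * b) • p
    α * ‖y‖ ^ 2 + 2 * (b * η) * ⟪y, p⟫ + η ^ 2 * (1 + q / 2) * ‖p‖ ^ 2
      ≤ (α - q * ν * (α * q + η) / 2) * ‖x‖ ^ 2 + 2 * B * ⟪x, w⟫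
        + C * (1 + q / 1.8) * ‖w‖ ^ 2 := by
  intro α B C p y
  have hα : 1 - q * ν / 2 ≤ α := by
    have : q * ν * η ≤ q * ν := mul_le_of_le_one_right (by positivity) h1
    simp only [α]; linarith
  have hα1 : α ≤ 1 := by
    have : 0 ≤ q * ν * η := by positivity
    simp only [α]; linarith
  have hqν : q * ν ≤ q * (1 / 4) := by gcongr
  have hα0 : 0.99 ≤ α := by linarith
  have hb4 : b ^ 2 ≤ 1 / 4 := by nlinarith
  have hC0 : 0 ≤ C := by simp only [C]; positivity
  have hη2 : η ^ 2 * (1 + q / 2) ≤ 1 := by nlinarith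
  have hC1 : C ≤ 1.01 := by
    have a1 : α * q ^ 2 * b ^ 2 ≤ 1 * (1 / 132) ^ 2 * (1 / 4) := by gcongr
    have a2 : 2 * b ^ 2 * η * q ≤ 2 * (1 / 4) * 1 * (1 / 132) := by gcongr
    simp only [C]; norm_num at a1 a2 ⊢; linarith
  have expand : α * ‖y‖ ^ 2 + 2 * (b * η) * ⟪y, p⟫ + η ^ 2 * (1 + q / 2) * ‖p‖ ^ 2
      = α * ‖x‖ ^ 2 + 2 * B * ⟪x, p⟫ + C * ‖p‖ ^ 2 := by
    simp only [y, norm_add_sq_real, inner_add_left, inner_smul_left, inner_smul_right, norm_smul,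
      Real.norm_eq_abs, mul_pow, sq_abs, RCLike.conj_to_real, real_inner_self_eq_norm_sq, B, C]
    ring
  rw [expand]
  have expand2 : α * ‖x‖ ^ 2 + 2 * B * ⟪x, p⟫ + C * ‖p‖ ^ 2
      = α * ‖x‖ ^ 2 + 2 * B * ⟪x, w⟫ + C * ‖w‖ ^ 2 - q * b * B * ⟪x, g⟫
        + q * b * C * (-⟪w, g⟫) + C * (q * b) ^ 2 / 4 * ‖g‖ ^ 2 := by
    simp only [p, norm_sub_sq_real, inner_sub_right, inner_smul_right, norm_smul,
      Real.norm_eq_abs, mul_pow, sq_abs]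
    rw [div_pow, mul_pow]; ring
  rw [expand2]
  -- The weight 0.9 b leaves 0.45 in front of ‖g‖², safely below the available η/2, at the price of
  -- q/1.8 instead of q/2 on the velocity.
  have hw := neg_inner_le_weighted w g (b := 0.9 * b) (by positivity)
  have e1 : q * b * C * (-⟪w, g⟫) ≤ q * b * C * ((0.9 * b * ‖g‖ ^ 2 + ‖w‖ ^ 2 / (0.9 * b)) / 2) :=
    mul_le_mul_of_nonneg_left hw (by positivity)
  have e1' : q * b * C * ((0.9 * b * ‖g‖ ^ 2 + ‖w‖ ^ 2 / (0.9 * b)) / 2)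
    = 0.45 * (q * b ^ 2) * C * ‖g‖ ^ 2 + C * (q / 1.8) * ‖w‖ ^ 2 := by
    field_simp; ring
  have hB0 : 0 ≤ B := by simp only [B]; positivity
  have e2 : (q * b * B / 2) * ‖g‖ ^ 2 ≤ (q * b * B / 2) * ⟪x, g⟫ :=
    mul_le_mul_of_nonneg_left hg (by positivity)
  have e3 : (q * b * B / 2) * (μ * ‖x‖ ^ 2) ≤ (q * b * B / 2) * ⟪x, g⟫ :=
    mul_le_mul_of_nonneg_left hμ (by positivity)
  have e3' : (q * b * B / 2) * (μ * ‖x‖ ^ 2) = q * ν * (α * q + η) / 2 * ‖x‖ ^ 2 := by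
    simp only [B, hν]; ring
  have e4 : 0.45 * (q * b ^ 2) * C + C * (q * b) ^ 2 / 4 ≤ q * b * B / 2 := by
    have : 0.45 * (q * b ^ 2) * C + C * (q * b) ^ 2 / 4 = (q * b ^ 2) * (0.45 * C + C * q / 4) := by
      ring
    rw [this]
    have : q * b * B / 2 = (q * b ^ 2) * ((α * q + η) / 2) := by simp only [B]; ring
    rw [this]
    apply mul_le_mul_of_nonneg_left _ (by positivity)
    have a : C * q ≤ 1.01 * (1 / 132) := by gcongr
    have a' : 0 ≤ α * q := by positivity
    norm_num at a; linarith
  have e5 : (0.45 * (q * b ^ 2) * C + C * (q * b) ^ 2 / 4) * ‖g‖ ^ 2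
      ≤ (q * b * B / 2) * ‖g‖ ^ 2 := mul_le_mul_of_nonneg_right e4 (by positivity)
  rw [e1'] at e1
  rw [e3'] at e3
  linarith

set_option maxHeartbeats 1000000 in
/-- One step of the chain contracts the modified norm of the difference of two trajectories
(in normalized units, where the gradient is `1`-Lipschitz). -/
lemma step_contraction_normalized (x u g₀ g₁ : E) {h Γ μ η : ℝ} (hΓ : 2 ≤ Γ) (hμ0 : 0 < μ)
    (hμ1 : μ ≤ 1) (hh : 0 < h) (hh1 : h ≤ μ / (33 * Γ ^ 3)) (hη : η = Real.exp (-(h * Γ / 2)))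
    {y u₁ : E} (hy : y = x + (h * η) • u - (h ^ 2 / 2) • g₀)
    (hu₁ : u₁ = η ^ 2 • u - (h * η / 2) • (g₀ + g₁))
    (hg₀ : ‖g₀‖ ^ 2 ≤ ⟪x, g₀⟫) (hx : μ * ‖x‖ ^ 2 ≤ ⟪x, g₀⟫)
    (hg₁ : ‖g₁‖ ^ 2 ≤ ⟪y, g₁⟫) (hy' : μ * ‖y‖ ^ 2 ≤ ⟪y, g₁⟫) :
    ‖y‖ ^ 2 + 2 / Γ * ⟪y, u₁⟫ + ‖u₁‖ ^ 2
      ≤ (1 - 2 / 3 * (μ / Γ) * h) * (‖x‖ ^ 2 + 2 / Γ * ⟪x, u⟫ + ‖u‖ ^ 2) := by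
  have hΓ0 : 0 < Γ := by linarith
  -- All estimates are made in b = 1/Γ, the damping exponent q = hΓ and ν = μ/Γ². The restriction on
  -- the time-step becomes q ≤ ν/33, so that q² is negligible against the contraction qν.
  obtain ⟨b, hb⟩ : ∃ b, b = 1 / Γ := ⟨_, rfl⟩
  obtain ⟨q, hq⟩ : ∃ q, q = h * Γ := ⟨_, rfl⟩
  have hb0 : 0 < b := by rw [hb]; positivity
  have hbΓ : b * Γ = 1 := by rw [hb]; field_simp
  have hqb : h = q * b := by rw [hq, mul_assoc, mul_comm Γ, hbΓ, mul_one]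
  have hb2 : b ≤ 1 / 2 := by
    rw [hb]; exact one_div_le_one_div_of_le (by norm_num) hΓ
  have hb4 : b ^ 2 ≤ 1 / 4 := by nlinarith
  obtain ⟨ν, hν⟩ : ∃ ν, ν = μ * b ^ 2 := ⟨_, rfl⟩
  have hν0 : 0 < ν := by rw [hν]; positivity
  have hν1 : ν ≤ 1 / 4 := by rw [hν]; nlinarith
  have hq0 : 0 < q := by rw [hq]; positivity
  have hqν : q ≤ ν / 33 := by
    have : q ≤ μ / (33 * Γ ^ 3) * Γ := by rw [hq]; gcongr
    refine this.trans (le_of_eq ?_)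
    rw [hν, hb]; field_simp
  have hq1 : q ≤ 1 / 132 := by linarith
  have hη' : η = Real.exp (-(q / 2)) := by rw [hη, hq]
  obtain ⟨h0, h1, h2, h3, h4, h5⟩ := damping_bounds hq0.le
  rw [← hη'] at h0 h1 h2 h3 h4 h5
  have k1 := kick_refresh_le y (η • u - (q * b / 2) • g₀) g₁ hb0 hq0.le h3 h0 hν hg₁ hy'
  have k2 := drift_kick_le x (η • u) g₀ hb0 hb2 hq0.le hq1 hν hν0 hν1 h0 h1 h2 h3 hg₀ hx
  simp only at k2
  have ey : x + (q * b) • (η • u - (q * b / 2) • g₀) = y := by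
    rw [hy, hqb]; module
  have eu : η • (η • u - (q * b / 2) • g₀) - (q * b * η / 2) • g₁ = u₁ := by
    rw [hu₁, hqb]; module
  rw [eu] at k1
  rw [ey] at k2
  have e2 : 2 / Γ = 2 * b := by rw [hb]; ring
  have e3 : 2 / 3 * (μ / Γ) * h = 2 / 3 * (q * ν) := by rw [hqb, hν, hb]; field_simp
  rw [e2, e3]
  refine k1.trans (k2.trans ?_)
  rw [inner_smul_right, norm_smul, Real.norm_eq_abs, mul_pow, sq_abs]
  set α := 1 - q * ν * η / 2 with hα
  have hqν0 : 0 < q * ν := by positivity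
  have hα_lo : 1 - q * ν / 2 ≤ α := by
    have : q * ν * η ≤ q * ν := mul_le_of_le_one_right hqν0.le h1
    linarith
  have hα_hi : α ≤ 1 := by
    have : 0 ≤ q * ν * η := by positivity
    linarith
  have hqq : q * q ≤ q * (1 / 132) := by gcongr
  have hqν' : q * q ≤ q * ν / 33 := by
    have := mul_le_mul_of_nonneg_left hqν hq0.le; linarith
  have hqν4 : q * ν ≤ q * (1 / 4) := by gcongr
  have hα0 : 0.99 ≤ α := by linarith
  -- the coefficient of the position
  have c1 : α - q * ν * (α * q + η) / 2 ≤ 1 - 0.996 * (q * ν) := by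
    have : q * ν * (α * q) ≥ 0 := by positivity
    have : q * ν * η ≥ q * ν * 0.996 := by gcongr; linarith
    linarith
  -- the cross term
  have hη_sq : 1 - q ≤ η ^ 2 := by
    have e1 := pow_le_pow_left₀ (by linarith) h2 2
    have e2 := sq_nonneg q
    linarith
  have hqη : q * (1 - q / 2) ≤ q * η := by gcongr
  have hqη' : q * η ≤ q := mul_le_of_le_one_right hq0.le h1
  have c2a : α * q * η ≤ q := by
    calc α * q * η ≤ 1 * q * 1 := by gcongr
      _ = q := by ring
  have c2b : q - 0.63 * (q * q) ≤ α * q * η := by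
    have e1 : (1 - q * ν / 2) * (q * η) ≤ α * (q * η) := by gcongr
    have e2 : q * ν / 2 * (q * η) ≤ q * ν / 2 * q := by gcongr
    have e3 : q * ν * q ≤ q * (1 / 4) * q := by gcongr
    have e4 : 0 ≤ q * q := by positivity
    linarith
  -- Mismatch between the desired and the actual cross coefficient. Since αqη + η² = 1 + O(q²), only
  -- about 2/3 qν remains, and it is treated as an error.
  set ε := 1 - 2 / 3 * (q * ν) - (α * q * η + η ^ 2) with hε
  have hε1 : ε ≤ 0.69 * (q * ν) := by linarith
  have hε2 : -(0.69 * (q * ν)) ≤ ε := by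
    have : q ^ 2 / 2 ≤ q * ν / 66 := by rw [sq]; linarith
    linarith
  -- The weight 0.47 is chosen so that 0.69 · 0.47 stays below 0.329, the slack left in the position
  -- coefficient (0.996 - 2/3).
  have cross : 2 * b * ε * ⟪x, u⟫ ≥ -(0.69 * (q * ν) * (0.47 * ‖x‖ ^ 2 + b ^ 2 / 0.47 * ‖u‖ ^ 2)) := by
    have hi := abs_real_inner_le_norm x u
    have hab : |ε| ≤ 0.69 * (q * ν) := abs_le.2 ⟨hε2, hε1⟩
    have : |ε * ⟪x, u⟫| ≤ 0.69 * (q * ν) * (‖x‖ * ‖u‖) := by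
      rw [abs_mul]; gcongr
    have h' := (abs_le.1 this).1
    have h'' : 2 * b * (‖x‖ * ‖u‖) ≤ 0.47 * ‖x‖ ^ 2 + b ^ 2 / 0.47 * ‖u‖ ^ 2 := by
      have := sq_nonneg (0.47 * ‖x‖ - b * ‖u‖)
      have e : 0.47 * (0.47 * ‖x‖ ^ 2 + b ^ 2 / 0.47 * ‖u‖ ^ 2 - 2 * b * (‖x‖ * ‖u‖))
        = (0.47 * ‖x‖ - b * ‖u‖) ^ 2 := by ring
      linarith
    have h3' : 0.69 * (q * ν) * (2 * b * (‖x‖ * ‖u‖))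
      ≤ 0.69 * (q * ν) * (0.47 * ‖x‖ ^ 2 + b ^ 2 / 0.47 * ‖u‖ ^ 2) := by gcongr
    have h4' : 2 * b * (ε * ⟪x, u⟫) ≥ 2 * b * (-(0.69 * (q * ν) * (‖x‖ * ‖u‖))) := by gcongr
    linarith
  -- the coefficient of the velocity
  set C := α * q ^ 2 * b ^ 2 + 2 * b ^ 2 * η * q + η ^ 2 * (1 + q / 2) with hC
  have hC1 : C ≤ 1 + 0.5 * (q * q) := by
    have a1 : α * q ^ 2 * b ^ 2 ≤ 1 * q ^ 2 * (1 / 4) := by gcongr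
    have a2 : 2 * b ^ 2 * η * q ≤ 2 * (1 / 4) * 1 * q := by gcongr
    have a3 : η ^ 2 * (1 + q / 2) ≤ η := by
      calc η ^ 2 * (1 + q / 2) = η * (η * (1 + q / 2)) := by ring
        _ ≤ η * 1 := by gcongr
        _ = η := mul_one η
    rw [hC]; linarith
  have hC0 : 0 ≤ C := by simp only [C]; positivity
  -- To first order the product is 1 - (4/9) q: the friction gives -q and the factor 1 + q/1.8
  -- returns 5/9 q.
  have c3 : C * (1 + q / 1.8) * η ^ 2 ≤ 1 - 0.4 * q := by
    have s1 : C * (1 + q / 1.8) * η ^ 2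
        ≤ (1 + 0.5 * (q * q)) * (1 + q / 1.8) * (1 - q + q ^ 2 / 2) := by
      gcongr
    refine s1.trans ?_
    have p1 : 0 ≤ q * q := by positivity
    have p2 : q * q * q ≤ q * q * (1 / 132) := by gcongr
    have p3 : q * q * q * q ≤ q * q * (1 / 132) := by
      calc q * q * q * q ≤ q * q * (1 / 132) * 1 := by gcongr; linarith
        _ = _ := by ring
    have p4 : q * q * q * q * q ≤ q * q * (1 / 132) := by
      calc q * q * q * q * q ≤ q * q * (1 / 132) * 1 * 1 := by gcongr <;> linarith
        _ = _ := by ring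
    have p0 : 0 ≤ q * q * q * q := by positivity
    have p0' : 0 ≤ q * q * q := by positivity
    have e : (1 + 0.5 * (q * q)) * (1 + q / 1.8) * (1 - q + q ^ 2 / 2)
        = 1 - 4 / 9 * q + 4 / 9 * (q * q) + 1 / 18 * (q * q * q) - 1 / 36 * (q * q * q * q)
          + 5 / 36 * (q * q * q * q * q) := by
      ring
    rw [e]
    linarith
  have fx := mul_le_mul_of_nonneg_right c1 (sq_nonneg ‖x‖)
  have fu := mul_le_mul_of_nonneg_right c3 (sq_nonneg ‖u‖)
  have hvel : (2 / 3 + 0.69 / 0.47 * b ^ 2) * (q * ν) ≤ 0.4 * q := by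
    calc (2 / 3 + 0.69 / 0.47 * b ^ 2) * (q * ν)
        ≤ (2 / 3 + 0.69 / 0.47 * (1 / 4)) * (q * (1 / 4)) := by gcongr
      _ ≤ 0.4 * q := by norm_num; linarith
  have fv := mul_le_mul_of_nonneg_right hvel (sq_nonneg ‖u‖)
  have key : 2 * (b * (α * q + η)) * (η * ⟪x, u⟫)
      = 2 * b * (1 - 2 / 3 * (q * ν)) * ⟪x, u⟫ - 2 * b * ε * ⟪x, u⟫ := by
    rw [hε]; ring
  rw [key]
  have hx2 : 0 ≤ (0.329 - 0.69 * 0.47) * (q * ν) * ‖x‖ ^ 2 := by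
    have : (0 : ℝ) ≤ 0.329 - 0.69 * 0.47 := by norm_num
    positivity
  have hx3 : 0.996 - 2 / 3 ≥ (0.329 : ℝ) := by norm_num
  have hx4 := mul_le_mul_of_nonneg_right hx3 (mul_nonneg hqν0.le (sq_nonneg ‖x‖))
  have hgoal : C * (1 + q / 1.8) * (η ^ 2 * ‖u‖ ^ 2) = C * (1 + q / 1.8) * η ^ 2 * ‖u‖ ^ 2 := by ring
  rw [hgoal]
  linear_combination fx + fu + fv + hx2 + hx4 + cross

end Inner

/-! ### Smooth strongly convex potentials -/

/-- If `f 0 = 0` and `f' t ≤ c t` on `[0, 1]`, then `f 1 ≤ c / 2`. -/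
lemma le_half_of_hasDerivAt_le {f f' : ℝ → ℝ} {c : ℝ} (hf : ∀ t, HasDerivAt f (f' t) t)
    (h : ∀ t, 0 ≤ t → t ≤ 1 → f' t ≤ c * t) : f 1 ≤ f 0 + c / 2 := by
  have hd : ∀ t, HasDerivAt (fun t => f t - c * t ^ 2 / 2) (f' t - c * t) t := by
    intro t
    have h2 := (((hasDerivAt_id t).pow 2).const_mul c).div_const 2
    refine ((hf t).sub h2).congr_deriv ?_
    simp; ring
  have hm : AntitoneOn (fun t => f t - c * t ^ 2 / 2) (Set.Icc 0 1) := by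
    apply antitoneOn_of_deriv_nonpos (convex_Icc 0 1)
    · exact fun t _ => (hd t).continuousAt.continuousWithinAt
    · exact fun t _ => (hd t).differentiableAt.differentiableWithinAt
    · intro t ht
      rw [interior_Icc] at ht
      rw [(hd t).deriv]
      linarith [h t ht.1.le ht.2.le]
  have := hm (Set.left_mem_Icc.2 zero_le_one) (Set.right_mem_Icc.2 zero_le_one) zero_le_one
  simp at this
  linarith

/-- The standing assumptions on the potential and the parameters of the scheme. -/
structure Setting {d : ℕ} (U : Pos d → ℝ) (m L γ δ : ℝ) : Prop where
  contDiff : ContDiff ℝ 2 U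
  m_pos : 0 < m
  L_pos : 0 < L
  m_le : m ≤ L
  lip : GradLip U L
  conv : StrongConv U m
  γ_ge : 2 * Real.sqrt L ≤ γ
  δ_pos : 0 < δ
  δ_le : δ ≤ m / (33 * γ ^ 3)

namespace Setting

variable {d : ℕ} {U : Pos d → ℝ} {m L γ δ : ℝ}

section Basic
variable (hS : Setting U m L γ δ)
include hS

lemma γ_pos : 0 < γ := by
  have := hS.γ_ge
  have := Real.sqrt_pos.2 hS.L_pos
  linarith

lemma hasGradientAt (x : Pos d) : HasGradientAt U (gradient U x) x :=
  ((hS.contDiff.differentiable (by norm_num)) x).hasGradientAt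

lemma contDiff_gradient : ContDiff ℝ 1 (gradient U) := by
  have h : ContDiff ℝ 1 (fderiv ℝ U) := hS.contDiff.fderiv_right (by norm_num)
  exact (InnerProductSpace.toDual ℝ (Pos d)).symm.contDiff.comp h

lemma continuous_gradient : Continuous (gradient U) := hS.contDiff_gradient.continuous

lemma differentiable_gradient : Differentiable ℝ (gradient U) :=
  hS.contDiff_gradient.differentiable (by norm_num)

lemma continuous_potential : Continuous U := hS.contDiff.continuous

lemma fderiv_apply (x h : Pos d) : fderiv ℝ U x h = ⟪gradient U x, h⟫ := by
  have := (hS.hasGradientAt x).hasFDerivAt.fderiv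
  rw [this]; simp

lemma norm_fderiv_gradient_le (x : Pos d) : ‖fderiv ℝ (gradient U) x‖ ≤ L := by
  have h : LipschitzWith L.toNNReal (gradient U) := by
    apply LipschitzWith.of_dist_le_mul
    intro x y
    rw [dist_eq_norm, dist_eq_norm, Real.coe_toNNReal _ hS.L_pos.le]
    exact hS.lip x y
  have := norm_fderiv_le_of_lipschitz ℝ h (x₀ := x)
  rwa [Real.coe_toNNReal _ hS.L_pos.le] at this

lemma inner_fderiv_gradient_comm (x u v : Pos d) :
    ⟪fderiv ℝ (gradient U) x u, v⟫ = ⟪u, fderiv ℝ (gradient U) x v⟫ := by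
  have hsym : IsSymmSndFDerivAt ℝ U x :=
    hS.contDiff.contDiffAt.isSymmSndFDerivAt (by simp)
  have key : ∀ u v, ⟪fderiv ℝ (gradient U) x u, v⟫ = fderiv ℝ (fderiv ℝ U) x u v := by
    intro u v
    have h1 : HasFDerivAt (fderiv ℝ U) (fderiv ℝ (fderiv ℝ U) x) x :=
      ((hS.contDiff.fderiv_right (m := 1) (by norm_num)).differentiable (by norm_num) x).hasFDerivAt
    have h2 := ((InnerProductSpace.toDual ℝ (Pos d)).symm.toContinuousLinearEquiv.toContinuousLinearMap.hasFDerivAt).comp x h1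
    have h3 : HasFDerivAt (gradient U) _ x := h2
    rw [h3.fderiv]
    simp
  rw [key u v, hsym u v, ← key v u, real_inner_comm]

lemma hasDerivAt_ray (x h : Pos d) (t : ℝ) :
    HasDerivAt (fun t : ℝ => U (x + t • h)) ⟪gradient U (x + t • h), h⟫ t := by
  have h1 : HasDerivAt (fun t : ℝ => x + t • h) h t := by
    simpa using ((hasDerivAt_id t).smul_const h).const_add x
  refine (((hS.hasGradientAt (x + t • h)).hasFDerivAt).comp_hasDerivAt t h1).congr_deriv ?_
  simp

lemma lower_bound (x y : Pos d) :
    U x + ⟪gradient U x, y - x⟫ + m / 2 * ‖y - x‖ ^ 2 ≤ U y := by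
  set h := y - x
  have hd : ∀ t, HasDerivAt (fun t : ℝ => -(U (x + t • h) - t * ⟪gradient U x, h⟫))
      (-(⟪gradient U (x + t • h), h⟫ - ⟪gradient U x, h⟫)) t := by
    intro t
    refine ((hS.hasDerivAt_ray x h t).sub ((hasDerivAt_id t).mul_const _)).neg.congr_deriv ?_
    simp
  have := le_half_of_hasDerivAt_le (c := -(m * ‖h‖ ^ 2)) hd (by
    intro t ht _
    rcases ht.eq_or_lt with rfl | ht
    · simp
    have hc := hS.conv (x + t • h) x
    rw [add_sub_cancel_left, inner_smul_left, norm_smul, Real.norm_eq_abs, mul_pow, sq_abs,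
      inner_sub_right] at hc
    simp only [RCLike.conj_to_real] at hc
    rw [real_inner_comm (gradient U (x + t • h)) h, real_inner_comm (gradient U x) h] at hc
    have : t * (m * t * ‖h‖ ^ 2) ≤ t * (⟪gradient U (x + t • h), h⟫ - ⟪gradient U x, h⟫) := by
      linarith
    have := le_of_mul_le_mul_left this ht
    linarith)
  simp only [one_smul, zero_smul, add_zero, one_mul, zero_mul, sub_zero] at this
  have e : x + h = y := by simp [h]
  rw [e] at this
  linarith

lemma upper_bound (x y : Pos d) :
    U y ≤ U x + ⟪gradient U x, y - x⟫ + L / 2 * ‖y - x‖ ^ 2 := by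
  set h := y - x
  have hd : ∀ t, HasDerivAt (fun t : ℝ => U (x + t • h) - t * ⟪gradient U x, h⟫)
      (⟪gradient U (x + t • h), h⟫ - ⟪gradient U x, h⟫) t := by
    intro t
    refine ((hS.hasDerivAt_ray x h t).sub ((hasDerivAt_id t).mul_const _)).congr_deriv ?_
    simp
  have := le_half_of_hasDerivAt_le (c := L * ‖h‖ ^ 2) hd (by
    intro t ht _
    have hl := hS.lip (x + t • h) x
    rw [add_sub_cancel_left, norm_smul, Real.norm_eq_abs, abs_of_nonneg ht] at hl
    rw [← inner_sub_left]
    calc ⟪gradient U (x + t • h) - gradient U x, h⟫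
        ≤ ‖gradient U (x + t • h) - gradient U x‖ * ‖h‖ := real_inner_le_norm _ _
      _ ≤ L * (t * ‖h‖) * ‖h‖ := by gcongr
      _ = L * ‖h‖ ^ 2 * t := by ring)
  simp only [one_smul, zero_smul, add_zero, one_mul, zero_mul, sub_zero] at this
  have e : x + h = y := by simp [h]
  rw [e] at this
  linarith

/-- Baillon–Haddad argument: bound U at the gradient step y - (∇U y - ∇U x)/L below by convexity at
x and above by smoothness at y. Adding the two inequalities obtained by exchanging x and y gives the
claim. -/
lemma cocoercive (x y : Pos d) :
    ‖gradient U x - gradient U y‖ ^ 2 ≤ L * ⟪x - y, gradient U x - gradient U y⟫ := by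
  have key : ∀ x y, U x + ⟪gradient U x, y - x⟫ + ‖gradient U y - gradient U x‖ ^ 2 / (2 * L)
      ≤ U y := by
    intro x y
    set w := gradient U y - gradient U x with hw
    have h1 := hS.lower_bound x (y - (1 / L) • w)
    have h2 := hS.upper_bound y (y - (1 / L) • w)
    have hp : 0 ≤ m / 2 * ‖y - (1 / L) • w - x‖ ^ 2 := by have := hS.m_pos; positivity
    have e1 : y - (1 / L) • w - y = -((1 / L) • w) := by abel
    have e2 : y - (1 / L) • w - x = (y - x) - (1 / L) • w := by abel
    rw [e1, norm_neg, inner_neg_right, inner_smul_right, norm_smul, Real.norm_eq_abs, mul_pow,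
      sq_abs] at h2
    rw [e2, inner_sub_right, inner_smul_right] at h1
    rw [e2] at hp
    have e3 : ⟪gradient U y, w⟫ - ⟪gradient U x, w⟫ = ‖w‖ ^ 2 := by
      rw [← inner_sub_left, ← hw, real_inner_self_eq_norm_sq]
    have e4 : L / 2 * ((1 / L) ^ 2 * ‖w‖ ^ 2) = ‖w‖ ^ 2 / (2 * L) := by
      have := hS.L_pos; field_simp
    have e5 : 1 / L * ⟪gradient U y, w⟫ - 1 / L * ⟪gradient U x, w⟫
        = 2 * (‖w‖ ^ 2 / (2 * L)) := by
      rw [← mul_sub, e3]; have := hS.L_pos; field_simp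
    linarith
  have h1 := key x y
  have h2 := key y x
  rw [norm_sub_rev (gradient U y)] at h1
  have e : ⟪x - y, gradient U x - gradient U y⟫
      = -(⟪gradient U x, y - x⟫ + ⟪gradient U y, x - y⟫) := by
    rw [real_inner_comm, inner_sub_left, ← neg_sub x y, inner_neg_right]; ring
  have hL := hS.L_pos
  have h3 : ‖gradient U x - gradient U y‖ ^ 2 / L ≤ ⟪x - y, gradient U x - gradient U y⟫ := by
    rw [e]
    have : ‖gradient U x - gradient U y‖ ^ 2 / L
      = 2 * (‖gradient U x - gradient U y‖ ^ 2 / (2 * L)) := by field_simp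
    linarith
  rwa [div_le_iff₀ hL, mul_comm] at h3

omit hS in
lemma gradient_eq_zero {xs : Pos d} (h : ∀ y, U xs ≤ U y) : gradient U xs = 0 := by
  have : IsLocalMin U xs := Filter.Eventually.of_forall h
  simp [gradient, this.fderiv_eq_zero]

/-- The time-step is small in the natural units. -/
lemma δ_sqrt_le : δ * Real.sqrt L ≤ 1 / 264 := by
  have hl := Real.sqrt_pos.2 hS.L_pos
  have hγ := hS.γ_ge
  have hγ0 := hS.γ_pos
  have hsq : Real.sqrt L ^ 2 = L := Real.sq_sqrt hS.L_pos.le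
  have h1 : δ ≤ L / (33 * (2 * Real.sqrt L) ^ 3) := by
    refine hS.δ_le.trans ?_
    have := hS.m_le
    have := hS.L_pos
    gcongr
  calc δ * Real.sqrt L ≤ L / (33 * (2 * Real.sqrt L) ^ 3) * Real.sqrt L := by gcongr
    _ = 1 / 264 := by
      nth_rw 1 [← hsq]; field_simp; norm_num

lemma δ_γ_le : δ * γ ≤ 1 / 132 := by
  have hγ := hS.γ_ge
  have hγ0 := hS.γ_pos
  have hsq : Real.sqrt L ^ 2 = L := Real.sq_sqrt hS.L_pos.le
  have h4 : 4 * L ≤ γ ^ 2 := by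
    calc 4 * L = (2 * Real.sqrt L) ^ 2 := by rw [mul_pow, hsq]; norm_num
      _ ≤ γ ^ 2 := by gcongr
  have hm := hS.m_le
  calc δ * γ ≤ m / (33 * γ ^ 3) * γ := by gcongr; exact hS.δ_le
    _ = m / (33 * γ ^ 2) := by field_simp
    _ ≤ 1 / 132 := by
      rw [div_le_div_iff₀ (by positivity) (by norm_num)]; linarith

lemma κ_pos : 0 < κ m γ := by
  have := hS.m_pos; have := hS.γ_pos; unfold κ; positivity

lemma δ_κ_le : δ * κ m γ ≤ 1 / 1000 := by
  have hγ := hS.γ_ge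
  have hγ0 := hS.γ_pos
  have hm0 := hS.m_pos
  have hL0 := hS.L_pos
  have hsq : Real.sqrt L ^ 2 = L := Real.sq_sqrt hS.L_pos.le
  have h4 : 4 * L ≤ γ ^ 2 := by
    calc 4 * L = (2 * Real.sqrt L) ^ 2 := by rw [mul_pow, hsq]; norm_num
      _ ≤ γ ^ 2 := by gcongr
  have hm : m ≤ γ ^ 2 / 4 := by linarith [hS.m_le]
  have e : κ m γ ≤ γ / 12 := by
    unfold κ
    rw [div_le_div_iff₀ (by positivity) (by norm_num)]; nlinarith
  calc δ * κ m γ ≤ δ * (γ / 12) := by have := hS.δ_pos; gcongr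
    _ = (δ * γ) / 12 := by ring
    _ ≤ 1 / 1000 := by have := hS.δ_γ_le; linarith

end Basic

end Setting

/-! ### The modified norm and the contraction of the chain -/

/-- One step of the chain, driven by the noise `ξ`. -/
def obaboStep {d : ℕ} (U : Pos d → ℝ) (γ δ : ℝ) (z ξ : Phase d) : Phase d :=
  (stepPos U γ δ z ξ.1, stepVel U γ δ z ξ.1 ξ.2)

/-- Isometric embedding of the modified norm into a Euclidean space. -/
def starMap {d : ℕ} (L γ : ℝ) (z : Phase d) : WithLp 2 (Phase d) :=
  WithLp.toLp 2 (z.1 + (1 / γ) • z.2, Real.sqrt (1 / L - 1 / γ ^ 2) • z.2)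

/-- The modified norm: its square is `|x|² + 2 x · v / γ + |v|² / L`. -/
def starNorm {d : ℕ} (L γ : ℝ) (z : Phase d) : ℝ := ‖starMap L γ z‖

section Star

variable {d : ℕ} {L γ : ℝ}

lemma starMap_add (z w : Phase d) : starMap L γ (z + w) = starMap L γ z + starMap L γ w := by
  apply (WithLp.equiv 2 (Phase d)).injective
  refine Prod.ext ?_ ?_
  · change z.1 + w.1 + (1 / γ) • (z.2 + w.2) = z.1 + (1 / γ) • z.2 + (w.1 + (1 / γ) • w.2)
    module
  · change Real.sqrt (1 / L - 1 / γ ^ 2) • (z.2 + w.2)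
      = Real.sqrt (1 / L - 1 / γ ^ 2) • z.2 + Real.sqrt (1 / L - 1 / γ ^ 2) • w.2
    module

lemma starNorm_add_le (z w : Phase d) : starNorm L γ (z + w) ≤ starNorm L γ z + starNorm L γ w := by
  unfold starNorm
  rw [starMap_add]
  exact norm_add_le _ _

lemma starNorm_nonneg (z : Phase d) : 0 ≤ starNorm L γ z := norm_nonneg _

lemma continuous_starNorm : Continuous (starNorm L γ : Phase d → ℝ) := by
  unfold starNorm starMap
  refine Continuous.norm ?_
  refine (WithLp.prod_continuous_toLp 2 _ _).comp ?_
  fun_prop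

lemma starNorm_sub_comm (z w : Phase d) : starNorm L γ (z - w) = starNorm L γ (w - z) := by
  unfold starNorm
  have h : starMap L γ (z - w) = - starMap L γ (w - z) := by
    rw [eq_neg_iff_add_eq_zero, ← starMap_add]
    simp [starMap]
  rw [h, norm_neg]

/-- Completing the square. The condition on γ makes 1/L - 1/γ² nonnegative, so the square root in
`starMap` is not truncated to zero. -/
lemma starNorm_sq (hL : 0 < L) (hγ : 2 * Real.sqrt L ≤ γ) (z : Phase d) :
    starNorm L γ z ^ 2 = ‖z.1‖ ^ 2 + 2 / γ * ⟪z.1, z.2⟫ + ‖z.2‖ ^ 2 / L := by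
  have hs := Real.sqrt_pos.2 hL
  have hγ0 : 0 < γ := by linarith
  have h4 : 4 * L ≤ γ ^ 2 := by
    calc 4 * L = (2 * Real.sqrt L) ^ 2 := by rw [mul_pow, Real.sq_sqrt hL.le]; norm_num
      _ ≤ γ ^ 2 := by gcongr
  have h0 : 0 ≤ 1 / L - 1 / γ ^ 2 := by
    rw [sub_nonneg]
    exact one_div_le_one_div_of_le hL (by linarith)
  unfold starNorm starMap
  rw [WithLp.prod_norm_sq_eq_of_L2]
  change ‖z.1 + (1 / γ) • z.2‖ ^ 2 + ‖Real.sqrt (1 / L - 1 / γ ^ 2) • z.2‖ ^ 2 = _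
  simp only [norm_add_sq_real, norm_smul, inner_smul_right, mul_pow, Real.norm_eq_abs, sq_abs,
    Real.sq_sqrt h0]
  ring

/-- The condition γ ≥ 2√L bounds the cross term by half of the diagonal part. -/
lemma starNorm_sq_bounds (hL : 0 < L) (hγ : 2 * Real.sqrt L ≤ γ) (z : Phase d) :
    (‖z.1‖ ^ 2 + ‖z.2‖ ^ 2 / L) / 2 ≤ starNorm L γ z ^ 2
      ∧ starNorm L γ z ^ 2 ≤ 3 / 2 * (‖z.1‖ ^ 2 + ‖z.2‖ ^ 2 / L) := by
  have hs := Real.sqrt_pos.2 hL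
  have hγ0 : 0 < γ := by linarith
  rw [starNorm_sq hL hγ]
  have h1 : |2 / γ * ⟪z.1, z.2⟫| ≤ (‖z.1‖ ^ 2 + ‖z.2‖ ^ 2 / L) / 2 := by
    rw [abs_mul, abs_of_pos (by positivity : 0 < 2 / γ)]
    calc 2 / γ * |⟪z.1, z.2⟫| ≤ 2 / (2 * Real.sqrt L) * (‖z.1‖ * ‖z.2‖) := by
          gcongr; exact abs_real_inner_le_norm _ _
      _ = ‖z.1‖ * (‖z.2‖ / Real.sqrt L) := by field_simp
      _ ≤ (‖z.1‖ ^ 2 + (‖z.2‖ / Real.sqrt L) ^ 2) / 2 := by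
          nlinarith [sq_nonneg (‖z.1‖ - ‖z.2‖ / Real.sqrt L)]
      _ = _ := by rw [div_pow, Real.sq_sqrt hL.le]
  have := abs_le.1 h1
  constructor <;> linarith

end Star

namespace Setting

variable {d : ℕ} {U : Pos d → ℝ} {m L γ δ : ℝ}

/-- The noise cancels in the difference. Measuring velocities in units √L, gradients in units L and
time in units 1/√L reduces the claim to `step_contraction_normalized` with Γ = γ/√L and μ = m/L. The
squared norm contracts by 1 - 2δκ, which is at most (1 - δκ)². -/
theorem starNorm_step_sub_le (hS : Setting U m L γ δ) (z w ξ : Phase d) :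
    starNorm L γ (obaboStep U γ δ z ξ - obaboStep U γ δ w ξ)
      ≤ (1 - δ * κ m γ) * starNorm L γ (z - w) := by
  have hL := hS.L_pos
  have hm := hS.m_pos
  have hδ := hS.δ_pos
  have hs := Real.sqrt_pos.2 hL
  have hss : Real.sqrt L * Real.sqrt L = L := Real.mul_self_sqrt hL.le
  have hss2 : Real.sqrt L ^ 2 = L := Real.sq_sqrt hL.le
  have hγ0 := hS.γ_pos
  set r := Real.sqrt L with hr
  set η := damping γ δ with hη
  set x := z.1 - w.1 with hx
  set v := z.2 - w.2 with hv
  set G₀ := gradient U z.1 - gradient U w.1 with hG₀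
  set z₁ := obaboStep U γ δ z ξ
  set w₁ := obaboStep U γ δ w ξ
  set G₁ := gradient U z₁.1 - gradient U w₁.1 with hG₁
  have hpos : z₁.1 - w₁.1 = x + (δ * r * η) • ((1 / r) • v) - ((δ * r) ^ 2 / 2) • ((1 / L) • G₀) := by
    have e1 : (δ * r * η) • ((1 / r) • v) = (δ * η) • v := by
      rw [smul_smul]; congr 1; field_simp
    have e2 : ((δ * r) ^ 2 / 2) • ((1 / L) • G₀) = (δ ^ 2 / 2) • G₀ := by
      rw [smul_smul]; congr 1; rw [mul_pow, hss2]; field_simp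
    rw [e1, e2]
    simp only [z₁, w₁, obaboStep, stepPos, ← hη, hx, hv, hG₀]
    module
  have hvel : (1 / r) • (z₁.2 - w₁.2)
      = η ^ 2 • ((1 / r) • v) - (δ * r * η / 2) • ((1 / L) • G₀ + (1 / L) • G₁) := by
    have e2 : (δ * r * η / 2) • ((1 / L) • G₀ + (1 / L) • G₁)
        = (1 / r) • ((δ * η / 2) • (G₀ + G₁)) := by
      rw [← smul_add, smul_smul, smul_smul]; congr 1; rw [← hss]; field_simp
    rw [e2, smul_comm (η ^ 2), ← smul_sub]
    congr 1
    simp only [z₁, w₁, obaboStep, stepVel, ← hη, hv, hG₀, hG₁]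
    module
  have coc : ∀ a b : Pos d, ‖(1 / L) • (gradient U a - gradient U b)‖ ^ 2
      ≤ ⟪a - b, (1 / L) • (gradient U a - gradient U b)⟫ := by
    intro a b
    have := hS.cocoercive a b
    rw [norm_smul, inner_smul_right, mul_pow, Real.norm_eq_abs, sq_abs]
    calc (1 / L) ^ 2 * ‖gradient U a - gradient U b‖ ^ 2
        ≤ (1 / L) ^ 2 * (L * ⟪a - b, gradient U a - gradient U b⟫) := by gcongr
      _ = _ := by field_simp
  have str : ∀ a b : Pos d, m / L * ‖a - b‖ ^ 2
      ≤ ⟪a - b, (1 / L) • (gradient U a - gradient U b)⟫ := by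
    intro a b
    have := hS.conv a b
    rw [inner_smul_right]
    calc m / L * ‖a - b‖ ^ 2 = 1 / L * (m * ‖a - b‖ ^ 2) := by ring
      _ ≤ _ := by gcongr
  have key := step_contraction_normalized x ((1 / r) • v) ((1 / L) • G₀) ((1 / L) • G₁)
    (h := δ * r) (Γ := γ / r) (μ := m / L) (η := η)
    (by rw [le_div_iff₀ hs]; exact hS.γ_ge) (by positivity)
    (by rw [div_le_one hL]; exact hS.m_le) (by positivity)
    (by
      have := hS.δ_le
      calc δ * r ≤ m / (33 * γ ^ 3) * r := by gcongr
        _ = m / L / (33 * (γ / r) ^ 3) := by rw [← hss]; field_simp)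
    (by rw [hη]; unfold damping; congr 1; field_simp)
    hpos hvel (coc _ _) (str _ _) (coc _ _) (str _ _)
  have conv : ∀ a b : Pos d, ‖a‖ ^ 2 + 2 / (γ / r) * ⟪a, (1 / r) • b⟫ + ‖(1 / r) • b‖ ^ 2
      = starNorm L γ (a, b) ^ 2 := by
    intro a b
    rw [starNorm_sq hL hS.γ_ge, inner_smul_right, norm_smul, mul_pow, Real.norm_eq_abs, sq_abs]
    have e1 : 2 / (γ / r) * (1 / r * ⟪a, b⟫) = 2 / γ * ⟪a, b⟫ := by field_simp
    have e2 : (1 / r) ^ 2 * ‖b‖ ^ 2 = ‖b‖ ^ 2 / L := by rw [← hss2]; field_simp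
    simp only
    rw [e1, e2]
  rw [conv, conv] at key
  have ec : 2 / 3 * (m / L / (γ / r)) * (δ * r) = 2 * (δ * κ m γ) := by
    unfold κ; rw [← hss]; field_simp
  rw [ec] at key
  have hk := hS.δ_κ_le
  have h0 : 0 ≤ 1 - δ * κ m γ := by linarith
  have h1 : 0 ≤ δ * κ m γ := by have := hS.κ_pos; positivity
  have e1 : (z₁ - w₁) = (z₁.1 - w₁.1, z₁.2 - w₁.2) := rfl
  have e2 : z - w = (x, v) := rfl
  rw [e1, e2]
  refine abs_le_of_sq_le_sq' ?_ (mul_nonneg h0 (starNorm_nonneg _)) |>.2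
  rw [mul_pow]
  refine key.trans ?_
  gcongr
  nlinarith

end Setting

/-! ### Splitting maps -/

/-- The velocity kick of length `h`. -/
def kick {d : ℕ} (U : Pos d → ℝ) (h : ℝ) (z : Phase d) : Phase d := (z.1, z.2 - h • gradient U z.1)

/-- The free flight of length `h`. -/
def drift {d : ℕ} (h : ℝ) (z : Phase d) : Phase d := (z.1 + h • z.2, z.2)

/-- The Verlet (kick-drift-kick) map. -/
def verlet {d : ℕ} (U : Pos d → ℝ) (h : ℝ) (z : Phase d) : Phase d :=
  kick U (h / 2) (drift h (kick U (h / 2) z))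

/-- The symplectic Euler map. -/
def euler {d : ℕ} (U : Pos d → ℝ) (h : ℝ) (z : Phase d) : Phase d := drift h (kick U h z)

section Volume

variable {d : ℕ} {U : Pos d → ℝ}

lemma continuous_kick (hU : Continuous (gradient U)) (h : ℝ) : Continuous (kick U h) := by
  unfold kick; fun_prop

lemma continuous_drift (h : ℝ) : Continuous (drift h : Phase d → Phase d) := by
  unfold drift; fun_prop

lemma continuous_verlet (hU : Continuous (gradient U)) (h : ℝ) : Continuous (verlet U h) :=
  (continuous_kick hU _).comp ((continuous_drift h).comp (continuous_kick hU _))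

lemma continuous_euler (hU : Continuous (gradient U)) (h : ℝ) : Continuous (euler U h) :=
  (continuous_drift h).comp (continuous_kick hU _)

/-- A kick is a shear: at each fixed position it is a translation in velocity. -/
lemma measurePreserving_kick (hU : Continuous (gradient U)) (h : ℝ) :
    MeasurePreserving (kick U h) (volume : Measure (Phase d)) volume := by
  have := MeasurePreserving.skew_product (μa := (volume : Measure (Pos d)))
    (μb := (volume : Measure (Pos d))) (μc := (volume : Measure (Pos d)))
    (μd := (volume : Measure (Pos d)))
    (f := id) (MeasurePreserving.id _) (g := fun x v => v - h • gradient U x)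
    (by
      have : Continuous (Function.uncurry fun (x v : Pos d) => v - h • gradient U x) := by
        unfold Function.uncurry; fun_prop
      exact this.measurable)
    (Eventually.of_forall fun x => by
      exact (measurePreserving_sub_right (volume : Measure (Pos d)) (h • gradient U x)).map_eq)
  exact this

lemma measurePreserving_drift (h : ℝ) :
    MeasurePreserving (drift h) (volume : Measure (Phase d)) volume := by
  have h1 := MeasurePreserving.skew_product (μa := (volume : Measure (Pos d)))
    (μb := (volume : Measure (Pos d))) (μc := (volume : Measure (Pos d)))
    (μd := (volume : Measure (Pos d)))
    (f := id) (MeasurePreserving.id _) (g := fun v x => x + h • v)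
    (by
      have : Continuous (Function.uncurry fun (v x : Pos d) => x + h • v) := by
        unfold Function.uncurry; fun_prop
      exact this.measurable)
    (Eventually.of_forall fun x => by
      exact (measurePreserving_add_right (volume : Measure (Pos d)) (h • x)).map_eq)
  have hs := Measure.measurePreserving_swap (μ := (volume : Measure (Pos d)))
    (ν := (volume : Measure (Pos d)))
  exact hs.comp (h1.comp hs)

lemma measurePreserving_verlet (hU : Continuous (gradient U)) (h : ℝ) :
    MeasurePreserving (verlet U h) (volume : Measure (Phase d)) volume :=
  (measurePreserving_kick hU _).comp ((measurePreserving_drift h).comp (measurePreserving_kick hU _))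

lemma measurePreserving_euler (hU : Continuous (gradient U)) (h : ℝ) :
    MeasurePreserving (euler U h) (volume : Measure (Phase d)) volume :=
  (measurePreserving_drift h).comp (measurePreserving_kick hU _)

end Volume

/-! ### The Hamiltonian dynamics -/

/-- `(X, V)` solves Hamilton's equations on `[0, T]`, started from `z`. -/
structure IsTraj {d : ℕ} (U : Pos d → ℝ) (T : ℝ) (z : Phase d) (X V : ℝ → Pos d) : Prop where
  pos_zero : X 0 = z.1
  vel_zero : V 0 = z.2
  hasDeriv_pos : ∀ t ∈ Set.Icc 0 T, HasDerivWithinAt X (V t) (Set.Icc 0 T) t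
  hasDeriv_vel : ∀ t ∈ Set.Icc 0 T, HasDerivWithinAt V (-gradient U (X t)) (Set.Icc 0 T) t

lemma hasDerivWithinAt_Ici_of_Icc {E : Type*} [NormedAddCommGroup E] [NormedSpace ℝ E]
    {f : ℝ → E} {f' : E} {a b t : ℝ} (h : HasDerivWithinAt f f' (Set.Icc a b) t)
    (ht : t ∈ Set.Ico a b) : HasDerivWithinAt f f' (Set.Ici t) t :=
  h.mono_of_mem_nhdsWithin <| by
    have : Set.Icc t b ∈ 𝓝[≥] t := Icc_mem_nhdsGE ht.2
    exact mem_of_superset this (Set.Icc_subset_Icc_left ht.1)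

namespace Setting

variable {d : ℕ} {U : Pos d → ℝ} {m L γ δ : ℝ}

/-- With velocities divided by √L the vector field is √L-Lipschitz. Since δ√L ≤ 1/264, one
application of Picard–Lindelöf covers the whole interval [0, δ]. -/
theorem exists_traj (hS : Setting U m L γ δ) (z : Phase d) : ∃ X V, IsTraj U δ z X V := by
  have hL := hS.L_pos
  have hs := Real.sqrt_pos.2 hL
  have hss : Real.sqrt L * Real.sqrt L = L := Real.mul_self_sqrt hL.le
  have hδ := hS.δ_pos
  have hδr := hS.δ_sqrt_le
  set r := Real.sqrt L with hr
  let f : Phase d → Phase d := fun y => (r • y.2, -(1 / r) • gradient U y.1)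
  have hlip : LipschitzWith r.toNNReal f := by
    apply LipschitzWith.of_dist_le_mul
    intro x y
    rw [Real.coe_toNNReal _ hs.le, dist_eq_norm, dist_eq_norm]
    have e : f x - f y = (r • (x.2 - y.2), -(1 / r) • (gradient U x.1 - gradient U y.1)) := by
      refine Prod.ext ?_ ?_ <;> simp only [f, Prod.fst_sub, Prod.snd_sub] <;> module
    rw [e, Prod.norm_mk]
    apply max_le
    · rw [norm_smul, Real.norm_eq_abs, abs_of_pos hs]
      gcongr
      exact norm_snd_le (x - y)
    · rw [norm_smul, Real.norm_eq_abs, abs_neg, abs_of_pos (by positivity)]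
      calc 1 / r * ‖gradient U x.1 - gradient U y.1‖ ≤ 1 / r * (L * ‖x.1 - y.1‖) := by
            gcongr; exact hS.lip _ _
        _ = r * ‖x.1 - y.1‖ := by rw [← hss]; field_simp
        _ ≤ r * ‖x - y‖ := by gcongr; exact norm_fst_le (x - y)
  let z₀ : Phase d := (z.1, (1 / r) • z.2)
  set M := ‖f z₀‖
  -- On the ball of radius a the field is bounded by M + √L a, and δ(M + √L a) ≤ δM + a/264 ≤ a.
  set a : ℝ := 2 * δ * M + 1 with ha
  have ha0 : 0 ≤ a := by positivity
  have hPL : IsPicardLindelof (fun _ : ℝ => f) (tmin := 0) (tmax := δ)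
      ⟨0, Set.left_mem_Icc.2 hδ.le⟩ z₀ a.toNNReal 0 (M + r * a).toNNReal r.toNNReal := by
    refine ⟨fun t _ => hlip.lipschitzOnWith, fun x _ => continuousOn_const, ?_, ?_⟩
    · intro t _ y hy
      rw [Real.coe_toNNReal _ (by positivity)]
      rw [Real.coe_toNNReal _ ha0, mem_closedBall_iff_norm] at hy
      have h1 := hlip.dist_le_mul y z₀
      rw [Real.coe_toNNReal _ hs.le, dist_eq_norm, dist_eq_norm] at h1
      calc ‖f y‖ = ‖f z₀ + (f y - f z₀)‖ := by congr 1; abel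
        _ ≤ ‖f z₀‖ + ‖f y - f z₀‖ := norm_add_le _ _
        _ ≤ M + r * a := by gcongr; exact h1.trans (by gcongr)
    · rw [Real.coe_toNNReal _ (by positivity), Real.coe_toNNReal _ ha0]
      simp only [sub_zero, sub_self, NNReal.coe_zero]
      rw [max_eq_left hδ.le]
      have : δ * r * a ≤ 1 / 264 * a := by gcongr
      rw [ha] at *
      nlinarith [mul_nonneg hδ.le (norm_nonneg (f z₀))]
  obtain ⟨α, hα0, hα⟩ := hPL.exists_eq_forall_mem_Icc_hasDerivWithinAt₀
  refine ⟨fun t => (α t).1, fun t => r • (α t).2, ?_, ?_, ?_, ?_⟩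
  · have : α 0 = z₀ := hα0
    simp [this, z₀]
  · have : α 0 = z₀ := hα0
    simp only [this, z₀, smul_smul]
    rw [mul_one_div_cancel hs.ne', one_smul]
  · intro t ht
    exact (hα t ht).fst
  · intro t ht
    have h2 : HasDerivWithinAt (fun t => (α t).2) (f (α t)).2 (Set.Icc 0 δ) t := (hα t ht).snd
    refine (h2.const_smul r).congr_deriv ?_
    simp only [f, smul_smul]
    rw [mul_neg, mul_one_div_cancel hs.ne', neg_smul, one_smul]

end Setting

namespace IsTraj

variable {d : ℕ} {U : Pos d → ℝ} {T : ℝ} {z : Phase d} {X V : ℝ → Pos d}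

lemma continuousOn_pos (h : IsTraj U T z X V) : ContinuousOn X (Set.Icc 0 T) :=
  fun t ht => (h.hasDeriv_pos t ht).continuousWithinAt

lemma continuousOn_vel (h : IsTraj U T z X V) : ContinuousOn V (Set.Icc 0 T) :=
  fun t ht => (h.hasDeriv_vel t ht).continuousWithinAt

/-- The energy is conserved. -/
lemma energy (h : IsTraj U T z X V) (hU : ∀ x, HasGradientAt U (gradient U x) x) {t : ℝ}
    (ht : t ∈ Set.Icc 0 T) : U (X t) + ‖V t‖ ^ 2 / 2 = U z.1 + ‖z.2‖ ^ 2 / 2 := by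
  have hd : ∀ s ∈ Set.Icc 0 T, HasDerivWithinAt (fun s => U (X s) + ‖V s‖ ^ 2 / 2) 0
      (Set.Icc 0 T) s := by
    intro s hs
    have h1 := (hU (X s)).hasFDerivAt.comp_hasDerivWithinAt s (h.hasDeriv_pos s hs)
    have h2 := ((h.hasDeriv_vel s hs).norm_sq).div_const 2
    refine (h1.add h2).congr_deriv ?_
    simp only [InnerProductSpace.toDual_apply_apply, inner_neg_right, real_inner_comm (V s)]
    ring
  have := constant_of_has_deriv_right_zero (f := fun s => U (X s) + ‖V s‖ ^ 2 / 2) (a := 0) (b := T)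
    (fun s hs => (hd s hs).continuousWithinAt)
    (fun s hs => hasDerivWithinAt_Ici_of_Icc (hd s (Set.Ico_subset_Icc_self hs)) hs) t ht
  simp only [h.pos_zero, h.vel_zero] at this
  exact this

/-- Mean value inequality along a trajectory between two times. -/
lemma norm_sub_sub_smul_le {E : Type*} [NormedAddCommGroup E] [NormedSpace ℝ E]
    {f f' : ℝ → E} {a b T C : ℝ} {c : E} (ha : 0 ≤ a) (hb : b ≤ T) (hab : a ≤ b)
    (hf : ∀ t ∈ Set.Icc 0 T, HasDerivWithinAt f (f' t) (Set.Icc 0 T) t)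
    (hC : ∀ t ∈ Set.Icc a b, ‖f' t - c‖ ≤ C) : ‖f b - f a - (b - a) • c‖ ≤ C * (b - a) := by
  have hsub : Set.Icc a b ⊆ Set.Icc 0 T := Set.Icc_subset_Icc ha hb
  have hd : ∀ t ∈ Set.Icc a b, HasDerivWithinAt (fun t => f t - t • c) (f' t - c)
      (Set.Icc a b) t := by
    intro t ht
    refine ((hf t (hsub ht)).mono hsub).sub ?_
    simpa using ((hasDerivAt_id t).smul_const c).hasDerivWithinAt
  have := norm_image_sub_le_of_norm_deriv_right_le_segment (f := fun t => f t - t • c)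
    (fun t ht => (hd t ht).continuousWithinAt)
    (fun t ht => hasDerivWithinAt_Ici_of_Icc (hd t (Set.Ico_subset_Icc_self ht)) ht)
    (fun t ht => hC t (Set.Ico_subset_Icc_self ht)) b (Set.right_mem_Icc.2 hab)
  convert this using 2
  module

end IsTraj

namespace Setting

variable {d : ℕ} {U : Pos d → ℝ} {m L γ δ : ℝ}

lemma euler_lipschitz (hS : Setting U m L γ δ) {h : ℝ} (hh : 0 ≤ h) (hh1 : h ≤ δ) (z w : Phase d) :
    ‖euler U h z - euler U h w‖ ≤ (1 + (1 + L + δ * L) * h) * ‖z - w‖ := by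
  have hL := hS.L_pos
  have h1 : ‖z.1 - w.1‖ ≤ ‖z - w‖ := norm_fst_le (z - w)
  have h2 : ‖z.2 - w.2‖ ≤ ‖z - w‖ := norm_snd_le (z - w)
  have hg := hS.lip z.1 w.1
  have hv : ‖(z.2 - h • gradient U z.1) - (w.2 - h • gradient U w.1)‖ ≤ (1 + h * L) * ‖z - w‖ := by
    have e : (z.2 - h • gradient U z.1) - (w.2 - h • gradient U w.1)
        = (z.2 - w.2) - h • (gradient U z.1 - gradient U w.1) := by module
    rw [e]
    refine (norm_sub_le _ _).trans ?_
    rw [norm_smul, Real.norm_eq_abs, abs_of_nonneg hh]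
    calc ‖z.2 - w.2‖ + h * ‖gradient U z.1 - gradient U w.1‖
        ≤ ‖z - w‖ + h * (L * ‖z - w‖) := by gcongr; exact hg.trans (by gcongr)
      _ = _ := by ring
  have hle : (1 + h * L) * ‖z - w‖ ≤ (1 + (1 + L + δ * L) * h) * ‖z - w‖ := by
    apply mul_le_mul_of_nonneg_right _ (norm_nonneg _)
    have : 0 ≤ (1 + δ * L) * h := by have := hS.δ_pos; positivity
    linarith
  have e : euler U h z - euler U h w
      = ((z.1 - w.1) + h • ((z.2 - h • gradient U z.1) - (w.2 - h • gradient U w.1)),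
        (z.2 - h • gradient U z.1) - (w.2 - h • gradient U w.1)) := by
    refine Prod.ext ?_ ?_ <;> simp only [euler, drift, kick, Prod.fst_sub, Prod.snd_sub]
    module
  rw [e, Prod.norm_mk]
  apply max_le
  · refine (norm_add_le _ _).trans ?_
    rw [norm_smul, Real.norm_eq_abs, abs_of_nonneg hh]
    calc ‖z.1 - w.1‖ + h * ‖(z.2 - h • gradient U z.1) - (w.2 - h • gradient U w.1)‖
        ≤ ‖z - w‖ + h * ((1 + h * L) * ‖z - w‖) := by gcongr
      _ = (1 + (1 + h * L) * h) * ‖z - w‖ := by ring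
      _ ≤ _ := by gcongr; nlinarith [mul_le_mul_of_nonneg_right hh1 hL.le]
  · exact hv.trans hle

/-- Only convergence of the scheme is needed, so the constant may depend on the trajectory: velocity
and gradient are bounded along it by compactness. -/
lemma euler_local_error (hS : Setting U m L γ δ) {z : Phase d} {X V : ℝ → Pos d}
    (h : IsTraj U δ z X V) :
    ∃ C, 0 ≤ C ∧ ∀ s t, 0 ≤ s → s ≤ t → t ≤ δ →
      ‖euler U (t - s) (X s, V s) - (X t, V t)‖ ≤ C * (t - s) ^ 2 := by
  have hL := hS.L_pos
  obtain ⟨Vb, hVb⟩ := isCompact_Icc.exists_bound_of_continuousOn h.continuousOn_vel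
  obtain ⟨Gb, hGb⟩ := isCompact_Icc.exists_bound_of_continuousOn
    (hS.continuous_gradient.comp_continuousOn h.continuousOn_pos)
  have h0 : (0 : ℝ) ∈ Set.Icc 0 δ := Set.left_mem_Icc.2 hS.δ_pos.le
  have hV0 : 0 ≤ Vb := (norm_nonneg _).trans (hVb 0 h0)
  have hG0 : 0 ≤ Gb := (norm_nonneg _).trans (hGb 0 h0)
  refine ⟨L * Vb + 2 * Gb, by positivity, fun s t hs hst ht => ?_⟩
  have hmem : ∀ r ∈ Set.Icc s t, r ∈ Set.Icc 0 δ := fun r hr => ⟨hs.trans hr.1, hr.2.trans ht⟩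
  have hX : ∀ r ∈ Set.Icc s t, ‖X r - X s‖ ≤ Vb * (t - s) := by
    intro r hr
    have := IsTraj.norm_sub_sub_smul_le (c := 0) hs (hr.2.trans ht) hr.1 h.hasDeriv_pos
      (fun u hu => by rw [sub_zero]; exact hVb u (hmem u ⟨hu.1, hu.2.trans hr.2⟩))
    rw [smul_zero, sub_zero] at this
    exact this.trans (by gcongr; exact hr.2)
  have hV : ∀ r ∈ Set.Icc s t, ‖V r - V s‖ ≤ Gb * (t - s) := by
    intro r hr
    have := IsTraj.norm_sub_sub_smul_le (c := 0) hs (hr.2.trans ht) hr.1 h.hasDeriv_vel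
      (fun u hu => by
        rw [sub_zero, norm_neg]; exact hGb u (hmem u ⟨hu.1, hu.2.trans hr.2⟩))
    rw [smul_zero, sub_zero] at this
    exact this.trans (by gcongr; exact hr.2)
  have e1 := IsTraj.norm_sub_sub_smul_le (c := V s) hs ht hst h.hasDeriv_pos hV
  have e2 := IsTraj.norm_sub_sub_smul_le (c := -gradient U (X s)) (C := L * (Vb * (t - s))) hs ht hst
    h.hasDeriv_vel (fun r hr => by
      rw [← neg_sub', norm_neg]
      exact (hS.lip _ _).trans (by have := hX r hr; gcongr))
  have e : euler U (t - s) (X s, V s) - (X t, V t)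
      = (-(X t - X s - (t - s) • V s) - (t - s) ^ 2 • gradient U (X s),
        -(V t - V s - (t - s) • -gradient U (X s))) := by
    refine Prod.ext ?_ ?_ <;> simp only [euler, drift, kick, Prod.fst_sub, Prod.snd_sub] <;> module
  have hts : 0 ≤ t - s := sub_nonneg.2 hst
  rw [e, Prod.norm_mk, norm_neg]
  apply max_le
  · refine (norm_sub_le _ _).trans ?_
    rw [norm_neg, norm_smul, Real.norm_eq_abs, abs_of_nonneg (by positivity)]
    have hg : ‖gradient U (X s)‖ ≤ Gb := hGb s (hmem s ⟨le_rfl, hst⟩)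
    calc ‖X t - X s - (t - s) • V s‖ + (t - s) ^ 2 * ‖gradient U (X s)‖
        ≤ Gb * (t - s) * (t - s) + (t - s) ^ 2 * Gb := by gcongr
      _ ≤ _ := by have : 0 ≤ L * Vb * (t - s) ^ 2 := by positivity
                  linarith
  · refine e2.trans ?_
    have : 0 ≤ 2 * Gb * (t - s) ^ 2 := by positivity
    linarith

/-- The symplectic Euler scheme converges to the Hamiltonian flow. -/
theorem tendsto_euler (hS : Setting U m L γ δ) {z : Phase d} {X V : ℝ → Pos d}
    (h : IsTraj U δ z X V) :
    Tendsto (fun n : ℕ => (euler U (δ / (n + 1)))^[n + 1] z) atTop (𝓝 (X δ, V δ)) := by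
  have hL := hS.L_pos
  have hδ := hS.δ_pos
  obtain ⟨C, hC0, hC⟩ := hS.euler_local_error h
  set K := 1 + L + δ * L with hK
  have hK0 : 0 ≤ K := by positivity
  -- Discrete Grönwall: each step multiplies the error by at most exp(Ks) and adds C s². After n + 1
  -- steps of length δ/(n + 1) the total is O(1/n).
  have bound : ∀ n : ℕ, ∀ k : ℕ, k ≤ n + 1 →
      ‖(euler U (δ / (n + 1)))^[k] z - (X (k * (δ / (n + 1))), V (k * (δ / (n + 1))))‖
        ≤ k * (C * (δ / (n + 1)) ^ 2) * Real.exp (K * (δ / (n + 1))) ^ k := by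
    intro n k
    set s : ℝ := δ / (n + 1) with hs
    have hs0 : 0 ≤ s := by positivity
    have hsn : (n + 1) * s = δ := by rw [hs]; field_simp
    have hs1 : s ≤ δ := by
      rw [hs]; apply div_le_self hδ.le; linarith [Nat.cast_nonneg (α := ℝ) n]
    induction k with
    | zero => intro _; simp [h.pos_zero, h.vel_zero]
    | succ k ih =>
      intro hk
      have ih := ih (by omega)
      rw [Function.iterate_succ_apply']
      have hk' : ((k + 1 : ℕ) : ℝ) ≤ n + 1 := by exact_mod_cast hk
      push_cast at hk' ⊢
      have ht : (k + 1) * s ≤ δ := by rw [← hsn]; gcongr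
      have e1 := hC (k * s) ((k + 1) * s) (by positivity) (by linarith) ht
      have es : (k + 1) * s - k * s = s := by ring
      rw [es] at e1
      have e2 := hS.euler_lipschitz hs0 hs1 ((euler U s)^[k] z) (X (k * s), V (k * s))
      have hexp : 1 + K * s ≤ Real.exp (K * s) := by linarith [Real.add_one_le_exp (K * s)]
      have hexp1 : 1 ≤ Real.exp (K * s) := Real.one_le_exp (by positivity)
      set A := Real.exp (K * s)
      calc ‖euler U s ((euler U s)^[k] z) - (X ((k + 1) * s), V ((k + 1) * s))‖
          ≤ ‖euler U s ((euler U s)^[k] z) - euler U s (X (k * s), V (k * s))‖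
            + ‖euler U s (X (k * s), V (k * s)) - (X ((k + 1) * s), V ((k + 1) * s))‖ :=
              norm_sub_le_norm_sub_add_norm_sub _ _ _
        _ ≤ A * (k * (C * s ^ 2) * A ^ k) + C * s ^ 2 * A ^ (k + 1) := by
            refine add_le_add (e2.trans ?_) (e1.trans ?_)
            · gcongr
            · exact le_mul_of_one_le_right (by positivity) (one_le_pow₀ hexp1)
        _ = _ := by ring
  rw [tendsto_iff_norm_sub_tendsto_zero]
  have lim : Tendsto (fun n : ℕ => C * δ ^ 2 * Real.exp (K * δ) * (1 / ((n : ℝ) + 1))) atTop (𝓝 0) := by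
    simpa using tendsto_one_div_add_atTop_nhds_zero_nat.const_mul (C * δ ^ 2 * Real.exp (K * δ))
  refine squeeze_zero (fun _ => norm_nonneg _) (fun n => ?_) lim
  have := bound n (n + 1) le_rfl
  push_cast at this
  have hsn : ((n : ℝ) + 1) * (δ / (n + 1)) = δ := by field_simp
  rw [hsn, ← Real.exp_nat_mul] at this
  refine this.trans (le_of_eq ?_)
  push_cast
  have e : ((n : ℝ) + 1) * (K * (δ / (n + 1))) = K * δ := by field_simp
  rw [e]
  field_simp

end Setting

/-! ### Confining potentials and moments -/

/-- Quadratic lower bound for a continuous potential. -/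
def IsConfining {d : ℕ} (W : Pos d → ℝ) : Prop :=
  Continuous W ∧ ∃ c w₀ : ℝ, 0 < c ∧ ∀ x, w₀ + c * ‖x‖ ^ 2 ≤ W x

lemma exists_rpow_le_exp_sq (r : ℝ) {c : ℝ} (hc : 0 < c) :
    ∃ C, 0 ≤ C ∧ ∀ t : ℝ, 0 ≤ t → (1 + t) ^ r ≤ C * Real.exp (c * t ^ 2) := by
  obtain ⟨n, hn⟩ := exists_nat_ge (max r 1)
  have hr : r ≤ n := (le_max_left _ _).trans hn
  have hn1 : (1 : ℝ) ≤ n := (le_max_right _ _).trans hn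
  have hn0 : (0 : ℝ) < n := by linarith
  -- `(1 + t) ≤ K exp (c t² / n)` for some `K`
  refine ⟨(1 + n / c + 1) ^ n, by positivity, fun t ht => ?_⟩
  have h1 : 1 + t ≤ (1 + n / c + 1) * Real.exp (c * t ^ 2 / n) := by
    have h2 := Real.add_one_le_exp (c * t ^ 2 / n)
    have h3 : 1 ≤ Real.exp (c * t ^ 2 / n) := Real.one_le_exp (by positivity)
    have h4 : t ≤ 1 + t ^ 2 := by nlinarith [sq_nonneg (t - 1)]
    have h5 : t ^ 2 ≤ n / c * Real.exp (c * t ^ 2 / n) := by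
      calc t ^ 2 = n / c * (c * t ^ 2 / n) := by field_simp
        _ ≤ n / c * Real.exp (c * t ^ 2 / n) := by gcongr; linarith
    nlinarith
  calc (1 + t) ^ r ≤ (1 + t) ^ (n : ℝ) := Real.rpow_le_rpow_of_exponent_le (by linarith) hr
    _ = (1 + t) ^ n := Real.rpow_natCast _ _
    _ ≤ ((1 + n / c + 1) * Real.exp (c * t ^ 2 / n)) ^ n := by gcongr
    _ = _ := by
      rw [mul_pow, ← Real.exp_nat_mul]; congr 2; field_simp

/-- The Boltzmann probability measure with potential `W`. -/
def boltzmann {d : ℕ} (W : Pos d → ℝ) : Measure (Pos d) := volume.tilted (fun x => -W x)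

namespace IsConfining

variable {d : ℕ} {W : Pos d → ℝ}

lemma integrable_of_growth (hW : IsConfining W) {f : Pos d → ℝ}
    (hf : AEStronglyMeasurable f volume) {C r : ℝ} (h : ∀ x, |f x| ≤ C * (1 + ‖x‖) ^ r) :
    Integrable (fun x => Real.exp (-W x) * f x) volume := by
  obtain ⟨hc, c, w₀, hc0, hw⟩ := hW
  obtain ⟨K, hK0, hK⟩ := exists_rpow_le_exp_sq r (half_pos hc0)
  have hg : Integrable (fun x : Pos d => Real.exp (-(c / 2) * ‖x‖ ^ 2)) volume := by
    have h1 := (GaussianFourier.integrable_cexp_neg_mul_sq_norm_add (V := Pos d) (b := (c / 2 : ℝ))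
      (by simpa using hc0) 0 0).norm
    refine h1.congr (Eventually.of_forall fun x => ?_)
    simp only [Complex.norm_exp]
    congr 1
    simp [← Complex.ofReal_pow]
  refine (hg.const_mul (|C| * Real.exp (-w₀) * K)).mono'
    ((Real.continuous_exp.comp hc.neg).aestronglyMeasurable.mul hf) (Eventually.of_forall fun x => ?_)
  rw [Real.norm_eq_abs, abs_mul, abs_of_pos (Real.exp_pos _)]
  have hC : |f x| ≤ |C| * (K * Real.exp (c / 2 * ‖x‖ ^ 2)) := by
    refine (h x).trans ?_
    have h0 : (0 : ℝ) ≤ (1 + ‖x‖) ^ r := by positivity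
    calc C * (1 + ‖x‖) ^ r ≤ |C| * (1 + ‖x‖) ^ r := by gcongr; exact le_abs_self C
      _ ≤ _ := by gcongr; exact hK _ (norm_nonneg x)
  calc Real.exp (-W x) * |f x|
      ≤ Real.exp (-w₀ + -(c * ‖x‖ ^ 2)) * (|C| * (K * Real.exp (c / 2 * ‖x‖ ^ 2))) := by
        gcongr; linarith [hw x]
    _ = |C| * Real.exp (-w₀) * K
        * (Real.exp (-(c * ‖x‖ ^ 2)) * Real.exp (c / 2 * ‖x‖ ^ 2)) := by rw [Real.exp_add]; ring
    _ = _ := by rw [← Real.exp_add]; congr 2; ring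

lemma integrable_exp (hW : IsConfining W) : Integrable (fun x => Real.exp (-W x)) volume := by
  have := hW.integrable_of_growth (f := fun _ => 1) aestronglyMeasurable_const (C := 1) (r := 0)
    (fun x => by simp)
  simpa using this

lemma isProbabilityMeasure (hW : IsConfining W) : IsProbabilityMeasure (boltzmann W) :=
  isProbabilityMeasure_tilted hW.integrable_exp

lemma integrable_boltzmann (hW : IsConfining W) {f : Pos d → ℝ}
    (hf : AEStronglyMeasurable f volume) {C r : ℝ} (h : ∀ x, |f x| ≤ C * (1 + ‖x‖) ^ r) :
    Integrable f (boltzmann W) := by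
  rw [boltzmann, integrable_tilted_iff hW.integrable_exp]
  exact hW.integrable_of_growth hf h

/-- Integration by parts: `∫ ∂_v f dμ = ∫ f ∂_v W dμ` for the Boltzmann measure `μ`. -/
lemma integral_by_parts (hW : IsConfining W) (hWd : Differentiable ℝ W) {CW : ℝ}
    (hCW : ∀ x, ‖fderiv ℝ W x‖ ≤ CW * (1 + ‖x‖)) {f : Pos d → ℝ} (hf : Differentiable ℝ f)
    {C r : ℝ} (h : ∀ x, |f x| ≤ C * (1 + ‖x‖) ^ r) {C' r' : ℝ}
    (h' : ∀ x, ‖fderiv ℝ f x‖ ≤ C' * (1 + ‖x‖) ^ r') (v : Pos d) :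
    ∫ x, f x * fderiv ℝ W x v ∂(boltzmann W) = ∫ x, fderiv ℝ f x v ∂(boltzmann W) := by
  have hd : ∀ x, HasFDerivAt (fun x => Real.exp (-W x)) (-(Real.exp (-W x)) • fderiv ℝ W x) x := by
    intro x
    refine ((hWd x).hasFDerivAt.neg.exp).congr_fderiv ?_
    simp
  have e : ∀ x, fderiv ℝ (fun x => Real.exp (-W x)) x v = -(Real.exp (-W x) * fderiv ℝ W x v) := by
    intro x; rw [(hd x).fderiv]; simp
  have i1 := hW.integrable_of_growth (f := fun x => fderiv ℝ f x v) (C := C' * ‖v‖) (r := r')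
    (measurable_fderiv_apply_const ℝ f v).aestronglyMeasurable (fun x => by
      rw [← Real.norm_eq_abs]
      refine ((fderiv ℝ f x).le_opNorm v).trans ?_
      calc ‖fderiv ℝ f x‖ * ‖v‖ ≤ C' * (1 + ‖x‖) ^ r' * ‖v‖ := by gcongr; exact h' x
        _ = _ := by ring)
  have i2 := hW.integrable_of_growth (f := f) hf.continuous.aestronglyMeasurable h
  have i3 := hW.integrable_of_growth (f := fun x => f x * fderiv ℝ W x v) (C := C * CW * ‖v‖)
    (r := r + 1)
    (hf.continuous.aestronglyMeasurable.mul
      (measurable_fderiv_apply_const ℝ W v).aestronglyMeasurable) (fun x => by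
      rw [abs_mul]
      have h1 : |fderiv ℝ W x v| ≤ CW * (1 + ‖x‖) * ‖v‖ := by
        rw [← Real.norm_eq_abs]
        exact ((fderiv ℝ W x).le_opNorm v).trans (by gcongr; exact hCW x)
      have h0 : 0 < 1 + ‖x‖ := by positivity
      rw [Real.rpow_add h0, Real.rpow_one]
      calc |f x| * |fderiv ℝ W x v| ≤ (C * (1 + ‖x‖) ^ r) * (CW * (1 + ‖x‖) * ‖v‖) := by
            gcongr
            · exact (abs_nonneg _).trans (h x)
            · exact h x
        _ = _ := by ring)
  have key := integral_mul_fderiv_eq_neg_fderiv_mul_of_integrable (𝕜 := ℝ) (μ := volume)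
    (f := f) (g := fun x => Real.exp (-W x)) (v := v)
    (i1.congr (Eventually.of_forall fun x => by simp only; ring))
    (by
      refine (i3.neg).congr (Eventually.of_forall fun x => ?_)
      simp only [e, Pi.neg_apply]; ring)
    (i2.congr (Eventually.of_forall fun x => by simp only; ring)) (fun x _ => hf x)
    (fun x _ => (hd x).differentiableAt)
  rw [boltzmann, integral_tilted, integral_tilted]
  set Z := ∫ x, Real.exp (-W x)
  have k1 : ∫ x, (Real.exp (-W x) / Z) • (f x * fderiv ℝ W x v)
      = Z⁻¹ * -∫ x, f x * fderiv ℝ (fun x => Real.exp (-W x)) x v := by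
    rw [← integral_neg, ← integral_const_mul]
    congr 1; ext x; rw [e, smul_eq_mul]; ring
  have k2 : ∫ x, (Real.exp (-W x) / Z) • (fderiv ℝ f x v)
      = Z⁻¹ * ∫ x, fderiv ℝ f x v * Real.exp (-W x) := by
    rw [← integral_const_mul]
    congr 1; ext x; rw [smul_eq_mul]; ring
  rw [k1, k2, key, neg_neg]

end IsConfining

/-- Weighted arithmetic-geometric mean inequality. -/
lemma mul_rpow_le_weighted {M X s : ℝ} (hM : 0 ≤ M) (hX : 0 ≤ X) (hs : 0 ≤ s) :
    M * X ^ s ≤ s / (s + 1) * X ^ (s + 1) + 1 / (s + 1) * M ^ (s + 1) := by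
  have hs1 : 0 < s + 1 := by linarith
  have h := Real.geom_mean_le_arith_mean2_weighted (w₁ := s / (s + 1)) (w₂ := 1 / (s + 1))
    (p₁ := X ^ (s + 1)) (p₂ := M ^ (s + 1)) (by positivity) (by positivity) (by positivity)
    (by positivity) (by field_simp)
  rw [← Real.rpow_mul hX, ← Real.rpow_mul hM, mul_div_cancel₀ _ hs1.ne', mul_one_div_cancel hs1.ne',
    Real.rpow_one] at h
  linarith

lemma clm_apply_eq_sum {d : ℕ} (T : Pos d →L[ℝ] ℝ) (y : Pos d) :
    T y = ∑ i, ⟪EuclideanSpace.basisFun (Fin d) ℝ i, y⟫ * T (EuclideanSpace.basisFun (Fin d) ℝ i) := by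
  conv_lhs => rw [← (EuclideanSpace.basisFun (Fin d) ℝ).sum_repr' y]
  rw [map_sum]
  exact Finset.sum_congr rfl fun i _ => by rw [map_smul, smul_eq_mul]

set_option maxHeartbeats 1000000 in
/-- Moment bound by Stein's method: if `c |G|² ≤ ∂_G W` and the derivative of `G` has norm at most
`Λ` and trace at most `Λ k`, then `E |G|^q ≤ (Λ (k + q - 2) / c)^(q/2)`. -/
theorem IsConfining.moment_le {d : ℕ} {W : Pos d → ℝ} (hW : IsConfining W)
    (hWd : Differentiable ℝ W) {CW : ℝ} (hCW : ∀ x, ‖fderiv ℝ W x‖ ≤ CW * (1 + ‖x‖))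
    {G : Pos d → Pos d} (hG : Differentiable ℝ G) {Λ c k q : ℝ} (hΛ : 0 ≤ Λ) (hc : 0 < c)
    (hk : 0 ≤ k) (hq : 2 ≤ q) (hGΛ : ∀ x, ‖fderiv ℝ G x‖ ≤ Λ)
    (htr : ∀ x, ∑ i, ⟪EuclideanSpace.basisFun (Fin d) ℝ i,
      fderiv ℝ G x (EuclideanSpace.basisFun (Fin d) ℝ i)⟫ ≤ Λ * k)
    (hGW : ∀ x, c * ‖G x‖ ^ 2 ≤ fderiv ℝ W x (G x)) :
    ∫ x, ‖G x‖ ^ q ∂(boltzmann W) ≤ (Λ * (k + q - 2) / c) ^ (q / 2) := by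
  have hprob := hW.isProbabilityMeasure
  set e := EuclideanSpace.basisFun (Fin d) ℝ with he
  set s := (q - 2) / 2 with hs
  have hs0 : 0 ≤ s := by rw [hs]; linarith
  have hlip : ∀ x, ‖G x‖ ≤ ‖G 0‖ + Λ * ‖x‖ := by
    intro x
    have := Convex.norm_image_sub_le_of_norm_fderiv_le (𝕜 := ℝ) (f := G) (s := Set.univ) (C := Λ)
      (fun x _ => hG x) (fun x _ => hGΛ x) convex_univ (Set.mem_univ 0) (Set.mem_univ x)
    rw [sub_zero] at this
    calc ‖G x‖ = ‖G 0 + (G x - G 0)‖ := by congr 1; abel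
      _ ≤ _ := (norm_add_le _ _).trans (by gcongr)
  -- growth
  set B := 1 + ‖G 0‖ + Λ with hB
  have hB1 : 1 ≤ B := by have := norm_nonneg (G 0); linarith
  have hgrow : ∀ x, ‖G x‖ ≤ B * (1 + ‖x‖) := by
    intro x
    refine (hlip x).trans ?_
    have := norm_nonneg (G 0); have := norm_nonneg x
    nlinarith [mul_nonneg (norm_nonneg (G 0)) (norm_nonneg x)]
  -- The power of |G|² need not be differentiable where G vanishes. It is replaced by |G|² + ε, and
  -- ε tends to 0 at the end.
  have main : ∀ ε : ℝ, 0 < ε → ε ≤ 1 →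
      ∫ x, ‖G x‖ ^ q ∂(boltzmann W) ≤ (Λ * (k + q - 2) / c + ε) ^ (q / 2) := by
    intro ε hε hε1
    let X : Pos d → ℝ := fun x => ‖G x‖ ^ 2 + ε
    have hX0 : ∀ x, 0 < X x := fun x => by positivity
    have hXgrow : ∀ x, X x ≤ (2 * B ^ 2) * (1 + ‖x‖) ^ 2 := by
      intro x
      have h1 : ‖G x‖ ^ 2 ≤ (B * (1 + ‖x‖)) ^ 2 := by gcongr; exact hgrow x
      have h2 : 1 ≤ (B * (1 + ‖x‖)) ^ 2 := one_le_pow₀ (by nlinarith [norm_nonneg x])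
      simp only [X]; rw [mul_pow] at *; linarith
    have hXpow : ∀ (t : ℝ), 0 ≤ t → ∀ x, X x ^ t ≤ (2 * B ^ 2) ^ t * (1 + ‖x‖) ^ (2 * t) := by
      intro t ht x
      calc X x ^ t ≤ ((2 * B ^ 2) * (1 + ‖x‖) ^ 2) ^ t :=
            Real.rpow_le_rpow (hX0 x).le (hXgrow x) ht
        _ = _ := by
          rw [Real.mul_rpow (by positivity) (by positivity), ← Real.rpow_natCast (1 + ‖x‖),
            ← Real.rpow_mul (by positivity)]
          norm_num
    have hXc : Continuous X := by
      have := hG.continuous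
      fun_prop
    have hXi : ∀ t : ℝ, 0 ≤ t → Integrable (fun x => X x ^ t) (boltzmann W) := by
      intro t ht
      refine hW.integrable_boltzmann (hXc.rpow_const fun x => Or.inl (hX0 x).ne').aestronglyMeasurable
        (C := (2 * B ^ 2) ^ t) (r := 2 * t) fun x => ?_
      rw [abs_of_nonneg (by have := hX0 x; positivity)]
      exact hXpow t ht x
    -- the vector field
    have hXd : ∀ x, HasFDerivAt (fun x => X x ^ s)
        ((s * X x ^ (s - 1)) • ((2 : ℝ) • (innerSL ℝ (G x)).comp (fderiv ℝ G x))) x := by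
      intro x
      have h1 : HasFDerivAt X ((2 : ℝ) • (innerSL ℝ (G x)).comp (fderiv ℝ G x)) x := by
        have := ((hG x).hasFDerivAt.norm_sq).add_const ε
        refine this.congr_fderiv ?_
        ext v; simp
      exact h1.rpow_const (Or.inl (hX0 x).ne')
    have hFd : ∀ i x, HasFDerivAt (fun x => X x ^ s * ⟪e i, G x⟫)
        (X x ^ s • (innerSL ℝ (e i)).comp (fderiv ℝ G x)
          + ⟪e i, G x⟫ • ((s * X x ^ (s - 1)) • ((2 : ℝ) • (innerSL ℝ (G x)).comp (fderiv ℝ G x)))) x := by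
      intro i x
      have h1 : HasFDerivAt (fun x => ⟪e i, G x⟫) ((innerSL ℝ (e i)).comp (fderiv ℝ G x)) x :=
        (innerSL ℝ (e i)).hasFDerivAt.comp x (hG x).hasFDerivAt
      exact (hXd x).mul h1
    have hei : ∀ i, ‖e i‖ = 1 := fun i => e.orthonormal.1 i
    have hGX : ∀ x, ‖G x‖ ^ 2 ≤ X x := fun x => by simp only [X]; linarith
    have hXs1 : ∀ x, X x ^ (s - 1) * X x = X x ^ s := by
      intro x
      nth_rw 2 [← Real.rpow_one (X x)]
      rw [← Real.rpow_add (hX0 x)]; congr 1; ring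
    have hFder : ∀ i x, ‖fderiv ℝ (fun x => X x ^ s * ⟪e i, G x⟫) x‖
        ≤ (Λ * (1 + 2 * s) * (2 * B ^ 2) ^ s) * (1 + ‖x‖) ^ (2 * s) := by
      intro i x
      rw [(hFd i x).fderiv]
      have a1 : ‖(innerSL ℝ (e i)).comp (fderiv ℝ G x)‖ ≤ Λ := by
        refine (ContinuousLinearMap.opNorm_comp_le _ _).trans ?_
        rw [innerSL_apply_norm, hei, one_mul]; exact hGΛ x
      have a2 : ‖(innerSL ℝ (G x)).comp (fderiv ℝ G x)‖ ≤ ‖G x‖ * Λ := by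
        refine (ContinuousLinearMap.opNorm_comp_le _ _).trans ?_
        rw [innerSL_apply_norm]; gcongr; exact hGΛ x
      have a3 : |⟪e i, G x⟫| ≤ ‖G x‖ := by
        have := abs_real_inner_le_norm (e i) (G x); rwa [hei, one_mul] at this
      have hXs : 0 ≤ X x ^ s := (Real.rpow_pos_of_pos (hX0 x) _).le
      have hXs' : 0 ≤ X x ^ (s - 1) := (Real.rpow_pos_of_pos (hX0 x) _).le
      refine (norm_add_le _ _).trans ?_
      rw [norm_smul, norm_smul, norm_smul, norm_smul, Real.norm_eq_abs, Real.norm_eq_abs,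
        Real.norm_eq_abs, Real.norm_eq_abs, abs_of_nonneg hXs, abs_of_nonneg (mul_nonneg hs0 hXs'),
        abs_two]
      calc X x ^ s * ‖(innerSL ℝ (e i)).comp (fderiv ℝ G x)‖
            + |⟪e i, G x⟫| * (s * X x ^ (s - 1) * (2 * ‖(innerSL ℝ (G x)).comp (fderiv ℝ G x)‖))
          ≤ X x ^ s * Λ + ‖G x‖ * (s * X x ^ (s - 1) * (2 * (‖G x‖ * Λ))) := by gcongr
        _ = X x ^ s * Λ + 2 * s * Λ * (X x ^ (s - 1) * ‖G x‖ ^ 2) := by ring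
        _ ≤ X x ^ s * Λ + 2 * s * Λ * (X x ^ (s - 1) * X x) := by gcongr; exact hGX x
        _ = Λ * (1 + 2 * s) * X x ^ s := by rw [hXs1]; ring
        _ ≤ _ := by rw [mul_assoc (Λ * (1 + 2 * s))]; gcongr; exact hXpow s hs0 x
    have hFgrow : ∀ i x, |X x ^ s * ⟪e i, G x⟫|
        ≤ ((2 * B ^ 2) ^ s * B) * (1 + ‖x‖) ^ (2 * s + 1) := by
      intro i x
      have hXs : 0 ≤ X x ^ s := (Real.rpow_pos_of_pos (hX0 x) _).le
      have a3 : |⟪e i, G x⟫| ≤ ‖G x‖ := by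
        have := abs_real_inner_le_norm (e i) (G x); rwa [hei, one_mul] at this
      rw [abs_mul, abs_of_nonneg hXs, Real.rpow_add (by positivity), Real.rpow_one]
      calc X x ^ s * |⟪e i, G x⟫|
          ≤ ((2 * B ^ 2) ^ s * (1 + ‖x‖) ^ (2 * s)) * (B * (1 + ‖x‖)) := by
            gcongr
            · exact hXpow s hs0 x
            · exact a3.trans (hgrow x)
        _ = _ := by ring
    have ibp : ∀ i, ∫ x, (X x ^ s * ⟪e i, G x⟫) * fderiv ℝ W x (e i) ∂(boltzmann W)
        = ∫ x, fderiv ℝ (fun x => X x ^ s * ⟪e i, G x⟫) x (e i) ∂(boltzmann W) := fun i =>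
      hW.integral_by_parts hWd hCW (fun x => (hFd i x).differentiableAt) (hFgrow i) (hFder i) (e i)
    have int2 : ∀ i, Integrable (fun x => fderiv ℝ (fun x => X x ^ s * ⟪e i, G x⟫) x (e i))
        (boltzmann W) := by
      intro i
      refine hW.integrable_boltzmann (measurable_fderiv_apply_const ℝ _ _).aestronglyMeasurable
        (C := Λ * (1 + 2 * s) * (2 * B ^ 2) ^ s) (r := 2 * s) fun x => ?_
      rw [← Real.norm_eq_abs]
      refine (ContinuousLinearMap.le_opNorm _ _).trans ?_
      rw [hei, mul_one]; exact hFder i x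
    have int1 : ∀ i, Integrable (fun x => (X x ^ s * ⟪e i, G x⟫) * fderiv ℝ W x (e i))
        (boltzmann W) := by
      intro i
      refine hW.integrable_boltzmann (C := ((2 * B ^ 2) ^ s * B) * CW) (r := 2 * s + 2)
        (Measurable.aestronglyMeasurable (Measurable.mul ?_ (measurable_fderiv_apply_const ℝ _ _)))
        fun x => ?_
      · exact (Differentiable.continuous fun x => (hFd i x).differentiableAt).measurable
      · rw [abs_mul]
        have h1 : |fderiv ℝ W x (e i)| ≤ CW * (1 + ‖x‖) := by
          rw [← Real.norm_eq_abs]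
          refine (ContinuousLinearMap.le_opNorm _ _).trans ?_
          rw [hei, mul_one]; exact hCW x
        calc |X x ^ s * ⟪e i, G x⟫| * |fderiv ℝ W x (e i)|
            ≤ (((2 * B ^ 2) ^ s * B) * (1 + ‖x‖) ^ (2 * s + 1)) * (CW * (1 + ‖x‖)) := by
              gcongr
              exact hFgrow i x
          _ = ((2 * B ^ 2) ^ s * B) * CW * ((1 + ‖x‖) ^ (2 * s + 1) * (1 + ‖x‖) ^ (1 : ℝ)) := by
              rw [Real.rpow_one]; ring
          _ = _ := by rw [← Real.rpow_add (by positivity)]; congr 2; ring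
    have sumL : ∀ x, ∑ i, (X x ^ s * ⟪e i, G x⟫) * fderiv ℝ W x (e i)
        = X x ^ s * fderiv ℝ W x (G x) := by
      intro x
      rw [clm_apply_eq_sum (fderiv ℝ W x) (G x), Finset.mul_sum]
      exact Finset.sum_congr rfl fun i _ => by rw [← he]; ring
    -- Divergence of the field X^s G: the trace of DG contributes Λk and differentiating X^s
    -- contributes at most 2sΛ = (q - 2)Λ.
    have sumR : ∀ x, ∑ i, fderiv ℝ (fun x => X x ^ s * ⟪e i, G x⟫) x (e i)
        ≤ Λ * (k + q - 2) * X x ^ s := by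
      intro x
      have hXs : 0 ≤ X x ^ s := (Real.rpow_pos_of_pos (hX0 x) _).le
      have hXs' : 0 ≤ X x ^ (s - 1) := (Real.rpow_pos_of_pos (hX0 x) _).le
      have e1 : ∑ i, fderiv ℝ (fun x => X x ^ s * ⟪e i, G x⟫) x (e i)
          = X x ^ s * ∑ i, ⟪e i, fderiv ℝ G x (e i)⟫
            + 2 * s * X x ^ (s - 1) * ⟪G x, fderiv ℝ G x (G x)⟫ := by
        have e2 : ⟪G x, fderiv ℝ G x (G x)⟫ = ∑ i, ⟪e i, G x⟫ * ⟪G x, fderiv ℝ G x (e i)⟫ := by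
          exact clm_apply_eq_sum ((innerSL ℝ (G x)).comp (fderiv ℝ G x)) (G x)
        rw [e2, Finset.mul_sum, Finset.mul_sum, ← Finset.sum_add_distrib]
        refine Finset.sum_congr rfl fun i _ => ?_
        rw [(hFd i x).fderiv]
        simp only [add_apply, smul_apply,
          ContinuousLinearMap.comp_apply, innerSL_apply_apply, smul_eq_mul]
        ring
      rw [e1]
      have e3 : ⟪G x, fderiv ℝ G x (G x)⟫ ≤ Λ * ‖G x‖ ^ 2 := by
        calc ⟪G x, fderiv ℝ G x (G x)⟫ ≤ ‖G x‖ * ‖fderiv ℝ G x (G x)‖ := real_inner_le_norm _ _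
          _ ≤ ‖G x‖ * (Λ * ‖G x‖) := by
              gcongr; exact (ContinuousLinearMap.le_opNorm _ _).trans (by gcongr; exact hGΛ x)
          _ = _ := by ring
      calc X x ^ s * ∑ i, ⟪e i, fderiv ℝ G x (e i)⟫
            + 2 * s * X x ^ (s - 1) * ⟪G x, fderiv ℝ G x (G x)⟫
          ≤ X x ^ s * (Λ * k) + 2 * s * X x ^ (s - 1) * (Λ * X x) := by
            gcongr
            · exact htr x
            · exact e3.trans (by gcongr; exact hGX x)
        _ = X x ^ s * (Λ * k) + 2 * s * Λ * (X x ^ (s - 1) * X x) := by ring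
        _ = _ := by rw [hXs1, hs]; ring
    -- conclusion
    have key : ∫ x, X x ^ s * fderiv ℝ W x (G x) ∂(boltzmann W)
        ≤ Λ * (k + q - 2) * ∫ x, X x ^ s ∂(boltzmann W) := by
      calc ∫ x, X x ^ s * fderiv ℝ W x (G x) ∂(boltzmann W)
          = ∑ i, ∫ x, (X x ^ s * ⟪e i, G x⟫) * fderiv ℝ W x (e i) ∂(boltzmann W) := by
            rw [← integral_finsetSum _ fun i _ => int1 i]
            simp_rw [sumL]
        _ = ∫ x, ∑ i, fderiv ℝ (fun x => X x ^ s * ⟪e i, G x⟫) x (e i) ∂(boltzmann W) := by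
            rw [integral_finsetSum _ fun i _ => int2 i]
            exact Finset.sum_congr rfl fun i _ => ibp i
        _ ≤ ∫ x, Λ * (k + q - 2) * X x ^ s ∂(boltzmann W) :=
            integral_mono (integrable_finsetSum _ fun i _ => int2 i) ((hXi s hs0).const_mul _) sumR
        _ = _ := integral_const_mul _ _
    have int3 : Integrable (fun x => X x ^ s * fderiv ℝ W x (G x)) (boltzmann W) :=
      (integrable_finsetSum Finset.univ fun i _ => int1 i).congr (Eventually.of_forall sumL)
    set M := Λ * (k + q - 2) / c + ε with hM
    have hM0 : 0 ≤ M := by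
      have : 0 ≤ Λ * (k + q - 2) / c := div_nonneg (mul_nonneg hΛ (by linarith)) hc.le
      linarith
    set A := ∫ x, X x ^ (s + 1) ∂(boltzmann W) with hA
    set S := ∫ x, X x ^ s ∂(boltzmann W) with hS
    -- Integration by parts along X^s G gives A ≤ M S. Young's inequality in the form M X^s ≤ (s
    -- X^(s+1) + M^(s+1))/(s + 1) then closes the estimate as A ≤ M^(s+1), without Hölder's
    -- inequality.
    have hAS : A ≤ M * S := by
      have h1 : ∀ x, c * X x ^ (s + 1) ≤ X x ^ s * fderiv ℝ W x (G x) + c * ε * X x ^ s := by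
        intro x
        have hXs : 0 ≤ X x ^ s := (Real.rpow_pos_of_pos (hX0 x) _).le
        rw [Real.rpow_add (hX0 x), Real.rpow_one]
        have := mul_le_mul_of_nonneg_left (hGW x) hXs
        have e4 : c * (X x ^ s * X x) = X x ^ s * (c * ‖G x‖ ^ 2) + c * ε * X x ^ s := by
          simp only [X]; ring
        linarith
      have h2 := integral_mono ((hXi (s + 1) (by linarith)).const_mul c)
        (int3.add ((hXi s hs0).const_mul (c * ε))) h1
      simp only [Pi.add_apply] at h2
      rw [integral_const_mul, integral_add int3 ((hXi s hs0).const_mul _), integral_const_mul] at h2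
      have h3 : c * A ≤ c * (M * S) := by
        have : c * (M * S) = Λ * (k + q - 2) * S + c * ε * S := by rw [hM]; field_simp
        rw [this]; linarith
      exact le_of_mul_le_mul_left h3 hc
    have hfin : A ≤ M ^ (s + 1) := by
      have hs1 : 0 < s + 1 := by linarith
      have h1 := integral_mono ((hXi s hs0).const_mul M)
        (((hXi (s + 1) (by linarith)).const_mul (s / (s + 1))).add
          (integrable_const (1 / (s + 1) * M ^ (s + 1))))
        (fun x => mul_rpow_le_weighted hM0 (hX0 x).le hs0)
      simp only [Pi.add_apply] at h1
      rw [integral_const_mul, integral_add ((hXi (s + 1) (by linarith)).const_mul _)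
        (integrable_const _), integral_const_mul, integral_const, probReal_univ, one_smul] at h1
      have h2 : A ≤ s / (s + 1) * A + 1 / (s + 1) * M ^ (s + 1) := hAS.trans h1
      have h3 : (s + 1) * A ≤ (s + 1) * (s / (s + 1) * A + 1 / (s + 1) * M ^ (s + 1)) := by gcongr
      have h4 : (s + 1) * (s / (s + 1) * A + 1 / (s + 1) * M ^ (s + 1)) = s * A + M ^ (s + 1) := by
        field_simp
      linarith
    have hsq : s + 1 = q / 2 := by rw [hs]; ring
    rw [hsq] at hfin hA
    have hGq : ∀ x, ‖G x‖ ^ q ≤ X x ^ (q / 2) := fun x => by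
      calc ‖G x‖ ^ q = (‖G x‖ ^ 2) ^ (q / 2) := by
            rw [← Real.rpow_natCast ‖G x‖, ← Real.rpow_mul (norm_nonneg _)]; congr 1; push_cast; ring
        _ ≤ X x ^ (q / 2) := Real.rpow_le_rpow (by positivity) (hGX x) (by linarith)
    have hle : ∫ x, ‖G x‖ ^ q ∂(boltzmann W) ≤ ∫ x, X x ^ (q / 2) ∂(boltzmann W) :=
      integral_mono_of_nonneg (Eventually.of_forall fun x => Real.rpow_nonneg (norm_nonneg _) _)
        (hXi (q / 2) (by linarith)) (Eventually.of_forall hGq)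
    exact hle.trans (hA.ge.trans hfin)
  have lim : Tendsto (fun ε : ℝ => (Λ * (k + q - 2) / c + ε) ^ (q / 2)) (𝓝[>] 0)
      (𝓝 ((Λ * (k + q - 2) / c) ^ (q / 2))) := by
    have h1 : ContinuousAt (fun ε : ℝ => (Λ * (k + q - 2) / c + ε) ^ (q / 2)) 0 :=
      ContinuousAt.rpow_const (by fun_prop) (Or.inr (by linarith))
    have := h1.tendsto.mono_left (nhdsWithin_le_nhds (s := Set.Ioi 0))
    simpa using this
  refine ge_of_tendsto lim ?_
  have : Set.Ioc (0 : ℝ) 1 ∈ 𝓝[>] (0 : ℝ) := Ioc_mem_nhdsGT one_pos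
  filter_upwards [this] with ε hε using main ε hε.1 hε.2

/-! ### Gaussian measures -/

lemma isConfining_gaussian (d : ℕ) : IsConfining (fun v : Pos d => ‖v‖ ^ 2 / 2) :=
  ⟨by fun_prop, 1 / 2, 0, by norm_num, fun x => by linarith⟩

/-- The characteristic functions agree. In this form the moment and perturbation estimates for
Boltzmann measures apply to the velocity too. -/
theorem boltzmann_gaussian (d : ℕ) :
    boltzmann (fun v : Pos d => ‖v‖ ^ 2 / 2) = stdGaussian (Pos d) := by
  have hc := isConfining_gaussian d
  have := hc.isProbabilityMeasure
  apply Measure.ext_of_charFun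
  ext t
  rw [charFun_stdGaussian, charFun_apply, boltzmann, integral_tilted]
  have hb : (0 : ℝ) < ((1 / 2 : ℝ) : ℂ).re := by simp
  have hZ := GaussianFourier.integral_cexp_neg_mul_sq_norm (V := Pos d) hb
  have hI := GaussianFourier.integral_cexp_neg_mul_sq_norm_add (V := Pos d) hb Complex.I t
  set Z := ∫ x : Pos d, Real.exp (-(‖x‖ ^ 2 / 2)) with hZdef
  have hZ0 : 0 < Z := integral_exp_pos hc.integrable_exp
  have eZ : (Z : ℂ) = ∫ v : Pos d, Complex.exp (-((1 / 2 : ℝ) : ℂ) * ‖v‖ ^ 2) := by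
    rw [hZdef, ← integral_complex_ofReal]
    congr 1; ext v; push_cast; congr 1; ring
  have e1 : ∫ x : Pos d, (Real.exp (-(‖x‖ ^ 2 / 2)) / Z) • Complex.exp (⟪x, t⟫ * Complex.I)
      = (Z : ℂ)⁻¹ * ∫ v : Pos d, Complex.exp (-((1 / 2 : ℝ) : ℂ) * ‖v‖ ^ 2 + Complex.I * ⟪t, v⟫) := by
    rw [← integral_const_mul]
    congr 1; ext v
    rw [Complex.exp_add, Complex.real_smul, real_inner_comm]
    push_cast
    rw [mul_comm Complex.I]
    have : Complex.exp (-(1 / 2) * (‖v‖ : ℂ) ^ 2) = Complex.exp (-((‖v‖ : ℂ) ^ 2 / 2)) := by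
      congr 1; ring
    rw [this]; ring
  rw [e1, hI, ← hZ, ← eZ, ← mul_assoc, inv_mul_cancel₀ (by exact_mod_cast hZ0.ne'), one_mul]
  congr 1
  rw [Complex.I_sq]; push_cast; ring

/-- Partial refreshment of the velocity. -/
def refresh {d : ℕ} (η : ℝ) (z : Phase d) (g : Pos d) : Phase d :=
  (z.1, η • z.2 + Real.sqrt (1 - η ^ 2) • g)

lemma measurable_refresh {d : ℕ} (η : ℝ) :
    Measurable (fun p : Phase d × Pos d => refresh η p.1 p.2) := by
  have : Continuous (fun p : Phase d × Pos d => refresh η p.1 p.2) := by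
    unfold refresh; fun_prop
  exact this.measurable

lemma measurePreserving_gaussian_comb (d : ℕ) {η : ℝ} (h1 : η ^ 2 ≤ 1) :
    MeasurePreserving (fun p : Pos d × Pos d => η • p.1 + Real.sqrt (1 - η ^ 2) • p.2)
      ((stdGaussian (Pos d)).prod (stdGaussian (Pos d))) (stdGaussian (Pos d)) := by
  refine ⟨by fun_prop, ?_⟩
  set s := Real.sqrt (1 - η ^ 2)
  have hs : s ^ 2 = 1 - η ^ 2 := Real.sq_sqrt (by linarith)
  have e : (fun p : Pos d × Pos d => η • p.1 + s • p.2)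
      = (fun p : Pos d × Pos d => p.1 + p.2) ∘ Prod.map (η • ·) (s • ·) := rfl
  rw [e, ← Measure.map_map (by fun_prop) (by fun_prop),
    ← Measure.map_prod_map _ _ (by fun_prop) (by fun_prop)]
  have m1 : IsProbabilityMeasure ((stdGaussian (Pos d)).map (η • ·)) :=
    Measure.isProbabilityMeasure_map (by fun_prop)
  have m2 : IsProbabilityMeasure ((stdGaussian (Pos d)).map (s • ·)) :=
    Measure.isProbabilityMeasure_map (by fun_prop)
  change Measure.conv ((stdGaussian (Pos d)).map (η • ·)) ((stdGaussian (Pos d)).map (s • ·)) = _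
  apply Measure.ext_of_charFun
  ext t
  rw [charFun_conv, charFun_map_smul, charFun_map_smul, charFun_stdGaussian, charFun_stdGaussian,
    charFun_stdGaussian, ← Complex.exp_add]
  congr 1
  rw [norm_smul, norm_smul]
  norm_cast
  rw [mul_pow, mul_pow, Real.norm_eq_abs, Real.norm_eq_abs, sq_abs, sq_abs, hs]
  ring

/-! ### Product Gibbs measures -/

/-- The Gibbs measure on phase space with position potential `W`. -/
def phaseMeasure {d : ℕ} (W : Pos d → ℝ) : Measure (Phase d) :=
  (boltzmann W).prod (stdGaussian (Pos d))

lemma IsConfining.isProbabilityMeasure_phase {d : ℕ} {W : Pos d → ℝ} (hW : IsConfining W) :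
    IsProbabilityMeasure (phaseMeasure W) := by
  have := hW.isProbabilityMeasure
  unfold phaseMeasure; infer_instance

lemma IsConfining.integrable_exp_phase {d : ℕ} {W : Pos d → ℝ} (hW : IsConfining W) :
    Integrable (fun z : Phase d => Real.exp (-(W z.1 + ‖z.2‖ ^ 2 / 2))) := by
  have := hW.integrable_exp.mul_prod (isConfining_gaussian d).integrable_exp
  refine this.congr (Eventually.of_forall fun z => ?_)
  simp only
  rw [← Real.exp_add]; congr 1; ring

theorem IsConfining.gibbs_eq {d : ℕ} {W : Pos d → ℝ} (hW : IsConfining W) :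
    gibbs W = phaseMeasure W := by
  have hZ : ∫ z : Phase d, Real.exp (-(W z.1 + ‖z.2‖ ^ 2 / 2))
      = (∫ x, Real.exp (-W x)) * ∫ v : Pos d, Real.exp (-(‖v‖ ^ 2 / 2)) := by
    rw [← integral_prod_mul]
    refine integral_congr_ae (Eventually.of_forall fun z => ?_)
    simp only
    rw [← Real.exp_add]; congr 1; ring
  have hm := hW.1.measurable
  unfold gibbs phaseMeasure
  rw [← boltzmann_gaussian]
  unfold boltzmann Measure.tilted
  rw [prod_withDensity (by fun_prop) (by fun_prop), hZ]
  change Measure.withDensity (Measure.prod volume volume) _ = _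
  congr 1
  ext z
  rw [← ENNReal.ofReal_mul (by positivity)]
  congr 1
  simp only
  rw [neg_add, Real.exp_add, div_mul_div_comm]

lemma measurePreserving_refresh {d : ℕ} (ρ : Measure (Pos d)) [SFinite ρ] {η : ℝ} (h1 : η ^ 2 ≤ 1) :
    MeasurePreserving (fun p : Phase d × Pos d => refresh η p.1 p.2)
      ((ρ.prod (stdGaussian (Pos d))).prod (stdGaussian (Pos d))) (ρ.prod (stdGaussian (Pos d))) := by
  have h := (MeasurePreserving.id ρ).prod (measurePreserving_gaussian_comb d h1)
  exact h.comp (measurePreserving_prodAssoc ρ (stdGaussian (Pos d)) (stdGaussian (Pos d)))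

/-- The law of the pair of noises used by one step of the chain. -/
def noise (d : ℕ) : Measure (Phase d) := (stdGaussian (Pos d)).prod (stdGaussian (Pos d))

instance (d : ℕ) : IsProbabilityMeasure (noise d) := by unfold noise; infer_instance

/-- Refresh, apply `Φ`, refresh. -/
def sandwich {d : ℕ} (η : ℝ) (Φ : Phase d → Phase d) (z ξ : Phase d) : Phase d :=
  refresh η (Φ (refresh η z ξ.1)) ξ.2

lemma measurable_sandwich {d : ℕ} (η : ℝ) {Φ : Phase d → Phase d} (hΦ : Measurable Φ) :
    Measurable (fun q : Phase d × Phase d => sandwich η Φ q.1 q.2) := by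
  have h1 : Measurable (fun q : Phase d × Phase d => Φ (refresh η q.1 q.2.1)) :=
    hΦ.comp ((measurable_refresh η).comp (by fun_prop : Measurable fun q : Phase d × Phase d =>
      (q.1, q.2.1)))
  exact (measurable_refresh η).comp (h1.prodMk (by fun_prop))

/-- This is the splitting O(BAB)O. Replacing the middle factor by the Hamiltonian flow produces the
ideal kernel to which the chain is compared. -/
lemma obaboStep_eq_sandwich {d : ℕ} (U : Pos d → ℝ) (γ δ : ℝ) (z ξ : Phase d) :
    obaboStep U γ δ z ξ = sandwich (damping γ δ) (verlet U δ) z ξ := by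
  have e : stepPos U γ δ z ξ.1 = (sandwich (damping γ δ) (verlet U δ) z ξ).1 := by
    simp only [stepPos, sandwich, refresh, verlet, kick, drift]
    module
  refine Prod.ext e ?_
  simp only [obaboStep, stepVel]
  rw [e]
  simp only [sandwich, refresh, verlet, kick, drift]
  module

lemma measurePreserving_sandwich {d : ℕ} (ρ : Measure (Pos d)) [IsProbabilityMeasure ρ] {η : ℝ}
    (h1 : η ^ 2 ≤ 1) {Φ : Phase d → Phase d}
    (hΦ : MeasurePreserving Φ (ρ.prod (stdGaussian (Pos d))) (ρ.prod (stdGaussian (Pos d)))) :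
    MeasurePreserving (fun q : Phase d × Phase d => sandwich η Φ q.1 q.2)
      ((ρ.prod (stdGaussian (Pos d))).prod (noise d)) (ρ.prod (stdGaussian (Pos d))) := by
  have hR := measurePreserving_refresh ρ h1
  have h := hR.comp ((hΦ.comp hR).prod (MeasurePreserving.id (stdGaussian (Pos d))))
  have hA := (measurePreserving_prodAssoc (ρ.prod (stdGaussian (Pos d))) (stdGaussian (Pos d))
    (stdGaussian (Pos d))).symm MeasurableEquiv.prodAssoc
  exact h.comp hA

/-! ### Invariance of the Gibbs measure under the Hamiltonian flow -/

namespace Setting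

variable {d : ℕ} {U : Pos d → ℝ} {m L γ δ : ℝ}

lemma isConfining (hS : Setting U m L γ δ) : IsConfining U := by
  refine ⟨hS.continuous_potential, m / 4, U 0 - ‖gradient U 0‖ ^ 2 / m, by linarith [hS.m_pos],
    fun x => ?_⟩
  have h := hS.lower_bound 0 x
  rw [sub_zero] at h
  have hm := hS.m_pos
  have h1 := abs_real_inner_le_norm (gradient U 0) x
  have h2 := (abs_le.1 h1).1
  have h3 : ‖gradient U 0‖ * ‖x‖ ≤ ‖gradient U 0‖ ^ 2 / m + m / 4 * ‖x‖ ^ 2 := by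
    have := sq_nonneg (‖gradient U 0‖ / m - ‖x‖ / 2)
    have e : ‖gradient U 0‖ ^ 2 / m + m / 4 * ‖x‖ ^ 2 - ‖gradient U 0‖ * ‖x‖
        = m * (‖gradient U 0‖ / m - ‖x‖ / 2) ^ 2 := by field_simp; ring
    nlinarith [mul_nonneg hm.le this]
  linarith

lemma damping_sq_le (hS : Setting U m L γ δ) : damping γ δ ^ 2 ≤ 1 := by
  have h : damping γ δ ≤ 1 := by
    unfold damping
    apply Real.exp_le_one_iff.2
    have := mul_pos hS.δ_pos hS.γ_pos; linarith
  have h0 : 0 ≤ damping γ δ := (Real.exp_pos _).le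
  nlinarith

/-- The Hamiltonian flow over the time-step preserves the Gibbs measure. -/
theorem exists_flow (hS : Setting U m L γ δ) : ∃ φ : Phase d → Phase d,
    MeasurePreserving φ (gibbs U) (gibbs U) ∧
      ∀ z, ∃ X V, IsTraj U δ z X V ∧ φ z = (X δ, V δ) := by
  choose X V hXV using hS.exists_traj
  let φ : Phase d → Phase d := fun z => (X z δ, V z δ)
  have hconv : ∀ z, Tendsto (fun n : ℕ => (euler U (δ / (n + 1)))^[n + 1] z) atTop (𝓝 (φ z)) :=
    fun z => hS.tendsto_euler (hXV z)
  have hcont : ∀ n : ℕ, Continuous ((euler U (δ / (n + 1)))^[n + 1]) := fun n =>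
    (continuous_euler hS.continuous_gradient _).iterate _
  have hmeas : Measurable φ :=
    measurable_of_tendsto_metrizable (fun n => (hcont n).measurable) (tendsto_pi_nhds.2 hconv)
  refine ⟨φ, ⟨hmeas, ?_⟩, fun z => ⟨X z, V z, hXV z, rfl⟩⟩
  have hprob : IsProbabilityMeasure (gibbs U) := by
    rw [hS.isConfining.gibbs_eq]; exact hS.isConfining.isProbabilityMeasure_phase
  set H : Phase d → ℝ := fun z => U z.1 + ‖z.2‖ ^ 2 / 2 with hH
  have hHc : Continuous H := by have := hS.continuous_potential; fun_prop
  have hHφ : ∀ z, H (φ z) = H z := fun z =>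
    (hXV z).energy hS.hasGradientAt (Set.right_mem_Icc.2 hS.δ_pos.le)
  set w : Phase d → ENNReal := fun z =>
    ENNReal.ofReal (Real.exp (-H z) / ∫ x, Real.exp (-H x)) with hw
  have hwc : Continuous w := by
    refine ENNReal.continuous_ofReal.comp ?_
    exact (Real.continuous_exp.comp hHc.neg).div_const _
  have hgib : ∀ f : Phase d → ENNReal, ∫⁻ z, f z ∂(gibbs U) = ∫⁻ z, w z * f z := by
    intro f
    rw [gibbs, lintegral_tilted]
  -- Fatou's lemma along the Euler schemes: they preserve Lebesgue measure and converge pointwise to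
  -- φ, while the Gibbs density is φ-invariant by conservation of energy. Infinite values are set
  -- aside because multiplication of extended reals is not continuous there.
  have key : ∀ f : Phase d → ENNReal, Continuous f →
      ∫⁻ z, f (φ z) ∂(gibbs U) ≤ ∫⁻ z, f z ∂(gibbs U) ∨ ∃ z, f z = ⊤ := by
    intro f hf
    by_cases hfin : ∃ z, f z = ⊤
    · exact Or.inr hfin
    push Not at hfin
    left
    rw [hgib, hgib]
    have hF : Continuous (fun z => w z * f z) := by
      refine continuous_iff_continuousAt.2 fun z => ?_
      exact ENNReal.Tendsto.mul hwc.continuousAt (Or.inr (hfin z)) hf.continuousAt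
        (Or.inr ENNReal.ofReal_ne_top)
    have e : ∀ z, w z * f (φ z)
        = liminf (fun n : ℕ => w ((euler U (δ / (n + 1)))^[n + 1] z)
            * f ((euler U (δ / (n + 1)))^[n + 1] z)) atTop := by
      intro z
      have hw' : w z = w (φ z) := by simp only [hw, hHφ]
      rw [hw']
      exact ((hF.continuousAt.tendsto.comp (hconv z)).liminf_eq).symm
    simp_rw [e]
    refine (lintegral_liminf_le fun n => (hF.comp (hcont n)).measurable).trans ?_
    have : ∀ n : ℕ, ∫⁻ z, w ((euler U (δ / (n + 1)))^[n + 1] z)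
            * f ((euler U (δ / (n + 1)))^[n + 1] z) = ∫⁻ z, w z * f z := fun n =>
      ((measurePreserving_euler hS.continuous_gradient _).iterate (n + 1)).lintegral_comp
        hF.measurable
    exact le_of_eq ((liminf_congr (Eventually.of_forall this)).trans (liminf_const _))
  have hprob' : IsProbabilityMeasure ((gibbs U).map φ) :=
    Measure.isProbabilityMeasure_map hmeas.aemeasurable
  apply ext_of_forall_lintegral_eq_of_IsFiniteMeasure
  intro f
  rw [lintegral_map (by exact (f.continuous.measurable.coe_nnreal_ennreal)) hmeas]
  obtain ⟨C, hC⟩ : ∃ C : NNReal, ∀ z, f z ≤ C := 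
    ⟨_, BoundedContinuousFunction.NNReal.upper_bound f⟩
  have h1 := (key (fun z => (f z : ENNReal))
    (ENNReal.continuous_coe.comp f.continuous)).resolve_right (by simp)
  -- Fatou gives only an inequality. Applied to C - f as well, it yields equality, since the
  -- integrals of f and C - f add up to C on both sides.
  have h2 := (key (fun z => ((C - f z : NNReal) : ENNReal))
    (ENNReal.continuous_coe.comp (continuous_const.sub f.continuous))).resolve_right (by simp)
  have hm1 : Measurable (fun z => (f z : ENNReal)) := f.continuous.measurable.coe_nnreal_ennreal
  have hm2 : Measurable (fun z => (f (φ z) : ENNReal)) := hm1.comp hmeas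
  have s1 : ∫⁻ z, (f (φ z) : ENNReal) ∂(gibbs U) + ∫⁻ z, ((C - f (φ z) : NNReal) : ENNReal) ∂(gibbs U)
      = C := by
    rw [← lintegral_add_left hm2]
    have : ∀ z, (f (φ z) : ENNReal) + ((C - f (φ z) : NNReal) : ENNReal) = C := fun z => by
      rw [← ENNReal.coe_add, add_tsub_cancel_of_le (hC _)]
    rw [lintegral_congr this, lintegral_const, measure_univ, mul_one]
  have s2 : ∫⁻ z, (f z : ENNReal) ∂(gibbs U) + ∫⁻ z, ((C - f z : NNReal) : ENNReal) ∂(gibbs U)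
      = C := by
    rw [← lintegral_add_left hm1]
    have : ∀ z, (f z : ENNReal) + ((C - f z : NNReal) : ENNReal) = C := fun z => by
      rw [← ENNReal.coe_add, add_tsub_cancel_of_le (hC _)]
    rw [lintegral_congr this, lintegral_const, measure_univ, mul_one]
  refine le_antisymm h1 ?_
  by_contra hlt
  push Not at hlt
  have hfin : ∫⁻ z, ((C - f (φ z) : NNReal) : ENNReal) ∂(gibbs U) ≠ ⊤ := by
    intro h; rw [h] at s1; simp at s1
  have := ENNReal.add_lt_add_of_lt_of_le hfin hlt h2
  rw [s1, s2] at this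
  exact lt_irrefl _ this

end Setting

/-! ### Sequences of independent noises -/

/-- Prepend an element to a sequence. -/
def consSeq {X : Type*} (q : X × (ℕ → X)) : ℕ → X := fun n => Nat.casesOn n q.1 q.2

lemma measurable_consSeq {X : Type*} [MeasurableSpace X] :
    Measurable (consSeq : X × (ℕ → X) → ℕ → X) := by
  refine measurable_pi_lambda _ fun n => ?_
  cases n with
  | zero => exact measurable_fst
  | succ n => exact (measurable_pi_apply n).comp measurable_snd

/-- An independent sequence preceded by one more independent term has the same law. This is the
stationarity behind the invariance of the backward limit. -/
lemma measurePreserving_consSeq {X : Type*} [MeasurableSpace X] (ν : Measure X)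
    [IsProbabilityMeasure ν] :
    MeasurePreserving consSeq (ν.prod (Measure.infinitePi fun _ : ℕ => ν))
      (Measure.infinitePi fun _ : ℕ => ν) := by
  refine ⟨measurable_consSeq, Measure.eq_infinitePi _ fun s t ht => ?_⟩
  set s' : Finset ℕ := s.preimage Nat.succ Nat.succ_injective.injOn with hs'
  have hpre : consSeq ⁻¹' (Set.pi (s : Set ℕ) t)
      = (if 0 ∈ s then t 0 else Set.univ) ×ˢ (Set.pi (s' : Set ℕ) fun n => t (n + 1)) := by
    ext q
    simp only [Set.mem_preimage, Set.mem_pi, Set.mem_prod, Finset.mem_coe, hs', Finset.mem_preimage]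
    constructor
    · intro h
      refine ⟨?_, fun i hi => h (i + 1) hi⟩
      split_ifs with h0
      · exact h 0 h0
      · trivial
    · rintro ⟨h0, h1⟩ i hi
      cases i with
      | zero => rw [if_pos hi] at h0; exact h0
      | succ n => exact h1 n hi
  rw [Measure.map_apply measurable_consSeq (MeasurableSet.pi s.countable_toSet fun i _ => ht i),
    hpre, Measure.prod_prod, Measure.infinitePi_pi (fun _ => ν) (fun i _ => ht (i + 1))]
  have himg : s.filter (· ≠ 0) = s'.image Nat.succ := by
    ext i
    simp only [hs', Finset.mem_filter, Finset.mem_image, Finset.mem_preimage]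
    constructor
    · rintro ⟨hi, h0⟩
      obtain ⟨n, rfl⟩ := Nat.exists_eq_succ_of_ne_zero h0
      exact ⟨n, hi, rfl⟩
    · rintro ⟨n, hn, rfl⟩
      exact ⟨hn, Nat.succ_ne_zero n⟩
  have hprod : ∏ i ∈ s', ν (t (i + 1)) = ∏ i ∈ s.filter (· ≠ 0), ν (t i) := by
    rw [himg, Finset.prod_image fun a _ b _ h => Nat.succ_injective h]
  rw [hprod]
  by_cases h0 : 0 ∈ s
  · rw [if_pos h0, ← Finset.mul_prod_erase s _ h0, Finset.filter_ne']
  · rw [if_neg h0, measure_univ, one_mul, Finset.filter_ne', Finset.erase_eq_of_notMem h0]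

/-- Backward iteration: the state obtained from `z` by applying the noises `ω (n-1), …, ω 0`. -/
def backward {X Y : Type*} (F : X → Y → X) : ℕ → (ℕ → Y) → X → X
  | 0, _, z => z
  | n + 1, ω, z => F (backward F n (fun k => ω (k + 1)) z) (ω 0)

lemma measurable_backward {X Y : Type*} [MeasurableSpace X] [MeasurableSpace Y] {F : X → Y → X}
    (hF : Measurable fun q : X × Y => F q.1 q.2) (n : ℕ) :
    Measurable fun q : (ℕ → Y) × X => backward F n q.1 q.2 := by
  induction n with
  | zero => exact measurable_snd
  | succ n ih =>
    have h1 : Measurable fun q : (ℕ → Y) × X => ((fun k => q.1 (k + 1) : ℕ → Y), q.2) := by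
      fun_prop
    exact hF.comp ((ih.comp h1).prodMk ((measurable_pi_apply 0).comp measurable_fst))

lemma eLpNorm_le_of_le_mul_add {X Y : Type*} [MeasurableSpace X] [MeasurableSpace Y]
    {μ : Measure X} {ν : Measure Y} [IsProbabilityMeasure μ] [IsProbabilityMeasure ν]
    {p : ENNReal} (hp : 1 ≤ p) {f : Y → ℝ} {g : X → ℝ} {h : X × Y → ℝ} (hf : Measurable f)
    (hg : Measurable g) {ρ : ℝ} (hρ : 0 ≤ ρ) (h0 : ∀ q, 0 ≤ h q)
    (hle : ∀ q, h q ≤ ρ * f q.2 + g q.1) :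
    eLpNorm h p (μ.prod ν) ≤ ENNReal.ofReal ρ * eLpNorm f p ν + eLpNorm g p μ := by
  have hf1 : AEStronglyMeasurable (fun q : X × Y => f q.2) (μ.prod ν) :=
    (hf.comp measurable_snd).aestronglyMeasurable
  have hg1 : AEStronglyMeasurable (fun q : X × Y => g q.1) (μ.prod ν) :=
    (hg.comp measurable_fst).aestronglyMeasurable
  have e1 : eLpNorm (fun q : X × Y => f q.2) p (μ.prod ν) = eLpNorm f p ν :=
    eLpNorm_comp_measurePreserving (p := p) hf.aestronglyMeasurable measurePreserving_snd
  have e2 : eLpNorm (fun q : X × Y => g q.1) p (μ.prod ν) = eLpNorm g p μ :=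
    eLpNorm_comp_measurePreserving (p := p) hg.aestronglyMeasurable measurePreserving_fst
  rw [← e1, ← e2]
  have e3 : eLpNorm (ρ • fun q : X × Y => f q.2) p (μ.prod ν)
      = ENNReal.ofReal ρ * eLpNorm (fun q : X × Y => f q.2) p (μ.prod ν) := by
    rw [eLpNorm_const_smul, Real.enorm_of_nonneg hρ]
  rw [← e3]
  refine le_trans (eLpNorm_mono_real fun q => ?_) (eLpNorm_add_le (hf1.const_smul ρ) hg1 hp)
  rw [Real.norm_of_nonneg (h0 q)]
  exact hle q

/-! ### Existence, uniqueness and moments of the invariant law -/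

namespace Setting

variable {d : ℕ} {U : Pos d → ℝ} {m L γ δ : ℝ}

lemma measurable_obaboStep (hS : Setting U m L γ δ) :
    Measurable (fun q : Phase d × Phase d => obaboStep U γ δ q.1 q.2) := by
  simp_rw [obaboStep_eq_sandwich]
  exact measurable_sandwich _ (continuous_verlet hS.continuous_gradient δ).measurable

lemma measurable_obaboStep_right (hS : Setting U m L γ δ) (z : Phase d) :
    Measurable (obaboStep U γ δ z) := by
  have h : Measurable fun ξ : Phase d => (z, ξ) := measurable_prodMk_left
  exact hS.measurable_obaboStep.comp h

lemma measurable_starNorm_step (hS : Setting U m L γ δ) (z : Phase d) :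
    Measurable fun ξ => starNorm L γ (obaboStep U γ δ z ξ) :=
  (continuous_starNorm (L := L) (γ := γ)).measurable.comp (hS.measurable_obaboStep_right z)

lemma measurable_backward_apply (hS : Setting U m L γ δ) (n : ℕ) (z : Phase d) :
    Measurable fun ω : ℕ → Phase d => backward (obaboStep U γ δ) n ω z := by
  have h : Measurable fun ω : ℕ → Phase d => (ω, z) := measurable_prodMk_right
  exact (measurable_backward hS.measurable_obaboStep n).comp h

lemma ρ_bounds (hS : Setting U m L γ δ) : 0 ≤ 1 - δ * κ m γ ∧ 1 - δ * κ m γ < 1 :=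
  ⟨by linarith [hS.δ_κ_le], by linarith [mul_pos hS.δ_pos hS.κ_pos]⟩

/-- Here ‖z‖ is the sup norm of the product type. It serves only for convergence and integrability,
where equivalence with the modified norm is enough. -/
lemma norm_le_starNorm (hS : Setting U m L γ δ) (z : Phase d) :
    ‖z‖ ≤ Real.sqrt (2 * (1 + L)) * starNorm L γ z := by
  have hL := hS.L_pos
  have h := (starNorm_sq_bounds hL hS.γ_ge z).1
  have h0 := starNorm_nonneg (L := L) (γ := γ) z
  have hv : 0 ≤ ‖z.2‖ ^ 2 / L := by positivity
  have hv' : ‖z.2‖ ^ 2 = L * (‖z.2‖ ^ 2 / L) := by field_simp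
  rw [← Real.sqrt_sq h0, ← Real.sqrt_mul (by positivity)]
  refine max_le ?_ ?_ <;> refine Real.le_sqrt_of_sq_le ?_
  · nlinarith [sq_nonneg ‖z.1‖, sq_nonneg (starNorm L γ z)]
  · have : 0 ≤ ‖z.1‖ ^ 2 := sq_nonneg _
    rw [hv']
    nlinarith [sq_nonneg (starNorm L γ z)]

lemma starNorm_le_norm (hS : Setting U m L γ δ) (z : Phase d) :
    starNorm L γ z ≤ Real.sqrt (3 / 2 * (1 + 1 / L)) * ‖z‖ := by
  have hL := hS.L_pos
  have h := (starNorm_sq_bounds hL hS.γ_ge z).2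
  have h0 := starNorm_nonneg (L := L) (γ := γ) z
  rw [← Real.sqrt_sq (norm_nonneg z), ← Real.sqrt_mul (by positivity)]
  refine Real.le_sqrt_of_sq_le (h.trans ?_)
  have h1 : ‖z.1‖ ^ 2 ≤ ‖z‖ ^ 2 := by gcongr; exact norm_fst_le z
  have h2 : ‖z.2‖ ^ 2 ≤ ‖z‖ ^ 2 := by gcongr; exact norm_snd_le z
  have h3 : ‖z.2‖ ^ 2 / L ≤ ‖z‖ ^ 2 / L := by gcongr
  rw [mul_assoc, add_mul, one_mul, one_div, inv_mul_eq_div]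
  linarith

lemma damping_nonneg : 0 ≤ damping γ δ := (Real.exp_pos _).le

lemma exists_step_zero_bound (hS : Setting U m L γ δ) :
    ∃ A B : ℝ, ∀ ξ : Phase d, ‖obaboStep U γ δ 0 ξ‖ ≤ A + B * ‖ξ‖ := by
  have hδ := hS.δ_pos
  have hL := hS.L_pos
  set η := damping γ δ
  have hη0 : 0 ≤ η := damping_nonneg
  have hη1 : η ≤ 1 := by have := hS.damping_sq_le; nlinarith
  set s := Real.sqrt (1 - η ^ 2)
  have hs0 : 0 ≤ s := Real.sqrt_nonneg _
  set g := ‖gradient U 0‖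
  have hpos : ∀ ξ : Phase d, ‖stepPos U γ δ 0 ξ.1‖ ≤ δ ^ 2 / 2 * g + δ * s * ‖ξ‖ := by
    intro ξ
    have e : stepPos U γ δ 0 ξ.1 = (δ * s) • ξ.1 - (δ ^ 2 / 2) • gradient U 0 := by
      simp only [stepPos, Prod.fst_zero, Prod.snd_zero]; module
    rw [e]
    refine (norm_sub_le _ _).trans ?_
    rw [norm_smul, norm_smul, Real.norm_of_nonneg (by positivity), Real.norm_of_nonneg (by positivity)]
    have : δ * s * ‖ξ.1‖ ≤ δ * s * ‖ξ‖ := by gcongr; exact norm_fst_le ξ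
    linarith
  have hvel : ∀ ξ : Phase d, ‖stepVel U γ δ 0 ξ.1 ξ.2‖
      ≤ δ * η / 2 * (2 * g + L * (δ ^ 2 / 2 * g + δ * s * ‖ξ‖)) + s * (η + 1) * ‖ξ‖ := by
    intro ξ
    have h1 : ‖gradient U (stepPos U γ δ 0 ξ.1)‖ ≤ g + L * ‖stepPos U γ δ 0 ξ.1‖ := by
      have h2 := hS.lip (stepPos U γ δ 0 ξ.1) 0
      rw [sub_zero] at h2
      have h3 := norm_sub_norm_le (gradient U (stepPos U γ δ 0 ξ.1)) (gradient U 0)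
      linarith
    have e : stepVel U γ δ 0 ξ.1 ξ.2 = s • (η • ξ.1 + ξ.2)
        - (δ * η / 2) • (gradient U 0 + gradient U (stepPos U γ δ 0 ξ.1)) := by
      simp only [stepVel, Prod.fst_zero, Prod.snd_zero]; module
    have h4 : ‖η • ξ.1 + ξ.2‖ ≤ (η + 1) * ‖ξ‖ := by
      refine (norm_add_le _ _).trans ?_
      rw [norm_smul, Real.norm_of_nonneg hη0, add_mul, one_mul]
      gcongr
      exacts [norm_fst_le ξ, norm_snd_le ξ]
    rw [e]
    refine (norm_sub_le _ _).trans ?_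
    rw [norm_smul, norm_smul, Real.norm_of_nonneg hs0, Real.norm_of_nonneg (by positivity)]
    have h5 := norm_add_le (gradient U 0) (gradient U (stepPos U γ δ 0 ξ.1))
    calc s * ‖η • ξ.1 + ξ.2‖ + δ * η / 2 * ‖gradient U 0 + gradient U (stepPos U γ δ 0 ξ.1)‖
        ≤ s * ((η + 1) * ‖ξ‖) + δ * η / 2 * (2 * g + L * (δ ^ 2 / 2 * g + δ * s * ‖ξ‖)) := by
          gcongr
          have := mul_le_mul_of_nonneg_left (hpos ξ) hL.le
          linarith
      _ = _ := by ring
  have hg0 : 0 ≤ g := norm_nonneg _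
  refine ⟨δ ^ 2 / 2 * g + δ * η / 2 * (2 * g + L * (δ ^ 2 / 2 * g)),
    δ * s + (δ * η / 2 * (L * (δ * s)) + s * (η + 1)), fun ξ => max_le ?_ ?_⟩
  · refine (hpos ξ).trans ?_
    have h6 : 0 ≤ δ * η / 2 * (2 * g + L * (δ ^ 2 / 2 * g)) := by positivity
    have h7 : 0 ≤ (δ * η / 2 * (L * (δ * s)) + s * (η + 1)) * ‖ξ‖ := by positivity
    linarith
  · refine (hvel ξ).trans ?_
    have h6 : 0 ≤ δ ^ 2 / 2 * g := by positivity
    have h7 : 0 ≤ δ * s * ‖ξ‖ := by positivity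
    linarith

/-- One step from the origin has moments of every order. -/
lemma memLp_step_zero (hS : Setting U m L γ δ) {p : ENNReal} (hp : p ≠ ⊤) :
    MemLp (fun ξ : Phase d => starNorm L γ (obaboStep U γ δ 0 ξ)) p (noise d) := by
  have hm : Measurable fun ξ : Phase d => starNorm L γ (obaboStep U γ δ 0 ξ) :=
    hS.measurable_starNorm_step 0
  have hg : IsGaussian (noise d) := by unfold noise; infer_instance
  have hid : MemLp (fun ξ : Phase d => ‖ξ‖) p (noise d) := (IsGaussian.memLp_id (noise d) p hp).norm
  obtain ⟨A, B, hAB⟩ := hS.exists_step_zero_bound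
  have hdom : MemLp (fun ξ : Phase d => Real.sqrt (3 / 2 * (1 + 1 / L)) * (A + B * ‖ξ‖)) p (noise d) :=
    ((memLp_const A).add (hid.const_mul B)).const_mul _
  refine hdom.mono hm.aestronglyMeasurable (Eventually.of_forall fun ξ => ?_)
  rw [Real.norm_of_nonneg (starNorm_nonneg _)]
  refine le_trans ?_ (le_abs_self _)
  exact (hS.starNorm_le_norm _).trans (by gcongr; exact hAB ξ)

lemma starNorm_backward_sub_le (hS : Setting U m L γ δ) (n : ℕ) (ω : ℕ → Phase d) (z w : Phase d) :
    starNorm L γ (backward (obaboStep U γ δ) n ω z - backward (obaboStep U γ δ) n ω w)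
      ≤ (1 - δ * κ m γ) ^ n * starNorm L γ (z - w) := by
  induction n generalizing ω with
  | zero => simp [backward]
  | succ n ih =>
    refine (hS.starNorm_step_sub_le _ _ _).trans ?_
    rw [pow_succ', mul_assoc]
    exact mul_le_mul_of_nonneg_left (ih _) hS.ρ_bounds.1

/-- The two iterates share the noises ω 0, …, ω (n-1). They differ only by one earlier step from the
origin, whose effect is contracted n times. -/
lemma starNorm_backward_succ_sub_le (hS : Setting U m L γ δ) (n : ℕ) (ω : ℕ → Phase d) :
    starNorm L γ (backward (obaboStep U γ δ) (n + 1) ω 0 - backward (obaboStep U γ δ) n ω 0)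
      ≤ (1 - δ * κ m γ) ^ n * starNorm L γ (obaboStep U γ δ 0 (ω n)) := by
  induction n generalizing ω with
  | zero => simp [backward]
  | succ n ih =>
    refine (hS.starNorm_step_sub_le _ _ _).trans ?_
    rw [pow_succ', mul_assoc]
    exact mul_le_mul_of_nonneg_left (ih _) hS.ρ_bounds.1

/-- A law of noise sequences. -/
abbrev noiseSeq (d : ℕ) : Measure (ℕ → Phase d) := Measure.infinitePi fun _ : ℕ => noise d

/-- By Tonelli the sum has expectation E[A]/(1 - ρ), which is finite, so it is finite almost surely.
-/
lemma ae_summable_pow_mul {X : Type*} [MeasurableSpace X] (ν : Measure X) [IsProbabilityMeasure ν]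
    {ρ : ℝ} (hρ0 : 0 ≤ ρ) (hρ1 : ρ < 1) {A : X → ℝ} (hA0 : ∀ ξ, 0 ≤ A ξ) (hAm : Measurable A)
    (hAi : Integrable A ν) :
    ∀ᵐ ω ∂(Measure.infinitePi fun _ : ℕ => ν), Summable fun n => ρ ^ n * A (ω n) := by
  have h1 : ∫⁻ ω, ∑' n, ENNReal.ofReal (ρ ^ n * A (ω n)) ∂(Measure.infinitePi fun _ : ℕ => ν) ≠ ⊤ := by
    rw [lintegral_tsum fun n => by
      have := hAm.comp (measurable_pi_apply (X := fun _ : ℕ => X) n)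
      exact (ENNReal.measurable_ofReal.comp (this.const_mul (ρ ^ n))).aemeasurable]
    have h2 : ∀ n, ∫⁻ ω, ENNReal.ofReal (ρ ^ n * A (ω n)) ∂(Measure.infinitePi fun _ : ℕ => ν)
        = ENNReal.ofReal (ρ ^ n) * ∫⁻ ξ, ENNReal.ofReal (A ξ) ∂ν := by
      intro n
      rw [← lintegral_const_mul _ hAm.ennreal_ofReal,
        ← (measurePreserving_eval_infinitePi (fun _ : ℕ => ν) n).lintegral_comp
          (hAm.ennreal_ofReal.const_mul _)]
      refine lintegral_congr fun ω => ?_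
      rw [ENNReal.ofReal_mul (by positivity)]
    simp_rw [h2]
    rw [ENNReal.tsum_mul_right]
    refine ENNReal.mul_ne_top ?_ ?_
    · rw [← ENNReal.ofReal_tsum_of_nonneg (fun n => by positivity)
        (summable_geometric_of_lt_one hρ0 hρ1)]
      exact ENNReal.ofReal_ne_top
    · exact hAi.lintegral_lt_top.ne
  have hm : Measurable fun ω : ℕ → X => ∑' n, ENNReal.ofReal (ρ ^ n * A (ω n)) := by
    refine Measurable.tsum fun n => ?_
    have := hAm.comp (measurable_pi_apply (X := fun _ : ℕ => X) n)
    exact ENNReal.measurable_ofReal.comp (this.const_mul (ρ ^ n))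
  filter_upwards [ae_lt_top hm h1] with ω hω
  have := ENNReal.summable_toReal hω.ne
  refine this.congr fun n => ?_
  exact ENNReal.toReal_ofReal (mul_nonneg (by positivity) (hA0 _))

/-- Successive backward iterates differ by geometrically weighted, integrable noise terms. They are
therefore almost surely Cauchy, unlike forward iterates, which converge only in law. -/
lemma exists_backward_limit (hS : Setting U m L γ δ) : ∃ Z : (ℕ → Phase d) → Phase d,
    Measurable Z ∧ ∀ᵐ ω ∂(noiseSeq d),
      Tendsto (fun n => backward (obaboStep U γ δ) n ω 0) atTop (𝓝 (Z ω)) := by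
  set ρ := 1 - δ * κ m γ with hρ
  obtain ⟨hρ0, hρ1⟩ := hS.ρ_bounds
  set A : Phase d → ℝ := fun ξ => starNorm L γ (obaboStep U γ δ 0 ξ) with hA
  have hAm : Measurable A :=
    hS.measurable_starNorm_step 0
  have hAi : Integrable A (noise d) := memLp_one_iff_integrable.1 (hS.memLp_step_zero (by simp))
  have hmeas : ∀ n, AEMeasurable (fun ω : ℕ → Phase d => backward (obaboStep U γ δ) n ω 0)
      (noiseSeq d) := fun n =>
    (hS.measurable_backward_apply n 0).aemeasurable
  have hsum := ae_summable_pow_mul (noise d) hρ0 hρ1 (fun ξ => starNorm_nonneg _) hAm hAi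
  have hlim : ∀ᵐ ω ∂(noiseSeq d), ∃ l,
      Tendsto (fun n => backward (obaboStep U γ δ) n ω 0) atTop (𝓝 l) := by
    filter_upwards [hsum] with ω hω
    refine cauchySeq_tendsto_of_complete (cauchySeq_of_dist_le_of_summable
      (fun n => Real.sqrt (2 * (1 + L)) * (ρ ^ n * A (ω n))) (fun n => ?_) (hω.mul_left _))
    rw [dist_comm, dist_eq_norm]
    exact (hS.norm_le_starNorm _).trans
      (mul_le_mul_of_nonneg_left (hS.starNorm_backward_succ_sub_le n ω) (Real.sqrt_nonneg _))
  exact measurable_limit_of_tendsto_metrizable_ae hmeas hlim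

lemma continuous_obaboStep_left (hS : Setting U m L γ δ) (ξ : Phase d) :
    Continuous fun z => obaboStep U γ δ z ξ := by
  have hg := hS.continuous_gradient
  simp_rw [obaboStep_eq_sandwich]
  have hv := continuous_verlet hg δ
  unfold sandwich refresh
  fun_prop

lemma transition_eq (U : Pos d → ℝ) (γ δ : ℝ) (μ : Measure (Phase d)) :
    transition U γ δ μ = (μ.prod (noise d)).map fun q => obaboStep U γ δ q.1 q.2 := rfl

/-- Starting from an invariant law, backward iteration keeps this law. -/
lemma map_backward_of_invariant (hS : Setting U m L γ δ) {μ : Measure (Phase d)}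
    (hμ : IsInvariantProb U γ δ μ) (n : ℕ) :
    ((noiseSeq d).prod μ).map (fun q => backward (obaboStep U γ δ) n q.1 q.2) = μ := by
  have := hμ.1
  induction n with
  | zero => exact Measure.map_snd_prod.trans (by simp)
  | succ n ih =>
    have hB := measurable_backward hS.measurable_obaboStep n
    have hB' := measurable_backward hS.measurable_obaboStep (n + 1)
    have hc : MeasurePreserving (Prod.map consSeq id)
        (((noise d).prod (noiseSeq d)).prod μ) ((noiseSeq d).prod μ) :=
      (measurePreserving_consSeq (noise d)).prod (MeasurePreserving.id μ)
    have hmp : MeasurePreserving (fun q : (ℕ → Phase d) × Phase d =>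
        backward (obaboStep U γ δ) n q.1 q.2) ((noiseSeq d).prod μ) μ := ⟨hB, ih⟩
    have h2 := (MeasurePreserving.id (noise d)).prod hmp
    have h3 := h2.comp (measurePreserving_prodAssoc (noise d) (noiseSeq d) μ)
    have h4 : MeasurePreserving Prod.swap ((noise d).prod μ) (μ.prod (noise d)) :=
      Measure.measurePreserving_swap
    have h5 : MeasurePreserving (fun q : Phase d × Phase d => obaboStep U γ δ q.1 q.2)
        (μ.prod (noise d)) μ := ⟨hS.measurable_obaboStep, hμ.2⟩
    have h6 := h5.comp (h4.comp h3)
    rw [← hc.map_eq, Measure.map_map hB' hc.measurable]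
    exact h6.map_eq

/-- Prepending a fresh noise to the sequence amounts to applying one step of the chain to the limit,
by continuity of the step. Since prepending preserves the law of the sequence, the law of the limit
is invariant. -/
lemma transition_map_limit (hS : Setting U m L γ δ) {Z : (ℕ → Phase d) → Phase d} (hZm : Measurable Z)
    (hZ : ∀ᵐ ω ∂(noiseSeq d), Tendsto (fun n => backward (obaboStep U γ δ) n ω 0) atTop (𝓝 (Z ω))) :
    transition U γ δ ((noiseSeq d).map Z) = (noiseSeq d).map Z := by
  have hμp : IsProbabilityMeasure ((noiseSeq d).map Z) :=
    Measure.isProbabilityMeasure_map hZm.aemeasurable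
  set F := obaboStep U γ δ with hF
  have hcons := measurePreserving_consSeq (noise d)
  have hae : ∀ᵐ q ∂((noise d).prod (noiseSeq d)), F (Z q.2) q.1 = Z (consSeq q) := by
    have h1 := hcons.quasiMeasurePreserving.ae hZ
    have h2 := (Measure.quasiMeasurePreserving_snd (μ := noise d) (ν := noiseSeq d)).ae hZ
    filter_upwards [h1, h2] with q hq1 hq2
    -- By definition, the backward iterate of order n + 1 along the prolonged sequence is one step,
    -- with the new noise, from the iterate of order n along the old one.
    have h3 : Tendsto (fun n => backward F (n + 1) (consSeq q) 0) atTop (𝓝 (F (Z q.2) q.1)) :=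
      ((hS.continuous_obaboStep_left q.1).tendsto (Z q.2)).comp hq2
    exact tendsto_nhds_unique h3 (hq1.comp (tendsto_add_atTop_nat 1))
  have h1 : MeasurePreserving (Prod.map Z id) ((noiseSeq d).prod (noise d))
      (((noiseSeq d).map Z).prod (noise d)) :=
    MeasurePreserving.prod ⟨hZm, rfl⟩ (MeasurePreserving.id _)
  have h4 : MeasurePreserving Prod.swap ((noise d).prod (noiseSeq d)) ((noiseSeq d).prod (noise d)) :=
    Measure.measurePreserving_swap
  have h5 := h1.comp h4
  rw [transition_eq, ← h5.map_eq, Measure.map_map hS.measurable_obaboStep h5.measurable]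
  refine (Measure.map_congr hae).trans ?_
  change Measure.map (Z ∘ consSeq) _ = _
  rw [← Measure.map_map hZm hcons.measurable, hcons.map_eq]

/-- Backward iterates started from an independent draw of ν keep the law ν, and by contraction they
merge with those started from 0. Dominated convergence against bounded continuous functions
identifies ν with the law of the limit. -/
lemma invariant_eq_map_limit (hS : Setting U m L γ δ) {Z : (ℕ → Phase d) → Phase d} (hZm : Measurable Z)
    (hZ : ∀ᵐ ω ∂(noiseSeq d), Tendsto (fun n => backward (obaboStep U γ δ) n ω 0) atTop (𝓝 (Z ω)))
    {ν : Measure (Phase d)} (hν : IsInvariantProb U γ δ ν) : ν = (noiseSeq d).map Z := by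
  have hμp : IsProbabilityMeasure ((noiseSeq d).map Z) :=
    Measure.isProbabilityMeasure_map hZm.aemeasurable
  set F := obaboStep U γ δ with hF
  have := hν.1
  apply ext_of_forall_integral_eq_of_IsFiniteMeasure
  intro f
  have hfm : Continuous f := f.continuous
  have h1 : ∀ n : ℕ, ∫ q, f (backward F n q.1 q.2) ∂((noiseSeq d).prod ν) = ∫ z, f z ∂ν := by
    intro n
    conv_rhs => rw [← hS.map_backward_of_invariant hν n]
    rw [integral_map (measurable_backward hS.measurable_obaboStep n).aemeasurable
      hfm.aestronglyMeasurable]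
  have h2 : Tendsto (fun n : ℕ => ∫ q, f (backward F n q.1 q.2) ∂((noiseSeq d).prod ν)) atTop
      (𝓝 (∫ q, f (Z q.1) ∂((noiseSeq d).prod ν))) := by
    refine tendsto_integral_of_dominated_convergence (fun _ => ‖f‖)
      (fun n => (hfm.measurable.comp
        (measurable_backward hS.measurable_obaboStep n)).aestronglyMeasurable)
      (integrable_const _) (fun n => Eventually.of_forall fun q => f.norm_coe_le_norm _) ?_
    have h3 := (Measure.quasiMeasurePreserving_fst (μ := noiseSeq d) (ν := ν)).ae hZ
    filter_upwards [h3] with q hq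
    refine (hfm.tendsto _).comp ?_
    have h4 : Tendsto (fun n => backward F n q.1 q.2 - backward F n q.1 0) atTop (𝓝 0) := by
      refine squeeze_zero_norm (a := fun n => Real.sqrt (2 * (1 + L))
        * ((1 - δ * κ m γ) ^ n * starNorm L γ (q.2 - 0))) (fun n => ?_) ?_
      · exact (hS.norm_le_starNorm _).trans (mul_le_mul_of_nonneg_left
          (hS.starNorm_backward_sub_le n q.1 q.2 0) (Real.sqrt_nonneg _))
      · have := tendsto_pow_atTop_nhds_zero_of_lt_one hS.ρ_bounds.1 hS.ρ_bounds.2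
        have h5 := (this.mul_const (starNorm L γ (q.2 - 0))).const_mul (Real.sqrt (2 * (1 + L)))
        rw [zero_mul, mul_zero] at h5
        exact h5
    have h5 := h4.add hq
    rw [zero_add] at h5
    exact h5.congr fun n => sub_add_cancel _ _
  simp_rw [h1] at h2
  have h3 := tendsto_nhds_unique h2 tendsto_const_nhds
  rw [← h3, integral_map hZm.aemeasurable hfm.aestronglyMeasurable]
  have h6 : MeasurePreserving Prod.fst ((noiseSeq d).prod ν) (noiseSeq d) := measurePreserving_fst
  have h7 : AEStronglyMeasurable (fun ω => f (Z ω)) (((noiseSeq d).prod ν).map Prod.fst) :=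
    (hfm.measurable.comp hZm).aestronglyMeasurable
  conv_rhs => rw [← h6.map_eq]
  rw [integral_map h6.measurable.aemeasurable h7]

/-- Minkowski's inequality gives a recursion aₙ₊₁ ≤ ρ aₙ + a, so all iterates have L^p norm at most
a/(1 - ρ). Fatou transfers this to the limit. -/
lemma memLp_map_limit (hS : Setting U m L γ δ) {Z : (ℕ → Phase d) → Phase d} (hZm : Measurable Z)
    (hZ : ∀ᵐ ω ∂(noiseSeq d), Tendsto (fun n => backward (obaboStep U γ δ) n ω 0) atTop (𝓝 (Z ω)))
    {p : ENNReal} (hp : 1 ≤ p) (hpt : p ≠ ⊤) :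
    MemLp (starNorm L γ) p ((noiseSeq d).map Z) := by
  set F := obaboStep U γ δ with hF
  have hcons := measurePreserving_consSeq (noise d)
  set ρ := 1 - δ * κ m γ with hρ
  obtain ⟨hρ0, hρ1⟩ := hS.ρ_bounds
  have hA := hS.memLp_step_zero (p := p) hpt
  set a := (eLpNorm (fun ξ : Phase d => starNorm L γ (F 0 ξ)) p (noise d)).toReal with ha
  have haA : eLpNorm (fun ξ : Phase d => starNorm L γ (F 0 ξ)) p (noise d) = ENNReal.ofReal a :=
    (ENNReal.ofReal_toReal hA.2.ne).symm
  have hB : ∀ n, Measurable fun ω : ℕ → Phase d => backward F n ω 0 := fun n =>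
    hS.measurable_backward_apply n 0
  have hNB : ∀ n, Measurable fun ω : ℕ → Phase d => starNorm L γ (backward F n ω 0) := fun n =>
    (continuous_starNorm (L := L) (γ := γ)).measurable.comp (hB n)
  have hbound : ∀ n, eLpNorm (fun ω : ℕ → Phase d => starNorm L γ (backward F n ω 0)) p (noiseSeq d)
      ≤ ENNReal.ofReal (a / (1 - ρ)) := by
    intro n
    induction n with
    | zero =>
      have : starNorm L γ (0 : Phase d) = 0 := by simp [starNorm, starMap]
      simp [backward, this]
    | succ n ih =>
      have e1 := eLpNorm_comp_measurePreserving (p := p) (hNB (n + 1)).aestronglyMeasurable hcons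
      rw [← e1]
      have hAm : Measurable fun ξ => starNorm L γ (F 0 ξ) :=
          hS.measurable_starNorm_step 0
      calc eLpNorm ((fun ω : ℕ → Phase d => starNorm L γ (backward F (n + 1) ω 0)) ∘ consSeq) p
            ((noise d).prod (noiseSeq d))
          ≤ ENNReal.ofReal ρ * eLpNorm (fun ω : ℕ → Phase d => starNorm L γ (backward F n ω 0)) p
              (noiseSeq d) + eLpNorm (fun ξ : Phase d => starNorm L γ (F 0 ξ)) p (noise d) := by
            refine eLpNorm_le_of_le_mul_add hp (hNB n) hAm hρ0 (fun q => starNorm_nonneg _)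
              fun q => ?_
            have h1 := hS.starNorm_step_sub_le (backward F n q.2 0) 0 q.1
            have h2 := starNorm_add_le (L := L) (γ := γ) (F (backward F n q.2 0) q.1 - F 0 q.1)
              (F 0 q.1)
            rw [sub_add_cancel] at h2
            rw [sub_zero] at h1
            exact h2.trans (add_le_add_left h1 _)
        _ ≤ ENNReal.ofReal ρ * ENNReal.ofReal (a / (1 - ρ)) + ENNReal.ofReal a := by
            rw [haA]; gcongr
        _ = _ := by
            have ha0 : 0 ≤ a := ENNReal.toReal_nonneg
            have h1 : 0 < 1 - ρ := by linarith
            rw [← ENNReal.ofReal_mul hρ0, ← ENNReal.ofReal_add (by positivity) ha0]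
            congr 1
            field_simp
            ring
  have hmap := eLpNorm_map_measure (p := p) (g := starNorm (d := d) L γ)
    (continuous_starNorm.aestronglyMeasurable) (hZm.aemeasurable (μ := noiseSeq d))
  refine ⟨continuous_starNorm.aestronglyMeasurable, ?_⟩
  rw [hmap]
  have hlim : eLpNorm (fun ω => starNorm L γ (Z ω)) p (noiseSeq d)
      ≤ liminf (fun n => eLpNorm (fun ω : ℕ → Phase d => starNorm L γ (backward F n ω 0)) p
        (noiseSeq d)) atTop := by
    refine Lp.eLpNorm_lim_le_liminf_eLpNorm (fun n => (hNB n).aestronglyMeasurable) _ ?_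
    filter_upwards [hZ] with ω hω
    exact (continuous_starNorm.tendsto _).comp hω
  exact lt_of_le_of_lt (hlim.trans (liminf_le_of_frequently_le' (Frequently.of_forall hbound)))
    ENNReal.ofReal_lt_top

theorem exists_invariant (hS : Setting U m L γ δ) : ∃ μ : Measure (Phase d),
    IsInvariantProb U γ δ μ ∧ (∀ ν, IsInvariantProb U γ δ ν → ν = μ) ∧
      ∀ p : ENNReal, 1 ≤ p → p ≠ ⊤ → MemLp (starNorm L γ) p μ := by
  obtain ⟨Z, hZm, hZ⟩ := hS.exists_backward_limit
  exact ⟨(noiseSeq d).map Z,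
    ⟨Measure.isProbabilityMeasure_map hZm.aemeasurable, hS.transition_map_limit hZm hZ⟩,
    fun ν hν => hS.invariant_eq_map_limit hZm hZ hν, fun p hp hpt => hS.memLp_map_limit hZm hZ hp hpt⟩

end Setting

/-! ### Local error of the Verlet scheme -/

section Taylor

variable {E : Type*} [NormedAddCommGroup E] [NormedSpace ℝ E]

lemma norm_le_of_norm_deriv_le_pow {f f' : ℝ → E} {T C : ℝ} (n : ℕ)
    (hf : ∀ t ∈ Set.Icc 0 T, HasDerivWithinAt f (f' t) (Set.Icc 0 T) t) (h0 : f 0 = 0)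
    (hC : ∀ t ∈ Set.Icc 0 T, ‖f' t‖ ≤ C * t ^ n) {t : ℝ} (ht : t ∈ Set.Icc 0 T) :
    ‖f t‖ ≤ C * t ^ (n + 1) / (n + 1) := by
  refine image_norm_le_of_norm_deriv_right_le_deriv_boundary (f' := f') (a := 0) (b := T)
    (B := fun t => C * t ^ (n + 1) / (n + 1)) (B' := fun t => C * t ^ n)
    (fun t ht => (hf t ht).continuousWithinAt)
    (fun t ht => hasDerivWithinAt_Ici_of_Icc (hf t (Set.Ico_subset_Icc_self ht)) ht)
    (by simp [h0]) (fun t => ?_) (fun t ht => hC t (Set.Ico_subset_Icc_self ht)) ht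
  have h := ((hasDerivAt_pow (n + 1) t).const_mul C).div_const ((n : ℝ) + 1)
  refine h.congr_deriv ?_
  have : (n : ℝ) + 1 ≠ 0 := by positivity
  simp only [Nat.cast_add, Nat.cast_one, Nat.add_sub_cancel]
  field_simp

variable {x v a : ℝ → E} {a' : ℝ → E} {T L : ℝ}

/-- A priori bound for the displacement. -/
lemma displacement_le (hT : 0 ≤ T) (hL : 0 ≤ L) (hTL : T ^ 2 * L ≤ 1 / 200)
    (hx : ∀ t ∈ Set.Icc 0 T, HasDerivWithinAt x (v t) (Set.Icc 0 T) t)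
    (hv : ∀ t ∈ Set.Icc 0 T, HasDerivWithinAt v (-a t) (Set.Icc 0 T) t)
    (ha : ∀ t ∈ Set.Icc 0 T, ‖a t - a 0‖ ≤ L * ‖x t - x 0‖) {t : ℝ} (ht : t ∈ Set.Icc 0 T) :
    ‖x t - x 0‖ ≤ 1.01 * (T * ‖v 0‖ + T ^ 2 * ‖a 0‖) := by
  have hcont : ContinuousOn (fun t => ‖x t - x 0‖) (Set.Icc 0 T) :=
    (ContinuousOn.sub (fun t ht => (hx t ht).continuousWithinAt) continuousOn_const).norm
  -- The maximal displacement M satisfies M ≤ T‖v 0‖ + T²‖a 0‖ + T²L M, and the last term is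
  -- absorbed because T²L ≤ 1/200.
  obtain ⟨t₀, ht₀, hmax⟩ := isCompact_Icc.exists_isMaxOn ⟨0, Set.left_mem_Icc.2 hT⟩ hcont
  set M := ‖x t₀ - x 0‖ with hM
  have hM' : ∀ t ∈ Set.Icc 0 T, ‖x t - x 0‖ ≤ M := fun t ht => hmax ht
  have hat : ∀ t ∈ Set.Icc 0 T, ‖a t‖ ≤ ‖a 0‖ + L * M := by
    intro t ht
    have h1 := ha t ht
    have h2 := mul_le_mul_of_nonneg_left (hM' t ht) hL
    have h3 := norm_sub_norm_le (a t) (a 0)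
    linarith
  have hvt : ∀ t ∈ Set.Icc 0 T, ‖v t‖ ≤ ‖v 0‖ + T * (‖a 0‖ + L * M) := by
    intro t ht
    have h1 := IsTraj.norm_sub_sub_smul_le (c := 0) le_rfl ht.2 ht.1 hv
      (C := ‖a 0‖ + L * M) (fun s hs => by
        rw [sub_zero, norm_neg]; exact hat s ⟨hs.1, hs.2.trans ht.2⟩)
    rw [smul_zero, sub_zero] at h1
    have h3 := norm_sub_norm_le (v t) (v 0)
    have h4 : (‖a 0‖ + L * M) * (t - 0) ≤ (‖a 0‖ + L * M) * T :=
      mul_le_mul_of_nonneg_left (by linarith [ht.2]) (by positivity)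
    linarith
  have h1 := IsTraj.norm_sub_sub_smul_le (c := 0) le_rfl ht₀.2 ht₀.1 hx
      (C := ‖v 0‖ + T * (‖a 0‖ + L * M)) (fun s hs => by
        rw [sub_zero]; exact hvt s ⟨hs.1, hs.2.trans ht₀.2⟩)
  rw [smul_zero, sub_zero] at h1
  have h2 : (‖v 0‖ + T * (‖a 0‖ + L * M)) * (t₀ - 0) ≤ (‖v 0‖ + T * (‖a 0‖ + L * M)) * T :=
    mul_le_mul_of_nonneg_left (by linarith [ht₀.2]) (by positivity)
  have h3 : M ≤ T * ‖v 0‖ + T ^ 2 * ‖a 0‖ + T ^ 2 * L * M := by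
    rw [hM]; refine (h1.trans h2).trans (le_of_eq ?_); ring
  have h4 : T ^ 2 * L * M ≤ 1 / 200 * M := mul_le_mul_of_nonneg_right hTL (norm_nonneg _)
  have h5 := norm_nonneg (v 0)
  have h6 : 0 ≤ T * ‖v 0‖ + T ^ 2 * ‖a 0‖ := by positivity
  refine (hM' t ht).trans ?_
  linarith

/-- Local error in the position. -/
lemma position_error_le (hT : 0 ≤ T) {K : ℝ}
    (hx : ∀ t ∈ Set.Icc 0 T, HasDerivWithinAt x (v t) (Set.Icc 0 T) t)
    (hv : ∀ t ∈ Set.Icc 0 T, HasDerivWithinAt v (-a t) (Set.Icc 0 T) t)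
    (ha : ∀ t ∈ Set.Icc 0 T, ‖a t - a 0‖ ≤ K * t) :
    ‖x 0 + T • v 0 - (T ^ 2 / 2) • a 0 - x T‖ ≤ K * T ^ 3 / 6 := by
  have hid : ∀ (t : ℝ) (c : E), HasDerivWithinAt (fun t : ℝ => t • c) c (Set.Icc 0 T) t :=
    fun t c => by simpa using ((hasDerivAt_id t).smul_const c).hasDerivWithinAt
  have hsq : ∀ (t : ℝ) (c : E), HasDerivWithinAt (fun t : ℝ => (t ^ 2 / 2) • c) (t • c)
      (Set.Icc 0 T) t := fun t c => by
    have h := (((hasDerivAt_pow 2 t).div_const 2).smul_const c).hasDerivWithinAt (s := Set.Icc 0 T)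
    refine h.congr_deriv ?_
    congr 1; simp
  have h1 : ∀ t ∈ Set.Icc 0 T, ‖v 0 - t • a 0 - v t‖ ≤ K / 2 * t ^ 2 := by
    intro t ht
    have := norm_le_of_norm_deriv_le_pow (f := fun t => v 0 - t • a 0 - v t)
      (f' := fun t => 0 - a 0 - -a t) (C := K) 1
      (fun t ht => ((hasDerivWithinAt_const t _ (v 0)).sub (hid t (a 0))).sub (hv t ht))
      (by simp) (fun t ht => by
        have := ha t ht
        rw [pow_one]; convert this using 2; abel) ht
    refine this.trans (le_of_eq ?_)
    norm_num; ring
  have := norm_le_of_norm_deriv_le_pow (f := fun t => x 0 + t • v 0 - (t ^ 2 / 2) • a 0 - x t)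
      (f' := fun t => 0 + v 0 - t • a 0 - v t) (C := K / 2) 2
      (fun t ht => ((((hasDerivWithinAt_const t _ (x 0)).add (hid t (v 0))).sub (hsq t (a 0))).sub
        (hx t ht))) (by simp) (fun t ht => by rw [zero_add]; exact h1 t ht)
      (Set.right_mem_Icc.2 hT)
  refine this.trans (le_of_eq ?_)
  norm_num; ring

/-- Error of the trapezoidal rule for the velocity. -/
lemma trapezoid_error_le (hT : 0 ≤ T) {B : ℝ}
    (hv : ∀ t ∈ Set.Icc 0 T, HasDerivWithinAt v (-a t) (Set.Icc 0 T) t)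
    (ha : ∀ t ∈ Set.Icc 0 T, HasDerivWithinAt a (a' t) (Set.Icc 0 T) t)
    (hB : ∀ t ∈ Set.Icc 0 T, ∀ s ∈ Set.Icc 0 t, ‖a' s - a' t‖ ≤ B * (t - s)) :
    ‖v 0 - v T - (T / 2) • (a 0 + a T)‖ ≤ B * T ^ 3 / 12 := by
  have h1 : ∀ t ∈ Set.Icc 0 T, ‖a t - a 0 - t • a' t‖ ≤ B * t ^ 2 / 2 := by
    intro t ht
    have hsub : Set.Icc 0 t ⊆ Set.Icc 0 T := Set.Icc_subset_Icc_right ht.2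
    have hd : ∀ s ∈ Set.Icc 0 t, HasDerivWithinAt (fun s => a s - a 0 - s • a' t) (a' s - a' t)
        (Set.Icc 0 t) s := fun s hs => by
      refine ((((ha s (hsub hs)).mono hsub).sub_const (a 0)).sub ?_)
      simpa using ((hasDerivAt_id s).smul_const (a' t)).hasDerivWithinAt
    have := image_norm_le_of_norm_deriv_right_le_deriv_boundary
      (f := fun s => a s - a 0 - s • a' t) (f' := fun s => a' s - a' t) (a := 0) (b := t)
      (B := fun s => B * (t * s - s ^ 2 / 2)) (B' := fun s => B * (t - s))
      (fun s hs => (hd s hs).continuousWithinAt)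
      (fun s hs => hasDerivWithinAt_Ici_of_Icc (hd s (Set.Ico_subset_Icc_self hs)) hs)
      (by simp) (fun s => by
        have h := (((hasDerivAt_id s).const_mul t).sub ((hasDerivAt_pow 2 s).div_const 2)).const_mul B
        refine h.congr_deriv ?_
        simp) (fun s hs => hB t ht s (Set.Ico_subset_Icc_self hs)) (Set.right_mem_Icc.2 ht.1)
    refine this.trans (le_of_eq ?_)
    ring
  -- The derivative of the trapezoidal error in its endpoint is half the Taylor remainder of a
  -- between t and 0, hence at most B t²/4. Integration gives B T³/12.
  have hd : ∀ t ∈ Set.Icc 0 T, HasDerivWithinAt (fun t => v 0 - v t - (t / 2) • (a 0 + a t))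
      ((1 / 2 : ℝ) • (a t - a 0 - t • a' t)) (Set.Icc 0 T) t := by
    intro t ht
    have h2 : HasDerivWithinAt (fun t : ℝ => t / 2) (1 / 2) (Set.Icc 0 T) t :=
      ((hasDerivAt_id t).div_const 2).hasDerivWithinAt
    have h3 := ((hv t ht).const_sub (v 0)).sub (h2.smul ((ha t ht).const_add (a 0)))
    refine h3.congr_deriv ?_
    module
  have := norm_le_of_norm_deriv_le_pow (C := B / 4) 2 hd (by simp) (fun t ht => by
    rw [norm_smul, Real.norm_of_nonneg (by norm_num)]
    linarith [h1 t ht]) (Set.right_mem_Icc.2 hT)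
  refine this.trans (le_of_eq ?_)
  norm_num; ring

lemma max_rpow_le {A B C l : ℝ} (hA : 0 ≤ A) (hB : 0 ≤ B) (hC : 0 ≤ C) :
    (max (max A B) C) ^ l ≤ A ^ l + B ^ l + C ^ l := by
  have h1 : 0 ≤ A ^ l := by positivity
  have h2 : 0 ≤ B ^ l := by positivity
  have h3 : 0 ≤ C ^ l := by positivity
  rcases max_choice (max A B) C with h | h
  · rw [h]
    rcases max_choice A B with h | h <;> rw [h] <;> linarith
  · rw [h]; linarith

/-- Separates a mixed product into pure powers, so that one moment of each variable suffices: V and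
μR are both at most twice the largest of α, b, r, whence V²(μR)^(l-2) is at most the l-th power of
that bound. -/
lemma sq_mul_one_add_rpow_le {α b r V R μ l : ℝ} (hα0 : 0 ≤ α) (hb0 : 0 ≤ b) (hr0 : 0 ≤ r)
    (hV0 : 0 ≤ V) (hR0 : 0 ≤ R) (hμ0 : 0 < μ) (hl2 : 0 ≤ l - 2)
    (hVb : V ≤ 1.01 * α + 0.01 * b) (hμR : μ * R ≤ r + (0.0051 * α + 0.0001 * b)) :
    V ^ 2 * (1 + R ^ (l - 2)) ≤ 4 * (α ^ 2 + b ^ 2)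
      + μ ^ (-(l - 2)) * (2 ^ l * (α ^ l + b ^ l + r ^ l)) := by
  have h1 : V ^ 2 ≤ 4 * (α ^ 2 + b ^ 2) := by
    calc V ^ 2 ≤ (1.01 * α + 0.01 * b) ^ 2 := by gcongr
      _ ≤ _ := by nlinarith [mul_nonneg hα0 hb0, sq_nonneg (α - b)]
  set S := 2 * max (max α b) r with hS
  have hmx1 : α ≤ max (max α b) r := (le_max_left _ _).trans (le_max_left _ _)
  have hmx2 : b ≤ max (max α b) r := (le_max_right _ _).trans (le_max_left _ _)
  have hmx3 : r ≤ max (max α b) r := le_max_right _ _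
  have hV2 : V ≤ S := by rw [hS]; linarith
  have hR2 : μ * R ≤ S := by rw [hS]; linarith
  have hS0 : 0 ≤ S := hV0.trans hV2
  have h2 : μ ^ (l - 2) * (V ^ 2 * R ^ (l - 2)) ≤ S ^ l := by
    calc μ ^ (l - 2) * (V ^ 2 * R ^ (l - 2)) = V ^ 2 * (μ * R) ^ (l - 2) := by
          rw [Real.mul_rpow hμ0.le hR0]; ring
      _ ≤ S ^ 2 * S ^ (l - 2) := by gcongr
      _ = S ^ l := by
        rw [← Real.rpow_two, ← Real.rpow_add_of_nonneg hS0 (by norm_num) hl2]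
        congr 1; ring
  have h3 : S ^ l ≤ 2 ^ l * (α ^ l + b ^ l + r ^ l) := by
    rw [hS, Real.mul_rpow (by norm_num) (hα0.trans hmx1)]
    gcongr
    exact max_rpow_le hα0 hb0 hr0
  have h4 : V ^ 2 * R ^ (l - 2) = μ ^ (-(l - 2)) * (μ ^ (l - 2) * (V ^ 2 * R ^ (l - 2))) := by
    rw [← mul_assoc, ← Real.rpow_add hμ0, neg_add_cancel, Real.rpow_zero, one_mul]
  calc V ^ 2 * (1 + R ^ (l - 2)) = V ^ 2 + V ^ 2 * R ^ (l - 2) := by ring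
    _ ≤ _ := add_le_add h1 (by
      rw [h4]
      exact mul_le_mul_of_nonneg_left (h2.trans h3) (by positivity))

set_option maxHeartbeats 800000 in
/-- Local error of one Verlet step in normalized variables. -/
lemma verlet_error_le (hT : 0 < T) {m Ll l : ℝ} (hm : 0 < m) (hmL : m ≤ L) (hLl : 0 ≤ Ll)
    (hl : 2 ≤ l) (hTL : T * Real.sqrt L ≤ 1 / 200) (xs x₁ a₁ : E)
    (hx : ∀ t ∈ Set.Icc 0 T, HasDerivWithinAt x (v t) (Set.Icc 0 T) t)
    (hv : ∀ t ∈ Set.Icc 0 T, HasDerivWithinAt v (-a t) (Set.Icc 0 T) t)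
    (ha' : ∀ t ∈ Set.Icc 0 T, HasDerivWithinAt a (a' t) (Set.Icc 0 T) t)
    (ha : ∀ t ∈ Set.Icc 0 T, ‖a t - a 0‖ ≤ L * ‖x t - x 0‖)
    (hB : ∀ t ∈ Set.Icc 0 T, ∀ s ∈ Set.Icc 0 T, ‖a' s - a' t‖ ≤ L * ‖v s - v t‖
      + Ll * ‖x s - x t‖ * (2 + ‖x s - xs‖ ^ (l - 2) + ‖x t - xs‖ ^ (l - 2)) / 4 * ‖v s‖)
    (hx₁ : x₁ = x 0 + T • v 0 - (T ^ 2 / 2) • a 0) (ha₁ : ‖a₁ - a T‖ ≤ L * ‖x₁ - x T‖) :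
    ‖x₁ - x T‖ + ‖v 0 - (T / 2) • (a 0 + a₁) - v T‖ / max 1 (Real.sqrt L)
      ≤ T ^ 3 * (L * (‖v 0‖ / 5 + ‖a 0‖ / Real.sqrt L / 8) + Ll / 24
        * (4 * (‖v 0‖ ^ 2 + (‖a 0‖ / Real.sqrt L) ^ 2) + Real.sqrt m ^ (-(l - 2))
          * (2 ^ l * (‖v 0‖ ^ l + (‖a 0‖ / Real.sqrt L) ^ l + (Real.sqrt m * ‖x 0 - xs‖) ^ l)))) := by
  have hL : 0 < L := hm.trans_le hmL
  set σ := Real.sqrt L with hσ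
  have hσ0 : 0 < σ := Real.sqrt_pos.2 hL
  have hσL : L = σ ^ 2 := (Real.sq_sqrt hL.le).symm
  set μ := Real.sqrt m with hμ
  have hμ0 : 0 < μ := Real.sqrt_pos.2 hm
  have hμσ : μ ≤ σ := Real.sqrt_le_sqrt hmL
  -- The quantities |v|, |∇U|/√L and √m |x - x⋆| have the units of a velocity, and under the Gibbs
  -- measure their moments obey the same bound.
  set α := ‖v 0‖ with hα
  set b := ‖a 0‖ / σ with hb
  have hα0 : 0 ≤ α := norm_nonneg _
  have hb0 : 0 ≤ b := by positivity
  have hβ : ‖a 0‖ = σ * b := by rw [hb]; field_simp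
  set r := μ * ‖x 0 - xs‖ with hr
  have hr0 : 0 ≤ r := by positivity
  set h := T * σ with hh
  have hh0 : 0 ≤ h := by positivity
  have hh2 : h ^ 2 ≤ 1 / 40000 := by
    calc h ^ 2 ≤ (1 / 200) ^ 2 := by gcongr
      _ = _ := by norm_num
  set M := 1.01 * (T * α + T ^ 2 * ‖a 0‖) with hM
  have hM0 : 0 ≤ M := by positivity
  have hxM : ∀ t ∈ Set.Icc 0 T, ‖x t - x 0‖ ≤ M := fun t ht =>
    displacement_le hT.le hL.le (by rw [hσL, ← mul_pow]; linarith) hx hv ha ht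
  have hσM : σ * M ≤ 1.01 * (h * α + h ^ 2 * b) := by
    rw [hM, hβ, hh]; apply le_of_eq; ring
  have hha : h * α ≤ 1 / 200 * α := mul_le_mul_of_nonneg_right hTL hα0
  have hhb : h * b ≤ 1 / 200 * b := mul_le_mul_of_nonneg_right hTL hb0
  have hh2b : h ^ 2 * b ≤ 1 / 40000 * b := mul_le_mul_of_nonneg_right hh2 hb0
  have hσM' : σ * M ≤ 0.0051 * α + 0.0001 * b := by
    refine hσM.trans ?_
    linarith
  -- bounds for the gradient, the velocity and the distance to the minimizer
  set Gm := ‖a 0‖ + L * M with hGm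
  have hat : ∀ t ∈ Set.Icc 0 T, ‖a t‖ ≤ Gm := by
    intro t ht
    have h1 := ha t ht
    have h2 := mul_le_mul_of_nonneg_left (hxM t ht) hL.le
    have h3 := norm_sub_norm_le (a t) (a 0)
    linarith
  have hGm0 : 0 ≤ Gm := by positivity
  have hGmb : Gm ≤ σ * (1.01 * b + 0.01 * α) := by
    rw [hGm, hβ, hσL]
    calc σ * b + σ ^ 2 * M = σ * (b + σ * M) := by ring
      _ ≤ σ * (b + (0.0051 * α + 0.0001 * b)) := by gcongr
      _ ≤ _ := by
        apply mul_le_mul_of_nonneg_left _ hσ0.le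
        linarith
  have hv' : ∀ s ∈ Set.Icc 0 T, ∀ t ∈ Set.Icc 0 T, s ≤ t → ‖v t - v s‖ ≤ Gm * (t - s) := by
    intro s hs t ht hst
    have h1 := IsTraj.norm_sub_sub_smul_le (c := 0) hs.1 ht.2 hst hv
      (C := Gm) (fun u hu => by
        rw [sub_zero, norm_neg]; exact hat u ⟨hs.1.trans hu.1, hu.2.trans ht.2⟩)
    rwa [smul_zero, sub_zero] at h1
  set V := α + T * Gm with hV
  have hV0 : 0 ≤ V := by positivity
  have hvt : ∀ t ∈ Set.Icc 0 T, ‖v t‖ ≤ V := by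
    intro t ht
    have h1 := hv' 0 (Set.left_mem_Icc.2 hT.le) t ht ht.1
    have h3 := norm_sub_norm_le (v t) (v 0)
    have h4 : Gm * (t - 0) ≤ Gm * T := mul_le_mul_of_nonneg_left (by linarith [ht.2]) hGm0
    rw [hV]; linarith
  have hVb : V ≤ 1.01 * α + 0.01 * b := by
    have : T * Gm ≤ h * (1.01 * b + 0.01 * α) := by
      calc T * Gm ≤ T * (σ * (1.01 * b + 0.01 * α)) := by gcongr
        _ = _ := by rw [hh]; ring
    rw [hV]
    linarith
  have hx' : ∀ s ∈ Set.Icc 0 T, ∀ t ∈ Set.Icc 0 T, s ≤ t → ‖x t - x s‖ ≤ V * (t - s) := by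
    intro s hs t ht hst
    have h1 := IsTraj.norm_sub_sub_smul_le (c := 0) hs.1 ht.2 hst hx
      (C := V) (fun u hu => by
        rw [sub_zero]; exact hvt u ⟨hs.1.trans hu.1, hu.2.trans ht.2⟩)
    rwa [smul_zero, sub_zero] at h1
  set R := ‖x 0 - xs‖ + M with hR
  have hR0 : 0 ≤ R := by positivity
  have hRt : ∀ t ∈ Set.Icc 0 T, ‖x t - xs‖ ≤ R := by
    intro t ht
    have := norm_add_le (x t - x 0) (x 0 - xs)
    rw [sub_add_sub_cancel] at this
    have := hxM t ht
    rw [hR]; linarith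
  have hμR : μ * R ≤ r + (0.0051 * α + 0.0001 * b) := by
    have : μ * M ≤ σ * M := mul_le_mul_of_nonneg_right hμσ hM0
    rw [hR, mul_add]; linarith
  -- position
  have hpos : ‖x₁ - x T‖ ≤ L * V * T ^ 3 / 6 := by
    rw [hx₁]
    refine position_error_le hT.le hx hv fun t ht => (ha t ht).trans ?_
    have := hx' 0 (Set.left_mem_Icc.2 hT.le) t ht ht.1
    rw [sub_zero] at this
    rw [mul_assoc]
    gcongr
  -- velocity
  set B := L * Gm + Ll / 2 * (V ^ 2 * (1 + R ^ (l - 2))) with hBdef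
  have hl2 : 0 ≤ l - 2 := by linarith
  have htrap : ‖v 0 - v T - (T / 2) • (a 0 + a T)‖ ≤ B * T ^ 3 / 12 := by
    refine trapezoid_error_le hT.le hv ha' fun t ht s hs => ?_
    have hs' : s ∈ Set.Icc 0 T := ⟨hs.1, hs.2.trans ht.2⟩
    refine (hB t ht s hs').trans ?_
    have h1 : ‖v s - v t‖ ≤ Gm * (t - s) := by rw [norm_sub_rev]; exact hv' s hs' t ht hs.2
    have h2 : ‖x s - x t‖ ≤ V * (t - s) := by rw [norm_sub_rev]; exact hx' s hs' t ht hs.2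
    have h3 : ‖x s - xs‖ ^ (l - 2) ≤ R ^ (l - 2) :=
      Real.rpow_le_rpow (norm_nonneg _) (hRt s hs') hl2
    have h4 : ‖x t - xs‖ ^ (l - 2) ≤ R ^ (l - 2) :=
      Real.rpow_le_rpow (norm_nonneg _) (hRt t ht) hl2
    have hts : 0 ≤ t - s := by linarith [hs.2]
    have hRp : 0 ≤ R ^ (l - 2) := by positivity
    calc L * ‖v s - v t‖
        + Ll * ‖x s - x t‖ * (2 + ‖x s - xs‖ ^ (l - 2) + ‖x t - xs‖ ^ (l - 2)) / 4 * ‖v s‖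
        ≤ L * (Gm * (t - s)) + Ll * (V * (t - s)) * (2 + R ^ (l - 2) + R ^ (l - 2)) / 4 * V := by
          gcongr
          exact hvt s hs'
      _ = B * (t - s) := by rw [hBdef]; ring
  have hvel : ‖v 0 - (T / 2) • (a 0 + a₁) - v T‖ ≤ B * T ^ 3 / 12 + T / 2 * (L * ‖x₁ - x T‖) := by
    have e : v 0 - (T / 2) • (a 0 + a₁) - v T
        = (v 0 - v T - (T / 2) • (a 0 + a T)) - (T / 2) • (a₁ - a T) := by module
    rw [e]
    refine (norm_sub_le _ _).trans ?_
    rw [norm_smul, Real.norm_of_nonneg (by positivity)]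
    gcongr
  set q := max 1 σ with hq
  have hq1 : 1 ≤ q := le_max_left _ _
  have hqσ : σ ≤ q := le_max_right _ _
  have hq0 : 0 < q := by linarith
  -- the nonlinear term
  have hW : V ^ 2 * (1 + R ^ (l - 2)) ≤ 4 * (α ^ 2 + b ^ 2)
      + μ ^ (-(l - 2)) * (2 ^ l * (α ^ l + b ^ l + r ^ l)) :=
    sq_mul_one_add_rpow_le hα0 hb0 hr0 hV0 hR0 hμ0 hl2 hVb hμR
  set N := 4 * (α ^ 2 + b ^ 2) + μ ^ (-(l - 2)) * (2 ^ l * (α ^ l + b ^ l + r ^ l)) with hN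
  have hN0 : 0 ≤ N := by positivity
  -- conclusion
  have hT3 : 0 ≤ T ^ 3 := by positivity
  -- The bound for the acceleration carries a factor σ = √L. Dividing the velocity error by max(1,
  -- √L) removes it and costs nothing on the nonlinear term.
  have hGq : Gm / q ≤ 1.01 * b + 0.01 * α := by
    rw [div_le_iff₀ hq0]
    refine hGmb.trans ?_
    rw [mul_comm]
    gcongr
  have hBq : B / q ≤ L * (1.01 * b + 0.01 * α) + Ll / 2 * N := by
    have h1 : Ll / 2 * (V ^ 2 * (1 + R ^ (l - 2))) / q ≤ Ll / 2 * N := by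
      rw [div_le_iff₀ hq0]
      calc Ll / 2 * (V ^ 2 * (1 + R ^ (l - 2))) ≤ Ll / 2 * N * 1 := by rw [mul_one]; gcongr
        _ ≤ Ll / 2 * N * q := by gcongr
    rw [hBdef, add_div, mul_div_assoc]
    exact add_le_add (mul_le_mul_of_nonneg_left hGq hL.le) h1
  have hTLq : T / 2 * L / q ≤ 0.01 := by
    rw [div_le_iff₀ hq0]
    calc T / 2 * L = h / 2 * σ := by rw [hh, hσL]; ring
      _ ≤ 0.01 * q := by
        apply mul_le_mul _ hqσ hσ0.le (by norm_num)
        linarith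
  have hpos' : L * V * T ^ 3 / 6 ≤ T ^ 3 * (L * (1.01 * α + 0.01 * b)) / 6 := by
    calc L * V * T ^ 3 / 6 = T ^ 3 * (L * V) / 6 := by ring
      _ ≤ _ := by gcongr
  calc ‖x₁ - x T‖ + ‖v 0 - (T / 2) • (a 0 + a₁) - v T‖ / q
      ≤ ‖x₁ - x T‖ + (B * T ^ 3 / 12 + T / 2 * (L * ‖x₁ - x T‖)) / q := by gcongr
    _ = (1 + T / 2 * L / q) * ‖x₁ - x T‖ + T ^ 3 / 12 * (B / q) := by ring
    _ ≤ (1 + 0.01) * (T ^ 3 * (L * (1.01 * α + 0.01 * b)) / 6)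
        + T ^ 3 / 12 * (L * (1.01 * b + 0.01 * α) + Ll / 2 * N) := by
        gcongr
        exact hpos.trans hpos'
    _ = T ^ 3 * (L * ((1.01 * (1.01 * α + 0.01 * b)) / 6 + (1.01 * b + 0.01 * α) / 12)
        + Ll / 24 * N) := by ring
    _ ≤ T ^ 3 * (L * (α / 5 + b / 8) + Ll / 24 * N) := by
        gcongr ?_ * (?_ * ?_ + _)
        linarith

end Taylor

/-! ### Orthogonal decompositions adapted to the potential -/

/-- A decomposition of the position space into orthogonal blocks of dimension at most `k`, given by
the orthogonal projections `P j`, along which the gradient of `U` decouples, with a polynomial local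
Lipschitz condition on the Hessian in each block. -/
structure Blocks {d : ℕ} {J : Type*} [Fintype J] (U : Pos d → ℝ) (m L Ll l k : ℝ) (xs : Pos d)
    (P : J → Pos d →L[ℝ] Pos d) : Prop where
  two_le : 2 ≤ l
  Ll_pos : 0 < Ll
  one_le : 1 ≤ k
  inner_proj : ∀ j x y, ⟪P j x, y⟫ = ⟪P j x, P j y⟫
  sum_sq : ∀ x, ∑ j, ‖P j x‖ ^ 2 = ‖x‖ ^ 2
  trace : ∀ j (A : Pos d →L[ℝ] Pos d), ∑ i, ⟪EuclideanSpace.basisFun (Fin d) ℝ i,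
    P j (A (EuclideanSpace.basisFun (Fin d) ℝ i))⟫ ≤ k * ‖A‖
  grad_xs : gradient U xs = 0
  grad_lip : ∀ j x y, ‖P j (gradient U x - gradient U y)‖ ≤ L * ‖P j (x - y)‖
  grad_mono : ∀ j x, m * ‖P j (x - xs)‖ ^ 2 ≤ ⟪P j (x - xs), gradient U x⟫
  hess : ∀ j x y w, ‖P j (fderiv ℝ (gradient U) y w - fderiv ℝ (gradient U) x w)‖
    ≤ Ll * ‖P j (x - y)‖ * (2 + ‖P j (x - xs)‖ ^ (l - 2) + ‖P j (y - xs)‖ ^ (l - 2)) / 4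
      * ‖P j w‖

namespace Blocks

variable {d : ℕ} {J : Type*} [Fintype J] {U : Pos d → ℝ} {m L Ll l k γ δ : ℝ} {xs : Pos d}
  {P : J → Pos d →L[ℝ] Pos d}

lemma norm_le (hP : Blocks U m L Ll l k xs P) (j : J) (x : Pos d) : ‖P j x‖ ≤ ‖x‖ := by
  have h : ‖P j x‖ ^ 2 ≤ ∑ j, ‖P j x‖ ^ 2 :=
    Finset.single_le_sum (f := fun j => ‖P j x‖ ^ 2) (fun _ _ => sq_nonneg _) (Finset.mem_univ j)
  rw [hP.sum_sq] at h
  exact le_of_sq_le_sq h (norm_nonneg _)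

lemma opNorm_le (hP : Blocks U m L Ll l k xs P) (j : J) : ‖P j‖ ≤ 1 :=
  (P j).opNorm_le_bound zero_le_one fun x => by rw [one_mul]; exact hP.norm_le j x

lemma norm_fderiv_le (hP : Blocks U m L Ll l k xs P) (hS : Setting U m L γ δ) (j : J)
    (x w : Pos d) : ‖P j (fderiv ℝ (gradient U) x w)‖ ≤ L * ‖P j w‖ := by
  have hd : HasDerivAt (fun t : ℝ => P j (gradient U (x + t • w)))
      (P j (fderiv ℝ (gradient U) x w)) 0 := by
    have h1 : HasDerivAt (fun t : ℝ => x + t • w) w 0 := by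
      simpa using ((hasDerivAt_id (0 : ℝ)).smul_const w).const_add x
    have h2 := (hS.differentiable_gradient (x + (0 : ℝ) • w)).hasFDerivAt.comp_hasDerivAt 0 h1
    have h3 := (P j).hasFDerivAt.comp_hasDerivAt (0 : ℝ) h2
    simp only [zero_smul, add_zero] at h3
    exact h3
  refine hd.le_of_lip' (by have := hS.L_pos; positivity) (Eventually.of_forall fun t => ?_)
  rw [← map_sub]
  refine (hP.grad_lip j _ _).trans (le_of_eq ?_)
  have : x + t • w - (x + (0 : ℝ) • w) = t • w := by module
  rw [this, map_smul, norm_smul, sub_zero]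
  ring

/-- Local error of the Verlet scheme in each block. -/
lemma error_le (hP : Blocks U m L Ll l k xs P) (hS : Setting U m L γ δ) (j : J) {z : Phase d}
    {X V : ℝ → Pos d} (hX : IsTraj U δ z X V) :
    ‖P j ((verlet U δ z).1 - X δ)‖ + ‖P j ((verlet U δ z).2 - V δ)‖ / max 1 (Real.sqrt L)
      ≤ δ ^ 3 * (L * (‖P j z.2‖ / 5 + ‖P j (gradient U z.1)‖ / Real.sqrt L / 8) + Ll / 24
        * (4 * (‖P j z.2‖ ^ 2 + (‖P j (gradient U z.1)‖ / Real.sqrt L) ^ 2)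
          + Real.sqrt m ^ (-(l - 2)) * (2 ^ l * (‖P j z.2‖ ^ l
            + (‖P j (gradient U z.1)‖ / Real.sqrt L) ^ l
            + (Real.sqrt m * ‖P j (z.1 - xs)‖) ^ l)))) := by
  have h1 : ∀ t ∈ Set.Icc 0 δ, HasDerivWithinAt (fun t => P j (X t)) (P j (V t)) (Set.Icc 0 δ) t :=
    fun t ht => (P j).hasFDerivAt.comp_hasDerivWithinAt t (hX.hasDeriv_pos t ht)
  have h2 : ∀ t ∈ Set.Icc 0 δ, HasDerivWithinAt (fun t => P j (V t)) (-P j (gradient U (X t)))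
      (Set.Icc 0 δ) t := fun t ht => by
    have := (P j).hasFDerivAt.comp_hasDerivWithinAt t (hX.hasDeriv_vel t ht)
    rwa [map_neg] at this
  have h3 : ∀ t ∈ Set.Icc 0 δ, HasDerivWithinAt (fun t => P j (gradient U (X t)))
      (P j (fderiv ℝ (gradient U) (X t) (V t))) (Set.Icc 0 δ) t := fun t ht =>
    (P j).hasFDerivAt.comp_hasDerivWithinAt t
      ((hS.differentiable_gradient (X t)).hasFDerivAt.comp_hasDerivWithinAt t (hX.hasDeriv_pos t ht))
  have h := verlet_error_le (T := δ) (L := L) (m := m) (Ll := Ll) (l := l)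
    (x := fun t => P j (X t)) (v := fun t => P j (V t)) (a := fun t => P j (gradient U (X t)))
    (a' := fun t => P j (fderiv ℝ (gradient U) (X t) (V t))) hS.δ_pos hS.m_pos hS.m_le
    hP.Ll_pos.le hP.two_le (by linarith [hS.δ_sqrt_le]) (P j xs) (P j (verlet U δ z).1)
    (P j (gradient U (verlet U δ z).1)) h1 h2 h3 (fun t ht => by
      rw [← map_sub, ← map_sub]; exact hP.grad_lip j _ _) (fun t ht s hs => by
      have e : P j (fderiv ℝ (gradient U) (X s) (V s)) - P j (fderiv ℝ (gradient U) (X t) (V t))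
          = P j (fderiv ℝ (gradient U) (X t) (V s - V t))
            + P j (fderiv ℝ (gradient U) (X s) (V s) - fderiv ℝ (gradient U) (X t) (V s)) := by
        simp only [map_sub]; abel
      rw [e]
      refine (norm_add_le _ _).trans (add_le_add ?_ ?_)
      · rw [← map_sub]; exact hP.norm_fderiv_le hS j _ _
      · refine (hP.hess j _ _ _).trans (le_of_eq ?_)
        simp only [map_sub]
        rw [norm_sub_rev (P j (X t)) (P j (X s)), add_right_comm]) (by
      simp only [hX.pos_zero, hX.vel_zero, verlet, kick, drift]
      rw [← map_smul, ← map_smul, ← map_add, ← map_sub]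
      congr 1; module) (by rw [← map_sub, ← map_sub]; exact hP.grad_lip j _ _)
  simp only [hX.pos_zero, hX.vel_zero] at h
  have e : P j ((verlet U δ z).2 - V δ)
      = P j z.2 - (δ / 2) • (P j (gradient U z.1) + P j (gradient U (verlet U δ z).1)) - P j (V δ) := by
    simp only [verlet, kick, drift, map_sub, map_smul]
    module
  rw [e, map_sub, map_sub (P j) z.1 xs]
  exact h

end Blocks

/-! ### Moments in each block -/

lemma rpow_growth {d : ℕ} {G : Pos d → Pos d} {A B q : ℝ} (hA : 0 ≤ A) (hB : 0 ≤ B) (hq : 0 ≤ q)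
    (hG : ∀ x, ‖G x‖ ≤ A + B * ‖x‖) (x : Pos d) :
    |‖G x‖ ^ q| ≤ (A + B) ^ q * (1 + ‖x‖) ^ q := by
  rw [abs_of_nonneg (by positivity), ← Real.mul_rpow (by positivity) (by positivity)]
  refine Real.rpow_le_rpow (norm_nonneg _) ((hG x).trans ?_) hq
  nlinarith [norm_nonneg x, mul_nonneg hA (norm_nonneg x)]

namespace Blocks

variable {d : ℕ} {J : Type*} [Fintype J] {U : Pos d → ℝ} {m L Ll l k γ δ : ℝ} {xs : Pos d}
  {P : J → Pos d →L[ℝ] Pos d}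

lemma trace_id_le (hP : Blocks U m L Ll l k xs P) (j : J) :
    ∑ i, ⟪EuclideanSpace.basisFun (Fin d) ℝ i, P j (EuclideanSpace.basisFun (Fin d) ℝ i)⟫ ≤ k := by
  refine (hP.trace j (ContinuousLinearMap.id ℝ _)).trans ?_
  have := ContinuousLinearMap.norm_id_le (𝕜 := ℝ) (E := Pos d)
  nlinarith [hP.one_le]

/-- Apply `IsConfining.moment_le` to the field P (x - x⋆), whose derivative is the projection. The
potential W is kept general because the estimate serves both U and the modified potential. -/
lemma moment_position (hP : Blocks U m L Ll l k xs P) {W : Pos d → ℝ} (hW : IsConfining W)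
    (hWd : Differentiable ℝ W) {CW : ℝ} (hCW : ∀ x, ‖fderiv ℝ W x‖ ≤ CW * (1 + ‖x‖)) {c : ℝ}
    (hc : 0 < c) (j : J) (hmono : ∀ x, c * ‖P j (x - xs)‖ ^ 2 ≤ fderiv ℝ W x (P j (x - xs)))
    {q : ℝ} (hq : 2 ≤ q) :
    Integrable (fun x => ‖P j (x - xs)‖ ^ q) (boltzmann W) ∧
      ∫ x, ‖P j (x - xs)‖ ^ q ∂(boltzmann W) ≤ ((k + q - 2) / c) ^ (q / 2) := by
  have hq0 : 0 ≤ q := by linarith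
  have hd : ∀ x, HasFDerivAt (fun x => P j (x - xs)) (P j) x := fun x =>
    (P j).hasFDerivAt.comp x ((hasFDerivAt_id x).sub_const xs)
  constructor
  · refine hW.integrable_boltzmann (C := (‖xs‖ + 1) ^ q) (r := q) ?_
      (rpow_growth (norm_nonneg _) zero_le_one hq0 fun x => ?_)
    · have : Continuous fun x => ‖P j (x - xs)‖ ^ q :=
        Continuous.rpow_const (by fun_prop) fun _ => Or.inr hq0
      exact this.aestronglyMeasurable
    · refine (hP.norm_le j _).trans ((norm_sub_le _ _).trans ?_)
      linarith
  · have h := hW.moment_le hWd hCW (G := fun x => P j (x - xs)) (fun x => (hd x).differentiableAt)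
      (Λ := 1) (c := c) (k := k) (q := q) zero_le_one hc (by linarith [hP.one_le]) hq
      (fun x => by rw [(hd x).fderiv]; exact hP.opNorm_le j)
      (fun x => by rw [(hd x).fderiv, one_mul]; exact hP.trace_id_le j) hmono
    rwa [one_mul] at h

lemma moment_velocity (hP : Blocks U m L Ll l k xs P) (j : J) {q : ℝ} (hq : 2 ≤ q) :
    Integrable (fun v => ‖P j v‖ ^ q) (stdGaussian (Pos d)) ∧
      ∫ v, ‖P j v‖ ^ q ∂(stdGaussian (Pos d)) ≤ (k + q - 2) ^ (q / 2) := by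
  have hq0 : 0 ≤ q := by linarith
  have hW := isConfining_gaussian d
  have hd : ∀ x : Pos d, HasFDerivAt (fun v : Pos d => ‖v‖ ^ 2 / 2) (innerSL ℝ x) x := fun x => by
    have h := (hasStrictFDerivAt_norm_sq x).hasFDerivAt.mul_const (1 / 2 : ℝ)
    refine (h.congr_fderiv ?_).congr_of_eventuallyEq (Eventually.of_forall fun v => ?_)
    · ext w; simp
    · ring
  rw [← boltzmann_gaussian]
  constructor
  · refine hW.integrable_boltzmann (C := (0 + 1) ^ q) (r := q) ?_
      (rpow_growth le_rfl zero_le_one hq0 fun x => ?_)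
    · have : Continuous fun x => ‖P j x‖ ^ q :=
        Continuous.rpow_const (by fun_prop) fun _ => Or.inr hq0
      exact this.aestronglyMeasurable
    · rw [zero_add, one_mul]; exact hP.norm_le j _
  · have h := hW.moment_le (fun x => (hd x).differentiableAt) (CW := 1) (fun x => by
        rw [(hd x).fderiv, innerSL_apply_norm]; linarith) (G := fun x => P j x)
      (fun x => (P j).differentiableAt)
      (Λ := 1) (c := 1) (k := k) (q := q) zero_le_one one_pos (by linarith [hP.one_le]) hq
      (fun x => by rw [(P j).fderiv]; exact hP.opNorm_le j)
      (fun x => by rw [(P j).fderiv, one_mul]; exact hP.trace_id_le j)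
      (fun x => by
        rw [(hd x).fderiv, innerSL_apply_apply, real_inner_comm, hP.inner_proj,
          real_inner_self_eq_norm_sq, one_mul])
    rwa [one_mul, div_one] at h

lemma norm_gradient_le (hP : Blocks U m L Ll l k xs P) (hS : Setting U m L γ δ) (x : Pos d) :
    ‖gradient U x‖ ≤ L * ‖x - xs‖ := by
  have := hS.lip x xs
  rwa [hP.grad_xs, sub_zero] at this

lemma norm_fderiv_potential_le (hP : Blocks U m L Ll l k xs P) (hS : Setting U m L γ δ) (x : Pos d) :
    ‖fderiv ℝ U x‖ ≤ L * (1 + ‖xs‖) * (1 + ‖x‖) := by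
  have hL := hS.L_pos
  refine ContinuousLinearMap.opNorm_le_bound _ (by positivity) fun w => ?_
  rw [hS.fderiv_apply, Real.norm_eq_abs]
  refine (abs_real_inner_le_norm _ _).trans ?_
  gcongr
  refine (hP.norm_gradient_le hS x).trans ?_
  rw [mul_assoc]
  gcongr
  have := norm_sub_le x xs
  nlinarith [mul_nonneg (norm_nonneg x) (norm_nonneg xs)]

lemma moment_position_gibbs (hP : Blocks U m L Ll l k xs P) (hS : Setting U m L γ δ) (j : J)
    {q : ℝ} (hq : 2 ≤ q) :
    Integrable (fun x => ‖P j (x - xs)‖ ^ q) (boltzmann U) ∧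
      ∫ x, ‖P j (x - xs)‖ ^ q ∂(boltzmann U) ≤ ((k + q - 2) / m) ^ (q / 2) :=
  hP.moment_position hS.isConfining (hS.contDiff.differentiable (by norm_num))
    (hP.norm_fderiv_potential_le hS) hS.m_pos j (fun x => by
      rw [hS.fderiv_apply, real_inner_comm]; exact hP.grad_mono j x) hq

/-- For the field P∇U the derivative of U along it is exactly |P∇U|², so c = 1 and Λ = L. The bound
involves no inverse power of m. -/
lemma moment_gradient_gibbs (hP : Blocks U m L Ll l k xs P) (hS : Setting U m L γ δ) (j : J)
    {q : ℝ} (hq : 2 ≤ q) :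
    Integrable (fun x => ‖P j (gradient U x)‖ ^ q) (boltzmann U) ∧
      ∫ x, ‖P j (gradient U x)‖ ^ q ∂(boltzmann U) ≤ (L * (k + q - 2)) ^ (q / 2) := by
  have hq0 : 0 ≤ q := by linarith
  have hL := hS.L_pos
  have hd : ∀ x, HasFDerivAt (fun x => P j (gradient U x))
      ((P j).comp (fderiv ℝ (gradient U) x)) x := fun x =>
    (P j).hasFDerivAt.comp x (hS.differentiable_gradient x).hasFDerivAt
  constructor
  · refine hS.isConfining.integrable_boltzmann (C := (L * ‖xs‖ + L) ^ q) (r := q) ?_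
      (rpow_growth (by positivity) hL.le hq0 fun x => ?_)
    · have hc := hS.continuous_gradient
      have : Continuous fun x => ‖P j (gradient U x)‖ ^ q :=
        Continuous.rpow_const (by fun_prop) fun _ => Or.inr hq0
      exact this.aestronglyMeasurable
    · refine (hP.norm_le j _).trans ((hP.norm_gradient_le hS x).trans ?_)
      nlinarith [norm_sub_le x xs]
  · have h := hS.isConfining.moment_le (hS.contDiff.differentiable (by norm_num))
      (hP.norm_fderiv_potential_le hS) (G := fun x => P j (gradient U x))
      (fun x => (hd x).differentiableAt)
      (Λ := L) (c := 1) (k := k) (q := q) hL.le one_pos (by linarith [hP.one_le]) hq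
      (fun x => by
        rw [(hd x).fderiv]
        refine ((P j).opNorm_comp_le _).trans ?_
        have h1 := hP.opNorm_le j
        have h2 := hS.norm_fderiv_gradient_le x
        nlinarith [norm_nonneg (P j), norm_nonneg (fderiv ℝ (gradient U) x)])
      (fun x => by
        rw [(hd x).fderiv]
        refine (hP.trace j (fderiv ℝ (gradient U) x)).trans ?_
        rw [mul_comm]
        have := hP.one_le
        gcongr
        exact hS.norm_fderiv_gradient_le x)
      (fun x => by
        rw [hS.fderiv_apply, real_inner_comm, hP.inner_proj, real_inner_self_eq_norm_sq, one_mul])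
    rwa [div_one] at h

end Blocks

/-- Normalized form of a moment bound. -/
lemma eLpNorm_rpow_le_one {X : Type*} [MeasurableSpace X] {μ : Measure X} {f : X → ℝ}
    (hf0 : ∀ x, 0 ≤ f x) {l p D : ℝ} (hp : 0 < p) (hD : 0 < D)
    (hi : Integrable (fun x => f x ^ (l * p)) μ)
    (hle : ∫ x, f x ^ (l * p) ∂μ ≤ D ^ (l * p / 2)) :
    eLpNorm (fun x => (f x / Real.sqrt D) ^ l) (ENNReal.ofReal p) μ ≤ 1 := by
  have hs := Real.sqrt_pos.2 hD
  rw [eLpNorm_eq_lintegral_rpow_enorm_toReal (by simpa using hp) (by simp),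
    ENNReal.toReal_ofReal hp.le]
  refine ENNReal.rpow_le_one ?_ (by positivity)
  have e : ∀ x, ‖(f x / Real.sqrt D) ^ l‖ₑ ^ p
      = ENNReal.ofReal (f x ^ (l * p) / D ^ (l * p / 2)) := by
    intro x
    have h0 : 0 ≤ f x / Real.sqrt D := div_nonneg (hf0 x) hs.le
    rw [Real.enorm_of_nonneg (by positivity), ENNReal.ofReal_rpow_of_nonneg (by positivity) hp.le,
      ← Real.rpow_mul h0, Real.div_rpow (hf0 x) hs.le, Real.sqrt_eq_rpow, ← Real.rpow_mul hD.le]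
    congr 3; ring
  simp_rw [e]
  rw [← ofReal_integral_eq_lintegral_ofReal (hi.div_const _)
    (Eventually.of_forall fun x => div_nonneg (Real.rpow_nonneg (hf0 x) _) (by positivity)),
    integral_div]
  rw [ENNReal.ofReal_le_one]
  exact div_le_one_of_le₀ hle (by positivity)

/-! ### Norm of the local error under the Gibbs measure -/

lemma eLpNorm_le_of_le_affine {X : Type*} [MeasurableSpace X] {μ : Measure X}
    [IsProbabilityMeasure μ] {p : ENNReal} (hp : 1 ≤ p) {f t s u : X → ℝ} (ht : Measurable t)
    (hs : Measurable s) (hu : Measurable u) (ht1 : eLpNorm t p μ ≤ 1) (hs1 : eLpNorm s p μ ≤ 1)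
    (hu1 : eLpNorm u p μ ≤ 1) {A₀ A₁ A₂ A₃ : ℝ} (h0 : 0 ≤ A₀) (h1 : 0 ≤ A₁) (h2 : 0 ≤ A₂)
    (h3 : 0 ≤ A₃) (hle : ∀ x, ‖f x‖ ≤ A₀ + A₁ * t x + A₂ * s x + A₃ * u x) :
    eLpNorm f p μ ≤ ENNReal.ofReal (A₀ + A₁ + A₂ + A₃) := by
  have key : ∀ {A : ℝ} {g : X → ℝ}, 0 ≤ A → eLpNorm g p μ ≤ 1 →
      eLpNorm (A • g) p μ ≤ ENNReal.ofReal A := by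
    intro A g hA hg
    rw [eLpNorm_const_smul, Real.enorm_of_nonneg hA]
    calc ENNReal.ofReal A * eLpNorm g p μ ≤ ENNReal.ofReal A * 1 := by gcongr
      _ = _ := mul_one _
  have hc : eLpNorm (fun _ : X => A₀) p μ = ENNReal.ofReal A₀ := by
    rw [eLpNorm_const A₀ (by positivity) (IsProbabilityMeasure.ne_zero μ), measure_univ,
      ENNReal.one_rpow, mul_one, Real.enorm_of_nonneg h0]
  have m0 : AEStronglyMeasurable (fun _ : X => A₀) μ := aestronglyMeasurable_const
  have m1 : AEStronglyMeasurable (A₁ • t) μ := ht.aestronglyMeasurable.const_smul A₁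
  have m2 : AEStronglyMeasurable (A₂ • s) μ := hs.aestronglyMeasurable.const_smul A₂
  have m3 : AEStronglyMeasurable (A₃ • u) μ := hu.aestronglyMeasurable.const_smul A₃
  calc eLpNorm f p μ ≤ eLpNorm ((((fun _ : X => A₀) + A₁ • t) + A₂ • s) + A₃ • u) p μ :=
        eLpNorm_mono_real hle
    _ ≤ eLpNorm (fun _ : X => A₀) p μ + eLpNorm (A₁ • t) p μ + eLpNorm (A₂ • s) p μ
        + eLpNorm (A₃ • u) p μ := by
        refine (eLpNorm_add_le ((m0.add m1).add m2) m3 hp).trans ?_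
        gcongr
        refine (eLpNorm_add_le (m0.add m1) m2 hp).trans ?_
        gcongr
        exact eLpNorm_add_le m0 m1 hp
    _ ≤ ENNReal.ofReal A₀ + ENNReal.ofReal A₁ + ENNReal.ofReal A₂ + ENNReal.ofReal A₃ := by
        rw [hc]
        gcongr
        exacts [key h1 ht1, key h2 hs1, key h3 hu1]
    _ = _ := by
        rw [ENNReal.ofReal_add (by positivity) h3, ENNReal.ofReal_add (by positivity) h2,
          ENNReal.ofReal_add h0 h1]

/-- Admissible combination constants for the `L^p` norm of the Euclidean norm of `N` functions. -/
def IsCombConst (N : ℕ) (p c : ℝ) : Prop := (1 ≤ p ∧ c = N) ∨ (2 ≤ p ∧ c = Real.sqrt N)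

lemma IsCombConst.one_le {N : ℕ} {p c : ℝ} (h : IsCombConst N p c) : 1 ≤ p := by
  rcases h with h | h <;> linarith [h.1]

lemma IsCombConst.nonneg {N : ℕ} {p c : ℝ} (h : IsCombConst N p c) : 0 ≤ c := by
  rcases h with h | h <;> rw [h.2] <;> positivity

/-- For p ≥ 2, Minkowski in L^(p/2) applied to the squares gives √N. For general p ≥ 1 the Euclidean
norm is bounded by the sum, giving N; this second form serves a single block, or p = 1 in the total
variation estimate. -/
lemma eLpNorm_sqrt_sum_sq_le {X : Type*} [MeasurableSpace X] {μ : Measure X} {J : Type*} [Fintype J]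
    {p c : ℝ} (hc : IsCombConst (Fintype.card J) p c) {f : J → X → ℝ} (hf : ∀ j, Measurable (f j))
    (hf0 : ∀ j x, 0 ≤ f j x) {B : ℝ} (hB0 : 0 ≤ B)
    (hB : ∀ j, eLpNorm (f j) (ENNReal.ofReal p) μ ≤ ENNReal.ofReal B) :
    eLpNorm (fun x => Real.sqrt (∑ j, f j x ^ 2)) (ENNReal.ofReal p) μ
      ≤ ENNReal.ofReal (c * B) := by
  rcases hc with ⟨hp, rfl⟩ | ⟨hp, rfl⟩
  · calc eLpNorm (fun x => Real.sqrt (∑ j, f j x ^ 2)) (ENNReal.ofReal p) μ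
        ≤ eLpNorm (∑ j, f j) (ENNReal.ofReal p) μ := by
          refine eLpNorm_mono_real fun x => ?_
          rw [Real.norm_of_nonneg (Real.sqrt_nonneg _), Finset.sum_apply]
          refine Real.sqrt_le_iff.2 ⟨Finset.sum_nonneg fun j _ => hf0 j x, ?_⟩
          exact Finset.sum_sq_le_sq_sum_of_nonneg fun j _ => hf0 j x
      _ ≤ ∑ j, eLpNorm (f j) (ENNReal.ofReal p) μ :=
          eLpNorm_sum_le (fun j _ => (hf j).aestronglyMeasurable) (by simpa using hp)
      _ ≤ ∑ _j : J, ENNReal.ofReal B := Finset.sum_le_sum fun j _ => hB j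
      _ = _ := by
          rw [Finset.sum_const, nsmul_eq_mul, Finset.card_univ, ENNReal.ofReal_mul (by positivity),
            ENNReal.ofReal_natCast]
  · set g : X → ℝ := fun x => Real.sqrt (∑ j, f j x ^ 2) with hg
    have hp2 : ENNReal.ofReal (p / 2) * ENNReal.ofReal 2 = ENNReal.ofReal p := by
      rw [← ENNReal.ofReal_mul (by linarith)]; congr 1; ring
    have h1 : ∀ h : X → ℝ, eLpNorm (fun x => ‖h x‖ ^ (2 : ℝ)) (ENNReal.ofReal (p / 2)) μ
        = eLpNorm h (ENNReal.ofReal p) μ ^ (2 : ℝ) := fun h => by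
      rw [eLpNorm_norm_rpow h two_pos, hp2]
    have h2 : eLpNorm g (ENNReal.ofReal p) μ ^ (2 : ℝ) ≤ ENNReal.ofReal (Real.sqrt (Fintype.card J) * B) ^ (2 : ℝ) := by
      rw [← h1]
      calc eLpNorm (fun x => ‖g x‖ ^ (2 : ℝ)) (ENNReal.ofReal (p / 2)) μ
          = eLpNorm (∑ j, fun x => ‖f j x‖ ^ (2 : ℝ)) (ENNReal.ofReal (p / 2)) μ := by
            congr 1; ext x
            rw [Finset.sum_apply, Real.norm_of_nonneg (Real.sqrt_nonneg _), Real.rpow_two,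
              Real.sq_sqrt (Finset.sum_nonneg fun j _ => sq_nonneg _)]
            refine Finset.sum_congr rfl fun j _ => ?_
            rw [Real.norm_of_nonneg (hf0 j x), Real.rpow_two]
        _ ≤ ∑ j, eLpNorm (fun x => ‖f j x‖ ^ (2 : ℝ)) (ENNReal.ofReal (p / 2)) μ := by
            refine eLpNorm_sum_le (fun j _ => ?_) ?_
            · exact ((hf j).norm.pow_const _).aestronglyMeasurable
            · rw [ENNReal.one_le_ofReal]; linarith
        _ ≤ ∑ _j : J, ENNReal.ofReal B ^ (2 : ℝ) := by
            refine Finset.sum_le_sum fun j _ => ?_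
            rw [h1]
            gcongr
            exact hB j
        _ = _ := by
            rw [Finset.sum_const, nsmul_eq_mul, Finset.card_univ,
              ENNReal.ofReal_rpow_of_nonneg hB0 (by norm_num),
              ENNReal.ofReal_rpow_of_nonneg (by positivity) (by norm_num), Real.rpow_two,
              Real.rpow_two, mul_pow, Real.sq_sqrt (by positivity),
              ENNReal.ofReal_mul (by positivity), ENNReal.ofReal_natCast]
    exact (ENNReal.rpow_le_rpow_iff two_pos).1 h2

/-! ### Lower bounds for the constants and scalar inequalities -/

lemma one_le_exp_mul {L δ : ℝ} (hL : 0 ≤ L) : 1 ≤ Real.exp (L * δ ^ 2) :=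
  Real.one_le_exp (by positivity)

/-- The constants enter the proof only through such lower bounds, which are their limits as δ → 0:
every δ-dependent factor is at least 1 and is dropped. -/
lemma le_K₅ {m L δ : ℝ} (hL : 0 < L) (hδ : 0 < δ) : L / 6 + L / (4 * Real.sqrt m) ≤ K₅ m L δ := by
  have h1 := one_le_exp_mul (δ := δ) hL.le
  have h2 : 1 ≤ 1 + δ * ((L + 1) / 2) + δ ^ 3 * (L / 40) := by
    have : 0 ≤ δ * ((L + 1) / 2) := by positivity
    have : 0 ≤ δ ^ 3 * (L / 40) := by positivity
    linarith
  have h3 : 1 ≤ 1 + δ * (L / (2 * Real.sqrt m)) := by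
    have : 0 ≤ δ * (L / (2 * Real.sqrt m)) := by positivity
    linarith
  unfold K₅
  have h4 : L / 6 ≤ L / 6 * (1 + δ * ((L + 1) / 2) + δ ^ 3 * (L / 40)) * Real.exp (L * δ ^ 2)
      * (1 + δ * (L / (2 * Real.sqrt m))) := by
    calc L / 6 = L / 6 * 1 * 1 * 1 := by ring
      _ ≤ _ := by gcongr
  linarith

lemma le_K₆ {m L l δ : ℝ} (hm : 0 < m) (hL : 0 < L) (hδ : 0 < δ) (hl : 2 ≤ l) :
    2 ^ (l - 2) * (1 + 1 / m ^ (l / 2)) ≤ K₆ m L l δ := by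
  have h1 := Real.exp_pos (L * δ ^ 2)
  have h2 : 1 ≤ 1 + Real.exp (L * δ ^ 2) * (δ ^ 2 / 12) := by
    have : 0 ≤ Real.exp (L * δ ^ 2) * (δ ^ 2 / 12) := by positivity
    linarith
  have h3 : 1 ≤ (1 + δ + Real.exp (L * δ ^ 2) * (δ ^ 3 / 6)) ^ (l - 2) := by
    refine Real.one_le_rpow ?_ (by linarith)
    have : 0 ≤ Real.exp (L * δ ^ 2) * (δ ^ 3 / 6) := by positivity
    linarith
  have h4 : 1 ≤ (1 + δ * L / 2) ^ l := by
    refine Real.one_le_rpow ?_ (by linarith)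
    have : 0 ≤ δ * L / 2 := by positivity
    linarith
  unfold K₆
  calc (2 : ℝ) ^ (l - 2) * (1 + 1 / m ^ (l / 2)) = 2 ^ (l - 2) * 1 * 1 * 1 * (1 + 1 / m ^ (l / 2)) := by
        ring
    _ ≤ _ := by gcongr

lemma le_rpow_convex {t l : ℝ} (ht : 0 ≤ t) (hl : 1 ≤ l) : t ≤ (l - 1) / l + t ^ l / l := by
  have h := Real.geom_mean_le_arith_mean2_weighted (w₁ := (l - 1) / l) (w₂ := 1 / l)
    (p₁ := 1) (p₂ := t ^ l) (div_nonneg (by linarith) (by linarith)) (by positivity) zero_le_one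
    (by positivity) (by field_simp; ring)
  rw [Real.one_rpow, one_mul, ← Real.rpow_mul ht, mul_one_div_cancel (by linarith), Real.rpow_one] at h
  linarith [h, (by ring : 1 / l * t ^ l = t ^ l / l)]

lemma sq_le_one_add_rpow {t l : ℝ} (ht : 0 ≤ t) (hl : 2 ≤ l) : t ^ 2 ≤ 1 + t ^ l := by
  have h0 : 0 ≤ t ^ l := by positivity
  rcases le_total t 1 with h | h
  · have : t ^ 2 ≤ 1 := pow_le_one₀ ht h
    linarith
  · have : t ^ 2 ≤ t ^ l := by
      rw [← Real.rpow_two]; exact Real.rpow_le_rpow_of_exponent_le h hl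
    linarith

/-- A power of 1/m with smaller exponent is at most 1 when 1/m ≤ 1, and otherwise at most the power
with larger exponent. -/
lemma sqrt_rpow_neg_le {m a b : ℝ} (hm : 0 < m) (ha : 0 ≤ a) (hab : a ≤ b) :
    Real.sqrt m ^ (-a) ≤ 1 + 1 / m ^ (b / 2) := by
  have e : Real.sqrt m ^ (-a) = (1 / m) ^ (a / 2) := by
    rw [Real.sqrt_eq_rpow, ← Real.rpow_mul hm.le, one_div m, Real.inv_rpow hm.le, ← Real.rpow_neg hm.le]
    congr 1; ring
  rw [e, one_div (m ^ _), ← Real.inv_rpow hm.le, ← one_div]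
  have h1 : 0 < 1 / m := by positivity
  have h2 : 0 ≤ (1 / m) ^ (b / 2) := by positivity
  rcases le_total (1 / m) 1 with h | h
  · have := Real.rpow_le_one h1.le h (by linarith : 0 ≤ a / 2)
    linarith
  · have := Real.rpow_le_rpow_of_exponent_le h (by linarith : a / 2 ≤ b / 2)
    linarith

namespace Blocks

variable {d : ℕ} {J : Type*} [Fintype J] {U : Pos d → ℝ} {m L Ll l k γ δ : ℝ} {xs : Pos d}
  {P : J → Pos d →L[ℝ] Pos d}

/-- Difference in block `j` between the Verlet map and `φ`. -/
def blockError (U : Pos d → ℝ) (L δ : ℝ) (P : J → Pos d →L[ℝ] Pos d) (φ : Phase d → Phase d) (j : J)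
    (z : Phase d) : ℝ :=
  ‖P j ((verlet U δ z).1 - (φ z).1)‖ + ‖P j ((verlet U δ z).2 - (φ z).2)‖ / max 1 (Real.sqrt L)

omit [Fintype J] in
lemma blockError_nonneg (φ : Phase d → Phase d) (j : J) (z : Phase d) :
    0 ≤ blockError U L δ P φ j z := by
  unfold blockError; positivity

omit [Fintype J] in
lemma measurable_blockError (hS : Setting U m L γ δ) {φ : Phase d → Phase d} (hφ : Measurable φ)
    (j : J) : Measurable (blockError U L δ P φ j) := by
  have hv := (continuous_verlet hS.continuous_gradient δ).measurable
  have h1 : Measurable fun z => P j ((verlet U δ z).1 - (φ z).1) :=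
    (P j).continuous.measurable.comp (hv.fst.sub hφ.fst)
  have h2 : Measurable fun z => P j ((verlet U δ z).2 - (φ z).2) :=
    (P j).continuous.measurable.comp (hv.snd.sub hφ.snd)
  exact h1.norm.add (h2.norm.div_const _)

/-- Factor out the moment scale √D and bound first and second powers by affine functions of l-th
powers. What remains is affine in the three normalized l-th powers, each of which has L^p norm at
most 1. -/
lemma blockError_le_affine {α b r D δ L Ll l m x : ℝ} (hα : 0 ≤ α) (hb : 0 ≤ b) (hr : 0 ≤ r)
    (hD : 1 ≤ D) (hδ : 0 < δ) (hL : 0 < L) (hLl : 0 < Ll) (hl : 2 ≤ l) (hm : 0 < m)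
    (hx : x ≤ δ ^ 3 * (L * (α / 5 + b / 8) + Ll / 24 * (4 * (α ^ 2 + b ^ 2)
      + Real.sqrt m ^ (-(l - 2)) * (2 ^ l * (α ^ l + b ^ l + r ^ l))))) :
    x ≤ δ ^ 3 * D ^ (l / 2) * (L * (13 / 40 * ((l - 1) / l)) + Ll / 3)
      + δ ^ 3 * D ^ (l / 2) * (L * (1 / (5 * l)) + Ll / 24 * (4 + Real.sqrt m ^ (-(l - 2)) * 2 ^ l))
          * (α / Real.sqrt D) ^ l
      + δ ^ 3 * D ^ (l / 2) * (L * (1 / (8 * l)) + Ll / 24 * (4 + Real.sqrt m ^ (-(l - 2)) * 2 ^ l))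
          * (b / Real.sqrt D) ^ l
      + δ ^ 3 * D ^ (l / 2) * (Ll / 24 * (Real.sqrt m ^ (-(l - 2)) * 2 ^ l))
          * (r / Real.sqrt D) ^ l := by
  have hD0 : 0 < D := by linarith
  set s := Real.sqrt D with hs
  have hs0 : 0 < s := Real.sqrt_pos.2 hD0
  have hs1 : 1 ≤ s := Real.one_le_sqrt.2 hD
  have hsl : D ^ (l / 2) = s ^ l := by
    rw [hs, Real.sqrt_eq_rpow, ← Real.rpow_mul hD0.le]; congr 1; ring
  have hs2 : s ^ 2 ≤ s ^ l := by
    rw [← Real.rpow_two]; exact Real.rpow_le_rpow_of_exponent_le hs1 hl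
  have hss : s ≤ s ^ l := by
    calc s = s ^ (1 : ℝ) := (Real.rpow_one s).symm
      _ ≤ s ^ l := Real.rpow_le_rpow_of_exponent_le hs1 (by linarith)
  set c := Real.sqrt m ^ (-(l - 2)) with hc
  have hc0 : 0 ≤ c := by positivity
  obtain ⟨t, rfl⟩ : ∃ t, α = s * t := ⟨α / s, by field_simp⟩
  obtain ⟨u, rfl⟩ : ∃ t, b = s * t := ⟨b / s, by field_simp⟩
  obtain ⟨w, rfl⟩ : ∃ t, r = s * t := ⟨r / s, by field_simp⟩
  have ht : 0 ≤ t := by by_contra! h; nlinarith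
  have hu : 0 ≤ u := by by_contra! h; nlinarith
  have hw : 0 ≤ w := by by_contra! h; nlinarith
  rw [mul_div_cancel_left₀ _ hs0.ne', mul_div_cancel_left₀ _ hs0.ne', mul_div_cancel_left₀ _ hs0.ne',
    hsl]
  rw [Real.mul_rpow hs0.le ht, Real.mul_rpow hs0.le hu, Real.mul_rpow hs0.le hw] at hx
  refine hx.trans ?_
  have k1 := le_rpow_convex ht (by linarith : 1 ≤ l)
  have k2 := le_rpow_convex hu (by linarith : 1 ≤ l)
  have k3 := sq_le_one_add_rpow ht hl
  have k4 := sq_le_one_add_rpow hu hl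
  have e1 : s * t / 5 + s * u / 8
      ≤ s ^ l * (((l - 1) / l + t ^ l / l) / 5 + ((l - 1) / l + u ^ l / l) / 8) := by
    calc s * t / 5 + s * u / 8 = s * (t / 5 + u / 8) := by ring
      _ ≤ _ := by gcongr
  have e2 : (s * t) ^ 2 + (s * u) ^ 2 ≤ s ^ l * ((1 + t ^ l) + (1 + u ^ l)) := by
    calc (s * t) ^ 2 + (s * u) ^ 2 = s ^ 2 * (t ^ 2 + u ^ 2) := by ring
      _ ≤ _ := by gcongr
  calc δ ^ 3 * (L * (s * t / 5 + s * u / 8) + Ll / 24 * (4 * ((s * t) ^ 2 + (s * u) ^ 2)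
        + c * (2 ^ l * (s ^ l * t ^ l + s ^ l * u ^ l + s ^ l * w ^ l))))
      ≤ δ ^ 3 * (L * (s ^ l * (((l - 1) / l + t ^ l / l) / 5 + ((l - 1) / l + u ^ l / l) / 8))
        + Ll / 24 * (4 * (s ^ l * ((1 + t ^ l) + (1 + u ^ l)))
        + c * (2 ^ l * (s ^ l * t ^ l + s ^ l * u ^ l + s ^ l * w ^ l)))) := by gcongr
    _ = _ := by ring

/-- The coefficients of L add up to 13/40 whatever l is, and half of it, 13/80, is below the 1/6
contained in `K₅`. The nonlinear coefficients are compared with `K₆` through 2^l = 4 · 2^(l-2). -/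
lemma sum_affine_le {D δ L Ll l m : ℝ}
    (hD : 1 ≤ D) (hδ : 0 < δ) (hL : 0 < L) (hLl : 0 < Ll) (hl : 2 ≤ l) (hm : 0 < m) :
    δ ^ 3 * D ^ (l / 2) * (L * (13 / 40 * ((l - 1) / l)) + Ll / 3)
      + δ ^ 3 * D ^ (l / 2) * (L * (1 / (5 * l)) + Ll / 24 * (4 + Real.sqrt m ^ (-(l - 2)) * 2 ^ l))
      + δ ^ 3 * D ^ (l / 2) * (L * (1 / (8 * l)) + Ll / 24 * (4 + Real.sqrt m ^ (-(l - 2)) * 2 ^ l))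
      + δ ^ 3 * D ^ (l / 2) * (Ll / 24 * (Real.sqrt m ^ (-(l - 2)) * 2 ^ l))
    ≤ 2 * δ ^ 3 * D ^ (l / 2) * (K₅ m L δ + Ll * K₆ m L l δ) := by
  have h5 := le_K₅ (m := m) hL hδ
  have h6 := le_K₆ hm hL hδ hl
  have hc := sqrt_rpow_neg_le hm (by linarith : 0 ≤ l - 2) (by linarith : l - 2 ≤ l)
  have h2l : (2 : ℝ) ^ l = 4 * 2 ^ (l - 2) := by
    rw [show l = (l - 2) + 2 by ring, Real.rpow_add two_pos, add_sub_cancel_right]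
    norm_num; ring
  set c := Real.sqrt m ^ (-(l - 2)) with hcdef
  set T := (2 : ℝ) ^ (l - 2) with hT
  have hT1 : 1 ≤ T := Real.one_le_rpow one_le_two (by linarith)
  set M := 1 / m ^ (l / 2) with hM
  have hM0 : 0 ≤ M := by positivity
  have hl0 : l ≠ 0 := by linarith
  have e : δ ^ 3 * D ^ (l / 2) * (L * (13 / 40 * ((l - 1) / l)) + Ll / 3)
      + δ ^ 3 * D ^ (l / 2) * (L * (1 / (5 * l)) + Ll / 24 * (4 + c * 2 ^ l))
      + δ ^ 3 * D ^ (l / 2) * (L * (1 / (8 * l)) + Ll / 24 * (4 + c * 2 ^ l))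
      + δ ^ 3 * D ^ (l / 2) * (Ll / 24 * (c * 2 ^ l))
      = 2 * δ ^ 3 * D ^ (l / 2) * (L * (13 / 80) + Ll * ((16 + 12 * (c * T)) / 48)) := by
    rw [h2l]; field_simp; ring
  rw [e]
  have hLm : 0 ≤ L / (4 * Real.sqrt m) := by positivity
  have h7 : (16 + 12 * (c * T)) / 48 ≤ T * (1 + M) := by
    have : c * T ≤ (1 + M) * T := mul_le_mul_of_nonneg_right hc (by linarith)
    have : 0 ≤ M * T := by positivity
    linarith
  gcongr
  · linarith
  · exact h7.trans h6

/-- The L^p norm of an l-th power is a moment of order lp, so the common moment scale of velocity,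
gradient and position in a block is D = k + lp - 2. Normalized by √D, their l-th powers have L^p
norm at most 1. -/
theorem eLpNorm_blockError_le (hP : Blocks U m L Ll l k xs P) (hS : Setting U m L γ δ)
    {φ : Phase d → Phase d} (hφ : ∀ z, ∃ X V, IsTraj U δ z X V ∧ φ z = (X δ, V δ)) (j : J) {p : ℝ}
    (hp : 1 ≤ p) :
    eLpNorm (blockError U L δ P φ j) (ENNReal.ofReal p) (gibbs U)
      ≤ ENNReal.ofReal (2 * δ ^ 3 * (k + l * p - 2) ^ (l / 2) * (K₅ m L δ + Ll * K₆ m L l δ)) := by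
  have hm := hS.m_pos
  have hL := hS.L_pos
  have hδ := hS.δ_pos
  have hl := hP.two_le
  have hLl := hP.Ll_pos
  have hlp : 2 ≤ l * p := by nlinarith
  set D := k + l * p - 2 with hD
  have hD1 : 1 ≤ D := by have := hP.one_le; rw [hD]; linarith
  have hD0 : 0 < D := by linarith
  have hUprob := hS.isConfining.isProbabilityMeasure
  have hprob : IsProbabilityMeasure (gibbs U) := by
    rw [hS.isConfining.gibbs_eq]; exact hS.isConfining.isProbabilityMeasure_phase
  have hsL := Real.sqrt_pos.2 hL
  have hsm := Real.sqrt_pos.2 hm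
  have hfst : MeasurePreserving Prod.fst (gibbs U) (boltzmann U) := by
    rw [hS.isConfining.gibbs_eq]; exact measurePreserving_fst
  have hsnd : MeasurePreserving Prod.snd (gibbs U) (stdGaussian (Pos d)) := by
    rw [hS.isConfining.gibbs_eq]; exact measurePreserving_snd
  have hgc := hS.continuous_gradient
  let t : Pos d → ℝ := fun v => (‖P j v‖ / Real.sqrt D) ^ l
  let s : Pos d → ℝ := fun x => (‖P j (gradient U x)‖ / Real.sqrt L / Real.sqrt D) ^ l
  let u : Pos d → ℝ := fun x => (Real.sqrt m * ‖P j (x - xs)‖ / Real.sqrt D) ^ l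
  have hl0 : 0 ≤ l := by linarith
  have mt : Measurable t := by
    have : Continuous t := Continuous.rpow_const (by fun_prop) fun _ => Or.inr hl0
    exact this.measurable
  have ms : Measurable s := by
    have : Continuous s := Continuous.rpow_const (by fun_prop) fun _ => Or.inr hl0
    exact this.measurable
  have mu : Measurable u := by
    have : Continuous u := Continuous.rpow_const (by fun_prop) fun _ => Or.inr hl0
    exact this.measurable
  have ht1 : eLpNorm (fun z : Phase d => t z.2) (ENNReal.ofReal p) (gibbs U) ≤ 1 := by
    have h := hP.moment_velocity j hlp
    have h1 := eLpNorm_comp_measurePreserving (p := ENNReal.ofReal p) mt.aestronglyMeasurable hsnd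
    rw [Function.comp_def] at h1
    rw [h1]
    exact eLpNorm_rpow_le_one (fun _ => norm_nonneg _) (by linarith) hD0 h.1 h.2
  have hs1 : eLpNorm (fun z : Phase d => s z.1) (ENNReal.ofReal p) (gibbs U) ≤ 1 := by
    have h := hP.moment_gradient_gibbs hS j hlp
    have h1 := eLpNorm_comp_measurePreserving (p := ENNReal.ofReal p) ms.aestronglyMeasurable hfst
    rw [Function.comp_def] at h1
    rw [h1]
    have e : ∀ x, (‖P j (gradient U x)‖ / Real.sqrt L) ^ (l * p)
        = ‖P j (gradient U x)‖ ^ (l * p) / L ^ (l * p / 2) := fun x => by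
      rw [Real.div_rpow (norm_nonneg _) hsL.le, Real.sqrt_eq_rpow, ← Real.rpow_mul hL.le]
      congr 2; ring
    refine eLpNorm_rpow_le_one (fun _ => by positivity) (by linarith) hD0 ?_ ?_
    · simp_rw [e]; exact h.1.div_const _
    · simp_rw [e]
      rw [integral_div, div_le_iff₀ (by positivity), ← Real.mul_rpow hD0.le hL.le, mul_comm D L]
      exact h.2
  have hu1 : eLpNorm (fun z : Phase d => u z.1) (ENNReal.ofReal p) (gibbs U) ≤ 1 := by
    have h := hP.moment_position_gibbs hS j hlp
    have h1 := eLpNorm_comp_measurePreserving (p := ENNReal.ofReal p) mu.aestronglyMeasurable hfst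
    rw [Function.comp_def] at h1
    rw [h1]
    have e : ∀ x, (Real.sqrt m * ‖P j (x - xs)‖) ^ (l * p)
        = m ^ (l * p / 2) * ‖P j (x - xs)‖ ^ (l * p) := fun x => by
      rw [Real.mul_rpow hsm.le (norm_nonneg _), Real.sqrt_eq_rpow, ← Real.rpow_mul hm.le]
      congr 2; ring
    refine eLpNorm_rpow_le_one (fun _ => by positivity) (by linarith) hD0 ?_ ?_
    · simp_rw [e]; exact h.1.const_mul _
    · simp_rw [e]
      rw [integral_const_mul]
      calc m ^ (l * p / 2) * ∫ x, ‖P j (x - xs)‖ ^ (l * p) ∂(boltzmann U)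
          ≤ m ^ (l * p / 2) * (D / m) ^ (l * p / 2) := by gcongr; exact h.2
        _ = D ^ (l * p / 2) := by
          rw [← Real.mul_rpow hm.le (by positivity)]; congr 1; field_simp
  have hl1 : 0 ≤ (l - 1) / l := div_nonneg (by linarith) hl0
  have hl5 : 0 ≤ 1 / (5 * l) := by positivity
  have hl8 : 0 ≤ 1 / (8 * l) := by positivity
  refine (eLpNorm_le_of_le_affine (by simpa using hp) (mt.comp measurable_snd)
    (ms.comp measurable_fst) (mu.comp measurable_fst) ht1 hs1 hu1 ?_ ?_ ?_ ?_ (fun z => ?_)).trans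
    (ENNReal.ofReal_le_ofReal (sum_affine_le (m := m) hD1 hδ hL hLl hl hm))
  · positivity
  · positivity
  · positivity
  · positivity
  · rw [Real.norm_of_nonneg (blockError_nonneg φ j z)]
    obtain ⟨X, V, hX, e⟩ := hφ z
    have h := hP.error_le hS j hX
    unfold blockError
    rw [e]
    exact blockError_le_affine (norm_nonneg _) (by positivity) (by positivity) hD1 hδ hL hLl hl hm h

end Blocks

/-! ### Couplings driven by a common noise -/

lemma IsCoupling.isProbabilityMeasure {X : Type*} [MeasurableSpace X] {c : Measure (X × X)}
    {μ ν : Measure X} [hμ : IsProbabilityMeasure μ] (hc : IsCoupling c μ ν) :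
    IsProbabilityMeasure c := by
  constructor
  have h := congrArg (fun m => m Set.univ) hc.1
  simp only [Measure.map_apply measurable_fst MeasurableSet.univ, Set.preimage_univ,
    measure_univ] at h
  exact h

lemma isCoupling_prod {X : Type*} [MeasurableSpace X] (μ ν : Measure X) [IsProbabilityMeasure μ]
    [IsProbabilityMeasure ν] : IsCoupling (μ.prod ν) μ ν :=
  ⟨by simp [Measure.map_fst_prod], by simp [Measure.map_snd_prod]⟩

/-- Apply two random maps driven by the same noise to the two components of a coupling. -/
def stepCoupling {X Y : Type*} [MeasurableSpace X] [MeasurableSpace Y] (F G : X → Y → X)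
    (ν : Measure Y) (c : Measure (X × X)) : Measure (X × X) :=
  (c.prod ν).map fun q => (F q.1.1 q.2, G q.1.2 q.2)

lemma isCoupling_stepCoupling {X Y : Type*} [MeasurableSpace X] [MeasurableSpace Y]
    {F G : X → Y → X} (hF : Measurable fun q : X × Y => F q.1 q.2)
    (hG : Measurable fun q : X × Y => G q.1 q.2) {n : Measure Y} [IsProbabilityMeasure n]
    {μ μ' ν ν' : Measure X} [IsProbabilityMeasure μ] [IsProbabilityMeasure ν]
    (hFμ : (μ.prod n).map (fun q => F q.1 q.2) = μ') (hGν : (ν.prod n).map (fun q => G q.1 q.2) = ν')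
    {c : Measure (X × X)} (hc : IsCoupling c μ ν) :
    IsCoupling (stepCoupling F G n c) μ' ν' := by
  have := hc.isProbabilityMeasure
  have h1 : MeasurePreserving (Prod.map Prod.fst id) (c.prod n) (μ.prod n) :=
    MeasurePreserving.prod ⟨measurable_fst, hc.1⟩ (MeasurePreserving.id n)
  have h2 : MeasurePreserving (Prod.map Prod.snd id) (c.prod n) (ν.prod n) :=
    MeasurePreserving.prod ⟨measurable_snd, hc.2⟩ (MeasurePreserving.id n)
  have hm : Measurable fun q : (X × X) × Y => (F q.1.1 q.2, G q.1.2 q.2) :=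
    (hF.comp h1.measurable).prodMk (hG.comp h2.measurable)
  constructor
  · rw [stepCoupling, Measure.map_map measurable_fst hm, ← hFμ, ← h1.map_eq,
      Measure.map_map hF h1.measurable]
    rfl
  · rw [stepCoupling, Measure.map_map measurable_snd hm, ← hGν, ← h2.map_eq,
      Measure.map_map hG h2.measurable]
    rfl

namespace Setting

variable {d : ℕ} {U : Pos d → ℝ} {m L γ δ : ℝ}

/-- Distance of two states in the modified norm. -/
def starDist (L γ : ℝ) (q : Phase d × Phase d) : ℝ := starNorm L γ (q.1 - q.2)

lemma continuous_starDist : Continuous (starDist L γ : Phase d × Phase d → ℝ) :=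
  continuous_starNorm.comp (continuous_fst.sub continuous_snd)

lemma starDist_nonneg (q : Phase d × Phase d) : 0 ≤ starDist L γ q := starNorm_nonneg _

/-- One step of the coupling of the chain with a chain with another kernel `Ψ`. -/
lemma eLpNorm_stepCoupling_le (hS : Setting U m L γ δ) {Ψ : Phase d → Phase d → Phase d}
    (hΨ : Measurable fun q : Phase d × Phase d => Ψ q.1 q.2) {μ π : Measure (Phase d)}
    [IsProbabilityMeasure μ] [IsProbabilityMeasure π] {p : ENNReal} (hp : 1 ≤ p)
    {E : Phase d × Phase d → ℝ} (hEm : Measurable E)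
    (hE : ∀ y ξ, starNorm L γ (obaboStep U γ δ y ξ - Ψ y ξ) ≤ E (y, ξ))
    {c : Measure (Phase d × Phase d)} (hc : IsCoupling c μ π) :
    eLpNorm (starDist L γ) p (stepCoupling (obaboStep U γ δ) Ψ (noise d) c)
      ≤ ENNReal.ofReal (1 - δ * κ m γ) * eLpNorm (starDist L γ) p c
        + eLpNorm E p (π.prod (noise d)) := by
  have := hc.isProbabilityMeasure
  have h1 : MeasurePreserving Prod.fst (c.prod (noise d)) c := measurePreserving_fst
  have h2 : MeasurePreserving (Prod.map Prod.snd id) (c.prod (noise d)) (π.prod (noise d)) :=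
    MeasurePreserving.prod ⟨measurable_snd, hc.2⟩ (MeasurePreserving.id _)
  have h3 : Measurable (Prod.map Prod.fst id : (Phase d × Phase d) × Phase d → Phase d × Phase d) := by
    fun_prop
  have hm : Measurable fun q : (Phase d × Phase d) × Phase d =>
      (obaboStep U γ δ q.1.1 q.2, Ψ q.1.2 q.2) :=
    (hS.measurable_obaboStep.comp h3).prodMk (hΨ.comp h2.measurable)
  have hsd := continuous_starDist (d := d) (L := L) (γ := γ)
  have m1 : AEStronglyMeasurable (fun q : (Phase d × Phase d) × Phase d => starDist L γ q.1)
      (c.prod (noise d)) := (hsd.measurable.comp measurable_fst).aestronglyMeasurable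
  have m2 : AEStronglyMeasurable (E ∘ (Prod.map Prod.snd id : (Phase d × Phase d) × Phase d → _))
      (c.prod (noise d)) := (hEm.comp h2.measurable).aestronglyMeasurable
  have e1 : eLpNorm (fun q : (Phase d × Phase d) × Phase d => starDist L γ q.1) p (c.prod (noise d))
      = eLpNorm (starDist L γ) p c :=
    eLpNorm_comp_measurePreserving (p := p) hsd.aestronglyMeasurable h1
  have e2 := eLpNorm_comp_measurePreserving (p := p) hEm.aestronglyMeasurable h2
  have e3 : eLpNorm ((1 - δ * κ m γ) • fun q : (Phase d × Phase d) × Phase d => starDist L γ q.1) p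
      (c.prod (noise d)) = ENNReal.ofReal (1 - δ * κ m γ) * eLpNorm (starDist L γ) p c := by
    rw [eLpNorm_const_smul, Real.enorm_of_nonneg hS.ρ_bounds.1, e1]
  rw [stepCoupling, eLpNorm_map_measure hsd.aestronglyMeasurable hm.aemeasurable, ← e2, ← e3]
  refine le_trans (eLpNorm_mono_real fun q => ?_) (eLpNorm_add_le (m1.const_smul _) m2 hp)
  rw [Function.comp_apply, Real.norm_of_nonneg (starDist_nonneg _)]
  have k1 := hS.starNorm_step_sub_le q.1.1 q.1.2 q.2
  have k2 := hE q.1.2 q.2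
  have k3 := starNorm_add_le (L := L) (γ := γ) (obaboStep U γ δ q.1.1 q.2 - obaboStep U γ δ q.1.2 q.2)
    (obaboStep U γ δ q.1.2 q.2 - Ψ q.1.2 q.2)
  rw [sub_add_sub_cancel] at k3
  exact k3.trans (add_le_add k1 k2)

lemma memLp_starDist {μ π : Measure (Phase d)} {p : ENNReal}
    {c : Measure (Phase d × Phase d)} (hc : IsCoupling c μ π) (hμ : MemLp (starNorm L γ) p μ)
    (hπ : MemLp (starNorm L γ) p π) : MemLp (starDist L γ) p c := by
  have h1 : MeasurePreserving Prod.fst c μ := ⟨measurable_fst, hc.1⟩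
  have h2 : MeasurePreserving Prod.snd c π := ⟨measurable_snd, hc.2⟩
  refine ((hμ.comp_measurePreserving h1).add (hπ.comp_measurePreserving h2)).mono
    continuous_starDist.aestronglyMeasurable (Eventually.of_forall fun q => ?_)
  rw [Real.norm_of_nonneg (starDist_nonneg _)]
  refine le_trans ?_ (le_abs_self _)
  have := starNorm_add_le (L := L) (γ := γ) q.1 (0 - q.2)
  rw [starNorm_sub_comm, sub_zero, zero_sub, ← sub_eq_add_neg] at this
  exact this

/-- A kernel close to the chain, with invariant measure `π`, yields couplings of `μ` and `π`. -/
theorem exists_coupling (hS : Setting U m L γ δ) {Ψ : Phase d → Phase d → Phase d}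
    (hΨ : Measurable fun q : Phase d × Phase d => Ψ q.1 q.2) {μ π : Measure (Phase d)}
    (hμ : IsInvariantProb U γ δ μ) [IsProbabilityMeasure π]
    (hπ : (π.prod (noise d)).map (fun q => Ψ q.1 q.2) = π) {p : ENNReal} (hp : 1 ≤ p)
    (hμp : MemLp (starNorm L γ) p μ) (hπp : MemLp (starNorm L γ) p π)
    {E : Phase d × Phase d → ℝ} (hEm : Measurable E)
    (hE : ∀ y ξ, starNorm L γ (obaboStep U γ δ y ξ - Ψ y ξ) ≤ E (y, ξ)) {e : ℝ} (he : 0 ≤ e)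
    (hEe : eLpNorm E p (π.prod (noise d)) ≤ ENNReal.ofReal e) {ε : ℝ} (hε : 0 < ε) :
    ∃ c, IsCoupling c μ π ∧
      eLpNorm (starDist L γ) p c ≤ ENNReal.ofReal (e / (δ * κ m γ) + ε) := by
  have := hμ.1
  obtain ⟨hρ0, hρ1⟩ := hS.ρ_bounds
  have hδκ : 0 < δ * κ m γ := mul_pos hS.δ_pos hS.κ_pos
  set A := (eLpNorm (starDist L γ) p (μ.prod π)).toReal with hA
  have hA0 : 0 ≤ A := ENNReal.toReal_nonneg
  have hAe : eLpNorm (starDist L γ) p (μ.prod π) = ENNReal.ofReal A :=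
    (ENNReal.ofReal_toReal (memLp_starDist (isCoupling_prod μ π) hμp hπp).2.ne).symm
  -- The product coupling is at finite distance by the moment assumptions, and e/(δκ) is the fixed
  -- point of a ↦ (1 - δκ)a + e.
  have key : ∀ n : ℕ, ∃ c, IsCoupling c μ π ∧ eLpNorm (starDist L γ) p c
      ≤ ENNReal.ofReal ((1 - δ * κ m γ) ^ n * A + e / (δ * κ m γ)) := by
    intro n
    induction n with
    | zero =>
      refine ⟨μ.prod π, isCoupling_prod μ π, ?_⟩
      rw [hAe, pow_zero, one_mul]
      exact ENNReal.ofReal_le_ofReal (le_add_of_nonneg_right (by positivity))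
    | succ n ih =>
      obtain ⟨c, hc, hcn⟩ := ih
      refine ⟨_, isCoupling_stepCoupling hS.measurable_obaboStep hΨ hμ.2 hπ hc, ?_⟩
      refine (hS.eLpNorm_stepCoupling_le hΨ hp hEm hE hc).trans ?_
      calc ENNReal.ofReal (1 - δ * κ m γ) * eLpNorm (starDist L γ) p c
            + eLpNorm E p (π.prod (noise d))
          ≤ ENNReal.ofReal (1 - δ * κ m γ)
              * ENNReal.ofReal ((1 - δ * κ m γ) ^ n * A + e / (δ * κ m γ)) + ENNReal.ofReal e := by
            gcongr
        _ = _ := by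
            rw [← ENNReal.ofReal_mul hρ0, ← ENNReal.ofReal_add (by positivity) he]
            congr 1
            have hr : e / (δ * κ m γ) * (δ * κ m γ) = e := div_mul_cancel₀ _ hδκ.ne'
            rw [pow_succ]
            linear_combination (-1 : ℝ) * hr
  have hlim : Tendsto (fun n : ℕ => (1 - δ * κ m γ) ^ n * A) atTop (𝓝 0) := by
    have h := (tendsto_pow_atTop_nhds_zero_of_lt_one hρ0 hρ1).mul_const A
    rwa [zero_mul] at h
  obtain ⟨n, hn⟩ := (hlim.eventually (gt_mem_nhds hε)).exists
  obtain ⟨c, hc, hcn⟩ := key n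
  exact ⟨c, hc, hcn.trans (ENNReal.ofReal_le_ofReal (by linarith))⟩

lemma _root_.OBABO.phaseDist_nonneg (z w : Phase d) : 0 ≤ phaseDist z w := Real.sqrt_nonneg _

lemma phaseDist_le_starDist (hS : Setting U m L γ δ) (q : Phase d × Phase d) :
    phaseDist q.1 q.2 ≤ Real.sqrt 2 * max 1 (Real.sqrt L) * starDist L γ q := by
  have hL := hS.L_pos
  have h := (starNorm_sq_bounds hL hS.γ_ge (q.1 - q.2)).1
  have h0 := starNorm_nonneg (L := L) (γ := γ) (q.1 - q.2)
  set Q := max 1 (Real.sqrt L) with hQ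
  have hQ1 : 1 ≤ Q := le_max_left _ _
  have hQ2 : L ≤ Q ^ 2 := by
    calc L = Real.sqrt L ^ 2 := (Real.sq_sqrt hL.le).symm
      _ ≤ Q ^ 2 := by gcongr; exact le_max_right _ _
  have hQ3 : 1 ≤ Q ^ 2 := one_le_pow₀ hQ1
  unfold phaseDist starDist
  refine Real.sqrt_le_iff.2 ⟨by positivity, ?_⟩
  rw [mul_pow, mul_pow, Real.sq_sqrt (by norm_num)]
  have h1 : ‖(q.1 - q.2).1‖ ^ 2 ≤ Q ^ 2 * ‖(q.1 - q.2).1‖ ^ 2 := le_mul_of_one_le_left (sq_nonneg _) hQ3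
  have h2 : ‖(q.1 - q.2).2‖ ^ 2 ≤ Q ^ 2 * (‖(q.1 - q.2).2‖ ^ 2 / L) := by
    calc ‖(q.1 - q.2).2‖ ^ 2 = L * (‖(q.1 - q.2).2‖ ^ 2 / L) := by field_simp
      _ ≤ _ := by gcongr
  have h3 := mul_le_mul_of_nonneg_left h (sq_nonneg Q)
  change ‖(q.1 - q.2).1‖ ^ 2 + ‖(q.1 - q.2).2‖ ^ 2 ≤ _
  linarith

/-- The slack ε is needed because the coupling recursion reaches the bound only in the limit. It
disappears in the infimum. -/
lemma wasserstein_le_of_coupling (hS : Setting U m L γ δ) {μ π : Measure (Phase d)} {p : ℝ}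
    (hp : 1 ≤ p) {a : ℝ} (h : ∀ ε > 0, ∃ c, IsCoupling c μ π ∧
      eLpNorm (starDist L γ) (ENNReal.ofReal p) c ≤ ENNReal.ofReal (a + ε)) :
    wasserstein p μ π ≤ ENNReal.ofReal (Real.sqrt 2 * max 1 (Real.sqrt L) * a) := by
  set Q := Real.sqrt 2 * max 1 (Real.sqrt L) with hQ
  have hQ0 : 0 ≤ Q := by positivity
  have key : ∀ ε > 0, wasserstein p μ π ≤ ENNReal.ofReal (Q * (a + ε)) := by
    intro ε hε
    obtain ⟨c, hc, hce⟩ := h ε hε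
    refine (iInf₂_le c hc).trans ?_
    have e1 : (∫⁻ q, ENNReal.ofReal (phaseDist q.1 q.2) ^ p ∂c) ^ (1 / p)
        = eLpNorm (fun q : Phase d × Phase d => phaseDist q.1 q.2) (ENNReal.ofReal p) c := by
      rw [eLpNorm_eq_lintegral_rpow_enorm_toReal (by simpa using by linarith) (by simp),
        ENNReal.toReal_ofReal (by linarith)]
      congr 1
      refine lintegral_congr fun q => ?_
      rw [Real.enorm_of_nonneg (phaseDist_nonneg _ _)]
    rw [e1]
    calc eLpNorm (fun q : Phase d × Phase d => phaseDist q.1 q.2) (ENNReal.ofReal p) c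
        ≤ eLpNorm (Q • starDist L γ) (ENNReal.ofReal p) c := by
          refine eLpNorm_mono_real fun q => ?_
          rw [Real.norm_of_nonneg (phaseDist_nonneg _ _)]
          exact hS.phaseDist_le_starDist q
      _ = ENNReal.ofReal Q * eLpNorm (starDist L γ) (ENNReal.ofReal p) c := by
          rw [eLpNorm_const_smul, Real.enorm_of_nonneg hQ0]
      _ ≤ ENNReal.ofReal Q * ENNReal.ofReal (a + ε) := by gcongr
      _ = _ := by rw [← ENNReal.ofReal_mul hQ0]
  have hlim : Tendsto (fun ε : ℝ => ENNReal.ofReal (Q * (a + ε))) (𝓝[>] 0)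
      (𝓝 (ENNReal.ofReal (Q * a))) := by
    have h1 : Continuous fun ε : ℝ => ENNReal.ofReal (Q * (a + ε)) :=
      ENNReal.continuous_ofReal.comp (by fun_prop)
    have h2 := (h1.tendsto 0).mono_left (nhdsWithin_le_nhds (s := Set.Ioi 0))
    rwa [add_zero] at h2
  exact ge_of_tendsto hlim (eventually_nhdsWithin_of_forall key)

lemma memLp_starNorm_phase (hS : Setting U m L γ δ) {W : Pos d → ℝ} (hW : IsConfining W)
    {p : ℝ} (hp : 1 ≤ p) : MemLp (starNorm L γ) (ENNReal.ofReal p) (phaseMeasure W) := by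
  have hWp := hW.isProbabilityMeasure
  have hp0 : 0 ≤ p := by linarith
  have h1 : MemLp (fun x : Pos d => ‖x‖) (ENNReal.ofReal p) (boltzmann W) := by
    have hm : AEStronglyMeasurable (fun x : Pos d => ‖x‖) (boltzmann W) :=
      continuous_norm.aestronglyMeasurable
    rw [← integrable_norm_rpow_iff hm (by simpa using by linarith) (by simp),
      ENNReal.toReal_ofReal hp0]
    simp only [norm_norm]
    refine hW.integrable_boltzmann (C := (0 + 1) ^ p) (r := p) ?_
      (rpow_growth (G := id) le_rfl zero_le_one hp0 fun x => by simp)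
    have : Continuous fun x : Pos d => ‖x‖ ^ p :=
      Continuous.rpow_const (by fun_prop) fun _ => Or.inr hp0
    exact this.aestronglyMeasurable
  have h2 : MemLp (fun x : Pos d => ‖x‖) (ENNReal.ofReal p) (stdGaussian (Pos d)) :=
    (IsGaussian.memLp_id (stdGaussian (Pos d)) _ (by simp)).norm
  have hfst : MeasurePreserving Prod.fst (phaseMeasure W) (boltzmann W) := measurePreserving_fst
  have hsnd : MeasurePreserving Prod.snd (phaseMeasure W) (stdGaussian (Pos d)) :=
    measurePreserving_snd
  refine (((h1.comp_measurePreserving hfst).add (h2.comp_measurePreserving hsnd)).const_mul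
    (Real.sqrt (3 / 2 * (1 + 1 / L)))).mono continuous_starNorm.aestronglyMeasurable
    (Eventually.of_forall fun z => ?_)
  rw [Real.norm_of_nonneg (starNorm_nonneg _)]
  refine le_trans ?_ (le_abs_self _)
  refine (hS.starNorm_le_norm z).trans ?_
  gcongr
  exact max_le (le_add_of_nonneg_right (norm_nonneg _)) (le_add_of_nonneg_left (norm_nonneg _))

end Setting

namespace Blocks

variable {d : ℕ} {J : Type*} [Fintype J] {U : Pos d → ℝ} {m L Ll l k γ δ : ℝ} {xs : Pos d}
  {P : J → Pos d →L[ℝ] Pos d}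

/-- With common noises the two kernels differ by the Verlet error at the refreshed state, and the
second refreshment only multiplies its velocity part by η ≤ 1. The refreshed state is again Gibbs
distributed when y is. -/
lemma starNorm_sandwich_sub_le (hP : Blocks U m L Ll l k xs P) (hS : Setting U m L γ δ)
    (φ : Phase d → Phase d) (y ξ : Phase d) :
    starNorm L γ (obaboStep U γ δ y ξ - sandwich (damping γ δ) φ y ξ)
      ≤ Real.sqrt (3 / 2) * (max 1 (Real.sqrt L) / Real.sqrt L)
        * Real.sqrt (∑ j, blockError U L δ P φ j (refresh (damping γ δ) y ξ.1) ^ 2) := by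
  have hL := hS.L_pos
  have hsL := Real.sqrt_pos.2 hL
  set w := refresh (damping γ δ) y ξ.1 with hw
  set Q := max 1 (Real.sqrt L) with hQ
  have hQ0 : 0 < Q := lt_of_lt_of_le one_pos (le_max_left _ _)
  have hQL : 1 ≤ Q / Real.sqrt L := (one_le_div hsL).2 (le_max_right _ _)
  set xe := (verlet U δ w).1 - (φ w).1 with hxe
  set ve := (verlet U δ w).2 - (φ w).2 with hve
  rw [obaboStep_eq_sandwich]
  have e : sandwich (damping γ δ) (verlet U δ) y ξ - sandwich (damping γ δ) φ y ξ
      = (xe, damping γ δ • ve) := by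
    refine Prod.ext rfl ?_
    change damping γ δ • (verlet U δ w).2 + Real.sqrt (1 - damping γ δ ^ 2) • ξ.2
      - (damping γ δ • (φ w).2 + Real.sqrt (1 - damping γ δ ^ 2) • ξ.2) = damping γ δ • ve
    rw [add_sub_add_right_eq_sub, ← smul_sub]
  rw [e]
  have h := (starNorm_sq_bounds hL hS.γ_ge (xe, damping γ δ • ve)).2
  have h0 := starNorm_nonneg (L := L) (γ := γ) (xe, damping γ δ • ve)
  have hη := hS.damping_sq_le
  have hηv : ‖damping γ δ • ve‖ ^ 2 ≤ ‖ve‖ ^ 2 := by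
    rw [norm_smul, mul_pow, Real.norm_eq_abs, sq_abs]
    exact mul_le_of_le_one_left (sq_nonneg _) hη
  have hsum : ‖xe‖ ^ 2 + ‖ve‖ ^ 2 / L
      ≤ (Q / Real.sqrt L) ^ 2 * ∑ j, blockError U L δ P φ j w ^ 2 := by
    rw [← hP.sum_sq xe, ← hP.sum_sq ve, Finset.sum_div, ← Finset.sum_add_distrib, Finset.mul_sum]
    refine Finset.sum_le_sum fun j _ => ?_
    have e2 : ‖P j ve‖ ^ 2 / L = (Q / Real.sqrt L) ^ 2 * (‖P j ve‖ / Q) ^ 2 := by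
      rw [div_pow, div_pow, Real.sq_sqrt hL.le]; field_simp
    have e3 : ‖P j xe‖ ^ 2 ≤ (Q / Real.sqrt L) ^ 2 * ‖P j xe‖ ^ 2 :=
      le_mul_of_one_le_left (sq_nonneg _) (one_le_pow₀ hQL)
    have e4 : ‖P j xe‖ ^ 2 + (‖P j ve‖ / Q) ^ 2 ≤ blockError U L δ P φ j w ^ 2 := by
      have h1 : 0 ≤ ‖P j xe‖ := norm_nonneg _
      have h2 : 0 ≤ ‖P j ve‖ / Q := by positivity
      have : blockError U L δ P φ j w = ‖P j xe‖ + ‖P j ve‖ / Q := rfl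
      rw [this]
      nlinarith [mul_nonneg h1 h2]
    calc ‖P j xe‖ ^ 2 + ‖P j ve‖ ^ 2 / L
        ≤ (Q / Real.sqrt L) ^ 2 * (‖P j xe‖ ^ 2 + (‖P j ve‖ / Q) ^ 2) := by rw [e2]; linarith
      _ ≤ _ := by gcongr
  have hS0 : 0 ≤ ∑ j, blockError U L δ P φ j w ^ 2 := Finset.sum_nonneg fun _ _ => sq_nonneg _
  refine le_of_sq_le_sq ?_ (by positivity)
  rw [mul_pow, mul_pow, Real.sq_sqrt (by norm_num), Real.sq_sqrt hS0]
  refine h.trans ?_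
  have : ‖damping γ δ • ve‖ ^ 2 / L ≤ ‖ve‖ ^ 2 / L := by gcongr
  simp only
  rw [mul_assoc]
  gcongr
  linarith

/-- Couplings of the invariant measure of the chain and the target. -/
theorem exists_coupling (hP : Blocks U m L Ll l k xs P) (hS : Setting U m L γ δ)
    {μ : Measure (Phase d)} (hμ : IsInvariantProb U γ δ μ)
    (hμm : ∀ p : ENNReal, 1 ≤ p → p ≠ ⊤ → MemLp (starNorm L γ) p μ) {p c : ℝ}
    (hc : IsCombConst (Fintype.card J) p c) {ε : ℝ} (hε : 0 < ε) :
    ∃ cp, IsCoupling cp μ (gibbs U) ∧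
      eLpNorm (Setting.starDist L γ) (ENNReal.ofReal p) cp ≤ ENNReal.ofReal
        (Real.sqrt (3 / 2) * (max 1 (Real.sqrt L) / Real.sqrt L) * (c * (2 * δ ^ 3
          * (k + l * p - 2) ^ (l / 2) * (K₅ m L δ + Ll * K₆ m L l δ))) / (δ * κ m γ) + ε) := by
  have hp := hc.one_le
  have hL := hS.L_pos
  have hδ := hS.δ_pos
  have hl := hP.two_le
  have hLl := hP.Ll_pos
  obtain ⟨φ, hφ, hφt⟩ := hS.exists_flow
  have hUprob := hS.isConfining.isProbabilityMeasure
  have hprob : IsProbabilityMeasure (gibbs U) := by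
    rw [hS.isConfining.gibbs_eq]; exact hS.isConfining.isProbabilityMeasure_phase
  have hD0 : 0 ≤ k + l * p - 2 := by have := hP.one_le; nlinarith
  set B := 2 * δ ^ 3 * (k + l * p - 2) ^ (l / 2) * (K₅ m L δ + Ll * K₆ m L l δ) with hB
  have h5 := le_K₅ (m := m) hL hδ
  have h6 := le_K₆ hS.m_pos hL hδ hl
  have hK5 : 0 ≤ K₅ m L δ := le_trans (by positivity) h5
  have hK6 : 0 ≤ K₆ m L l δ := by
    refine le_trans ?_ h6
    have := hS.m_pos
    positivity
  have hB0 : 0 ≤ B := by positivity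
  have hc0 := hc.nonneg
  set A := Real.sqrt (3 / 2) * (max 1 (Real.sqrt L) / Real.sqrt L) with hA
  have hA0 : 0 ≤ A := by positivity
  let E : Phase d → ℝ := fun w => Real.sqrt (∑ j, blockError U L δ P φ j w ^ 2)
  have hbm := fun j => measurable_blockError (P := P) hS hφ.measurable j
  have hEm : Measurable E := by
    refine Measurable.sqrt (Finset.measurable_sum _ fun j _ => ?_)
    exact (hbm j).pow_const 2
  have hEle : eLpNorm E (ENNReal.ofReal p) (gibbs U) ≤ ENNReal.ofReal (c * B) :=
    eLpNorm_sqrt_sum_sq_le hc hbm (fun j z => blockError_nonneg φ j z) hB0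
      fun j => hP.eLpNorm_blockError_le hS hφt j hp
  have hR : MeasurePreserving (fun q : Phase d × Phase d => refresh (damping γ δ) q.1 q.2.1)
      ((gibbs U).prod (noise d)) (gibbs U) := by
    have h1 : MeasurePreserving (Prod.map id Prod.fst) ((gibbs U).prod (noise d))
        ((gibbs U).prod (stdGaussian (Pos d))) :=
      (MeasurePreserving.id _).prod measurePreserving_fst
    have h2 := measurePreserving_refresh (boltzmann U) hS.damping_sq_le
    rw [hS.isConfining.gibbs_eq] at h1 ⊢
    exact h2.comp h1
  have hΨ : MeasurePreserving (fun q : Phase d × Phase d => sandwich (damping γ δ) φ q.1 q.2)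
      ((gibbs U).prod (noise d)) (gibbs U) := by
    have h1 := hφ
    rw [hS.isConfining.gibbs_eq] at h1 ⊢
    exact measurePreserving_sandwich (boltzmann U) hS.damping_sq_le h1
  refine hS.exists_coupling (e := A * (c * B)) hΨ.measurable hμ hΨ.map_eq (by simpa using hp)
    (hμm _ (by simpa using hp) (by simp)) ?_
    (E := fun q => A * E (refresh (damping γ δ) q.1 q.2.1)) ((hEm.comp hR.measurable).const_mul A)
    (fun y ξ => hP.starNorm_sandwich_sub_le hS φ y ξ) (by positivity) ?_ hε
  · rw [hS.isConfining.gibbs_eq]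
    exact hS.memLp_starNorm_phase hS.isConfining hp
  · have e1 := eLpNorm_comp_measurePreserving (p := ENNReal.ofReal p) hEm.aestronglyMeasurable hR
    have e2 : eLpNorm (A • (E ∘ fun q : Phase d × Phase d => refresh (damping γ δ) q.1 q.2.1))
        (ENNReal.ofReal p) ((gibbs U).prod (noise d))
        = ENNReal.ofReal A * eLpNorm E (ENNReal.ofReal p) (gibbs U) := by
      rw [eLpNorm_const_smul, Real.enorm_of_nonneg hA0, e1]
    refine (le_of_eq e2).trans ?_
    rw [ENNReal.ofReal_mul hA0]
    gcongr

/-- In this form K₁ is the product of the two comparison constants √2 max(1, √L) (modified to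
Euclidean distance) and √(3/2) max(1, √L)/√L (block errors to modified norm). -/
lemma K₁_eq (hL : 0 < L) : K₁ L = Real.sqrt 3 * (max 1 (Real.sqrt L) ^ 2 / Real.sqrt L) := by
  have hs := Real.sqrt_pos.2 hL
  unfold K₁
  rw [← Real.sqrt_eq_rpow, Real.rpow_neg hL.le, ← Real.sqrt_eq_rpow]
  congr 1
  rcases le_total 1 (Real.sqrt L) with h | h
  · rw [max_eq_right h, max_eq_left ((inv_le_one_of_one_le₀ h).trans h)]
    field_simp
  · rw [max_eq_left h, max_eq_right (h.trans ((one_le_inv₀ hs).2 h))]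
    simp

/-- Dividing the local error of order δ³ by the contraction rate δκ leaves δ²/κ, and the two norm
comparisons multiply to K₁. -/
theorem wasserstein_le (hP : Blocks U m L Ll l k xs P) (hS : Setting U m L γ δ)
    {μ : Measure (Phase d)} (hμ : IsInvariantProb U γ δ μ)
    (hμm : ∀ p : ENNReal, 1 ≤ p → p ≠ ⊤ → MemLp (starNorm L γ) p μ) {p c : ℝ}
    (hc : IsCombConst (Fintype.card J) p c) :
    wasserstein p μ (gibbs U) ≤ ENNReal.ofReal
      (δ ^ 2 * c * (k + l * p - 2) ^ (l / 2) * constW m L γ l Ll δ) := by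
  have hp := hc.one_le
  have hL := hS.L_pos
  have hδ := hS.δ_pos
  have hκ := hS.κ_pos
  refine (hS.wasserstein_le_of_coupling hp
    fun ε hε => hP.exists_coupling hS hμ hμm hc hε).trans (le_of_eq ?_)
  congr 1
  unfold constW
  rw [K₁_eq hL]
  have e : Real.sqrt 3 = Real.sqrt 2 * Real.sqrt (3 / 2) := by
    rw [← Real.sqrt_mul (by norm_num)]; norm_num
  have hs := Real.sqrt_pos.2 hL
  rw [e]
  field_simp

end Blocks

/-! ### Total variation estimates -/

/-- `μ` exceeds `ν` by at most `ε` on test functions with values in `[0, 1]`. -/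
def TVLe {X : Type*} [MeasurableSpace X] (μ ν : Measure X) (ε : ℝ) : Prop :=
  ∀ f : X → ENNReal, Measurable f → (∀ x, f x ≤ 1) → ∫⁻ x, f x ∂μ ≤ ∫⁻ x, f x ∂ν + ENNReal.ofReal ε

namespace TVLe

variable {X Y : Type*} [MeasurableSpace X] [MeasurableSpace Y] {μ ν ρ : Measure X} {a b : ℝ}

lemma of_one_le [IsProbabilityMeasure μ] (ha : 1 ≤ a) : TVLe μ ν a := fun f _ hf => by
  calc ∫⁻ x, f x ∂μ ≤ ∫⁻ _, 1 ∂μ := lintegral_mono hf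
    _ = ENNReal.ofReal 1 := by simp
    _ ≤ ENNReal.ofReal a := ENNReal.ofReal_le_ofReal ha
    _ ≤ _ := le_add_self

lemma mono (h : TVLe μ ν a) (hab : a ≤ b) : TVLe μ ν b := fun f hf hf1 =>
  (h f hf hf1).trans (by gcongr)

lemma trans (h : TVLe μ ν a) (h' : TVLe ν ρ b) (ha : 0 ≤ a) (hb : 0 ≤ b) : TVLe μ ρ (a + b) := by
  intro f hf hf1
  rw [ENNReal.ofReal_add ha hb, add_comm (ENNReal.ofReal a), ← add_assoc]
  exact (h f hf hf1).trans (by gcongr; exact h' f hf hf1)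

lemma symm [IsProbabilityMeasure μ] [IsProbabilityMeasure ν] (h : TVLe μ ν a) : TVLe ν μ a := by
  intro f hf hf1
  have key : ∀ τ : Measure X, IsProbabilityMeasure τ → ∫⁻ x, f x ∂τ + ∫⁻ x, (1 - f x) ∂τ = 1 := by
    intro τ _
    rw [← lintegral_add_left hf]
    have : ∀ x, f x + (1 - f x) = 1 := fun x => add_tsub_cancel_of_le (hf1 x)
    simp [this]
  have h1 := h (fun x => 1 - f x) (measurable_const.sub hf) (fun x => tsub_le_self)
  have hμ := key μ inferInstance
  have hν := key ν inferInstance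
  have hfin : ∫⁻ x, (1 - f x) ∂μ ≠ ⊤ := by
    intro h; rw [h] at hμ; simp at hμ
  refine (ENNReal.add_le_add_iff_right hfin).1 ?_
  calc ∫⁻ x, f x ∂ν + ∫⁻ x, (1 - f x) ∂μ
      ≤ ∫⁻ x, f x ∂ν + (∫⁻ x, (1 - f x) ∂ν + ENNReal.ofReal a) := by gcongr
    _ = 1 + ENNReal.ofReal a := by rw [← add_assoc, hν]
    _ = (∫⁻ x, f x ∂μ + ∫⁻ x, (1 - f x) ∂μ) + ENNReal.ofReal a := by rw [hμ]
    _ = ∫⁻ x, f x ∂μ + ENNReal.ofReal a + ∫⁻ x, (1 - f x) ∂μ := add_right_comm _ _ _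

/-- A random map does not increase the total variation. -/
lemma map_prod (h : TVLe μ ν a) [SFinite μ] [SFinite ν] {n : Measure Y} [IsProbabilityMeasure n]
    {Z : Type*} [MeasurableSpace Z] {F : X → Y → Z} (hF : Measurable fun q : X × Y => F q.1 q.2) :
    TVLe ((μ.prod n).map fun q => F q.1 q.2) ((ν.prod n).map fun q => F q.1 q.2) a := by
  intro f hf hf1
  have hfF : Measurable fun q : X × Y => f (F q.1 q.2) := hf.comp hF
  rw [lintegral_map hf hF, lintegral_map hf hF, lintegral_prod _ hfF.aemeasurable,
    lintegral_prod _ hfF.aemeasurable]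
  refine h _ hfF.lintegral_prod_right' fun x => ?_
  calc ∫⁻ y, f (F x y) ∂n ≤ ∫⁻ _, 1 ∂n := lintegral_mono fun y => hf1 _
    _ = 1 := by simp

/-- Maximal coupling. -/
theorem tvNorm_le [MeasurableEq X] [IsProbabilityMeasure μ] [IsProbabilityMeasure ν]
    (h : TVLe μ ν a) : tvNorm μ ν ≤ ENNReal.ofReal (2 * a) := by
  set σ := μ + ν with hσ
  have hμσ : μ ≪ σ := Measure.absolutelyContinuous_of_le (Measure.le_add_right le_rfl)
  have hνσ : ν ≪ σ := Measure.absolutelyContinuous_of_le (Measure.le_add_left le_rfl)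
  set f := μ.rnDeriv σ with hf
  set g := ν.rnDeriv σ with hg
  have hfm : Measurable f := Measure.measurable_rnDeriv _ _
  have hgm : Measurable g := Measure.measurable_rnDeriv _ _
  have hμf : σ.withDensity f = μ := Measure.withDensity_rnDeriv_eq μ σ hμσ
  have hνg : σ.withDensity g = ν := Measure.withDensity_rnDeriv_eq ν σ hνσ
  have hmin : Measurable (fun x => min (f x) (g x)) := hfm.min hgm
  -- The minimum of the two densities is placed on the diagonal. The excesses ρ₁ and ρ₂ have equal
  -- mass r and are coupled independently.
  set lam := σ.withDensity (fun x => min (f x) (g x)) with hlam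
  set ρ₁ := σ.withDensity (fun x => f x - g x) with hρ₁
  set ρ₂ := σ.withDensity (fun x => g x - f x) with hρ₂
  have e1 : lam + ρ₁ = μ := by
    rw [hlam, hρ₁, ← withDensity_add_left hmin, ← hμf]
    congr 1; ext x
    change min (f x) (g x) + (f x - g x) = f x
    rcases le_total (f x) (g x) with h | h
    · rw [min_eq_left h, tsub_eq_zero_of_le h, add_zero]
    · rw [min_eq_right h, add_tsub_cancel_of_le h]
  have e2 : lam + ρ₂ = ν := by
    rw [hlam, hρ₂, ← withDensity_add_left hmin, ← hνg]
    congr 1; ext x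
    change min (f x) (g x) + (g x - f x) = g x
    rcases le_total (f x) (g x) with h | h
    · rw [min_eq_left h, add_tsub_cancel_of_le h]
    · rw [min_eq_right h, tsub_eq_zero_of_le h, add_zero]
  have fl : IsFiniteMeasure lam := isFiniteMeasure_of_le μ (e1 ▸ Measure.le_add_right le_rfl)
  have f1 : IsFiniteMeasure ρ₁ := isFiniteMeasure_of_le μ (e1 ▸ Measure.le_add_left le_rfl)
  have f2 : IsFiniteMeasure ρ₂ := isFiniteMeasure_of_le ν (e2 ▸ Measure.le_add_left le_rfl)
  set r := ρ₁ Set.univ with hr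
  have hr2 : ρ₂ Set.univ = r := by
    have h1 : lam Set.univ + ρ₁ Set.univ = 1 := by rw [← Measure.add_apply, e1, measure_univ]
    have h2 : lam Set.univ + ρ₂ Set.univ = 1 := by rw [← Measure.add_apply, e2, measure_univ]
    rw [← h1] at h2
    exact (ENNReal.add_right_inj (measure_ne_top lam _)).1 h2
  have hrt : r ≠ ⊤ := measure_ne_top ρ₁ _
  have hra : r ≤ ENNReal.ofReal a := by
    set A := {x | g x < f x} with hA
    have hAm : MeasurableSet A := measurableSet_lt hgm hfm
    have h0 : ρ₁ Aᶜ = 0 := by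
      rw [hρ₁, withDensity_apply _ hAm.compl]
      refine (setLIntegral_congr_fun (g := fun _ => 0) hAm.compl fun x hx => ?_).trans (by simp)
      exact tsub_eq_zero_of_le (not_lt.1 hx)
    have h1 : r = ρ₁ A := by rw [hr, ← measure_add_measure_compl hAm, h0, add_zero]
    have h2 : lam A = ν A := by
      rw [hlam, withDensity_apply _ hAm, ← hνg, withDensity_apply _ hAm]
      exact setLIntegral_congr_fun hAm fun x hx => min_eq_right (le_of_lt hx)
    have h3 := h (A.indicator 1) (measurable_one.indicator hAm)
      fun x => Set.indicator_le_self' (by simp) x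
    have h4 : μ A = ν A + r := by
      rw [← h2, h1, ← Measure.add_apply]
      exact congrArg (fun τ : Measure X => τ A) e1.symm
    rw [lintegral_indicator_one hAm, lintegral_indicator_one hAm, h4] at h3
    exact (ENNReal.add_le_add_iff_left (measure_ne_top ν A)).1 h3
  have hdiag : Measurable fun x : X => (x, x) := measurable_id.prodMk measurable_id
  -- If r = 0 then r⁻¹ is infinite, but the measures to be rescaled vanish.
  have hscale : ∀ τ : Measure X, τ Set.univ = r → r⁻¹ • r • τ = τ := by
    intro τ hτ
    by_cases h0 : r = 0
    · rw [h0] at hτ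
      rw [Measure.measure_univ_eq_zero.1 hτ]; simp
    · rw [smul_smul, ENNReal.inv_mul_cancel h0 hrt, one_smul]
  have hc : IsCoupling (lam.map (fun x => (x, x)) + r⁻¹ • ρ₁.prod ρ₂) μ ν := by
    constructor
    · rw [Measure.map_add _ _ measurable_fst, Measure.map_map measurable_fst hdiag, Measure.map_smul,
        Measure.map_fst_prod, hr2, hscale ρ₁ rfl]
      change lam.map id + _ = _
      rw [Measure.map_id, e1]
    · rw [Measure.map_add _ _ measurable_snd, Measure.map_map measurable_snd hdiag, Measure.map_smul,
        Measure.map_snd_prod, ← hr, hscale ρ₂ hr2]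
      change lam.map id + _ = _
      rw [Measure.map_id, e2]
  unfold tvNorm
  refine (iInf₂_le (f := fun (c : Measure (X × X)) (_ : IsCoupling c μ ν) => 2 * c {q | q.1 ≠ q.2})
    _ hc).trans ?_
  · have hne : MeasurableSet {q : X × X | q.1 ≠ q.2} :=
      (measurableSet_eq_fun measurable_fst measurable_snd).compl
    rw [Measure.add_apply, Measure.map_apply hdiag hne, Measure.smul_apply, smul_eq_mul]
    have h1 : (fun x : X => (x, x)) ⁻¹' {q : X × X | q.1 ≠ q.2} = ∅ := by ext x; simp
    rw [h1, measure_empty, zero_add, ENNReal.ofReal_mul (by norm_num)]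
    have h2 : r⁻¹ * (ρ₁.prod ρ₂) {q : X × X | q.1 ≠ q.2} ≤ r := by
      calc r⁻¹ * (ρ₁.prod ρ₂) {q : X × X | q.1 ≠ q.2} ≤ r⁻¹ * (ρ₁.prod ρ₂) Set.univ := by
            gcongr; exact Set.subset_univ _
        _ = r⁻¹ * (r * r) := by
            rw [← Set.univ_prod_univ, Measure.prod_prod, hr2]
        _ ≤ r := by
            rw [← mul_assoc]
            exact mul_le_of_le_one_left' (ENNReal.inv_mul_le_one r)
    rw [ENNReal.ofReal_ofNat]
    gcongr
    exact h2.trans hra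

end TVLe

/-- From 1 - t ≤ exp(-t). Since `ENNReal.ofReal` truncates negative values, only the positive part
of the energy increase matters, and no bound on its exponential is required. -/
lemma exp_neg_div_le (a b : ℝ) {Z : ℝ} (hZ : 0 ≤ Z) :
    ENNReal.ofReal (Real.exp (-a) / Z) ≤ ENNReal.ofReal (Real.exp (-b) / Z)
      + ENNReal.ofReal (Real.exp (-a) / Z) * ENNReal.ofReal (b - a) := by
  rw [← ENNReal.ofReal_mul (by positivity)]
  rcases le_total b a with h | h
  · refine le_trans (ENNReal.ofReal_le_ofReal ?_) le_self_add
    gcongr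
  · rw [← ENNReal.ofReal_add (by positivity) (mul_nonneg (by positivity) (by linarith))]
    apply ENNReal.ofReal_le_ofReal
    have h1 := Real.add_one_le_exp (-(b - a))
    have h2 : Real.exp (-b) = Real.exp (-a) * Real.exp (-(b - a)) := by
      rw [← Real.exp_add]; congr 1; ring
    have h3 : Real.exp (-a) ≤ Real.exp (-b) + Real.exp (-a) * (b - a) := by
      rw [h2]; nlinarith [Real.exp_pos (-a)]
    calc Real.exp (-a) / Z ≤ (Real.exp (-b) + Real.exp (-a) * (b - a)) / Z := by gcongr
      _ = _ := by ring

/-- Perturbation of a Boltzmann measure by a volume-preserving map. -/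
theorem tvLe_map_tilted {X : Type*} [MeasurableSpace X] {vol : Measure X} {H : X → ℝ}
    (hH : Measurable H) {Φ : X → X} (hΦ : MeasurePreserving Φ vol vol) {ε : ℝ}
    (h : ∫⁻ z, ENNReal.ofReal (H (Φ z) - H z) ∂(vol.tilted fun z => -H z) ≤ ENNReal.ofReal ε) :
    TVLe ((vol.tilted fun z => -H z).map Φ) (vol.tilted fun z => -H z) ε := by
  intro f hf hf1
  set Z := ∫ x, Real.exp (-H x) ∂vol with hZ
  have hZ0 : 0 ≤ Z := integral_nonneg fun _ => (Real.exp_pos _).le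
  set w : X → ENNReal := fun z => ENNReal.ofReal (Real.exp (-H z) / Z) with hw
  have hwm : Measurable w := (hH.neg.exp.div_const Z).ennreal_ofReal
  rw [lintegral_map hf hΦ.measurable]
  have h1 : ∫⁻ z, f (Φ z) ∂(vol.tilted fun z => -H z) = ∫⁻ z, w z * f (Φ z) ∂vol :=
    lintegral_tilted _ _
  have h2 : ∫⁻ z, f z ∂(vol.tilted fun z => -H z) = ∫⁻ z, w (Φ z) * f (Φ z) ∂vol := by
    rw [lintegral_tilted]
    exact (hΦ.lintegral_comp (hwm.mul hf)).symm
  have h3 : ∫⁻ z, ENNReal.ofReal (H (Φ z) - H z) ∂(vol.tilted fun z => -H z)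
      = ∫⁻ z, w z * ENNReal.ofReal (H (Φ z) - H z) ∂vol := lintegral_tilted _ _
  refine le_trans ?_ (add_le_add_right h _)
  have hm : Measurable fun z => w (Φ z) * f (Φ z) :=
    (hwm.comp hΦ.measurable).mul (hf.comp hΦ.measurable)
  rw [h1, h2, h3, ← lintegral_add_left hm]
  refine lintegral_mono fun z => ?_
  calc w z * f (Φ z) ≤ (w (Φ z) + w z * ENNReal.ofReal (H (Φ z) - H z)) * f (Φ z) := by
        gcongr; exact exp_neg_div_le _ _ hZ0
    _ = w (Φ z) * f (Φ z) + w z * ENNReal.ofReal (H (Φ z) - H z) * f (Φ z) := add_mul _ _ _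
    _ ≤ _ := add_le_add_right (mul_le_of_le_one_right' (hf1 _)) _

/-- Comparison of two Boltzmann measures. -/
theorem tvLe_tilted {X : Type*} [MeasurableSpace X] {vol : Measure X} [NeZero vol] {H H' : X → ℝ}
    (hH : Measurable H) (hi : Integrable (fun z => Real.exp (-H z)) vol)
    (hi' : Integrable (fun z => Real.exp (-H' z)) vol) (hle : ∀ z, H' z ≤ H z) {ε : ℝ}
    (h : ∫⁻ z, ENNReal.ofReal (H z - H' z) ∂(vol.tilted fun z => -H' z) ≤ ENNReal.ofReal ε) :
    TVLe (vol.tilted fun z => -H' z) (vol.tilted fun z => -H z) ε := by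
  intro f hf hf1
  have hZ0 : 0 < ∫ x, Real.exp (-H x) ∂vol := integral_exp_pos hi
  -- The order between the two potentials makes the normalizing constants compare in the favourable
  -- direction, so they need not be estimated.
  have hZZ : ∫ x, Real.exp (-H x) ∂vol ≤ ∫ x, Real.exp (-H' x) ∂vol :=
    integral_mono hi hi' fun z => Real.exp_le_exp.2 (neg_le_neg (hle z))
  refine le_trans ?_ (add_le_add_right h _)
  have hm : Measurable fun x =>
      ENNReal.ofReal (Real.exp (-H x) / ∫ x, Real.exp (-H x) ∂vol) * f x :=
    (hH.neg.exp.div_const _).ennreal_ofReal.mul hf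
  rw [lintegral_tilted, lintegral_tilted, lintegral_tilted, ← lintegral_add_left hm]
  refine lintegral_mono fun z => ?_
  have h1 := exp_neg_div_le (H' z) (H z) (hZ0.le.trans hZZ)
  calc ENNReal.ofReal (Real.exp (-H' z) / ∫ x, Real.exp (-H' x) ∂vol) * f z
      ≤ (ENNReal.ofReal (Real.exp (-H z) / ∫ x, Real.exp (-H' x) ∂vol)
        + ENNReal.ofReal (Real.exp (-H' z) / ∫ x, Real.exp (-H' x) ∂vol)
          * ENNReal.ofReal (H z - H' z)) * f z := by gcongr
    _ = ENNReal.ofReal (Real.exp (-H z) / ∫ x, Real.exp (-H' x) ∂vol) * f z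
        + ENNReal.ofReal (Real.exp (-H' z) / ∫ x, Real.exp (-H' x) ∂vol)
          * ENNReal.ofReal (H z - H' z) * f z := add_mul _ _ _
    _ ≤ ENNReal.ofReal (Real.exp (-H z) / ∫ x, Real.exp (-H x) ∂vol) * f z
        + ENNReal.ofReal (Real.exp (-H' z) / ∫ x, Real.exp (-H' x) ∂vol)
          * ENNReal.ofReal (H z - H' z) * f z := by
        refine add_le_add_left (mul_le_mul_left (ENNReal.ofReal_le_ofReal ?_) _) _
        exact div_le_div_of_nonneg_left (Real.exp_pos _).le hZ0 hZZ
    _ ≤ _ := add_le_add_right (mul_le_of_le_one_right' (hf1 _)) _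

/-! ### Shifts of Gaussian measures -/

/-- A translation preserves volume and changes the Gaussian energy by ⟪a, y⟫ + |a|²/2, whose
positive part has mean at most |a| + |a|²/2. For |a| ≤ 1 this is at most 3|a|/2; for |a| ≥ 1 the
bound is trivial. -/
lemma tvLe_gaussian_shift {d : ℕ} (a : Pos d) :
    TVLe ((stdGaussian (Pos d)).map fun y => y + a) (stdGaussian (Pos d)) (3 / 2 * ‖a‖) := by
  have hpm : IsProbabilityMeasure ((stdGaussian (Pos d)).map fun y => y + a) :=
    Measure.isProbabilityMeasure_map (by fun_prop)
  rcases le_total 1 ‖a‖ with ha | ha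
  · exact TVLe.of_one_le (by linarith)
  rcases eq_or_ne a 0 with rfl | ha0
  · simp only [add_zero, norm_zero, mul_zero]
    intro f hf hf1
    simp
  have hap : 0 < ‖a‖ := norm_pos_iff.2 ha0
  have hmem : MemLp (fun y : Pos d => ⟪a, y⟫) 2 (stdGaussian (Pos d)) :=
    IsGaussian.memLp_dual (stdGaussian (Pos d)) (innerSL ℝ a) 2 (by simp)
  have hsq : ∫ y, ⟪a, y⟫ ^ 2 ∂(stdGaussian (Pos d)) = ‖a‖ ^ 2 := by
    have h1 := variance_dual_stdGaussian (innerSL ℝ a : StrongDual ℝ (Pos d))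
    rw [variance_of_integral_eq_zero (innerSL ℝ a).continuous.aemeasurable
      (integral_strongDual_stdGaussian _), innerSL_apply_norm] at h1
    exact h1
  have hi := hmem.integrable_sq
  have key : ∫⁻ y, ENNReal.ofReal (‖y + a‖ ^ 2 / 2 - ‖y‖ ^ 2 / 2) ∂(stdGaussian (Pos d))
      ≤ ENNReal.ofReal (3 / 2 * ‖a‖) := by
    have hI : Integrable (fun y : Pos d => ⟪a, y⟫ ^ 2 / (2 * ‖a‖) + (‖a‖ / 2 + ‖a‖ ^ 2 / 2))
        (stdGaussian (Pos d)) := (hi.div_const _).add (integrable_const _)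
    calc ∫⁻ y, ENNReal.ofReal (‖y + a‖ ^ 2 / 2 - ‖y‖ ^ 2 / 2) ∂(stdGaussian (Pos d))
        ≤ ∫⁻ y, ENNReal.ofReal (⟪a, y⟫ ^ 2 / (2 * ‖a‖) + (‖a‖ / 2 + ‖a‖ ^ 2 / 2))
            ∂(stdGaussian (Pos d)) := by
          refine lintegral_mono fun y => ENNReal.ofReal_le_ofReal ?_
          rw [norm_add_sq_real, real_inner_comm]
          have h1 : ⟪a, y⟫ ≤ ⟪a, y⟫ ^ 2 / (2 * ‖a‖) + ‖a‖ / 2 := by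
            rw [div_add_div _ _ (by positivity) two_ne_zero, le_div_iff₀ (by positivity)]
            nlinarith [sq_nonneg (⟪a, y⟫ - ‖a‖)]
          linarith
      _ = ENNReal.ofReal (∫ y, (⟪a, y⟫ ^ 2 / (2 * ‖a‖) + (‖a‖ / 2 + ‖a‖ ^ 2 / 2))
            ∂(stdGaussian (Pos d))) :=
          (ofReal_integral_eq_lintegral_ofReal hI (Eventually.of_forall fun y => by positivity)).symm
      _ ≤ _ := by
          apply ENNReal.ofReal_le_ofReal
          rw [integral_add (hi.div_const _) (integrable_const _), integral_div, hsq]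
          simp only [integral_const, probReal_univ, one_smul]
          have : ‖a‖ ^ 2 / (2 * ‖a‖) = ‖a‖ / 2 := by field_simp
          rw [this]
          nlinarith
  have h := tvLe_map_tilted (vol := (volume : Measure (Pos d))) (H := fun y => ‖y‖ ^ 2 / 2)
    (by fun_prop) (measurePreserving_add_right volume a) (ε := 3 / 2 * ‖a‖)
  have e : (volume : Measure (Pos d)).tilted (fun z => -(‖z‖ ^ 2 / 2)) = stdGaussian (Pos d) :=
    boltzmann_gaussian d
  rw [e] at h
  exact h key

/-- The two Gaussian components are shifted one after the other by Fubini, and the costs add. -/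
lemma tvLe_noise_shift {d : ℕ} (b : Phase d) :
    TVLe ((noise d).map fun ξ => ξ + b) (noise d) (3 / 2 * (‖b.1‖ + ‖b.2‖)) := by
  intro f hf hf1
  have hs : Measurable fun ξ : Phase d => ξ + b := measurable_add_const b
  set g := stdGaussian (Pos d) with hg
  rw [lintegral_map hf hs]
  unfold noise
  have hfs : Measurable fun ξ : Pos d × Pos d => f (ξ + b) := hf.comp hs
  rw [← hg, lintegral_prod _ hfs.aemeasurable, lintegral_prod _ hf.aemeasurable]
  have h1 : ∀ x, ∫⁻ y, f ((x, y) + b) ∂g ≤ ∫⁻ y, f (x + b.1, y) ∂g + ENNReal.ofReal (3 / 2 * ‖b.2‖) := by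
    intro x
    have hfx : Measurable fun y => f (x + b.1, y) := hf.comp measurable_prodMk_left
    have := tvLe_gaussian_shift b.2 _ hfx fun y => hf1 _
    rw [lintegral_map hfx (measurable_add_const b.2)] at this
    exact this
  have hF : Measurable fun x => ∫⁻ y, f (x, y) ∂g := hf.lintegral_prod_right'
  have h2 : ∫⁻ x, ∫⁻ y, f (x + b.1, y) ∂g ∂g
      ≤ ∫⁻ x, ∫⁻ y, f (x, y) ∂g ∂g + ENNReal.ofReal (3 / 2 * ‖b.1‖) := by
    have := tvLe_gaussian_shift b.1 _ hF fun x => by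
      calc ∫⁻ y, f (x, y) ∂g ≤ ∫⁻ _, 1 ∂g := lintegral_mono fun y => hf1 _
        _ = 1 := by simp [hg]
    rw [lintegral_map hF (measurable_add_const b.1)] at this
    exact this
  calc ∫⁻ x, ∫⁻ y, f ((x, y) + b) ∂g ∂g
      ≤ ∫⁻ x, (∫⁻ y, f (x + b.1, y) ∂g + ENNReal.ofReal (3 / 2 * ‖b.2‖)) ∂g :=
        lintegral_mono h1
    _ = ∫⁻ x, ∫⁻ y, f (x + b.1, y) ∂g ∂g + ENNReal.ofReal (3 / 2 * ‖b.2‖) := by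
        rw [lintegral_add_right _ measurable_const]; simp [hg]
    _ ≤ _ := by
        rw [mul_add, ENNReal.ofReal_add (by positivity) (by positivity), ← add_assoc]
        gcongr

/-! ### The modified potential -/

/-- The potential whose Gibbs measure is almost preserved by the Verlet scheme. -/
def modPot {d : ℕ} (U : Pos d → ℝ) (δ : ℝ) (x : Pos d) : ℝ := U x - δ ^ 2 / 8 * ‖gradient U x‖ ^ 2

namespace Setting

variable {d : ℕ} {U : Pos d → ℝ} {m L γ δ : ℝ}

lemma δ_mul_L_le (hS : Setting U m L γ δ) : δ * L ≤ Real.sqrt m / 264 := by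
  have hL := hS.L_pos
  have hs := Real.sqrt_pos.2 hL
  have hm := Real.sqrt_pos.2 hS.m_pos
  have hss : Real.sqrt L ^ 2 = L := Real.sq_sqrt hL.le
  have hmm : Real.sqrt m ^ 2 = m := Real.sq_sqrt hS.m_pos.le
  have hml : Real.sqrt m ≤ Real.sqrt L := Real.sqrt_le_sqrt hS.m_le
  have h1 : δ ≤ m / (33 * (2 * Real.sqrt L) ^ 3) := by
    refine hS.δ_le.trans ?_
    have := hS.γ_ge
    have := hS.m_pos
    gcongr
  calc δ * L ≤ m / (33 * (2 * Real.sqrt L) ^ 3) * L := by gcongr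
    _ = Real.sqrt m ^ 2 / Real.sqrt L / 264 := by
      rw [hmm]; nth_rw 2 [← hss]; field_simp; ring
    _ ≤ _ := by
      gcongr
      rw [div_le_iff₀ hs]; nlinarith

lemma δ_sq_L_sq_le (hS : Setting U m L γ δ) : δ ^ 2 * L ^ 2 ≤ m / 264 ^ 2 := by
  have h := hS.δ_mul_L_le
  have h0 : 0 ≤ δ * L := (mul_pos hS.δ_pos hS.L_pos).le
  calc δ ^ 2 * L ^ 2 = (δ * L) ^ 2 := by ring
    _ ≤ (Real.sqrt m / 264) ^ 2 := by gcongr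
    _ = _ := by rw [div_pow, Real.sq_sqrt hS.m_pos.le]

lemma hasFDerivAt_modPot (hS : Setting U m L γ δ) (x : Pos d) :
    HasFDerivAt (modPot U δ) (innerSL ℝ (gradient U x) - (δ ^ 2 / 4) •
      (innerSL ℝ (gradient U x)).comp (fderiv ℝ (gradient U) x)) x := by
  have h1 := ((hS.contDiff.differentiable (by norm_num)) x).hasFDerivAt
  have h2 := (hS.differentiable_gradient x).hasFDerivAt
  have h3 := (h2.norm_sq).const_mul (δ ^ 2 / 8)
  refine (h1.sub h3).congr_fderiv ?_
  ext w
  simp only [sub_apply, smul_apply, hS.fderiv_apply,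
    ContinuousLinearMap.comp_apply, innerSL_apply_apply, smul_eq_mul, nsmul_eq_mul]
  push_cast
  ring

lemma continuous_modPot (hS : Setting U m L γ δ) : Continuous (modPot U δ) := by
  have h1 := hS.continuous_potential
  have h2 := hS.continuous_gradient
  unfold modPot
  fun_prop

end Setting

namespace Blocks

variable {d : ℕ} {J : Type*} [Fintype J] {U : Pos d → ℝ} {m L Ll l k γ δ : ℝ} {xs : Pos d}
  {P : J → Pos d →L[ℝ] Pos d}

lemma isConfining_modPot (hP : Blocks U m L Ll l k xs P) (hS : Setting U m L γ δ) :
    IsConfining (modPot U δ) := by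
  have hm := hS.m_pos
  refine ⟨hS.continuous_modPot, m / 8, U xs - m / 4 * ‖xs‖ ^ 2, by positivity, fun x => ?_⟩
  have h1 := hS.lower_bound xs x
  rw [hP.grad_xs, inner_zero_left] at h1
  have h2 := hP.norm_gradient_le hS x
  have h3 : ‖gradient U x‖ ^ 2 ≤ L ^ 2 * ‖x - xs‖ ^ 2 := by
    rw [← mul_pow]; gcongr
  have h4 := hS.δ_sq_L_sq_le
  have h5 : δ ^ 2 / 8 * ‖gradient U x‖ ^ 2 ≤ m / 4 * ‖x - xs‖ ^ 2 := by
    calc δ ^ 2 / 8 * ‖gradient U x‖ ^ 2 ≤ δ ^ 2 / 8 * (L ^ 2 * ‖x - xs‖ ^ 2) := by gcongr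
      _ = (δ ^ 2 * L ^ 2) / 8 * ‖x - xs‖ ^ 2 := by ring
      _ ≤ _ := by gcongr ?_ * _; linarith
  have h6 : ‖x‖ ^ 2 ≤ 2 * ‖x - xs‖ ^ 2 + 2 * ‖xs‖ ^ 2 := by
    have : ‖x‖ ≤ ‖x - xs‖ + ‖xs‖ := by simpa using norm_add_le (x - xs) xs
    nlinarith [sq_nonneg (‖x - xs‖ - ‖xs‖), norm_nonneg x]
  unfold modPot
  nlinarith

lemma norm_fderiv_modPot_le (hP : Blocks U m L Ll l k xs P) (hS : Setting U m L γ δ) (x : Pos d) :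
    ‖fderiv ℝ (modPot U δ) x‖ ≤ (1 + δ ^ 2 / 4 * L) * L * (1 + ‖xs‖) * (1 + ‖x‖) := by
  have hL := hS.L_pos
  refine ContinuousLinearMap.opNorm_le_bound _ (by positivity) fun w => ?_
  rw [(hS.hasFDerivAt_modPot x).fderiv]
  simp only [sub_apply, smul_apply,
    ContinuousLinearMap.comp_apply, innerSL_apply_apply, smul_eq_mul]
  have h1 := norm_inner_le_norm (𝕜 := ℝ) (gradient U x) w
  have h2 := norm_inner_le_norm (𝕜 := ℝ) (gradient U x) (fderiv ℝ (gradient U) x w)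
  have h3 : ‖fderiv ℝ (gradient U) x w‖ ≤ L * ‖w‖ :=
    ((fderiv ℝ (gradient U) x).le_opNorm w).trans
      (by gcongr; exact hS.norm_fderiv_gradient_le x)
  have h4 : ‖gradient U x‖ ≤ L * ((1 + ‖xs‖) * (1 + ‖x‖)) := by
    refine (hP.norm_gradient_le hS x).trans ?_
    gcongr
    have := norm_sub_le x xs
    nlinarith [mul_nonneg (norm_nonneg x) (norm_nonneg xs)]
  calc ‖⟪gradient U x, w⟫ - δ ^ 2 / 4 * ⟪gradient U x, fderiv ℝ (gradient U) x w⟫‖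
      ≤ ‖gradient U x‖ * ‖w‖ + δ ^ 2 / 4 * (‖gradient U x‖ * (L * ‖w‖)) := by
        refine (norm_sub_le _ _).trans ?_
        rw [norm_mul, Real.norm_of_nonneg (by positivity : 0 ≤ δ ^ 2 / 4)]
        gcongr
        exact h2.trans (by gcongr)
    _ = (1 + δ ^ 2 / 4 * L) * ‖gradient U x‖ * ‖w‖ := by ring
    _ ≤ (1 + δ ^ 2 / 4 * L) * (L * ((1 + ‖xs‖) * (1 + ‖x‖))) * ‖w‖ := by gcongr
    _ = _ := by ring

/-- The correction contributes δ²/4 ⟪∇U, D²U h⟫. Symmetry of the Hessian brings this back to the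
block of h, where it is at most δ²L²|h|²/4, less than one percent of m|h|². -/
lemma modPot_mono (hP : Blocks U m L Ll l k xs P) (hS : Setting U m L γ δ) (j : J) (x : Pos d) :
    99 / 100 * m * ‖P j (x - xs)‖ ^ 2 ≤ fderiv ℝ (modPot U δ) x (P j (x - xs)) := by
  set h := P j (x - xs) with hh
  rw [(hS.hasFDerivAt_modPot x).fderiv]
  simp only [sub_apply, smul_apply,
    ContinuousLinearMap.comp_apply, innerSL_apply_apply, smul_eq_mul]
  have h1 := hP.grad_mono j x
  rw [← hh, real_inner_comm] at h1
  have h2 : ⟪gradient U x, fderiv ℝ (gradient U) x h⟫ ≤ L ^ 2 * ‖h‖ ^ 2 := by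
    rw [← hS.inner_fderiv_gradient_comm, real_inner_comm, hh, hP.inner_proj, ← hh]
    have h3 := hP.norm_fderiv_le hS j x (gradient U x)
    have h4 := hP.grad_lip j x xs
    rw [hP.grad_xs, sub_zero, ← hh] at h4
    have hL := hS.L_pos
    calc ⟪h, P j (fderiv ℝ (gradient U) x (gradient U x))⟫
        ≤ ‖h‖ * ‖P j (fderiv ℝ (gradient U) x (gradient U x))‖ := real_inner_le_norm _ _
      _ ≤ ‖h‖ * (L * (L * ‖h‖)) := by gcongr; exact h3.trans (by gcongr)
      _ = _ := by ring
  have h3 : δ ^ 2 / 4 * ⟪gradient U x, fderiv ℝ (gradient U) x h⟫ ≤ 1 / 100 * m * ‖h‖ ^ 2 := by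
    have h4 := hS.δ_sq_L_sq_le
    have hm := hS.m_pos
    calc δ ^ 2 / 4 * ⟪gradient U x, fderiv ℝ (gradient U) x h⟫
        ≤ δ ^ 2 / 4 * (L ^ 2 * ‖h‖ ^ 2) := by gcongr
      _ = (δ ^ 2 * L ^ 2) / 4 * ‖h‖ ^ 2 := by ring
      _ ≤ _ := by gcongr; linarith
  linarith

lemma moment_position_modPot (hP : Blocks U m L Ll l k xs P) (hS : Setting U m L γ δ) (j : J)
    {q : ℝ} (hq : 2 ≤ q) :
    Integrable (fun x => ‖P j (x - xs)‖ ^ q) (boltzmann (modPot U δ)) ∧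
      ∫ x, ‖P j (x - xs)‖ ^ q ∂(boltzmann (modPot U δ))
        ≤ ((k + q - 2) / (99 / 100 * m)) ^ (q / 2) :=
  hP.moment_position (hP.isConfining_modPot hS)
    (fun x => (hS.hasFDerivAt_modPot x).differentiableAt) (hP.norm_fderiv_modPot_le hS)
    (by have := hS.m_pos; positivity) j (hP.modPot_mono hS j) hq

/-- Comparison of the target with the Gibbs measure of the modified potential. -/
theorem tvLe_modPot (hP : Blocks U m L Ll l k xs P) (hS : Setting U m L γ δ) :
    TVLe (gibbs (modPot U δ)) (gibbs U)
      (Fintype.card J * (δ ^ 2 * L ^ 2 * k / (7.92 * m))) := by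
  have hW := hP.isConfining_modPot hS
  have hm := hS.m_pos
  have hprob := hW.isProbabilityMeasure
  refine tvLe_tilted (H := fun z : Phase d => U z.1 + ‖z.2‖ ^ 2 / 2)
    (H' := fun z : Phase d => modPot U δ z.1 + ‖z.2‖ ^ 2 / 2) ?_
    hS.isConfining.integrable_exp_phase hW.integrable_exp_phase (fun z => ?_) ?_
  · have := hS.continuous_potential
    exact Continuous.measurable (by fun_prop)
  · simp only [modPot]
    have : 0 ≤ δ ^ 2 / 8 * ‖gradient U z.1‖ ^ 2 := by positivity
    linarith
  · change ∫⁻ z : Phase d, ENNReal.ofReal (U z.1 + ‖z.2‖ ^ 2 / 2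
      - (modPot U δ z.1 + ‖z.2‖ ^ 2 / 2)) ∂(gibbs (modPot U δ)) ≤ _
    have hfst : MeasurePreserving Prod.fst (phaseMeasure (modPot U δ)) (boltzmann (modPot U δ)) :=
      measurePreserving_fst
    have hmom := fun j => hP.moment_position_modPot hS j (le_refl (2 : ℝ))
    have hi : Integrable (fun x => ∑ j, δ ^ 2 / 8 * L ^ 2 * ‖P j (x - xs)‖ ^ (2 : ℝ))
        (boltzmann (modPot U δ)) :=
      integrable_finsetSum _ fun j _ => (hmom j).1.const_mul _
    have hmeas : Measurable fun x => ENNReal.ofReal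
        (∑ j, δ ^ 2 / 8 * L ^ 2 * ‖P j (x - xs)‖ ^ (2 : ℝ)) := by
      simp only [Real.rpow_two]
      exact ENNReal.measurable_ofReal.comp (Continuous.measurable (by fun_prop))
    rw [hW.gibbs_eq]
    calc ∫⁻ z : Phase d, ENNReal.ofReal (U z.1 + ‖z.2‖ ^ 2 / 2
          - (modPot U δ z.1 + ‖z.2‖ ^ 2 / 2)) ∂(phaseMeasure (modPot U δ))
        ≤ ∫⁻ z : Phase d, (fun x => ENNReal.ofReal
            (∑ j, δ ^ 2 / 8 * L ^ 2 * ‖P j (x - xs)‖ ^ (2 : ℝ))) z.1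
              ∂(phaseMeasure (modPot U δ)) := by
          refine lintegral_mono fun z => ENNReal.ofReal_le_ofReal ?_
          simp only [modPot, Real.rpow_two]
          rw [← Finset.mul_sum, hP.sum_sq]
          have h2 : ‖gradient U z.1‖ ^ 2 ≤ L ^ 2 * ‖z.1 - xs‖ ^ 2 := by
            rw [← mul_pow]; gcongr; exact hP.norm_gradient_le hS z.1
          nlinarith [sq_nonneg δ]
      _ = ∫⁻ x, ENNReal.ofReal (∑ j, δ ^ 2 / 8 * L ^ 2 * ‖P j (x - xs)‖ ^ (2 : ℝ))
            ∂(boltzmann (modPot U δ)) :=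
          hfst.lintegral_comp hmeas
      _ = ENNReal.ofReal (∫ x, ∑ j, δ ^ 2 / 8 * L ^ 2 * ‖P j (x - xs)‖ ^ (2 : ℝ)
            ∂(boltzmann (modPot U δ))) :=
          (ofReal_integral_eq_lintegral_ofReal hi (Eventually.of_forall fun x => by positivity)).symm
      _ ≤ _ := by
          apply ENNReal.ofReal_le_ofReal
          rw [integral_finsetSum _ fun j _ => (hmom j).1.const_mul _]
          simp_rw [integral_const_mul]
          -- The denominator 7.92 is 8 · 99/100: the second moment is taken under the modified
          -- measure, with convexity constant 99m/100.
          calc ∑ j, δ ^ 2 / 8 * L ^ 2 * ∫ x, ‖P j (x - xs)‖ ^ (2 : ℝ) ∂(boltzmann (modPot U δ))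
              ≤ ∑ _j : J, δ ^ 2 / 8 * L ^ 2 * ((k + 2 - 2) / (99 / 100 * m)) ^ ((2 : ℝ) / 2) := by
                gcongr with j
                exact (hmom j).2
            _ = _ := by
                rw [Finset.sum_const, Finset.card_univ, nsmul_eq_mul, div_self two_ne_zero,
                  Real.rpow_one]
                field_simp
                ring

/-! ### Energy error of the Verlet scheme -/

lemma sum_inner (hP : Blocks U m L Ll l k xs P) (x y : Pos d) : ∑ j, ⟪P j x, P j y⟫ = ⟪x, y⟫ := by
  have h := hP.sum_sq (x + y)
  simp only [map_add, norm_add_sq_real, Finset.sum_add_distrib, ← Finset.mul_sum, hP.sum_sq] at h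
  linarith

/-- Apply `trapezoid_error_le` on [0, 1] to t ↦ U(x + t h). The second derivative splits over the
blocks, and its variation is controlled in each by the local Lipschitz condition on the Hessian,
which produces the third power of |P j h|. -/
lemma energy_error_le (hP : Blocks U m L Ll l k xs P) (hS : Setting U m L γ δ) (x h : Pos d) :
    |U (x + h) - U x - ⟪gradient U x + gradient U (x + h), h⟫ / 2|
      ≤ ∑ j, Ll / 24 * ‖P j h‖ ^ 3 * (1 + (‖P j (x - xs)‖ + ‖P j h‖) ^ (l - 2)) := by
  have hLl := hP.Ll_pos
  have hl2 : 0 ≤ l - 2 := by linarith [hP.two_le]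
  set B := ∑ j, Ll / 2 * ‖P j h‖ ^ 3 * (1 + (‖P j (x - xs)‖ + ‖P j h‖) ^ (l - 2)) with hB
  have hray : ∀ t : ℝ, HasDerivAt (fun t : ℝ => x + t • h) h t := fun t => by
    simpa using ((hasDerivAt_id t).smul_const h).const_add x
  have key := trapezoid_error_le (v := fun t : ℝ => U (x + t • h))
    (a := fun t : ℝ => -⟪gradient U (x + t • h), h⟫)
    (a' := fun t : ℝ => -⟪fderiv ℝ (gradient U) (x + t • h) h, h⟫) (T := 1) (B := B) zero_le_one
    (fun t _ => by rw [neg_neg]; exact (hS.hasDerivAt_ray x h t).hasDerivWithinAt)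
    (fun t _ => by
      have h1 := (hS.differentiable_gradient (x + t • h)).hasFDerivAt.comp_hasDerivAt t (hray t)
      have h2 := (h1.inner ℝ (hasDerivAt_const t h)).neg
      simp only [inner_zero_right, zero_add] at h2
      exact h2.hasDerivWithinAt)
    (fun t ht s hs => by
      have hts : 0 ≤ t - s := sub_nonneg.2 hs.2
      have hR : ∀ r : ℝ, 0 ≤ r → r ≤ 1 → ∀ j, ‖P j (x + r • h - xs)‖ ^ (l - 2)
          ≤ (‖P j (x - xs)‖ + ‖P j h‖) ^ (l - 2) := fun r hr0 hr1 j => by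
        refine Real.rpow_le_rpow (norm_nonneg _) ?_ hl2
        rw [add_sub_right_comm, map_add, map_smul]
        refine (norm_add_le _ _).trans ?_
        rw [norm_smul, Real.norm_of_nonneg hr0]
        gcongr
        exact mul_le_of_le_one_left (norm_nonneg _) hr1
      rw [neg_sub_neg, ← inner_sub_left, ← hP.sum_inner, hB, Finset.sum_mul]
      refine (norm_sum_le _ _).trans (Finset.sum_le_sum fun j _ => ?_)
      refine (norm_inner_le_norm _ _).trans ?_
      have e : x + s • h - (x + t • h) = (s - t) • h := by module
      have h1 := hP.hess j (x + s • h) (x + t • h) h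
      rw [e, map_smul, norm_smul, Real.norm_eq_abs, abs_sub_comm, abs_of_nonneg hts] at h1
      calc _ ≤ Ll * ((t - s) * ‖P j h‖) * (2 + (‖P j (x - xs)‖ + ‖P j h‖) ^ (l - 2)
              + (‖P j (x - xs)‖ + ‖P j h‖) ^ (l - 2)) / 4 * ‖P j h‖ * ‖P j h‖ := by
            refine mul_le_mul_of_nonneg_right (h1.trans ?_) (norm_nonneg _)
            have h2 := hR s hs.1 (hs.2.trans ht.2) j
            have h3 := hR t ht.1 ht.2 j
            gcongr ?_ / 4 * _
            refine mul_le_mul_of_nonneg_left ?_ (by positivity)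
            linarith
        _ = _ := by ring)
  simp only [zero_smul, add_zero, one_smul, one_div, one_pow, mul_one, smul_eq_mul,
    Real.norm_eq_abs] at key
  have e : ∑ j, Ll / 24 * ‖P j h‖ ^ 3 * (1 + (‖P j (x - xs)‖ + ‖P j h‖) ^ (l - 2)) = B / 12 := by
    rw [hB, Finset.sum_div]
    refine Finset.sum_congr rfl fun j _ => by ring
  rw [e, ← abs_neg]
  refine (le_of_eq (congrArg _ ?_)).trans key
  rw [inner_add_left]
  ring

/-- The reason for the coefficient δ²/8: the squares of the gradients at both ends created by the
two half-kicks are cancelled by the correction, leaving exactly the trapezoidal error for U along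
the displacement. -/
lemma _root_.OBABO.modEnergy_verlet_sub (U : Pos d → ℝ) (δ : ℝ) (z : Phase d) :
    modPot U δ (verlet U δ z).1 + ‖(verlet U δ z).2‖ ^ 2 / 2 - (modPot U δ z.1 + ‖z.2‖ ^ 2 / 2)
      = U (z.1 + δ • (z.2 - (δ / 2) • gradient U z.1)) - U z.1
        - ⟪gradient U z.1 + gradient U (z.1 + δ • (z.2 - (δ / 2) • gradient U z.1)),
          δ • (z.2 - (δ / 2) • gradient U z.1)⟫ / 2 := by
  set w := z.2 - (δ / 2) • gradient U z.1 with hw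
  have hv : z.2 = w + (δ / 2) • gradient U z.1 := by simp [hw]
  have h1 : (verlet U δ z).1 = z.1 + δ • w := by simp only [verlet, kick, drift, hw]
  have h2 : (verlet U δ z).2 = w - (δ / 2) • gradient U (z.1 + δ • w) := by
    simp only [verlet, kick, drift, hw]
  rw [h1, h2, hv]
  simp only [modPot, norm_add_sq_real, norm_sub_sq_real, inner_smul_right, inner_add_left,
    norm_smul, mul_pow, Real.norm_eq_abs, sq_abs]
  rw [real_inner_comm w, real_inner_comm w]
  ring

end Blocks

/-! ### Almost invariance of the modified Gibbs measure -/

/-- A cubic factor times a power l - 2 is a power l + 1, whence the exponent (l + 1)/2 in the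
dimension. After division of a and b by their moment scales, everything is bounded by the larger of
the two normalized variables. -/
lemma energy_block_le {a b h δ D m L l : ℝ} (ha : 0 ≤ a) (hb : 0 ≤ b) (hh : 0 ≤ h) (hδ : 0 < δ)
    (hm : 0 < m) (hl : 2 ≤ l) (hD : 1 ≤ D) (h1 : h ≤ δ * (b + δ * L / 2 * a))
    (hδL : δ * L ≤ Real.sqrt m / 264) (hδm : δ * Real.sqrt m ≤ 1 / 264) :
    h ^ 3 * (1 + (a + h) ^ (l - 2)) ≤ δ ^ 3 * D ^ ((l + 1) / 2) * 2 ^ (l - 2) * (107 / 100) *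
      (1 + (1 + Real.sqrt m ^ (-(l - 2)))
        * ((99 / 100 * m / D) ^ ((l + 1) / 2) * a ^ (l + 1)
          + (1 / D) ^ ((l + 1) / 2) * b ^ (l + 1))) := by
  have hD0 : 0 < D := by linarith
  set s := Real.sqrt D with hs
  have hs0 : 0 < s := Real.sqrt_pos.2 hD0
  have hs1 : 1 ≤ s := Real.one_le_sqrt.2 hD
  set r := Real.sqrt m with hr
  have hr0 : 0 < r := Real.sqrt_pos.2 hm
  have hl2 : 0 ≤ l - 2 := by linarith
  have hsl : D ^ ((l + 1) / 2) = s ^ (l + 1) := by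
    rw [hs, Real.sqrt_eq_rpow, ← Real.rpow_mul hD0.le]; congr 1; ring
  have hs3 : s ^ 3 ≤ s ^ (l + 1) := by
    rw [← Real.rpow_natCast]; exact Real.rpow_le_rpow_of_exponent_le hs1 (by push_cast; linarith)
  set u := Real.sqrt (99 / 100 * m) * a / s with hu
  set w := b / s with hw
  have hu0 : 0 ≤ u := by positivity
  have hw0 : 0 ≤ w := by positivity
  set M := max u w with hM
  have hM0 : 0 ≤ M := le_max_of_le_left hu0
  have eS : (99 / 100 * m / D) ^ ((l + 1) / 2) * a ^ (l + 1)
      + (1 / D) ^ ((l + 1) / 2) * b ^ (l + 1) = u ^ (l + 1) + w ^ (l + 1) := by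
    have hc : 0 ≤ 99 / 100 * m := by positivity
    rw [hu, hw, Real.div_rpow (by positivity) hs0.le, Real.div_rpow hb hs0.le,
      Real.mul_rpow (by positivity) ha, Real.div_rpow hc hD0.le, Real.div_rpow zero_le_one hD0.le,
      Real.one_rpow, ← hsl, Real.sqrt_eq_rpow, ← Real.rpow_mul hc]
    have : 1 / 2 * (l + 1) = (l + 1) / 2 := by ring
    rw [this]; ring
  set S := u ^ (l + 1) + w ^ (l + 1) with hS
  have hMS : M ^ (l + 1) ≤ S := by
    rcases le_total u w with h | h
    · rw [hM, max_eq_right h]; exact le_add_of_nonneg_left (by positivity)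
    · rw [hM, max_eq_left h]; exact le_add_of_nonneg_right (by positivity)
  have hM3 : M ^ 3 ≤ 1 + S := by
    refine le_trans ?_ (add_le_add_right hMS 1)
    rcases le_total M 1 with h | h
    · have : M ^ 3 ≤ 1 := pow_le_one₀ hM0 h
      have : 0 ≤ M ^ (l + 1) := by positivity
      linarith
    · have : M ^ 3 ≤ M ^ (l + 1) := by
        rw [← Real.rpow_natCast]; exact Real.rpow_le_rpow_of_exponent_le h (by push_cast; linarith)
      linarith
  have hbM : b ≤ s * M := by
    calc b = s * w := by rw [hw]; field_simp
      _ ≤ s * M := by gcongr; exact le_max_right _ _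
  have haM : r * a ≤ 101 / 100 * (s * M) := by
    have h99 : r ≤ 101 / 100 * Real.sqrt (99 / 100 * m) := by
      refine Real.sqrt_le_iff.2 ⟨by positivity, ?_⟩
      rw [mul_pow, Real.sq_sqrt (by positivity)]; linarith
    calc r * a ≤ 101 / 100 * Real.sqrt (99 / 100 * m) * a := by gcongr
      _ = 101 / 100 * (s * u) := by rw [hu]; field_simp
      _ ≤ _ := by gcongr; exact le_max_left _ _
  have hsM : 0 ≤ s * M := by positivity
  have hhM : h ≤ δ * (s * (102 / 100 * M)) := by
    refine h1.trans ?_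
    gcongr
    have : δ * L / 2 * a ≤ r / 264 / 2 * a := by gcongr
    nlinarith
  have hR : a + h ≤ r⁻¹ * (s * (102 / 100 * M)) := by
    rw [inv_mul_eq_div, le_div_iff₀ hr0]
    have : h * r ≤ 1 / 264 * (s * (102 / 100 * M)) := by
      calc h * r ≤ δ * (s * (102 / 100 * M)) * r := by gcongr
        _ = (δ * r) * (s * (102 / 100 * M)) := by ring
        _ ≤ _ := by gcongr
    nlinarith
  have hR' : (a + h) ^ (l - 2) ≤ r ^ (-(l - 2)) * (s ^ (l - 2) * (2 ^ (l - 2) * M ^ (l - 2))) := by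
    calc (a + h) ^ (l - 2) ≤ (r⁻¹ * (s * (2 * M))) ^ (l - 2) := by
          refine Real.rpow_le_rpow (by positivity) (hR.trans ?_) hl2
          gcongr; norm_num
      _ = _ := by
          rw [Real.mul_rpow (by positivity) (by positivity), Real.mul_rpow hs0.le (by positivity),
            Real.mul_rpow (by norm_num) hM0, Real.inv_rpow hr0.le, Real.rpow_neg hr0.le]
  -- The factor 107/100 is an upper bound for 1.02³.
  have h3 : h ^ 3 ≤ δ ^ 3 * s ^ 3 * (107 / 100 * M ^ 3) := by
    calc h ^ 3 ≤ (δ * (s * (102 / 100 * M))) ^ 3 := by gcongr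
      _ = δ ^ 3 * s ^ 3 * ((102 / 100) ^ 3 * M ^ 3) := by ring
      _ ≤ _ := by gcongr; norm_num
  have eM : M ^ 3 * M ^ (l - 2) = M ^ (l + 1) := by
    rw [← Real.rpow_natCast, ← Real.rpow_add_of_nonneg hM0 (by norm_num) hl2]; congr 1; push_cast; ring
  have es : s ^ 3 * s ^ (l - 2) = s ^ (l + 1) := by
    rw [← Real.rpow_natCast, ← Real.rpow_add hs0]; congr 1; push_cast; ring
  have h2l : (1 : ℝ) ≤ 2 ^ (l - 2) := Real.one_le_rpow (by norm_num) hl2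
  have hc0 : 0 ≤ r ^ (-(l - 2)) := by positivity
  have hS0 : 0 ≤ S := by positivity
  rw [eS, hsl]
  calc h ^ 3 * (1 + (a + h) ^ (l - 2))
      ≤ (δ ^ 3 * s ^ 3 * (107 / 100 * M ^ 3))
        * (1 + r ^ (-(l - 2)) * (s ^ (l - 2) * (2 ^ (l - 2) * M ^ (l - 2)))) := by gcongr
    _ = δ ^ 3 * (107 / 100) * (s ^ 3 * M ^ 3 + 2 ^ (l - 2) * r ^ (-(l - 2)) * (s ^ 3 * s ^ (l - 2))
        * (M ^ 3 * M ^ (l - 2))) := by ring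
    _ ≤ δ ^ 3 * (107 / 100) * (s ^ (l + 1) * (2 ^ (l - 2) * (1 + S))
        + 2 ^ (l - 2) * r ^ (-(l - 2)) * s ^ (l + 1) * S) := by
        rw [eM, es]
        gcongr
        exact hM3.trans (le_mul_of_one_le_left (by positivity) h2l)
    _ = _ := by ring

namespace Blocks

variable {d : ℕ} {J : Type*} [Fintype J] {U : Pos d → ℝ} {m L Ll l k γ δ : ℝ} {xs : Pos d}
  {P : J → Pos d →L[ℝ] Pos d}

/-- Energy error of the Verlet scheme, on average with respect to the modified Gibbs measure. -/
lemma lintegral_energy_le (hP : Blocks U m L Ll l k xs P) (hS : Setting U m L γ δ) :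
    ∫⁻ z : Phase d, ENNReal.ofReal (modPot U δ (verlet U δ z).1 + ‖(verlet U δ z).2‖ ^ 2 / 2
        - (modPot U δ z.1 + ‖z.2‖ ^ 2 / 2)) ∂(gibbs (modPot U δ))
      ≤ ENNReal.ofReal (Fintype.card J * (Ll / 24 * (δ ^ 3 * (k + l - 1) ^ ((l + 1) / 2)
        * 2 ^ (l - 2) * (107 / 100) * (5 * (1 + 1 / m ^ ((l + 1) / 2)))))) := by
  have hW := hP.isConfining_modPot hS
  have hm := hS.m_pos
  have hL := hS.L_pos
  have hδ := hS.δ_pos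
  have hl := hP.two_le
  have hLl := hP.Ll_pos
  have hk := hP.one_le
  have hprob := hW.isProbabilityMeasure
  have hD : 1 ≤ k + l - 1 := by linarith
  set D := k + l - 1 with hDdef
  have hD0 : 0 < D := by linarith
  set π := phaseMeasure (modPot U δ) with hπ
  have hpp : IsProbabilityMeasure π := hW.isProbabilityMeasure_phase
  have hfst : MeasurePreserving Prod.fst π (boltzmann (modPot U δ)) := measurePreserving_fst
  have hsnd : MeasurePreserving Prod.snd π (stdGaussian (Pos d)) := measurePreserving_snd
  set q := l + 1 with hq
  have hq2 : 2 ≤ q := by linarith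
  have eD : k + q - 2 = D := by rw [hq, hDdef]; ring
  set c₁ := (99 / 100 * m / D) ^ (q / 2) with hc₁
  set c₂ := (1 / D) ^ (q / 2) with hc₂
  set y := Real.sqrt m ^ (-(l - 2)) with hy
  have hy0 : 0 ≤ y := by positivity
  let S : J → Phase d → ℝ := fun j z => c₁ * ‖P j (z.1 - xs)‖ ^ q + c₂ * ‖P j z.2‖ ^ q
  have hS0 : ∀ j z, 0 ≤ S j z := fun j z => by positivity
  have i1 : ∀ j, Integrable (fun z : Phase d => c₁ * ‖P j (z.1 - xs)‖ ^ q) π := fun j =>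
    (hfst.integrable_comp_of_integrable (hP.moment_position_modPot hS j hq2).1).const_mul c₁
  have i2 : ∀ j, Integrable (fun z : Phase d => c₂ * ‖P j z.2‖ ^ q) π := fun j =>
    (hsnd.integrable_comp_of_integrable (hP.moment_velocity j hq2).1).const_mul c₂
  have iS : ∀ j, Integrable (S j) π := fun j => (i1 j).add (i2 j)
  -- The weights c₁ and c₂ are the inverses of the moment bounds, so each term contributes at most
  -- 1.
  have bS : ∀ j, ∫ z, S j z ∂π ≤ 2 := fun j => by
    have e1 : ∫ z, ‖P j (z.1 - xs)‖ ^ q ∂π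
        = ∫ x, ‖P j (x - xs)‖ ^ q ∂(boltzmann (modPot U δ)) := by
      rw [← hfst.map_eq, integral_map measurable_fst.aemeasurable]
      rw [hfst.map_eq]
      exact (hP.moment_position_modPot hS j hq2).1.aestronglyMeasurable
    have e2 : ∫ z, ‖P j z.2‖ ^ q ∂π = ∫ v, ‖P j v‖ ^ q ∂(stdGaussian (Pos d)) := by
      rw [← hsnd.map_eq, integral_map measurable_snd.aemeasurable]
      rw [hsnd.map_eq]
      exact (hP.moment_velocity j hq2).1.aestronglyMeasurable
    have b1 := (hP.moment_position_modPot hS j hq2).2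
    have b2 := (hP.moment_velocity j hq2).2
    rw [eD] at b1 b2
    have r1 : c₁ * (D / (99 / 100 * m)) ^ (q / 2) = 1 := by
      rw [hc₁, ← Real.mul_rpow (by positivity) (by positivity)]
      have : 99 / 100 * m / D * (D / (99 / 100 * m)) = 1 := by field_simp
      rw [this, Real.one_rpow]
    have r2 : c₂ * D ^ (q / 2) = 1 := by
      rw [hc₂, ← Real.mul_rpow (by positivity) (by positivity)]
      have : 1 / D * D = 1 := by field_simp
      rw [this, Real.one_rpow]
    rw [integral_add (i1 j) (i2 j), integral_const_mul, integral_const_mul, e1, e2]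
    have p1 : 0 ≤ c₁ := by positivity
    have p2 : 0 ≤ c₂ := by positivity
    have := mul_le_mul_of_nonneg_left b1 p1
    have := mul_le_mul_of_nonneg_left b2 p2
    linarith
  set A := δ ^ 3 * D ^ (q / 2) * 2 ^ (l - 2) * (107 / 100) with hA
  have hA0 : 0 ≤ A := by positivity
  have iF : ∀ j, Integrable (fun z => Ll / 24 * (A * (1 + (1 + y) * S j z))) π := fun j =>
    (((integrable_const 1).add ((iS j).const_mul _)).const_mul A).const_mul _
  have hpt : ∀ z, modPot U δ (verlet U δ z).1 + ‖(verlet U δ z).2‖ ^ 2 / 2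
        - (modPot U δ z.1 + ‖z.2‖ ^ 2 / 2) ≤ ∑ j, Ll / 24 * (A * (1 + (1 + y) * S j z)) := by
    intro z
    rw [modEnergy_verlet_sub]
    refine (le_abs_self _).trans ((hP.energy_error_le hS _ _).trans
      (Finset.sum_le_sum fun j _ => ?_))
    set h := δ • (z.2 - (δ / 2) • gradient U z.1) with hh
    have h1 : ‖P j h‖ ≤ δ * (‖P j z.2‖ + δ * L / 2 * ‖P j (z.1 - xs)‖) := by
      rw [hh, map_smul, norm_smul, Real.norm_of_nonneg hδ.le, map_sub, map_smul]
      gcongr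
      refine (norm_sub_le _ _).trans ?_
      rw [norm_smul, Real.norm_of_nonneg (by positivity)]
      have := hP.grad_lip j z.1 xs
      rw [hP.grad_xs, sub_zero] at this
      calc ‖P j z.2‖ + δ / 2 * ‖P j (gradient U z.1)‖
          ≤ ‖P j z.2‖ + δ / 2 * (L * ‖P j (z.1 - xs)‖) := by gcongr
        _ = _ := by ring
    have hδm : δ * Real.sqrt m ≤ 1 / 264 := by
      refine le_trans ?_ hS.δ_sqrt_le
      gcongr
      exact hS.m_le
    have h2 := energy_block_le (norm_nonneg (P j (z.1 - xs))) (norm_nonneg (P j z.2))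
      (norm_nonneg (P j h)) hδ hm hl hD h1 hS.δ_mul_L_le hδm
    rw [mul_assoc]
    gcongr
  rw [hW.gibbs_eq]
  calc ∫⁻ z : Phase d, ENNReal.ofReal (modPot U δ (verlet U δ z).1 + ‖(verlet U δ z).2‖ ^ 2 / 2
        - (modPot U δ z.1 + ‖z.2‖ ^ 2 / 2)) ∂π
      ≤ ∫⁻ z, ENNReal.ofReal (∑ j, Ll / 24 * (A * (1 + (1 + y) * S j z))) ∂π :=
        lintegral_mono fun z => ENNReal.ofReal_le_ofReal (hpt z)
    _ = ENNReal.ofReal (∫ z, ∑ j, Ll / 24 * (A * (1 + (1 + y) * S j z)) ∂π) :=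
        (ofReal_integral_eq_lintegral_ofReal (integrable_finsetSum _ fun j _ => iF j)
          (Eventually.of_forall fun z => Finset.sum_nonneg fun j _ => by
            have := hS0 j z
            positivity)).symm
    _ ≤ _ := by
        apply ENNReal.ofReal_le_ofReal
        rw [integral_finsetSum _ fun j _ => iF j]
        calc ∑ j, ∫ z, Ll / 24 * (A * (1 + (1 + y) * S j z)) ∂π
            ≤ ∑ _j : J, Ll / 24 * (A * (5 * (1 + 1 / m ^ (q / 2)))) := by
              refine Finset.sum_le_sum fun j _ => ?_
              rw [integral_const_mul, integral_const_mul,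
                integral_add (integrable_const _) ((iS j).const_mul _), integral_const_mul]
              simp only [integral_const, probReal_univ, one_smul]
              gcongr
              -- With M = m^(-q/2) and y ≤ 1 + M, the mean is at most 1 + 2(1 + y) ≤ 5 + 2M ≤ 5(1 +
              -- M).
              have h1 := sqrt_rpow_neg_le hm (by linarith : 0 ≤ l - 2) (by linarith : l - 2 ≤ q)
              have h2 := bS j
              have h3 : (1 + y) * ∫ z, S j z ∂π ≤ (1 + y) * 2 := by gcongr
              have h4 : 0 ≤ 1 / m ^ (q / 2) := by positivity
              linarith
          _ = _ := by rw [Finset.sum_const, Finset.card_univ, nsmul_eq_mul]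

lemma le_K₈ {m L l δ : ℝ} (hm : 0 < m) (hL : 0 < L) (hδ : 0 < δ) (hl : 2 ≤ l) :
    8 * 2 ^ (l - 2) * (1 + 1 / m ^ ((l + 1) / 2)) ≤ K₈ m L l δ := by
  have e : (2 : ℝ) ^ (l + 1) = 8 * 2 ^ (l - 2) := by
    have : l + 1 = 3 + (l - 2) := by ring
    rw [this, Real.rpow_add two_pos]; norm_num
  have h1 : (1 : ℝ) ≤ (1 + δ + δ ^ 2 * L / 2) ^ (l - 2) :=
    Real.one_le_rpow (by have : 0 ≤ δ ^ 2 * L / 2 := by positivity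
                         linarith) (by linarith)
  have h2 : 1 ≤ (1 + δ * L / 2) ^ 3 := one_le_pow₀ (by
    have : 0 ≤ δ * L / 2 := by positivity
    linarith)
  unfold K₈
  rw [e]
  refine mul_le_mul_of_nonneg_right ?_ (by positivity)
  calc 8 * (2 : ℝ) ^ (l - 2) = 8 * 2 ^ (l - 2) * 1 * 1 := by ring
    _ ≤ _ := by gcongr

/-- One step of the chain almost preserves the modified Gibbs measure. -/
theorem tvLe_transition_modPot (hP : Blocks U m L Ll l k xs P) (hS : Setting U m L γ δ) :
    TVLe (transition U γ δ (gibbs (modPot U δ))) (gibbs (modPot U δ))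
      (Fintype.card J * (δ ^ 3 * (k + l - 1) ^ ((l + 1) / 2) * (Ll * K₈ m L l δ) / 35)) := by
  have hW := hP.isConfining_modPot hS
  have hprob := hW.isProbabilityMeasure
  have hm := hS.m_pos
  have hδ := hS.δ_pos
  have hk := hP.one_le
  have hl := hP.two_le
  have hLl := hP.Ll_pos
  have hv := measurePreserving_verlet hS.continuous_gradient δ
  have h1 : TVLe ((gibbs (modPot U δ)).map (verlet U δ)) (gibbs (modPot U δ)) _ :=
    tvLe_map_tilted (H := fun z : Phase d => modPot U δ z.1 + ‖z.2‖ ^ 2 / 2)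
      (by have := hS.continuous_modPot; exact Continuous.measurable (by fun_prop)) hv
      (hP.lintegral_energy_le hS)
  have h2 : TVLe ((gibbs (modPot U δ)).map (verlet U δ)) (gibbs (modPot U δ))
      (Fintype.card J * (δ ^ 3 * (k + l - 1) ^ ((l + 1) / 2) * (Ll * K₈ m L l δ) / 35)) := by
    refine h1.mono ?_
    have h3 := le_K₈ hm hS.L_pos hδ hl
    have hD : 0 < k + l - 1 := by linarith
    set y := (1 + 1 / m ^ ((l + 1) / 2)) with hy
    have hy0 : 0 ≤ y := by positivity
    have h2l : (0 : ℝ) ≤ 2 ^ (l - 2) := by positivity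
    have hp := mul_nonneg h2l hy0
    -- Numerically 1.07 · 5/24 is just below 8/35, and 8 is the factor supplied by `le_K₈`.
    have h4 : 2 ^ (l - 2) * (107 / 100) * (5 * y) / 24 ≤ K₈ m L l δ / 35 := by linarith
    calc (Fintype.card J : ℝ) * (Ll / 24 * (δ ^ 3 * (k + l - 1) ^ ((l + 1) / 2)
        * 2 ^ (l - 2) * (107 / 100) * (5 * y)))
        = Fintype.card J * (δ ^ 3 * (k + l - 1) ^ ((l + 1) / 2) * Ll
          * (2 ^ (l - 2) * (107 / 100) * (5 * y) / 24)) := by ring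
      _ ≤ Fintype.card J * (δ ^ 3 * (k + l - 1) ^ ((l + 1) / 2) * Ll * (K₈ m L l δ / 35)) := by
          gcongr
      _ = _ := by ring
  have hR : MeasurePreserving (fun p : Phase d × Pos d => refresh (damping γ δ) p.1 p.2)
      ((gibbs (modPot U δ)).prod (stdGaussian (Pos d))) (gibbs (modPot U δ)) := by
    rw [hW.gibbs_eq]; exact measurePreserving_refresh _ hS.damping_sq_le
  have hpg : IsProbabilityMeasure (gibbs (modPot U δ)) := by
    rw [hW.gibbs_eq]; exact hW.isProbabilityMeasure_phase
  have hpv : IsProbabilityMeasure ((gibbs (modPot U δ)).map (verlet U δ)) :=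
    Measure.isProbabilityMeasure_map hv.measurable.aemeasurable
  have hA := (measurePreserving_prodAssoc (gibbs (modPot U δ)) (stdGaussian (Pos d))
    (stdGaussian (Pos d))).symm MeasurableEquiv.prodAssoc
  have hΦ : MeasurePreserving (verlet U δ) (gibbs (modPot U δ))
      ((gibbs (modPot U δ)).map (verlet U δ)) := ⟨hv.measurable, rfl⟩
  have hB := ((hΦ.comp hR).prod (MeasurePreserving.id (stdGaussian (Pos d)))).comp hA
  -- The first refreshment leaves the modified measure invariant and the second cannot increase the
  -- total variation, so only the Verlet map counts.
  have e : transition U γ δ (gibbs (modPot U δ))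
      = (((gibbs (modPot U δ)).map (verlet U δ)).prod (stdGaussian (Pos d))).map
        fun p => refresh (damping γ δ) p.1 p.2 := by
    rw [Setting.transition_eq, ← hB.map_eq, Measure.map_map (measurable_refresh _) hB.measurable]
    congr 1
    ext1 q
    rw [obaboStep_eq_sandwich]
    rfl
  have h3 := h2.map_prod (n := stdGaussian (Pos d)) (measurable_refresh (damping γ δ))
  rw [hR.map_eq, ← e] at h3
  exact h3

end Blocks

/-! ### Smoothing by the noise of one step -/

namespace Setting

variable {d : ℕ} {U : Pos d → ℝ} {m L γ δ : ℝ}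

lemma damping_sq_lt (hS : Setting U m L γ δ) : damping γ δ ^ 2 < 1 := by
  have h : damping γ δ < 1 := by
    unfold damping
    rw [← Real.exp_zero, Real.exp_lt_exp]
    have := mul_pos hS.δ_pos hS.γ_pos; linarith
  have h0 : 0 < damping γ δ := Real.exp_pos _
  nlinarith

/-- Shift of the noise that compensates a difference `Δ` of initial conditions, where `g` is the
difference of the gradients. -/
def noiseShift (γ δ : ℝ) (Δ : Phase d) (g : Pos d) : Phase d :=
  ((1 / (δ * Real.sqrt (1 - damping γ δ ^ 2))) •
      (Δ.1 + (δ * damping γ δ) • Δ.2 - (δ ^ 2 / 2) • g),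
    -(damping γ δ / (δ * Real.sqrt (1 - damping γ δ ^ 2))) • Δ.1)

/-- The first noise is shifted so that the new positions coincide; the gradients there are then
equal, whatever the potential. The remaining discrepancy of velocities is affine and is removed by
shifting the second noise. -/
lemma obaboStep_eq_shift (hS : Setting U m L γ δ) (z w ξ : Phase d) :
    obaboStep U γ δ z ξ
      = obaboStep U γ δ w (ξ + noiseShift γ δ (z - w) (gradient U z.1 - gradient U w.1)) := by
  set s := Real.sqrt (1 - damping γ δ ^ 2) with hs
  have hs0 : 0 < s := Real.sqrt_pos.2 (by linarith [hS.damping_sq_lt])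
  have hδ := hS.δ_pos
  set η := damping γ δ with hη
  set b := noiseShift γ δ (z - w) (gradient U z.1 - gradient U w.1) with hb
  have e1 : (δ * s) • b.1 = z.1 - w.1 + (δ * η) • (z.2 - w.2)
      - (δ ^ 2 / 2) • (gradient U z.1 - gradient U w.1) := by
    rw [hb, noiseShift, smul_smul, mul_one_div_cancel (by positivity), one_smul]
    rfl
  have e2 : s • b.2 = -(η / δ) • (z.1 - w.1) := by
    rw [hb, noiseShift, smul_smul, ← hη, ← hs]
    congr 1
    field_simp
  have hx : stepPos U γ δ z ξ.1 = stepPos U γ δ w (ξ.1 + b.1) := by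
    unfold stepPos
    rw [← hs, ← hη]
    have : w.1 + δ • (η • w.2 + s • (ξ.1 + b.1)) - (δ ^ 2 / 2) • gradient U w.1
        = w.1 + δ • (η • w.2 + s • ξ.1) - (δ ^ 2 / 2) • gradient U w.1 + (δ * s) • b.1 := by module
    rw [this, e1]
    module
  refine Prod.ext hx ?_
  change stepVel U γ δ z ξ.1 ξ.2 = stepVel U γ δ w (ξ.1 + b.1) (ξ.2 + b.2)
  unfold stepVel
  rw [← hs, ← hη, ← hx]
  have e3 : (s * η) • b.1 = (η / δ) • ((δ * s) • b.1) := by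
    rw [smul_smul]; congr 1; field_simp
  have e4 : (η / δ) • (z.1 - w.1 + (δ * η) • (z.2 - w.2)
      - (δ ^ 2 / 2) • (gradient U z.1 - gradient U w.1))
      = (η / δ) • (z.1 - w.1) + (η ^ 2) • (z.2 - w.2)
        - (δ * η / 2) • (gradient U z.1 - gradient U w.1) := by
    have k1 : η / δ * (δ * η) = η ^ 2 := by field_simp
    have k2 : η / δ * (δ ^ 2 / 2) = δ * η / 2 := by field_simp
    rw [smul_sub, smul_add, smul_smul, smul_smul, k1, k2]
  have : s • (η • (ξ.1 + b.1) + (ξ.2 + b.2))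
      = s • (η • ξ.1 + ξ.2) + (s * η) • b.1 + s • b.2 := by module
  rw [this, e3, e1, e4, e2]
  module

/-- The position noise has amplitude δ√(1 - η²), hence the denominator. The two components are at
most 1.6 and 1.5 times the modified distance; their sum is rounded up to 4, and 3/2 · 4 = 6. -/
lemma noiseShift_le (hS : Setting U m L γ δ) (z w : Phase d) :
    3 / 2 * (‖(noiseShift γ δ (z - w) (gradient U z.1 - gradient U w.1)).1‖
        + ‖(noiseShift γ δ (z - w) (gradient U z.1 - gradient U w.1)).2‖)
      ≤ 6 / (δ * Real.sqrt (1 - damping γ δ ^ 2)) * starDist L γ (z, w) := by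
  set s := Real.sqrt (1 - damping γ δ ^ 2) with hs
  have hs0 : 0 < s := Real.sqrt_pos.2 (by linarith [hS.damping_sq_lt])
  have hδ := hS.δ_pos
  have hL := hS.L_pos
  have hη0 : 0 ≤ damping γ δ := (Real.exp_pos _).le
  have hη1 : damping γ δ ≤ 1 := by nlinarith [hS.damping_sq_le]
  have hsL := Real.sqrt_pos.2 hL
  have hδL := hS.δ_sqrt_le
  have hδL0 : 0 < δ * Real.sqrt L := by positivity
  set N := starDist L γ (z, w) with hN
  have hN0 : 0 ≤ N := starDist_nonneg _
  have hb := (starNorm_sq_bounds hL hS.γ_ge (z - w)).1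
  change (‖z.1 - w.1‖ ^ 2 + ‖z.2 - w.2‖ ^ 2 / L) / 2 ≤ N ^ 2 at hb
  have hx : ‖z.1 - w.1‖ ≤ 3 / 2 * N := by
    refine le_of_sq_le_sq ?_ (by positivity)
    have : 0 ≤ ‖z.2 - w.2‖ ^ 2 / L := by positivity
    nlinarith [sq_nonneg N]
  have hv : ‖z.2 - w.2‖ ≤ Real.sqrt L * (3 / 2 * N) := by
    refine le_of_sq_le_sq ?_ (by positivity)
    rw [mul_pow, Real.sq_sqrt hL.le]
    have : ‖z.2 - w.2‖ ^ 2 / L ≤ (3 / 2 * N) ^ 2 := by nlinarith [sq_nonneg N, sq_nonneg ‖z.1 - w.1‖]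
    rwa [div_le_iff₀' hL] at this
  have hg : ‖gradient U z.1 - gradient U w.1‖ ≤ L * (3 / 2 * N) := (hS.lip _ _).trans (by gcongr)
  have h1 : ‖(z - w).1 + (δ * damping γ δ) • (z - w).2
      - (δ ^ 2 / 2) • (gradient U z.1 - gradient U w.1)‖ ≤ 16 / 10 * N := by
    refine (norm_sub_le _ _).trans ((add_le_add_left (norm_add_le _ _) _).trans ?_)
    rw [norm_smul, norm_smul, Real.norm_of_nonneg (by positivity), Real.norm_of_nonneg (by positivity)]
    change ‖z.1 - w.1‖ + δ * damping γ δ * ‖z.2 - w.2‖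
      + δ ^ 2 / 2 * ‖gradient U z.1 - gradient U w.1‖ ≤ _
    have h2 : δ * damping γ δ * ‖z.2 - w.2‖ ≤ 1 / 264 * (3 / 2 * N) := by
      calc δ * damping γ δ * ‖z.2 - w.2‖ ≤ δ * 1 * (Real.sqrt L * (3 / 2 * N)) := by gcongr
        _ = (δ * Real.sqrt L) * (3 / 2 * N) := by ring
        _ ≤ _ := by gcongr
    have h3 : δ ^ 2 / 2 * ‖gradient U z.1 - gradient U w.1‖ ≤ (1 / 264) ^ 2 / 2 * (3 / 2 * N) := by
      calc δ ^ 2 / 2 * ‖gradient U z.1 - gradient U w.1‖ ≤ δ ^ 2 / 2 * (L * (3 / 2 * N)) := by gcongr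
        _ = (δ * Real.sqrt L) ^ 2 / 2 * (3 / 2 * N) := by rw [mul_pow, Real.sq_sqrt hL.le]; ring
        _ ≤ _ := by gcongr
    linarith
  have h2 : damping γ δ * ‖(z - w).1‖ ≤ 1 * (3 / 2 * N) := by gcongr; exact hx
  unfold noiseShift
  simp only [norm_smul, norm_neg]
  rw [← hs, Real.norm_of_nonneg (by positivity : 0 ≤ 1 / (δ * s)),
    Real.norm_of_nonneg (by positivity : 0 ≤ damping γ δ / (δ * s))]
  calc 3 / 2 * (1 / (δ * s) * ‖(z - w).1 + (δ * damping γ δ) • (z - w).2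
        - (δ ^ 2 / 2) • (gradient U z.1 - gradient U w.1)‖ + damping γ δ / (δ * s) * ‖(z - w).1‖)
      = 3 / 2 / (δ * s) * (‖(z - w).1 + (δ * damping γ δ) • (z - w).2
        - (δ ^ 2 / 2) • (gradient U z.1 - gradient U w.1)‖ + damping γ δ * ‖(z - w).1‖) := by ring
    _ ≤ 3 / 2 / (δ * s) * (4 * N) := by gcongr; linarith
    _ = _ := by ring


lemma isProbabilityMeasure_iterate (hS : Setting U m L γ δ) {μ : Measure (Phase d)}
    (hμ : IsProbabilityMeasure μ) (n : ℕ) : IsProbabilityMeasure ((transition U γ δ)^[n] μ) := by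
  induction n with
  | zero => exact hμ
  | succ n ih =>
    rw [Function.iterate_succ_apply', transition_eq]
    exact Measure.isProbabilityMeasure_map hS.measurable_obaboStep.aemeasurable

/-- Laws that can be coupled become close in total variation after one step. -/
theorem tvLe_transition_of_coupling (hS : Setting U m L γ δ) {μ ν : Measure (Phase d)}
    [IsProbabilityMeasure μ] [IsProbabilityMeasure ν] {c : Measure (Phase d × Phase d)}
    (hc : IsCoupling c μ ν) {a : ℝ} (ha : eLpNorm (starDist L γ) 1 c ≤ ENNReal.ofReal a) :
    TVLe (transition U γ δ μ) (transition U γ δ ν)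
      (6 / (δ * Real.sqrt (1 - damping γ δ ^ 2)) * a) := by
  have := hc.isProbabilityMeasure
  intro f hf hf1
  set C := 6 / (δ * Real.sqrt (1 - damping γ δ ^ 2)) with hC
  have hC0 : 0 ≤ C := by have := hS.δ_pos; positivity
  have hm := hS.measurable_obaboStep
  have hfm : Measurable fun q : Phase d × Phase d => f (obaboStep U γ δ q.1 q.2) := hf.comp hm
  have hF : Measurable fun z => ∫⁻ ξ, f (obaboStep U γ δ z ξ) ∂(noise d) :=
    hfm.lintegral_prod_right'
  have key : ∀ τ : Measure (Phase d), IsProbabilityMeasure τ →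
      ∫⁻ x, f x ∂(transition U γ δ τ) = ∫⁻ z, ∫⁻ ξ, f (obaboStep U γ δ z ξ) ∂(noise d) ∂τ := by
    intro τ _
    rw [transition_eq, lintegral_map hf hm, lintegral_prod _ hfm.aemeasurable]
  have hstep : ∀ z w : Phase d, ∫⁻ ξ, f (obaboStep U γ δ z ξ) ∂(noise d)
      ≤ ∫⁻ ξ, f (obaboStep U γ δ w ξ) ∂(noise d) + ENNReal.ofReal (C * starDist L γ (z, w)) := by
    intro z w
    have hfw : Measurable fun ξ => f (obaboStep U γ δ w ξ) := hfm.comp measurable_prodMk_left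
    have h1 := tvLe_noise_shift (noiseShift γ δ (z - w) (gradient U z.1 - gradient U w.1)) _ hfw
      fun ξ => hf1 _
    rw [lintegral_map hfw (measurable_add_const _)] at h1
    simp_rw [← hS.obaboStep_eq_shift] at h1
    exact h1.trans (add_le_add_right (ENNReal.ofReal_le_ofReal (hS.noiseShift_le z w)) _)
  rw [key μ inferInstance, key ν inferInstance]
  have e1 : ∫⁻ z, ∫⁻ ξ, f (obaboStep U γ δ z ξ) ∂(noise d) ∂μ
      = ∫⁻ q, ∫⁻ ξ, f (obaboStep U γ δ q.1 ξ) ∂(noise d) ∂c := by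
    rw [← hc.1, lintegral_map hF measurable_fst]
  have e2 : ∫⁻ z, ∫⁻ ξ, f (obaboStep U γ δ z ξ) ∂(noise d) ∂ν
      = ∫⁻ q, ∫⁻ ξ, f (obaboStep U γ δ q.2 ξ) ∂(noise d) ∂c := by
    rw [← hc.2, lintegral_map hF measurable_snd]
  rw [e1, e2]
  have hF2 : Measurable fun q : Phase d × Phase d => ∫⁻ ξ, f (obaboStep U γ δ q.2 ξ) ∂(noise d) :=
    hF.comp measurable_snd
  calc ∫⁻ q, ∫⁻ ξ, f (obaboStep U γ δ q.1 ξ) ∂(noise d) ∂c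
      ≤ ∫⁻ q, (∫⁻ ξ, f (obaboStep U γ δ q.2 ξ) ∂(noise d)
          + ENNReal.ofReal (C * starDist L γ q)) ∂c := lintegral_mono fun q => hstep q.1 q.2
    _ = ∫⁻ q, ∫⁻ ξ, f (obaboStep U γ δ q.2 ξ) ∂(noise d) ∂c
          + ENNReal.ofReal C * eLpNorm (starDist L γ) 1 c := by
        rw [lintegral_add_left hF2, eLpNorm_one_eq_lintegral_enorm,
          ← lintegral_const_mul' _ _ ENNReal.ofReal_ne_top]
        congr 1
        refine lintegral_congr fun q => ?_
        rw [ENNReal.ofReal_mul hC0, Real.enorm_of_nonneg (starDist_nonneg _)]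
    _ ≤ _ := by
        rw [ENNReal.ofReal_mul hC0]
        gcongr

/-- Parallel coupling of two copies of the chain. -/
lemma exists_coupling_iterate (hS : Setting U m L γ δ) {μ ν : Measure (Phase d)}
    [hμ : IsProbabilityMeasure μ] [hν : IsProbabilityMeasure ν] {c : Measure (Phase d × Phase d)}
    (hc : IsCoupling c μ ν) {a : ℝ} (ha : eLpNorm (starDist L γ) 1 c ≤ ENNReal.ofReal a) (n : ℕ) :
    ∃ c', IsCoupling c' ((transition U γ δ)^[n] μ) ((transition U γ δ)^[n] ν) ∧
      eLpNorm (starDist L γ) 1 c' ≤ ENNReal.ofReal ((1 - δ * κ m γ) ^ n * a) := by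
  have hρ := hS.ρ_bounds.1
  induction n with
  | zero => exact ⟨c, hc, by simpa using ha⟩
  | succ n ih =>
    obtain ⟨c', hc', hn⟩ := ih
    have h1 := hS.isProbabilityMeasure_iterate hμ n
    have h2 := hS.isProbabilityMeasure_iterate hν n
    rw [Function.iterate_succ_apply', Function.iterate_succ_apply']
    refine ⟨_, isCoupling_stepCoupling hS.measurable_obaboStep hS.measurable_obaboStep rfl rfl hc', ?_⟩
    · refine (hS.eLpNorm_stepCoupling_le hS.measurable_obaboStep le_rfl (E := fun _ => 0)
        measurable_const (fun y ξ => ?_) hc').trans ?_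
      · rw [sub_self]; simp [starNorm, starMap]
      · rw [eLpNorm_zero', add_zero, pow_succ', mul_assoc, ENNReal.ofReal_mul hρ]
        gcongr

lemma tvLe_iterate (hS : Setting U m L γ δ) {μ ν : Measure (Phase d)}
    [hμ : IsProbabilityMeasure μ] [hν : IsProbabilityMeasure ν] {a : ℝ} (h : TVLe μ ν a) (n : ℕ) :
    TVLe ((transition U γ δ)^[n] μ) ((transition U γ δ)^[n] ν) a := by
  induction n with
  | zero => exact h
  | succ n ih =>
    have h1 := hS.isProbabilityMeasure_iterate hμ n
    have h2 := hS.isProbabilityMeasure_iterate hν n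
    rw [Function.iterate_succ_apply', Function.iterate_succ_apply']
    exact ih.map_prod hS.measurable_obaboStep

lemma tvLe_iterate_self (hS : Setting U m L γ δ) {μ : Measure (Phase d)}
    [hμ : IsProbabilityMeasure μ] {a : ℝ} (ha : 0 ≤ a) (h : TVLe (transition U γ δ μ) μ a) (n : ℕ) :
    TVLe ((transition U γ δ)^[n] μ) μ (n * a) := by
  induction n with
  | zero => intro f hf hf1; simp
  | succ n ih =>
    have h1 := hS.isProbabilityMeasure_iterate hμ 1
    have h2 := hS.tvLe_iterate (μ := transition U γ δ μ) (ν := μ) (hμ := h1) h n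
    rw [Function.iterate_succ_apply]
    refine (h2.trans ih ha (by positivity)).mono (le_of_eq ?_)
    push_cast; ring

/-- Total variation bound from a coupling, smoothing, and an almost invariant measure. -/
theorem tvLe_of_coupling (hS : Setting U m L γ δ) {μ π π' : Measure (Phase d)}
    (hμ : IsInvariantProb U γ δ μ) [hπ : IsProbabilityMeasure π] [hπ' : IsProbabilityMeasure π']
    {c : Measure (Phase d × Phase d)} (hc : IsCoupling c μ π) {a e₂ e₃ : ℝ} (ha0 : 0 ≤ a)
    (ha : eLpNorm (starDist L γ) 1 c ≤ ENNReal.ofReal a) (h2 : 0 ≤ e₂) (h3 : 0 ≤ e₃)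
    (hππ' : TVLe π' π e₂) (hT : TVLe (transition U γ δ π') π' e₃) (n : ℕ) :
    TVLe μ π (6 / (δ * Real.sqrt (1 - damping γ δ ^ 2)) * ((1 - δ * κ m γ) ^ n * a)
      + 2 * e₂ + (n + 1) * e₃) := by
  have hμp := hμ.1
  have hρ := hS.ρ_bounds.1
  have hδ := hS.δ_pos
  obtain ⟨c', hc', hn⟩ := hS.exists_coupling_iterate hc ha n
  have p1 := hS.isProbabilityMeasure_iterate hμp n
  have p2 := hS.isProbabilityMeasure_iterate hπ n
  have k1 := hS.tvLe_transition_of_coupling hc' hn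
  rw [← Function.iterate_succ_apply' (transition U γ δ), ← Function.iterate_succ_apply'
    (transition U γ δ), Function.iterate_fixed hμ.2] at k1
  have k2 := hS.tvLe_iterate hππ'.symm (n + 1)
  have k3 := hS.tvLe_iterate_self h3 hT (n + 1)
  -- Write P for the transition. The chain of comparisons is μ = μPⁿ⁺¹, πPⁿ⁺¹ by coupling and
  -- smoothing, π'Pⁿ⁺¹ (cost e₂), π' (cost (n+1)e₃), and π (cost e₂).
  have k4 := ((k1.trans k2 (by positivity) h2).trans k3 (by positivity) (by positivity)).trans hππ'
    (by positivity) h2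
  refine k4.mono (le_of_eq ?_)
  push_cast; ring

end Setting

/-! ### The total variation bound -/

/-- The first bound is used for the smoothing term, the second for the comparison of the target with
the modified measure. -/
lemma one_le_K₁_sq {L : ℝ} (hL : 0 < L) :
    3 * (max 1 (Real.sqrt L) / Real.sqrt L) ≤ K₁ L ^ 2 ∧ 3 * L ≤ K₁ L ^ 2 := by
  have hs := Real.sqrt_pos.2 hL
  rw [Blocks.K₁_eq hL, mul_pow, Real.sq_sqrt (by norm_num)]
  set Q := max 1 (Real.sqrt L) with hQ
  have hQ1 : 1 ≤ Q := le_max_left _ _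
  have hQ2 : Real.sqrt L ≤ Q := le_max_right _ _
  constructor
  · gcongr
    have h1 : Q / Real.sqrt L * 1 ≤ Q / Real.sqrt L * (Q ^ 2 * (Q / Real.sqrt L)) := by
      gcongr
      exact one_le_mul_of_one_le_of_one_le (one_le_pow₀ hQ1) ((one_le_div hs).2 hQ2)
    calc Q / Real.sqrt L = Q / Real.sqrt L * 1 := (mul_one _).symm
      _ ≤ _ := h1
      _ = _ := by ring
  · gcongr
    have h1 : Real.sqrt L ≤ Q ^ 2 / Real.sqrt L := by
      rw [le_div_iff₀ hs]; nlinarith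
    calc L = Real.sqrt L ^ 2 := (Real.sq_sqrt hL.le).symm
      _ ≤ _ := by gcongr

/-- The maximum in `K₂` is at least 2 and 1/√(2π) ≥ 1/3 because 2π ≤ 9. -/
lemma le_K₂ {L γ δ : ℝ} (hL : 0 < L) (hδ : 0 < δ) (h : damping γ δ ^ 2 < 1) :
    2 / 3 * (Real.sqrt δ / Real.sqrt (1 - damping γ δ ^ 2)) ≤ K₂ L γ δ := by
  have hs : 0 < 1 - damping γ δ ^ 2 := by linarith
  have h1 : Real.sqrt δ / Real.sqrt (1 - damping γ δ ^ 2) / 3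
      ≤ Real.sqrt (δ / (2 * Real.pi * (1 - damping γ δ ^ 2))) := by
    rw [← Real.sqrt_div hδ.le]
    apply Real.le_sqrt_of_sq_le
    rw [div_pow, Real.sq_sqrt (by positivity), div_div]
    exact div_le_div_of_nonneg_left hδ.le (by positivity) (by nlinarith [Real.pi_lt_four])
  have h2 : 2 ≤ max (2 + 3 * δ ^ 2 * L / 2) (3 * δ) := by
    refine le_max_of_le_left ?_
    have : 0 ≤ 3 * δ ^ 2 * L / 2 := by positivity
    linarith
  unfold K₂
  calc 2 / 3 * (Real.sqrt δ / Real.sqrt (1 - damping γ δ ^ 2))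
      = Real.sqrt δ / Real.sqrt (1 - damping γ δ ^ 2) / 3 * 2 := by ring
    _ ≤ _ := by gcongr

lemma le_K₇ {m L δ : ℝ} (hm : 0 < m) (hL : 0 < L) (hδ : 0 < δ) : L ≤ K₇ m L δ := by
  have h1 : 1 ≤ 1 + δ * L := by
    have : 0 ≤ δ * L := by positivity
    linarith
  have h2 : 1 ≤ 1 + δ ^ 2 * L ^ 2 / (4 * m) := by
    have : 0 ≤ δ ^ 2 * L ^ 2 / (4 * m) := by positivity
    linarith
  unfold K₇
  calc L = L * 1 * 1 := by ring
    _ ≤ _ := by gcongr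

/-- Used with y = δ³D: the logarithmic number of contracting steps must gain √y = δ√δ√D, the loss
incurred by smoothing, together with a numerical factor e⁻⁶. -/
lemma exp_neg_abs_log_le {y : ℝ} (hy : 0 < y) :
    Real.exp (-(3 * (2 + |Real.log y|))) ≤ 1 / 100 * Real.sqrt y := by
  have h6 : Real.exp (-6) ≤ 1 / 100 := by
    have h1 : (27 / 10 : ℝ) ≤ Real.exp 1 := by linarith [Real.exp_one_gt_d9]
    have h2 : Real.exp 6 = Real.exp 1 ^ 6 := by rw [← Real.exp_nat_mul]; norm_num
    have h3 : (100 : ℝ) ≤ Real.exp 6 := by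
      rw [h2]
      calc (100 : ℝ) ≤ (27 / 10) ^ 6 := by norm_num
        _ ≤ _ := by gcongr
    rw [Real.exp_neg, ← one_div]
    gcongr
  have h1 : -(3 * (2 + |Real.log y|)) ≤ -6 + Real.log y / 2 := by
    have := neg_abs_le (Real.log y)
    have := abs_nonneg (Real.log y)
    linarith
  calc Real.exp (-(3 * (2 + |Real.log y|))) ≤ Real.exp (-6 + Real.log y / 2) :=
        Real.exp_le_exp.2 h1
    _ = Real.exp (-6) * Real.sqrt y := by
        rw [Real.exp_add, Real.exp_half, Real.exp_log hy]
    _ ≤ _ := by gcongr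

namespace Setting

variable {d : ℕ} {U : Pos d → ℝ} {m L γ δ : ℝ}

lemma _root_.OBABO.one_sub_damping_sq_le (γ δ : ℝ) : 1 - damping γ δ ^ 2 ≤ δ * γ := by
  have h : damping γ δ ^ 2 = Real.exp (-(δ * γ)) := by
    unfold damping; rw [← Real.exp_nat_mul]; congr 1; push_cast; ring
  rw [h]
  linarith [Real.add_one_le_exp (-(δ * γ))]

/-- Smoothing costs 1/(δs) with s = √(1 - η²), and the contraction gains δ√δ√D. What remains is
√δ/s, absorbed by K₂, and √D, which raises the exponent l/2 to (l + 1)/2. The factor 24 is 6 from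
smoothing, 2 from the normalization of the total variation and 2 from the slack in the coupling. -/
lemma smoothing_le (hS : Setting U m L γ δ) {B D l Λ : ℝ} (hB : 0 ≤ B) (hD : 0 < D) {n : ℕ}
    (hΛ : Λ = 2 + |Real.log (δ ^ 3 * D)|) (hn : 3 * Λ ≤ n * (δ * κ m γ)) :
    24 / (δ * Real.sqrt (1 - damping γ δ ^ 2)) * ((1 - δ * κ m γ) ^ n
        * (Real.sqrt (3 / 2) * (max 1 (Real.sqrt L) / Real.sqrt L)
          * (2 * δ ^ 3 * D ^ (l / 2) * B) / (δ * κ m γ)))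
      ≤ δ ^ 2 * Λ * D ^ ((l + 1) / 2) * (K₁ L ^ 2 * K₂ L γ δ * B) / κ m γ := by
  have hδ := hS.δ_pos
  have hL := hS.L_pos
  have hκ := hS.κ_pos
  have hρ := hS.ρ_bounds.1
  set s := Real.sqrt (1 - damping γ δ ^ 2) with hs
  have hs0 : 0 < s := Real.sqrt_pos.2 (by linarith [hS.damping_sq_lt])
  have hsL := Real.sqrt_pos.2 hL
  set q := max 1 (Real.sqrt L) / Real.sqrt L with hq
  have hq0 : 0 ≤ q := by positivity
  have hk1 := (one_le_K₁_sq hL).1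
  have hk2 := le_K₂ hL hδ hS.damping_sq_lt
  rw [← hq] at hk1
  rw [← hs] at hk2
  have hpow : (1 - δ * κ m γ) ^ n ≤ 1 / 100 * (δ * Real.sqrt δ * Real.sqrt D) := by
    calc (1 - δ * κ m γ) ^ n ≤ Real.exp (-(δ * κ m γ)) ^ n := by
          gcongr
          linarith [Real.add_one_le_exp (-(δ * κ m γ))]
      _ = Real.exp (-(n * (δ * κ m γ))) := by rw [← Real.exp_nat_mul]; congr 1; ring
      _ ≤ Real.exp (-(3 * Λ)) := Real.exp_le_exp.2 (by linarith)
      _ ≤ 1 / 100 * Real.sqrt (δ ^ 3 * D) := by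
          rw [hΛ]; exact exp_neg_abs_log_le (by positivity)
      _ = _ := by
          have : δ ^ 3 * D = δ ^ 2 * (δ * D) := by ring
          rw [this, Real.sqrt_mul (by positivity), Real.sqrt_sq hδ.le, Real.sqrt_mul hδ.le]
          ring
  have h32 : Real.sqrt (3 / 2) ≤ 13 / 10 := by
    rw [Real.sqrt_le_left (by norm_num)]; norm_num
  have hΛ2 : 2 ≤ Λ := by rw [hΛ]; linarith [abs_nonneg (Real.log (δ ^ 3 * D))]
  have eD : D ^ ((l + 1) / 2) = Real.sqrt D * D ^ (l / 2) := by
    rw [Real.sqrt_eq_rpow, ← Real.rpow_add hD]; congr 1; ring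
  have hDl : 0 ≤ D ^ (l / 2) := by positivity
  calc 24 / (δ * s) * ((1 - δ * κ m γ) ^ n * (Real.sqrt (3 / 2) * q
          * (2 * δ ^ 3 * D ^ (l / 2) * B) / (δ * κ m γ)))
      ≤ 24 / (δ * s) * (1 / 100 * (δ * Real.sqrt δ * Real.sqrt D) * (13 / 10 * q
          * (2 * δ ^ 3 * D ^ (l / 2) * B) / (δ * κ m γ))) := by gcongr
    _ = 624 / 1000 * (δ ^ 2 * (Real.sqrt D * D ^ (l / 2)) / κ m γ * (q * (Real.sqrt δ / s) * B)) := by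
        field_simp; ring
    _ ≤ 4 * (δ ^ 2 * (Real.sqrt D * D ^ (l / 2)) / κ m γ * (q * (Real.sqrt δ / s) * B)) := by
        gcongr; norm_num
    _ = δ ^ 2 * 2 * (Real.sqrt D * D ^ (l / 2)) * ((3 * q) * (2 / 3 * (Real.sqrt δ / s)) * B)
          / κ m γ := by ring
    _ ≤ _ := by rw [eD]; gcongr

/-- The comparison of the two Gibbs measures produces L²/m, to be absorbed by the available
constants over κ = m/(3γ). If L ≤ 1 the term K₇ ≥ L suffices because L ≤ √L ≤ γ. If L ≥ 1, the bound
1 - η² ≤ δγ gives K₂ ≥ 2/(3√γ), so that 6γK₁²K₂B is at least 2L²√γ. -/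
lemma comparison_le (hS : Setting U m L γ δ) {B : ℝ} (hB : L / 6 ≤ B) :
    L ^ 2 / m ≤ 2 * (K₁ L ^ 2 * K₂ L γ δ * B + K₇ m L δ) / κ m γ := by
  have hδ := hS.δ_pos
  have hL := hS.L_pos
  have hm := hS.m_pos
  have hγ := hS.γ_pos
  have hγ2 := hS.γ_ge
  have hs := Real.sqrt_pos.2 hL
  have hss : Real.sqrt L ^ 2 = L := Real.sq_sqrt hL.le
  have hk1 := (one_le_K₁_sq hL).2
  have hk2 := le_K₂ hL hδ hS.damping_sq_lt
  have hk7 := le_K₇ hm hL hδ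
  have hB0 : 0 < B := by linarith
  have hk20 : 0 ≤ K₂ L γ δ := le_trans (by positivity) hk2
  suffices h : L ^ 2 ≤ 6 * γ * (K₁ L ^ 2 * K₂ L γ δ * B + K₇ m L δ) by
    unfold κ
    rw [div_le_div_iff₀ hm (by positivity)]
    have e : 2 * (K₁ L ^ 2 * K₂ L γ δ * B + K₇ m L δ) * m
      = 6 * γ * (K₁ L ^ 2 * K₂ L γ δ * B + K₇ m L δ) * (m / (3 * γ)) := by field_simp; ring
    rw [e]
    gcongr
  rcases le_total L 1 with h1 | h1
  · have hsl : L ≤ Real.sqrt L := Real.le_sqrt_of_sq_le (by nlinarith)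
    have : 0 ≤ K₁ L ^ 2 * K₂ L γ δ * B := by positivity
    calc L ^ 2 = L * L := sq L
      _ ≤ (6 * γ) * K₇ m L δ := by gcongr; linarith
      _ ≤ _ := by gcongr; linarith
  · have hγ1 : 1 ≤ Real.sqrt γ := by
      refine Real.one_le_sqrt.2 ?_
      have := Real.one_le_sqrt.2 h1
      linarith
    have hγγ : Real.sqrt γ ^ 2 = γ := Real.sq_sqrt hγ.le
    have hg0 : 0 < Real.sqrt γ := by linarith
    have h2 : 2 / 3 * (1 / Real.sqrt γ) ≤ K₂ L γ δ := by
      refine le_trans ?_ hk2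
      have hs0 : 0 < Real.sqrt (1 - damping γ δ ^ 2) :=
        Real.sqrt_pos.2 (by linarith [hS.damping_sq_lt])
      gcongr ?_ * ?_
      rw [div_le_div_iff₀ hg0 hs0, one_mul, ← Real.sqrt_mul hδ.le]
      exact Real.sqrt_le_sqrt (one_sub_damping_sq_le γ δ)
    calc L ^ 2 ≤ 2 * L ^ 2 * Real.sqrt γ := by nlinarith [sq_nonneg L]
      _ = 6 * Real.sqrt γ ^ 2 * ((3 * L) * (2 / 3 * (1 / Real.sqrt γ)) * (L / 6)) := by
          field_simp
      _ ≤ 6 * γ * (K₁ L ^ 2 * K₂ L γ δ * B) := by rw [hγγ]; gcongr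
      _ ≤ _ := by gcongr; linarith

end Setting

namespace Blocks

variable {d : ℕ} {J : Type*} [Fintype J] {U : Pos d → ℝ} {m L Ll l k γ δ : ℝ} {xs : Pos d}
  {P : J → Pos d →L[ℝ] Pos d}

/-- The constant is spent as follows: one copy of K₁²K₂B pays for smoothing, the other copy with K₇
for the comparison of the target with the modified measure, and the term with K₈ for the accumulated
drift of the modified measure. -/
theorem tvNorm_le (hP : Blocks U m L Ll l k xs P) (hS : Setting U m L γ δ) [Nonempty J]
    {μ : Measure (Phase d)} (hμ : IsInvariantProb U γ δ μ)
    (hμm : ∀ p : ENNReal, 1 ≤ p → p ≠ ⊤ → MemLp (starNorm L γ) p μ) :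
    tvNorm μ (gibbs U) ≤ ENNReal.ofReal (δ ^ 2 * Fintype.card J
      * (2 + |Real.log (δ ^ 3 * (k + l - 1))|) * (k + l - 1) ^ ((l + 1) / 2)
        * constTV m L γ l Ll δ) := by
  have hμp := hμ.1
  have hδ := hS.δ_pos
  have hL := hS.L_pos
  have hm := hS.m_pos
  have hκ := hS.κ_pos
  have hl := hP.two_le
  have hk := hP.one_le
  have hLl := hP.Ll_pos
  have hδκ : 0 < δ * κ m γ := mul_pos hδ hκ
  set D := k + l - 1 with hDdef
  have hD1 : 1 ≤ D := by linarith
  have hD0 : 0 < D := by linarith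
  have hkD : k ≤ D := by linarith
  set N : ℝ := ((Fintype.card J : ℕ) : ℝ) with hN
  have hN1 : 1 ≤ N := by rw [hN]; exact_mod_cast Fintype.card_pos
  set B := K₅ m L δ + Ll * K₆ m L l δ with hB
  have hK6 : 0 ≤ K₆ m L l δ := le_trans (by positivity) (le_K₆ hm hL hδ hl)
  have hK8 : 0 ≤ K₈ m L l δ := le_trans (by positivity) (le_K₈ hm hL hδ hl)
  have hB6 : L / 6 ≤ B := by
    have h1 := le_K₅ (m := m) hL hδ
    have h2 : 0 ≤ L / (4 * Real.sqrt m) := by positivity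
    have h3 := mul_nonneg hLl.le hK6
    linarith
  have hB0 : 0 < B := by linarith
  set e₀ := Real.sqrt (3 / 2) * (max 1 (Real.sqrt L) / Real.sqrt L)
    * (2 * δ ^ 3 * D ^ (l / 2) * B) / (δ * κ m γ) with he₀
  have he0 : 0 < e₀ := by
    have := Real.sqrt_pos.2 hL
    positivity
  obtain ⟨c, hc, hce⟩ := hP.exists_coupling hS hμ hμm
    (Or.inl ⟨le_rfl, rfl⟩ : IsCombConst (Fintype.card J) 1 (Fintype.card J)) he0
  rw [ENNReal.ofReal_one] at hce
  -- The slack in the coupling is taken equal to e₀, whence 2N e₀. The L¹ estimate has scale k + l -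
  -- 2, enlarged to D = k + l - 1, the scale of the moments of order l + 1 in the energy error.
  have ha : eLpNorm (Setting.starDist L γ) 1 c ≤ ENNReal.ofReal (2 * N * e₀) := by
    refine hce.trans (ENNReal.ofReal_le_ofReal ?_)
    have h0 : 0 ≤ k + l * 1 - 2 := by linarith
    calc Real.sqrt (3 / 2) * (max 1 (Real.sqrt L) / Real.sqrt L)
          * (N * (2 * δ ^ 3 * (k + l * 1 - 2) ^ (l / 2) * B)) / (δ * κ m γ) + e₀
        ≤ Real.sqrt (3 / 2) * (max 1 (Real.sqrt L) / Real.sqrt L)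
          * (N * (2 * δ ^ 3 * D ^ (l / 2) * B)) / (δ * κ m γ) + e₀ := by
          gcongr
          linarith
      _ = N * e₀ + e₀ := by rw [he₀]; ring
      _ ≤ _ := by nlinarith
  have hp1 : IsProbabilityMeasure (gibbs U) := by
    rw [hS.isConfining.gibbs_eq]; exact hS.isConfining.isProbabilityMeasure_phase
  have hW := hP.isConfining_modPot hS
  have hp2 : IsProbabilityMeasure (gibbs (modPot U δ)) := by
    rw [hW.gibbs_eq]; exact hW.isProbabilityMeasure_phase
  set Λ := 2 + |Real.log (δ ^ 3 * D)| with hΛ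
  have hΛ2 : 2 ≤ Λ := by linarith [abs_nonneg (Real.log (δ ^ 3 * D))]
  -- Enough steps for (1 - δκ)ⁿ to fall below exp(-3Λ); n δκ exceeds 3Λ by at most one δκ.
  set n := ⌈3 * Λ / (δ * κ m γ)⌉₊ with hn
  have hn1 : 3 * Λ ≤ n * (δ * κ m γ) := (div_le_iff₀ hδκ).1 (Nat.le_ceil _)
  have hn2 : n * (δ * κ m γ) ≤ 3 * Λ + δ * κ m γ := by
    have h1 := (Nat.ceil_lt_add_one (by positivity : 0 ≤ 3 * Λ / (δ * κ m γ))).le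
    calc n * (δ * κ m γ) ≤ (3 * Λ / (δ * κ m γ) + 1) * (δ * κ m γ) := by gcongr
      _ = _ := by field_simp
  set e₂ := N * (δ ^ 2 * L ^ 2 * k / (7.92 * m)) with he₂
  set e₃ := N * (δ ^ 3 * D ^ ((l + 1) / 2) * (Ll * K₈ m L l δ) / 35) with he₃
  have hk0 : 0 ≤ k := by linarith
  refine (TVLe.tvNorm_le (hS.tvLe_of_coupling hμ hc (by positivity) ha
    (by positivity : 0 ≤ e₂) (by positivity : 0 ≤ e₃) (hP.tvLe_modPot hS)
    (hP.tvLe_transition_modPot hS) n)).trans (ENNReal.ofReal_le_ofReal ?_)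
  have k1 := hS.smoothing_le (l := l) hB0.le hD0 hΛ hn1
  rw [← he₀] at k1
  have k2 : 4 * (L ^ 2 * k / (7.92 * m))
      ≤ Λ * D ^ ((l + 1) / 2) * (K₁ L ^ 2 * K₂ L γ δ * B + K₇ m L δ) / κ m γ := by
    have h1 := hS.comparison_le hB6
    have h2 : k ≤ D ^ ((l + 1) / 2) := by
      calc k ≤ D ^ (1 : ℝ) := by rwa [Real.rpow_one]
        _ ≤ _ := Real.rpow_le_rpow_of_exponent_le hD1 (by linarith)
    have hpos : 0 ≤ (K₁ L ^ 2 * K₂ L γ δ * B + K₇ m L δ) / κ m γ := by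
      have : 0 ≤ L ^ 2 / m := by positivity
      rw [mul_div_assoc] at h1
      linarith
    calc 4 * (L ^ 2 * k / (7.92 * m)) = 4 / 7.92 * (k * (L ^ 2 / m)) := by field_simp
      _ ≤ 1 * (k * (L ^ 2 / m)) := by gcongr; norm_num
      _ ≤ 1 * (D ^ ((l + 1) / 2)
          * (2 * (K₁ L ^ 2 * K₂ L γ δ * B + K₇ m L δ) / κ m γ)) := by gcongr
      _ = 2 * D ^ ((l + 1) / 2) * ((K₁ L ^ 2 * K₂ L γ δ * B + K₇ m L δ) / κ m γ) := by ring
      _ ≤ Λ * D ^ ((l + 1) / 2) * ((K₁ L ^ 2 * K₂ L γ δ * B + K₇ m L δ) / κ m γ) := by gcongr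
      _ = _ := by ring
  -- The accumulated drift: (n + 1)δκ is at most 3Λ + 2/1000, so the factor 1/35 leaves ample room.
  have k3 : 2 * ((n + 1) * (δ * κ m γ)) / 35 ≤ Λ := by
    have := hS.δ_κ_le
    linarith
  have hDl : 0 ≤ D ^ ((l + 1) / 2) := by positivity
  have j1 := mul_le_mul_of_nonneg_left k1 (by linarith : 0 ≤ N)
  have j2 := mul_le_mul_of_nonneg_left k2 (by positivity : 0 ≤ N * δ ^ 2)
  have j3 := mul_le_mul_of_nonneg_left k3
    (by positivity : 0 ≤ N * δ ^ 2 * D ^ ((l + 1) / 2) * (Ll * K₈ m L l δ) / κ m γ)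
  have r3 : N * δ ^ 2 * D ^ ((l + 1) / 2) * (Ll * K₈ m L l δ) / κ m γ
      * (2 * ((n + 1) * (δ * κ m γ)) / 35) = 2 * ((n + 1) * e₃) := by
    rw [he₃]; field_simp
  rw [r3] at j3
  have r0 : δ ^ 2 * N * Λ * D ^ ((l + 1) / 2) * constTV m L γ l Ll δ
      = N * (δ ^ 2 * Λ * D ^ ((l + 1) / 2) * (K₁ L ^ 2 * K₂ L γ δ * B) / κ m γ)
        + N * δ ^ 2 * (Λ * D ^ ((l + 1) / 2) * (K₁ L ^ 2 * K₂ L γ δ * B + K₇ m L δ) / κ m γ)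
        + N * δ ^ 2 * D ^ ((l + 1) / 2) * (Ll * K₈ m L l δ) / κ m γ * Λ := by
    unfold constTV
    rw [← hB]; ring
  rw [r0]
  refine le_trans (le_of_eq ?_) (add_le_add (add_le_add j1 j2) j3)
  rw [he₂]
  ring

end Blocks

/-! ### Limits of the constants -/

lemma tendsto_K₅ (m L : ℝ) :
    Tendsto (fun t => K₅ m L t) (𝓝[>] 0) (𝓝 (L / (4 * Real.sqrt m) + L / 6)) := by
  have h : Continuous fun t => K₅ m L t := by unfold K₅; fun_prop
  have h2 := (h.tendsto 0).mono_left (nhdsWithin_le_nhds (s := Set.Ioi 0))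
  have e : K₅ m L 0 = L / (4 * Real.sqrt m) + L / 6 := by simp [K₅]
  rwa [e] at h2

lemma tendsto_K₇ (m L : ℝ) : Tendsto (fun t => K₇ m L t) (𝓝[>] 0) (𝓝 L) := by
  have h : Continuous fun t => K₇ m L t := by unfold K₇; fun_prop
  have h2 := (h.tendsto 0).mono_left (nhdsWithin_le_nhds (s := Set.Ioi 0))
  have e : K₇ m L 0 = L := by simp [K₇]
  rwa [e] at h2

lemma tendsto_K₆ (m L : ℝ) (l : ℝ) : Tendsto (fun t => K₆ m L l t) (𝓝[>] 0)
    (𝓝 ((2 : ℝ) ^ (l - 2) * (1 + 1 / m ^ (l / 2)))) := by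
  have h : ContinuousAt (fun t => K₆ m L l t) 0 := by
    unfold K₆
    have h1 : ContinuousAt (fun t : ℝ => (1 + t + Real.exp (L * t ^ 2) * (t ^ 3 / 6)) ^ (l - 2)) 0 :=
      ContinuousAt.rpow_const (Continuous.continuousAt (by fun_prop)) (Or.inl (by simp))
    have h2 : ContinuousAt (fun t : ℝ => (1 + t * L / 2) ^ l) 0 :=
      ContinuousAt.rpow_const (Continuous.continuousAt (by fun_prop)) (Or.inl (by simp))
    fun_prop
  have h2 := h.tendsto.mono_left (nhdsWithin_le_nhds (s := Set.Ioi 0))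
  have e : K₆ m L l 0 = (2 : ℝ) ^ (l - 2) * (1 + 1 / m ^ (l / 2)) := by simp [K₆]
  rwa [e] at h2

lemma tendsto_K₈ (m L : ℝ) (l : ℝ) : Tendsto (fun t => K₈ m L l t) (𝓝[>] 0)
    (𝓝 ((2 : ℝ) ^ (l + 1) * (1 + 1 / m ^ ((l + 1) / 2)))) := by
  have h : ContinuousAt (fun t => K₈ m L l t) 0 := by
    unfold K₈
    have h1 : ContinuousAt (fun t : ℝ => (1 + t + t ^ 2 * L / 2) ^ (l - 2)) 0 :=
      ContinuousAt.rpow_const (Continuous.continuousAt (by fun_prop)) (Or.inl (by simp))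
    fun_prop
  have h2 := h.tendsto.mono_left (nhdsWithin_le_nhds (s := Set.Ioi 0))
  have e : K₈ m L l 0 = (2 : ℝ) ^ (l + 1) * (1 + 1 / m ^ ((l + 1) / 2)) := by simp [K₈]
  rwa [e] at h2

/-! ### The two decompositions -/

/-- Test both conditions on a unit vector, which exists because d ≥ 1. -/
lemma le_of_strongConv_of_gradLip {d : ℕ} (hd : 1 ≤ d) {U : Pos d → ℝ} {m L : ℝ}
    (hLip : GradLip U L) (hConv : StrongConv U m) : m ≤ L := by
  set e : Pos d := EuclideanSpace.single ⟨0, hd⟩ 1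
  have he : ‖e - 0‖ = 1 := by simp [e]
  have h1 := hConv e 0
  have h2 := hLip e 0
  have h3 := real_inner_le_norm (e - 0) (gradient U e - gradient U 0)
  rw [he] at h1 h2 h3
  linarith

section Instances

variable {d : ℕ} {U : Pos d → ℝ} {m L γ δ l Ll : ℝ}

/-- The trivial decomposition. -/
theorem blocks_of_hessPol (hS : Setting U m L γ δ) (hd : 1 ≤ d) (hl : 2 ≤ l) (hLl : 0 < Ll)
    {xs : Pos d} (hxs : ∀ y, U xs ≤ U y) (hH : HessPol U l Ll xs) :
    Blocks U m L Ll l d xs (fun _ : Unit => ContinuousLinearMap.id ℝ (Pos d)) where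
  two_le := hl
  Ll_pos := hLl
  one_le := by exact_mod_cast hd
  inner_proj _ _ _ := rfl
  sum_sq x := by simp
  trace _ A := by
    calc ∑ i, ⟪EuclideanSpace.basisFun (Fin d) ℝ i, A (EuclideanSpace.basisFun (Fin d) ℝ i)⟫
        ≤ ∑ _i : Fin d, ‖A‖ := Finset.sum_le_sum fun i _ => by
          have h1 : ‖EuclideanSpace.basisFun (Fin d) ℝ i‖ = 1 :=
            (EuclideanSpace.basisFun (Fin d) ℝ).orthonormal.1 i
          have h2 := A.le_opNorm (EuclideanSpace.basisFun (Fin d) ℝ i)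
          have h3 := real_inner_le_norm (EuclideanSpace.basisFun (Fin d) ℝ i)
            (A (EuclideanSpace.basisFun (Fin d) ℝ i))
          rw [h1, one_mul] at h3
          rw [h1, mul_one] at h2
          exact h3.trans h2
      _ = d * ‖A‖ := by simp
  grad_xs := Setting.gradient_eq_zero hxs
  grad_lip _ x y := hS.lip x y
  grad_mono _ x := by
    have := hS.conv x xs
    rwa [Setting.gradient_eq_zero hxs, sub_zero] at this
  hess _ x y w := by
    refine (((fderiv ℝ (gradient U) y - fderiv ℝ (gradient U) x).le_opNorm w)).trans ?_
    exact mul_le_mul_of_nonneg_right (hH x y) (norm_nonneg w)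

/-- Projection on the line spanned by `u`. -/
def lineProj (u : Pos d) : Pos d →L[ℝ] Pos d := (innerSL ℝ u).smulRight u

lemma lineProj_apply (u x : Pos d) : lineProj u x = ⟪u, x⟫ • u := rfl

lemma norm_lineProj {u : Pos d} (hu : ‖u‖ = 1) (x : Pos d) : ‖lineProj u x‖ = |⟪u, x⟫| := by
  rw [lineProj_apply, norm_smul, hu, mul_one, Real.norm_eq_abs]

/-- The decomposition along the axes of a separable potential. -/
theorem blocks_of_separablePol (hS : Setting U m L γ δ) (hl : 2 ≤ l) (hLl : 0 < Ll)
    {Q : Pos d ≃ₗᵢ[ℝ] Pos d} {xs : Pos d} (hxs : ∀ y, U (Q xs) ≤ U y)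
    (hU : SeparablePol U Q l Ll xs) :
    Blocks U m L Ll l 1 (Q xs) (fun j : Fin d => lineProj (Q (EuclideanSpace.single j 1))) := by
  obtain ⟨V, hV, hUV, hVl⟩ := hU
  set u : Fin d → Pos d := fun j => Q (EuclideanSpace.single j 1) with hu
  have hu1 : ∀ j, ‖u j‖ = 1 := fun j => by simp [hu]
  have hcoord : ∀ j (y : Pos d), ⟪u j, Q y⟫ = y j := fun j y => by
    change ⟪Q (EuclideanSpace.single j 1), Q y⟫ = y j
    rw [Q.inner_map_map, EuclideanSpace.inner_single_left]
    simp
  have hcoord' : ∀ j (x : Pos d), ⟪u j, x⟫ = Q.symm x j := fun j x => by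
    rw [← hcoord, Q.apply_symm_apply]
  have hVd : ∀ j, Differentiable ℝ (V j) := fun j => (hV j).differentiable (by norm_num)
  have hVd' : ∀ j, Differentiable ℝ (deriv (V j)) := fun j =>
    ((contDiff_succ_iff_deriv (n := 1)).1 (hV j)).2.2.differentiable (by norm_num)
  -- Differentiating U along u j moves only the j-th coordinate, so this component of the gradient
  -- depends on that coordinate alone.
  have hgrad : ∀ j x, ⟪u j, gradient U x⟫ = deriv (V j) ⟪u j, x⟫ := by
    intro j x
    set y := Q.symm x with hy
    have h1 := hS.hasDerivAt_ray x (u j) 0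
    rw [zero_smul, add_zero, real_inner_comm] at h1
    have e : (fun t : ℝ => U (x + t • u j))
        = fun t : ℝ => ∑ i, V i (y i + t * (EuclideanSpace.single j (1 : ℝ) : Pos d) i) := by
      ext t
      have : x + t • u j = Q (y + t • EuclideanSpace.single j 1) := by
        rw [map_add, map_smul, hy, Q.apply_symm_apply]
      rw [this, hUV]
      rfl
    rw [e] at h1
    have h2 : HasDerivAt
        (fun t : ℝ => ∑ i, V i (y i + t * (EuclideanSpace.single j (1 : ℝ) : Pos d) i))
        (∑ i, deriv (V i) (y i) * (EuclideanSpace.single j (1 : ℝ) : Pos d) i) 0 := by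
      refine HasDerivAt.fun_sum fun i _ => ?_
      have h3 : HasDerivAt (fun t : ℝ => y i + t * (EuclideanSpace.single j (1 : ℝ) : Pos d) i)
          ((EuclideanSpace.single j (1 : ℝ) : Pos d) i) 0 := by
        simpa using ((hasDerivAt_id (0 : ℝ)).mul_const
          ((EuclideanSpace.single j (1 : ℝ) : Pos d) i)).const_add (y i)
      have h4 : HasDerivAt (V i) (deriv (V i) (y i))
          (y i + 0 * (EuclideanSpace.single j (1 : ℝ) : Pos d) i) := by
        rw [zero_mul, add_zero]; exact (hVd i (y i)).hasDerivAt
      exact h4.comp (0 : ℝ) h3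
    rw [h1.unique h2, hcoord']
    simp [hy]
  -- The conditions on the gradient of U pass to each one-dimensional potential by restriction to
  -- the line spanned by u j.
  have hlip1 : ∀ j (s t : ℝ), |deriv (V j) s - deriv (V j) t| ≤ L * |s - t| := by
    intro j s t
    have h1 := hS.lip (s • u j) (t • u j)
    rw [← sub_smul, norm_smul, hu1, mul_one, Real.norm_eq_abs] at h1
    have h2 := abs_real_inner_le_norm (u j) (gradient U (s • u j) - gradient U (t • u j))
    rw [hu1, one_mul, inner_sub_right, hgrad, hgrad, inner_smul_right, inner_smul_right,
      real_inner_self_eq_norm_sq, hu1, one_pow, mul_one, mul_one] at h2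
    exact h2.trans h1
  have hmono1 : ∀ j (s t : ℝ), m * (s - t) ^ 2 ≤ (s - t) * (deriv (V j) s - deriv (V j) t) := by
    intro j s t
    have h1 := hS.conv (s • u j) (t • u j)
    rw [← sub_smul, norm_smul, hu1, mul_one, Real.norm_eq_abs, sq_abs, real_inner_smul_left,
      inner_sub_right, hgrad, hgrad, inner_smul_right, inner_smul_right,
      real_inner_self_eq_norm_sq, hu1, one_pow, mul_one, mul_one] at h1
    exact h1
  have hg0 : gradient U (Q xs) = 0 := Setting.gradient_eq_zero hxs
  have hfd : ∀ j x w, ⟪u j, fderiv ℝ (gradient U) x w⟫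
      = iteratedDeriv 2 (V j) ⟪u j, x⟫ * ⟪u j, w⟫ := by
    intro j x w
    have h1 : HasDerivAt (fun t : ℝ => x + t • w) w 0 := by
      simpa using ((hasDerivAt_id (0 : ℝ)).smul_const w).const_add x
    have h2 := (hS.differentiable_gradient (x + (0 : ℝ) • w)).hasFDerivAt.comp_hasDerivAt 0 h1
    have h3 := (innerSL ℝ (u j)).hasFDerivAt.comp_hasDerivAt (0 : ℝ) h2
    have h4 := (innerSL ℝ (u j)).hasFDerivAt.comp_hasDerivAt (0 : ℝ) h1
    have h5 := ((hVd' j (innerSL ℝ (u j) (x + (0 : ℝ) • w))).hasDerivAt).comp (0 : ℝ) h4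
    have e : (innerSL ℝ (u j)) ∘ (gradient U) ∘ (fun t : ℝ => x + t • w)
        = deriv (V j) ∘ ((innerSL ℝ (u j)) ∘ fun t : ℝ => x + t • w) := by
      ext t
      exact hgrad j _
    rw [e] at h3
    have h6 := h3.unique h5
    simp only [zero_smul, add_zero, innerSL_apply_apply] at h6
    rw [h6, iteratedDeriv_succ, iteratedDeriv_one]
  exact
  { two_le := hl
    Ll_pos := hLl
    one_le := le_rfl
    inner_proj := fun j x y => by
      rw [lineProj_apply, lineProj_apply, real_inner_smul_left, real_inner_smul_left,
        inner_smul_right, real_inner_self_eq_norm_sq]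
      change _ = _ * (_ * ‖u j‖ ^ 2)
      rw [hu1, one_pow, mul_one]
    sum_sq := fun x => by
      have h : ∀ j, ‖lineProj (u j) x‖ ^ 2 = (Q.symm x j) ^ 2 := fun j => by
        rw [norm_lineProj (hu1 j), sq_abs, hcoord']
      change ∑ j, ‖lineProj (u j) x‖ ^ 2 = _
      simp_rw [h]
      rw [← EuclideanSpace.real_norm_sq_eq, Q.symm.norm_map]
    trace := fun j A => by
      -- The trace of a rank-one projection composed with A collapses to ⟪u j, A (u j)⟫, which
      -- explains k = 1.
      have h1 : ∀ i, ⟪EuclideanSpace.basisFun (Fin d) ℝ i,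
          lineProj (u j) (A (EuclideanSpace.basisFun (Fin d) ℝ i))⟫
          = ⟪u j, A (⟪EuclideanSpace.basisFun (Fin d) ℝ i, u j⟫ •
              EuclideanSpace.basisFun (Fin d) ℝ i)⟫ := fun i => by
        rw [lineProj_apply, inner_smul_right, map_smul, inner_smul_right]; ring
      change ∑ i, ⟪EuclideanSpace.basisFun (Fin d) ℝ i,
          lineProj (u j) (A (EuclideanSpace.basisFun (Fin d) ℝ i))⟫ ≤ _
      simp_rw [h1]
      rw [← inner_sum, ← map_sum, OrthonormalBasis.sum_repr', one_mul]
      calc ⟪u j, A (u j)⟫ ≤ ‖u j‖ * ‖A (u j)‖ := real_inner_le_norm _ _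
        _ ≤ ‖u j‖ * (‖A‖ * ‖u j‖) := by gcongr; exact A.le_opNorm _
        _ = ‖A‖ := by rw [hu1]; ring
    grad_xs := hg0
    grad_lip := fun j x y => by
      change ‖lineProj (u j) _‖ ≤ L * ‖lineProj (u j) _‖
      rw [norm_lineProj (hu1 j), norm_lineProj (hu1 j), inner_sub_right, inner_sub_right, hgrad,
        hgrad]
      exact hlip1 j _ _
    grad_mono := fun j x => by
      change m * ‖lineProj (u j) _‖ ^ 2 ≤ ⟪lineProj (u j) _, _⟫
      have h0 : deriv (V j) ⟪u j, Q xs⟫ = 0 := by rw [← hgrad, hg0, inner_zero_right]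
      have h1 := hmono1 j ⟪u j, x⟫ ⟪u j, Q xs⟫
      rw [h0, sub_zero] at h1
      rw [norm_lineProj (hu1 j), sq_abs, lineProj_apply, real_inner_smul_left, hgrad,
        inner_sub_right]
      exact h1
    hess := fun j x y w => by
      change ‖lineProj (u j) _‖ ≤ Ll * ‖lineProj (u j) _‖
        * (2 + ‖lineProj (u j) _‖ ^ (l - 2) + ‖lineProj (u j) _‖ ^ (l - 2)) / 4 * ‖lineProj (u j) _‖
      simp only [norm_lineProj (hu1 j), inner_sub_right, hfd]
      rw [← sub_mul, abs_mul, hcoord]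
      gcongr
      exact hVl j _ _ }

end Instances

end OBABO

end

/-! ### The main theorem -/

theorem mainTheorem7 (d : ℕ) (hd : 1 ≤ d)
    (U : OBABO.Pos d → ℝ) (hU : ContDiff ℝ 2 U)
    (m L γ δ : ℝ) (hm : 0 < m) (hL : 0 < L)
    (hLip : OBABO.GradLip U L) (hConv : OBABO.StrongConv U m)
    (hγ : 2 * Real.sqrt L ≤ γ) (hδ : 0 < δ) (hδm : δ ≤ m / (33 * γ ^ 3)) :
    (∃ πδ : Measure (OBABO.Phase d),
      OBABO.IsInvariantProb U γ δ πδ ∧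
      (∀ μ : Measure (OBABO.Phase d), OBABO.IsInvariantProb U γ δ μ → μ = πδ) ∧
      -- first part: polynomial local Lipschitz condition on the Hessian
      (∀ (l Ll : ℝ) (xs : OBABO.Pos d), 2 ≤ l → 0 < Ll → (∀ y, U xs ≤ U y) →
        OBABO.HessPol U l Ll xs →
        (∀ p : ℝ, 1 ≤ p →
          OBABO.wasserstein p πδ (OBABO.gibbs U) ≤ ENNReal.ofReal
            (δ ^ 2 * (d + l * p - 2) ^ (l / 2) * OBABO.constW m L γ l Ll δ)) ∧
        OBABO.tvNorm πδ (OBABO.gibbs U) ≤ ENNReal.ofReal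
          (δ ^ 2 * (2 + |Real.log (δ ^ 3 * (d + l - 1))|) * (d + l - 1) ^ ((l + 1) / 2)
            * OBABO.constTV m L γ l Ll δ)) ∧
      -- second part: separable target
      (∀ (l Ll : ℝ) (Q : OBABO.Pos d ≃ₗᵢ[ℝ] OBABO.Pos d) (xs : OBABO.Pos d),
        2 ≤ l → 0 < Ll → (∀ y, U (Q xs) ≤ U y) → OBABO.SeparablePol U Q l Ll xs →
        (∀ p : ℝ, 2 ≤ p →
          OBABO.wasserstein p πδ (OBABO.gibbs U) ≤ ENNReal.ofReal
            (δ ^ 2 * Real.sqrt d * (l * p - 1) ^ (l / 2) * OBABO.constW m L γ l Ll δ)) ∧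
        OBABO.tvNorm πδ (OBABO.gibbs U) ≤ ENNReal.ofReal
          (δ ^ 2 * d * (2 + |Real.log (δ ^ 3 * l)|) * l ^ ((l + 1) / 2)
            * OBABO.constTV m L γ l Ll δ))) ∧
    -- limits of the constants as the time-step vanishes
    Tendsto (fun t => OBABO.K₅ m L t) (𝓝[>] 0) (𝓝 (L / (4 * Real.sqrt m) + L / 6)) ∧
    Tendsto (fun t => OBABO.K₇ m L t) (𝓝[>] 0) (𝓝 L) ∧
    (∀ l : ℝ, 2 ≤ l →
      Tendsto (fun t => OBABO.K₆ m L l t) (𝓝[>] 0)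
        (𝓝 ((2 : ℝ) ^ (l - 2) * (1 + 1 / m ^ (l / 2)))) ∧
      Tendsto (fun t => OBABO.K₈ m L l t) (𝓝[>] 0)
        (𝓝 ((2 : ℝ) ^ (l + 1) * (1 + 1 / m ^ ((l + 1) / 2))))) := by
  have hS : OBABO.Setting U m L γ δ := ⟨hU, hm, hL,
    OBABO.le_of_strongConv_of_gradLip hd hLip hConv, hLip, hConv, hγ, hδ, hδm⟩
  refine ⟨?_, OBABO.tendsto_K₅ m L, OBABO.tendsto_K₇ m L, fun l _ =>
    ⟨OBABO.tendsto_K₆ m L l, OBABO.tendsto_K₈ m L l⟩⟩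
  obtain ⟨μ, hμ, huniq, hμm⟩ := hS.exists_invariant
  refine ⟨μ, hμ, huniq, fun l Ll xs hl hLl hxs hH => ?_, fun l Ll Q xs hl hLl hxs hsep => ?_⟩
  · have hB := OBABO.blocks_of_hessPol hS hd hl hLl hxs hH
    refine ⟨fun p hp => ?_, ?_⟩
    · have h := hB.wasserstein_le hS hμ hμm (p := p) (c := 1) (Or.inl ⟨hp, by simp⟩)
      rwa [mul_one] at h
    · have h := hB.tvNorm_le hS hμ hμm
      rwa [Fintype.card_unit, Nat.cast_one, mul_one] at h
  · have hB := OBABO.blocks_of_separablePol hS hl hLl hxs hsep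
    refine ⟨fun p hp => ?_, ?_⟩
    · have h := hB.wasserstein_le hS hμ hμm (p := p) (c := Real.sqrt d) (Or.inr ⟨hp, by simp⟩)
      have e : 1 + l * p - 2 = l * p - 1 := by ring
      rwa [e] at h
    · have hne : Nonempty (Fin d) := ⟨⟨0, hd⟩⟩
      have h := hB.tvNorm_le hS hμ hμm
      have e : 1 + l - 1 = l := by ring
      rwa [Fintype.card_fin, e] at h
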